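/- Let $\alpha,\beta>0$ be real numbers such that $\beta/\alpha$ is not an integer, and let $\mathbb{T}=\mathbb{R}/2\pi\mathbb{Z}$. Consider the Zakharov system $$i\partial_t u+\alpha\,\partial_x^2u=un,\qquad \beta^{-2}\partial_t^2n-\partial_x^2n=\partial_x^2(|u|^2),\qquad (u,n,\partial_tn)|_{t=0}=(u_0,n_0,n_1)$$ on $\mathbb{R}\times\mathbb{T}$, with $u$ complex valued and $n$ real valued, in the phase space $\mathcal H=L^2(\mathbb{T})\times H^{-1/2}(\mathbb{T})\times H^{-3/2}(\mathbb{T})$ (second and third components real valued), with norm $\|(u,n,m)\|_{\mathcal H}=\|u\|_{L^2}+\|n\|_{H^{-1/2}}+\|m\|_{H^{-3/2}}$. The system is globally well-posed in $\mathcal H$, in the following sense. Write $\langle x\rangle=(1+x^2)^{1/2}$ and let $\tilde f(k,\tau)=\iint e^{-ikx-i\tau t}f(t,x)\,dx\,dt$. Let $Y^s_S$ and $Y^s_W$ be the spaces of functions of $(t,x)\in\mathbb{R}\times\mathbb{T}$ with finite norm $$\big\|\langle k\rangle^{s}\langle w(k,\tau)\rangle^{1/2}\tilde f(k,\tau)\big\|_{\ell^2_kL^2_\tau}+\big\|\langle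 k\rangle^s\tilde f(k,\tau)\big\|_{\ell^2_kL^1_\tau},$$ where $w(k,\tau)=\tau+\alpha k^2$ for $Y^s_S$ and $w(k,\tau)=|\tau|-\beta|k|$ for $Y^s_W$. For $a\le 0\le b$, a solution on $[a,b]$ with data $(u_0,n_0,n_1)\in\mathcal H$ is a curve $(u,n,\partial_tn)\in C([a,b];\mathcal H)$, equal to $(u_0,n_0,n_1)$ at $t=0$, such that $u$ and $n$ are restrictions to $[a,b]$ of elements of $Y^0_S$ and of $Y^{-1/2}_W$, and Duhamel's formulas $$u(t)=U(t)u_0-i\int_0^tU(t-s)[un](s)\,ds,\qquad n(t)=\partial_tV(t)n_0+V(t)n_1+\beta^2\int_0^tV(t-s)\,\partial_x^2[|u|^2](s)\,ds$$ hold for $t\in[a,b]$, where $U(t)=e^{i\alpha t\partial_x^2}$ and $V(t)=\dfrac{\sin(\beta t\sqrt{-\partial_x^2})}{\beta\sqrt{-\partial_x^2}}$ (multiplication by $t$ on the zero Fourier mode). In the first formula the $k$-th Fourier coefficient of the integral is the (convergent) sum over $j\in\mathbb{Z}$ of the contributions of the interactions of the mode $k-j$ of $u$ with the mode $j$ of $n$.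 A global solution is a curve $\mathbb{R}\to\mathcal H$ that is a solution on $[-T,T]$ for every $T>0$. Then there are maps $Z(t):\mathcal H\to\mathcal H$, $t\in\mathbb{R}$, such that: 1. (existence) for every $z_0\in\mathcal H$, $t\mapsto Z(t)z_0$ is a global solution with data $z_0$; 2. (uniqueness) for every $z_0\in\mathcal H$ and $a\le 0\le b$, every solution on $[a,b]$ with data $z_0$ equals $Z(t)z_0$ for $t\in[a,b]$; 3. (bounds) for all $T,R>0$ there is a constant $C=C(T,R,\alpha,\beta)$ such that $\sup_{|t|\le T}\|Z(t)z_0\|_{\mathcal H}\le C$ whenever $\|z_0\|_{\mathcal H}\le R$; 4. (continuous dependence) for every $T>0$ the map $z_0\mapsto Z(\cdot)z_0$ is continuous from $\mathcal H$ to $C([-T,T];\mathcal H)$. -/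

import Mathlib

open Filter Topology MeasureTheory
open scoped ENNReal

noncomputable section

namespace Zakharov

/-- The Japanese bracket `⟨x⟩ = (1 + |x|²)^{1/2}`. -/
def bracket (x : ℝ) : ℝ := Real.sqrt (1 + x ^ 2)

/-- A periodic distribution on `𝕋 = ℝ / 2πℤ` is represented by its sequence of Fourier coefficients
`f̂ k = ∫_𝕋 e^{-ikx} f(x) dx`, so that `f(x) = (2π)⁻¹ ∑ k, f̂ k e^{ikx}`. -/
abbrev Coeffs := ℤ → ℂ

/-- The norm of `H^s(𝕋)`, equal to `(2π)^{-1/2} (∑ k, ⟨k⟩^{2s} |f̂ k|²)^{1/2}`, with value `∞` if `f`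
does not belong to `H^s(𝕋)`. For `s = 0` it is the norm of `L²(𝕋)`, by Parseval's identity. -/
def sobolevNorm (s : ℝ) (f : Coeffs) : ℝ≥0∞ :=
  ENNReal.ofReal ((2 * Real.pi) ^ (-(1 / 2) : ℝ)) *
    (∑' k : ℤ, ENNReal.ofReal (bracket k ^ (2 * s)) * ‖f k‖ₑ ^ 2) ^ (1 / 2 : ℝ)

/-- The distribution with Fourier coefficients `f` is real valued. -/
def IsRealValued (f : Coeffs) : Prop := ∀ k : ℤ, f (-k) = starRingEnd ℂ (f k)

/-- Triples `(u, n, ∂ₜn)` of periodic distributions. -/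
abbrev Triple := Coeffs × Coeffs × Coeffs

/-- The norm `‖u‖_{L²} + ‖n‖_{H^{-1/2}} + ‖m‖_{H^{-3/2}}` of a triple `(u, n, m)`. -/
def phaseNorm (z : Triple) : ℝ≥0∞ :=
  sobolevNorm 0 z.1 + sobolevNorm (-(1 / 2)) z.2.1 + sobolevNorm (-(3 / 2)) z.2.2

/-- The phase space `L²(𝕋) × H^{-1/2}(𝕋) × H^{-3/2}(𝕋)`; the first component is complex valued and
the other two are real valued. -/
def PhaseSpace : Set Triple :=
  {z | phaseNorm z < ∞ ∧ IsRealValued z.2.1 ∧ IsRealValued z.2.2}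

/-- The norm of the Bourgain space `X^{s,b}` of a function of space and time with space-time Fourier
transform `F k τ`; here `w k τ` is the modulation. -/
def bourgainNorm (w : ℤ → ℝ → ℝ) (s b : ℝ) (F : ℤ → ℝ → ℂ) : ℝ≥0∞ :=
  (∑' k : ℤ, ∫⁻ τ : ℝ,
    ENNReal.ofReal (bracket k ^ (2 * s) * bracket (w k τ) ^ (2 * b)) * ‖F k τ‖ₑ ^ 2) ^ (1 / 2 : ℝ)

/-- The norm of the space `Y^s`, equal to `‖f‖_{X^{s,1/2}} + ‖⟨k⟩^s F k τ‖_{ℓ²_k L¹_τ}`. -/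
def yNorm (w : ℤ → ℝ → ℝ) (s : ℝ) (F : ℤ → ℝ → ℂ) : ℝ≥0∞ :=
  bourgainNorm w s (1 / 2) F +
    (∑' k : ℤ, (∫⁻ τ : ℝ, ENNReal.ofReal (bracket k ^ s) * ‖F k τ‖ₑ) ^ 2) ^ (1 / 2 : ℝ)

/-- The modulation of the Schrödinger flow `e^{iαt∂ₓ²}`, whose space-time Fourier transform (with
kernel `e^{-ikx-iτt}`) lives on `τ = -αk²`. -/
def schrodingerWeight (α : ℝ) (k : ℤ) (τ : ℝ) : ℝ := τ + α * (k : ℝ) ^ 2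

/-- The modulation of the wave flow of speed `β`. -/
def waveWeight (β : ℝ) (k : ℤ) (τ : ℝ) : ℝ := |τ| - β * |(k : ℝ)|

/-- The function `f`, given by its spatial Fourier coefficients `f t k` at the times `t`, belongs to
the space `Y^s` with modulation `w` restricted to the time interval `[a, b]`: it agrees on `[a, b]`
with a function whose space-time Fourier transform `F` has a finite `Y^s` norm. -/
def MemY (w : ℤ → ℝ → ℝ) (s a b : ℝ) (f : ℝ → Coeffs) : Prop :=
  ∃ F : ℤ → ℝ → ℂ, (∀ k, AEStronglyMeasurable (F k) volume) ∧ yNorm w s F < ∞ ∧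
    ∀ t ∈ Set.Icc a b, ∀ k : ℤ,
      f t k = (2 * Real.pi : ℂ)⁻¹ * ∫ τ : ℝ, Complex.exp (Complex.I * τ * t) * F k τ

/-- The Fourier multiplier `e^{-iαk²t}` of `U(t) = e^{iαt∂ₓ²}`. -/
def U (α t : ℝ) (k : ℤ) : ℂ := Complex.exp (-(Complex.I * α * (k : ℂ) ^ 2 * t))

/-- The Fourier multiplier `sin(βt|k|) / (β|k|)` of `V(t) = sin(βt(-∂ₓ²)^{1/2}) / (β(-∂ₓ²)^{1/2})`;
for `k = 0` it is `t`. -/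
def V (β t : ℝ) (k : ℤ) : ℝ :=
  if k = 0 then t else Real.sin (β * t * |(k : ℝ)|) / (β * |(k : ℝ)|)

/-- The Fourier multiplier `cos(βt|k|)` of `∂ₜV(t)`. -/
def dV (β t : ℝ) (k : ℤ) : ℝ := Real.cos (β * t * |(k : ℝ)|)

/-- The `k`-th Fourier coefficient of `|u|²`. -/
def normSqCoeff (u : Coeffs) (k : ℤ) : ℂ :=
  (2 * Real.pi : ℂ)⁻¹ * ∑' j : ℤ, u (k + j) * starRingEnd ℂ (u j)

/-- `u(t) = U(t) u₀ - i ∫₀ᵗ U(t-s) [un](s) ds` on `[a, b]`, read on the Fourier side. The `k`-th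
Fourier coefficient of `un` is the sum over `j` of the interactions `(2π)⁻¹ û(k-j) n̂(j)`. For
`u(s) ∈ L²` and `n(s) ∈ H^{-1/2}` this sum need not converge at a fixed time `s`: the product is
understood in the sense of distributions in time, and the sum is taken after the integration. -/
def SchrodingerDuhamel (α a b : ℝ) (u₀ : Coeffs) (u n : ℝ → Coeffs) : Prop :=
  ∀ t ∈ Set.Icc a b, ∀ k : ℤ,
    HasSum (fun j : ℤ => -Complex.I *
        ∫ s in (0 : ℝ)..t, U α (t - s) k * ((2 * Real.pi : ℂ)⁻¹ * (u s (k - j) * n s j)))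
      (u t k - U α t k * u₀ k)

/-- `n(t) = ∂ₜV(t) n₀ + V(t) n₁ + β² ∫₀ᵗ V(t-s) ∂ₓ²[|u|²](s) ds` on `[a, b]`, on the Fourier side. -/
def WaveDuhamel (β a b : ℝ) (n₀ n₁ : Coeffs) (u n : ℝ → Coeffs) : Prop :=
  ∀ t ∈ Set.Icc a b, ∀ k : ℤ,
    n t k = dV β t k * n₀ k + V β t k * n₁ k +
      (β : ℂ) ^ 2 * ∫ s in (0 : ℝ)..t, (V β (t - s) k : ℂ) * (-(k : ℂ) ^ 2 * normSqCoeff (u s) k)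

/-- `z = (u, n, ∂ₜn)` is a solution on the time interval `[a, b]` (where `a ≤ 0 ≤ b`) of the Zakharov
system `i∂ₜu + α∂ₓ²u = un`, `β⁻²∂ₜ²n - ∂ₓ²n = ∂ₓ²(|u|²)` with initial data `z₀ = (u₀, n₀, n₁)`: it is
a continuous curve in the phase space, with `u` and `n` in the restricted spaces `Y^0` of the
Schrödinger flow and `Y^{-1/2}` of the wave flow, and it satisfies Duhamel's formulas. -/
structure IsSolutionOn (α β a b : ℝ) (z₀ : Triple) (z : ℝ → Triple) : Prop where
  initial : z 0 = z₀
  mem : ∀ t ∈ Set.Icc a b, z t ∈ PhaseSpace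
  continuous : ∀ t ∈ Set.Icc a b,
    Tendsto (fun s => phaseNorm (z s - z t)) (𝓝[Set.Icc a b] t) (𝓝 0)
  memY_u : MemY (schrodingerWeight α) 0 a b (fun t => (z t).1)
  memY_n : MemY (waveWeight β) (-(1 / 2)) a b (fun t => (z t).2.1)
  schrodinger : SchrodingerDuhamel α a b z₀.1 (fun t => (z t).1) (fun t => (z t).2.1)
  wave : WaveDuhamel β a b z₀.2.1 z₀.2.2 (fun t => (z t).1) (fun t => (z t).2.1)
  deriv : ∀ t ∈ Set.Icc a b, ∀ k : ℤ,
    HasDerivWithinAt (fun s => (z s).2.1 k) ((z t).2.2 k) (Set.Icc a b) t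

/-- A solution on all of `ℝ`, that is, on every interval `[-T, T]`. -/
def IsGlobalSolution (α β : ℝ) (z₀ : Triple) (z : ℝ → Triple) : Prop :=
  ∀ T : ℝ, 0 < T → IsSolutionOn α β (-T) T z₀ z

end Zakharov

end

/-! In interaction variables the linear flows disappear. Put `u_k = e^{-iαk²t} f_k` and split the
density into half waves, `n_k = ⟨k⟩^{1/2} (w_k + conj w_{-k})` with `w_k = e^{iβ|k|t} g_k`. The pair
`(f, g)` lies in `ℓ² × ℓ²`, and the system becomes two quadratic equations with oscillating factors.
Their phases are `α(k² - m²) ± β|k - m|` for `u n → u`, and up to sign the same expressions for `u ū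
→ n`. They factor as `α (k - m) (k + m ± β/α)`. Since `β/α` is not an integer, the last factor is at
least a multiple of `⟨k + m⟩`, so an interaction with `k ≠ m` has resonance at least `c |k - m| ⟨k +
m⟩`. The coefficient of `u n → u` has square of order `⟨k - m⟩`, and the square of the other
coefficient has the corresponding bound. Hence the squared coefficient divided by the resonance is
`O(1/⟨k + m⟩)`.

One of the three modulations in an interaction dominates the resonance, which recovers the half
derivative of `n`. What remains is a sum of `⟨k + m⟩^{-1}` over one frequency. It would diverge
logarithmically, but the integrals over modulations leave a small extra decay in the phase. On a
time interval of length `δ`, rescaled to unit length, this gives a bilinear estimate in `Y` with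
constant of order `(δ log(1/δ))^{1/2}` for small `δ` (`tsum_weighted_le`,
`exists_interactionBound_schr`, `exists_interactionBound_wave`, `Coupling.yn_duh_le`). The `ℓ²L¹`
part of the norm gives continuity in time and makes the sum over interactions converge after
integration in time (`Coupling.hasSum_ev_duh`).

A contraction gives a local flow with Lipschitz dependence (`exists_local_flow`). For uniqueness,
the difference of two solutions on an interval has extensions to `Y` of norms as small as desired,
because each substitution into the equation halves the norm and the Duhamel integral sees only the
values between `0` and `t` (`LocalSystem.norm_ev_sub_halving`). The `L²` norm of `u` is conserved:
frequency truncations preserve it, because the interaction matrix is antihermitian, and they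
converge in `Y` (`LocalSystem.norm_ev_eq`).

There is no conserved quantity for `n` at this regularity, but its source depends on `u` only. If
`M` bounds `g`, the contraction allows a step `δ` of order `1/(M² log M)`, and over this step `‖g‖`
grows by `O(1/M)`, with a constant depending on the conserved `‖u₀‖` and on the mean drift. Thus
`M²` grows by a bounded amount per step, the `n`-th step is of order `1/(n log n)`, and the steps
sum to infinity (`exists_sum_timeStep_ge`, `exists_sys_bound`). This gives global existence with
bounds depending only on the size of the data.

The remaining work is the equivalence between the system for `(f, g)` and Duhamel's formulas for
`(u, n)`. The zero mode of `n` needs separate care: it moves linearly in time and appears as a drift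
`-ρ` of `g_0`. -/

noncomputable section

namespace Zakharov

/-! ### The bracket as an extended nonnegative weight -/

theorem one_le_bracket (x : ℝ) : 1 ≤ bracket x := by
  unfold bracket
  exact Real.one_le_sqrt.2 (by nlinarith [sq_nonneg x])

theorem bracket_pos (x : ℝ) : 0 < bracket x := lt_of_lt_of_le one_pos (one_le_bracket x)

theorem bracket_sq (x : ℝ) : bracket x ^ 2 = 1 + x ^ 2 :=
  Real.sq_sqrt (by positivity)

theorem continuous_bracket : Continuous bracket := by
  unfold bracket; fun_prop

theorem bracket_neg (x : ℝ) : bracket (-x) = bracket x := by simp [bracket]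

theorem abs_le_bracket (x : ℝ) : |x| ≤ bracket x :=
  Real.abs_le_sqrt (by linarith)

theorem bracket_le_one_add_abs (x : ℝ) : bracket x ≤ 1 + |x| := by
  refine Real.sqrt_le_iff.2 ⟨by positivity, ?_⟩
  nlinarith [abs_nonneg x, sq_abs x]

theorem bracket_le_bracket {x y : ℝ} (h : |x| ≤ |y|) : bracket x ≤ bracket y :=
  Real.sqrt_le_sqrt (by linarith [sq_le_sq.2 h])

theorem bracket_add_le (x y : ℝ) : bracket (x + y) ≤ bracket x + bracket y := by
  refine Real.sqrt_le_iff.2 ⟨by linarith [bracket_pos x, bracket_pos y], ?_⟩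
  have h1 : |x| * |y| ≤ bracket x * bracket y :=
    mul_le_mul (abs_le_bracket x) (abs_le_bracket y) (abs_nonneg y) (bracket_pos x).le
  have h2 : x * y ≤ |x| * |y| := by rw [← abs_mul]; exact le_abs_self _
  nlinarith [bracket_sq x, bracket_sq y]

theorem bracket_add_le_mul (x y : ℝ) : bracket (x + y) ≤ 2 * (bracket x * bracket y) := by
  nlinarith [bracket_add_le x y, one_le_bracket x, one_le_bracket y]

/-- The Japanese bracket with values in `ℝ≥0∞`. -/
def jb (x : ℝ) : ℝ≥0∞ := ENNReal.ofReal (bracket x)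

theorem one_le_jb (x : ℝ) : 1 ≤ jb x := by
  rw [jb, ← ENNReal.ofReal_one]; exact ENNReal.ofReal_le_ofReal (one_le_bracket x)

theorem jb_ne_zero (x : ℝ) : jb x ≠ 0 := (lt_of_lt_of_le one_pos (one_le_jb x)).ne'

theorem jb_ne_top (x : ℝ) : jb x ≠ ∞ := ENNReal.ofReal_ne_top

theorem jb_neg (x : ℝ) : jb (-x) = jb x := by rw [jb, jb, bracket_neg]

theorem jb_le_jb {x y : ℝ} (h : |x| ≤ |y|) : jb x ≤ jb y :=
  ENNReal.ofReal_le_ofReal (bracket_le_bracket h)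

theorem jb_add_le (x y : ℝ) : jb (x + y) ≤ jb x + jb y := by
  rw [jb, jb, jb, ← ENNReal.ofReal_add (bracket_pos x).le (bracket_pos y).le]
  exact ENNReal.ofReal_le_ofReal (bracket_add_le x y)

theorem jb_add_le_mul (x y : ℝ) : jb (x + y) ≤ 2 * (jb x * jb y) := by
  have : (2 : ℝ≥0∞) = ENNReal.ofReal 2 := by simp
  rw [jb, jb, jb, this, ← ENNReal.ofReal_mul (bracket_pos x).le, ← ENNReal.ofReal_mul (by norm_num)]
  exact ENNReal.ofReal_le_ofReal (bracket_add_le_mul x y)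

@[fun_prop]
theorem measurable_jb : Measurable jb :=
  ENNReal.measurable_ofReal.comp continuous_bracket.measurable

theorem jb_rpow (x a : ℝ) : jb x ^ a = ENNReal.ofReal (bracket x ^ a) :=
  ENNReal.ofReal_rpow_of_pos (bracket_pos x)

theorem jb_rpow_add (x a b : ℝ) : jb x ^ (a + b) = jb x ^ a * jb x ^ b :=
  ENNReal.rpow_add _ _ (jb_ne_zero x) (jb_ne_top x)

theorem jb_rpow_ne_zero (x a : ℝ) : jb x ^ a ≠ 0 := by
  rw [jb_rpow]; simpa using Real.rpow_pos_of_pos (bracket_pos x) a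

theorem jb_rpow_le {a b : ℝ} (x : ℝ) (h : a ≤ b) : jb x ^ a ≤ jb x ^ b :=
  ENNReal.rpow_le_rpow_of_exponent_le (one_le_jb x) h

theorem jb_rpow_le_one {a : ℝ} (x : ℝ) (h : a ≤ 0) : jb x ^ a ≤ 1 := by
  simpa using jb_rpow_le x h

theorem one_le_jb_rpow {a : ℝ} (x : ℝ) (h : 0 ≤ a) : 1 ≤ jb x ^ a := by
  simpa using jb_rpow_le x h

theorem rpow_antitone {x y : ℝ≥0∞} {a : ℝ} (h : x ≤ y) (ha : a ≤ 0) : y ^ a ≤ x ^ a := by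
  have := ENNReal.rpow_le_rpow h (neg_nonneg.2 ha)
  rw [ENNReal.rpow_neg, ENNReal.rpow_neg] at this
  exact ENNReal.inv_le_inv.1 this

theorem rpow_mul_rpow_le {x y : ℝ≥0∞} {a b : ℝ} (hx : 1 ≤ x) (hy : 1 ≤ y) (hx' : x ≠ ∞) (hy' : y ≠ ∞)
    (ha : a ≤ 0) (hb : b ≤ 0) : x ^ a * y ^ b ≤ x ^ (a + b) + y ^ (a + b) := by
  have hx0 : x ≠ 0 := (lt_of_lt_of_le one_pos hx).ne'
  have hy0 : y ≠ 0 := (lt_of_lt_of_le one_pos hy).ne'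
  rcases le_total x y with h | h
  · calc x ^ a * y ^ b ≤ x ^ a * x ^ b := mul_le_mul' le_rfl (rpow_antitone h hb)
      _ = x ^ (a + b) := (ENNReal.rpow_add _ _ hx0 hx').symm
      _ ≤ _ := le_self_add
  · calc x ^ a * y ^ b ≤ y ^ a * y ^ b := mul_le_mul' (rpow_antitone h ha) le_rfl
      _ = y ^ (a + b) := (ENNReal.rpow_add _ _ hy0 hy').symm
      _ ≤ _ := le_add_self

/-- The integral of `⟨x⟩^{-6/5}`. -/
def tailMass : ℝ≥0∞ := ∫⁻ x : ℝ, jb x ^ (-(6 / 5) : ℝ)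

theorem tailMass_ne_top : tailMass ≠ ∞ := by
  have h := (integrable_rpow_neg_one_add_norm_sq (E := ℝ) (μ := volume) (r := 6 / 5)
    (by simp; norm_num)).lintegral_lt_top
  refine ne_of_lt (lt_of_le_of_lt (le_of_eq ?_) h)
  refine lintegral_congr fun x => ?_
  rw [jb_rpow]
  congr 1
  rw [bracket, Real.sqrt_eq_rpow, ← Real.rpow_mul (by positivity), Real.norm_eq_abs, sq_abs]
  norm_num

theorem lintegral_jb_rpow_ne_top {a : ℝ} (ha : a ≤ -(6 / 5)) : ∫⁻ x : ℝ, jb x ^ a ≠ ∞ :=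
  ne_top_of_le_ne_top tailMass_ne_top (lintegral_mono fun x => jb_rpow_le x ha)

/-- Write `4/5 = 3/10 + 1/2` and `1 = 3/10 + 7/10`. The two factors of exponent `3/10` produce
`⟨s⟩^{-3/10}` because `⟨s⟩ ≤ 2 ⟨σ⟩ ⟨s - σ⟩`, and the rest has total exponent `6/5`, which is
integrable. The decay in `s` that survives is what defeats the logarithm in the frequency sums. -/
theorem lintegral_kernel_le (s : ℝ) :
    ∫⁻ σ : ℝ, jb σ ^ (-(4 / 5) : ℝ) * jb (s - σ) ^ (-1 : ℝ) ≤
      4 * tailMass * jb s ^ (-(3 / 10) : ℝ) := by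
  have key : ∀ σ : ℝ, jb σ ^ (-(4 / 5) : ℝ) * jb (s - σ) ^ (-1 : ℝ) ≤
      2 * jb s ^ (-(3 / 10) : ℝ) * (jb σ ^ (-(6 / 5) : ℝ) + jb (s - σ) ^ (-(6 / 5) : ℝ)) := by
    intro σ
    have h1 : jb σ ^ (-(4 / 5) : ℝ) = jb σ ^ (-(3 / 10) : ℝ) * jb σ ^ (-(1 / 2) : ℝ) := by
      rw [← jb_rpow_add]; norm_num
    have h2 : jb (s - σ) ^ (-1 : ℝ) = jb (s - σ) ^ (-(3 / 10) : ℝ) * jb (s - σ) ^ (-(7 / 10) : ℝ) := by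
      rw [← jb_rpow_add]; norm_num
    have h3 : jb σ ^ (-(3 / 10) : ℝ) * jb (s - σ) ^ (-(3 / 10) : ℝ) ≤ 2 * jb s ^ (-(3 / 10) : ℝ) := by
      rw [← ENNReal.mul_rpow_of_ne_top (jb_ne_top _) (jb_ne_top _)]
      have h4 := jb_add_le_mul σ (s - σ)
      rw [add_sub_cancel] at h4
      have h5 := rpow_antitone (a := -(3 / 10)) h4 (by norm_num)
      rw [ENNReal.mul_rpow_of_ne_top (by simp)
        (ENNReal.mul_ne_top (jb_ne_top _) (jb_ne_top _))] at h5
      calc (jb σ * jb (s - σ)) ^ (-(3 / 10) : ℝ)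
          = 2 ^ (3 / 10 : ℝ) * (2 ^ (-(3 / 10) : ℝ) * (jb σ * jb (s - σ)) ^ (-(3 / 10) : ℝ)) := by
            rw [← mul_assoc, ← ENNReal.rpow_add _ _ (by simp) (by simp)]; norm_num
        _ ≤ 2 ^ (1 : ℝ) * jb s ^ (-(3 / 10) : ℝ) := by
            gcongr
            · norm_num
            · norm_num
        _ = _ := by rw [ENNReal.rpow_one]
    have h6 := rpow_mul_rpow_le (one_le_jb σ) (one_le_jb (s - σ)) (jb_ne_top _) (jb_ne_top _)
      (a := -(1 / 2)) (b := -(7 / 10)) (by norm_num) (by norm_num)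
    norm_num at h6
    calc _ = (jb σ ^ (-(3 / 10) : ℝ) * jb (s - σ) ^ (-(3 / 10) : ℝ)) *
          (jb σ ^ (-(1 / 2) : ℝ) * jb (s - σ) ^ (-(7 / 10) : ℝ)) := by rw [h1, h2]; ring
      _ ≤ _ := by gcongr
  calc _ ≤ ∫⁻ σ : ℝ, 2 * jb s ^ (-(3 / 10) : ℝ) *
        (jb σ ^ (-(6 / 5) : ℝ) + jb (s - σ) ^ (-(6 / 5) : ℝ)) := lintegral_mono key
    _ = 2 * jb s ^ (-(3 / 10) : ℝ) * (tailMass + tailMass) := by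
        rw [lintegral_const_mul _ (by fun_prop), lintegral_add_left (by fun_prop),
          lintegral_sub_left_eq_self (fun x => jb x ^ (-(6 / 5) : ℝ)) s]; rfl
    _ = _ := by ring

/-! ### The `L²` functional on nonnegative functions -/

section L2

variable {X Y : Type*} [MeasurableSpace X] [MeasurableSpace Y] {μ : Measure X}

/-- The `L²` norm of a nonnegative function. -/
def l2 (μ : Measure X) (f : X → ℝ≥0∞) : ℝ≥0∞ := (∫⁻ x, f x ^ 2 ∂μ) ^ (1 / 2 : ℝ)

theorem l2_sq (f : X → ℝ≥0∞) : l2 μ f ^ 2 = ∫⁻ x, f x ^ 2 ∂μ := by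
  rw [l2, ← ENNReal.rpow_natCast, ← ENNReal.rpow_mul]; norm_num

theorem le_of_sq_le_sq {a b : ℝ≥0∞} (h : a ^ 2 ≤ b ^ 2) : a ≤ b :=
  (ENNReal.pow_right_strictMono (n := 2) two_ne_zero).le_iff_le.1 h

theorem l2_mono_ae {f g : X → ℝ≥0∞} (h : f ≤ᵐ[μ] g) : l2 μ f ≤ l2 μ g := by
  refine ENNReal.rpow_le_rpow (lintegral_mono_ae ?_) (by norm_num)
  filter_upwards [h] with x hx
  gcongr

theorem l2_mono {f g : X → ℝ≥0∞} (h : ∀ x, f x ≤ g x) : l2 μ f ≤ l2 μ g :=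
  l2_mono_ae (Eventually.of_forall h)

theorem l2_const_mul (c : ℝ≥0∞) {f : X → ℝ≥0∞} (hf : Measurable f) :
    l2 μ (fun x => c * f x) = c * l2 μ f := by
  apply (ENNReal.pow_right_strictMono (n := 2) two_ne_zero).injective
  simp only
  rw [mul_pow, l2_sq, l2_sq, ← lintegral_const_mul _ (by fun_prop)]
  simp only [mul_pow]

theorem l2_add_le {f g : X → ℝ≥0∞} (hf : Measurable f) (hg : Measurable g) :
    l2 μ (fun x => f x + g x) ≤ l2 μ f + l2 μ g := by
  have := ENNReal.lintegral_Lp_add_le (μ := μ) hf.aemeasurable hg.aemeasurable (p := 2) (by norm_num)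
  simpa [l2] using this

/-- Minkowski's inequality passes from finite to countable sums by monotone convergence. It is the
ingredient of completeness of `Y`. -/
theorem l2_tsum_le {f : ℕ → X → ℝ≥0∞} (hf : ∀ n, Measurable (f n)) :
    l2 μ (fun x => ∑' n, f n x) ≤ ∑' n, l2 μ (f n) := by
  have hfin : ∀ n, l2 μ (fun x => ∑ i ∈ Finset.range n, f i x) ≤ ∑ i ∈ Finset.range n, l2 μ (f i) := by
    intro n
    induction n with
    | zero => simp [l2]
    | succ n ih =>
      simp only [Finset.sum_range_succ]
      exact (l2_add_le (Finset.measurable_sum _ fun i _ => hf i) (hf n)).trans (by gcongr)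
  apply le_of_sq_le_sq
  rw [l2_sq]
  have h1 : ∀ x, (∑' n, f n x) ^ 2 = ⨆ n, (∑ i ∈ Finset.range n, f i x) ^ 2 := by
    intro x
    rw [ENNReal.tsum_eq_iSup_nat]
    have hm : Monotone fun n => ∑ i ∈ Finset.range n, f i x := fun a b hab =>
      Finset.sum_le_sum_of_subset (Finset.range_mono hab)
    have h2 := (ENNReal.continuous_pow 2).continuousAt.tendsto.comp (tendsto_atTop_iSup hm)
    refine tendsto_nhds_unique h2 (tendsto_atTop_iSup fun a b hab => ?_)
    exact pow_le_pow_left' (hm hab) 2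
  simp only [h1]
  rw [lintegral_iSup (fun n => (Finset.measurable_sum _ fun i _ => hf i).pow_const 2)]
  · refine iSup_le fun n => ?_
    rw [← l2_sq]
    exact pow_le_pow_left' ((hfin n).trans (ENNReal.sum_le_tsum _)) 2
  · intro a b hab x
    exact pow_le_pow_left' (Finset.sum_le_sum_of_subset (Finset.range_mono hab)) 2

theorem sq_lintegral_mul_le {f g : X → ℝ≥0∞} (hf : Measurable f) (hg : Measurable g) :
    (∫⁻ x, f x * g x ∂μ) ^ 2 ≤ (∫⁻ x, f x ^ 2 ∂μ) * ∫⁻ x, g x ^ 2 ∂μ := by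
  have h := ENNReal.lintegral_mul_le_Lp_mul_Lq μ (p := 2) (q := 2) (by constructor <;> norm_num)
    hf.aemeasurable hg.aemeasurable
  have h' : (∫⁻ x, f x * g x ∂μ) ≤ l2 μ f * l2 μ g := by simpa [l2] using h
  rw [← l2_sq, ← l2_sq, ← mul_pow]
  exact pow_le_pow_left' h' 2

theorem ae_lt_top_of_l2 {f : X → ℝ≥0∞} (hf : Measurable f) (h : l2 μ f ≠ ∞) : ∀ᵐ x ∂μ, f x < ∞ := by
  have h2 : ∫⁻ x, f x ^ 2 ∂μ ≠ ∞ := by rw [← l2_sq]; exact ENNReal.pow_ne_top h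
  filter_upwards [ae_lt_top (by fun_prop) h2] with x hx
  exact lt_top_iff_ne_top.2 fun h => by simp [h] at hx

end L2

end Zakharov

end

noncomputable section

namespace Zakharov

/-! ### Twisted convolutions on `ℤ × ℝ` -/

/-- The product of the counting measure and the Lebesgue measure. -/
abbrev mu : Measure (ℤ × ℝ) := (Measure.count : Measure ℤ).prod volume

theorem lintegral_mu {f : ℤ × ℝ → ℝ≥0∞} (hf : Measurable f) :
    ∫⁻ x, f x ∂mu = ∑' k : ℤ, ∫⁻ τ : ℝ, f (k, τ) := by
  rw [lintegral_prod _ hf.aemeasurable, lintegral_count]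

theorem measurable_mu {γ : Type*} [MeasurableSpace γ] {f : ℤ × ℝ → γ}
    (hf : ∀ k, Measurable fun τ => f (k, τ)) : Measurable f :=
  measurable_from_prod_countable_right hf

theorem lintegral_mu_sub_left {f : ℤ × ℝ → ℝ≥0∞} (hf : Measurable f) (k : ℤ) (ν : ℝ) (w : ℤ → ℝ) :
    ∫⁻ y, f (k - y.1, ν - y.2 - w y.1) ∂mu = ∫⁻ y, f y ∂mu := by
  rw [lintegral_mu (by fun_prop), lintegral_mu hf, ← (Equiv.subLeft k).tsum_eq]
  refine tsum_congr fun m => ?_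
  simp only [Equiv.subLeft_apply, sub_sub_cancel]
  rw [← lintegral_sub_left_eq_self (fun τ => f (m, τ)) (ν - w (k - m))]
  refine lintegral_congr fun σ => ?_
  congr 2; ring

theorem lintegral_mu_sub_right {f : ℤ × ℝ → ℝ≥0∞} (hf : Measurable f) (m : ℤ) (σ : ℝ) (w : ℤ → ℝ) :
    ∫⁻ x, f (x.1 - m, x.2 - σ - w x.1) ∂mu = ∫⁻ x, f x ∂mu := by
  rw [lintegral_mu (by fun_prop), lintegral_mu hf, ← (Equiv.subRight m).tsum_eq (fun k => ∫⁻ τ : ℝ, f (k, τ))]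
  refine tsum_congr fun k => ?_
  simp only [Equiv.subRight_apply]
  rw [← lintegral_sub_right_eq_self (fun τ => f (k - m, τ)) (σ + w k)]
  refine lintegral_congr fun ν => ?_
  congr 2; ring

/-- The twisted convolution of nonnegative functions. -/
def tconv (κ : ℤ → ℤ → ℝ≥0∞) (ω : ℤ → ℤ → ℝ) (A B : ℤ × ℝ → ℝ≥0∞) (x : ℤ × ℝ) : ℝ≥0∞ :=
  ∫⁻ y, κ x.1 y.1 * (A y * B (x.1 - y.1, x.2 - y.2 - ω x.1 y.1)) ∂mu

variable {κ : ℤ → ℤ → ℝ≥0∞} {ω : ℤ → ℤ → ℝ} {A B : ℤ × ℝ → ℝ≥0∞}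

theorem measurable_tconv (hA : Measurable A) (hB : Measurable B) : Measurable (tconv κ ω A B) := by
  unfold tconv
  exact Measurable.lintegral_prod_right' (f := fun p : (ℤ × ℝ) × (ℤ × ℝ) =>
    κ p.1.1 p.2.1 * (A p.2 * B (p.1.1 - p.2.1, p.1.2 - p.2.2 - ω p.1.1 p.2.1))) (by fun_prop)

theorem lintegral_lintegral_sub_right {f : ℤ × ℝ → ℝ≥0∞} {g : ℤ × ℝ → ℝ≥0∞} (hf : Measurable f)
    (hg : Measurable g) (ω : ℤ → ℤ → ℝ) :
    ∫⁻ x, ∫⁻ y, f y * g (x.1 - y.1, x.2 - y.2 - ω x.1 y.1) ∂mu ∂mu =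
      (∫⁻ y, f y ∂mu) * ∫⁻ y, g y ∂mu := by
  rw [lintegral_lintegral_swap (Measurable.aemeasurable (by fun_prop))]
  have : ∀ y : ℤ × ℝ, ∫⁻ x, f y * g (x.1 - y.1, x.2 - y.2 - ω x.1 y.1) ∂mu =
      f y * ∫⁻ y, g y ∂mu := by
    intro y
    rw [lintegral_const_mul _ (by fun_prop),
      lintegral_mu_sub_right hg y.1 y.2 fun k => ω k y.1]
  simp only [this]
  rw [lintegral_mul_const _ hf]

/-- The weight `⟨τ⟩^{1/2}`. -/
def wt (A : ℤ × ℝ → ℝ≥0∞) (x : ℤ × ℝ) : ℝ≥0∞ := jb x.2 ^ (1 / 2 : ℝ) * A x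

@[fun_prop]
theorem measurable_wt (hA : Measurable A) : Measurable (wt A) := by unfold wt; fun_prop

theorem jb_half_sq (x : ℝ) : (jb x ^ (1 / 2 : ℝ)) ^ 2 = jb x := by
  rw [← ENNReal.rpow_natCast, ← ENNReal.rpow_mul]; norm_num

theorem jb_rpow_sq (x a : ℝ) : (jb x ^ a) ^ 2 = jb x ^ (2 * a) := by
  rw [← ENNReal.rpow_natCast, ← ENNReal.rpow_mul, mul_comm]; norm_num

theorem jb_neg_half_mul_wt (A : ℤ × ℝ → ℝ≥0∞) (x : ℤ × ℝ) :
    jb x.2 ^ (-(1 / 2) : ℝ) * wt A x = A x := by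
  rw [wt, ← mul_assoc, ← jb_rpow_add]; norm_num

/-- Cauchy–Schwarz at a fixed output point, with the weights `⟨σ⟩^{-1/2}` of both inputs put on the
kernel. Integration over the output then decouples the two inputs by Tonelli's theorem. -/
theorem lintegral_tconv_sq_le (hA : Measurable A) (hB : Measurable B) {S : ℝ≥0∞}
    (hS : ∀ x : ℤ × ℝ, ∫⁻ y, κ x.1 y.1 ^ 2 *
      (jb y.2 ^ (-1 : ℝ) * jb (x.2 - y.2 - ω x.1 y.1) ^ (-1 : ℝ)) ∂mu ≤ S) :
    ∫⁻ x, tconv κ ω A B x ^ 2 ∂mu ≤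
      S * ((∫⁻ x, wt A x ^ 2 ∂mu) * ∫⁻ x, wt B x ^ 2 ∂mu) := by
  have h1 : ∀ x, tconv κ ω A B x ^ 2 ≤ S * ∫⁻ y, wt A y ^ 2 *
      wt B (x.1 - y.1, x.2 - y.2 - ω x.1 y.1) ^ 2 ∂mu := by
    intro x
    have h2 : tconv κ ω A B x = ∫⁻ y, (κ x.1 y.1 * (jb y.2 ^ (-(1 / 2) : ℝ) *
        jb (x.2 - y.2 - ω x.1 y.1) ^ (-(1 / 2) : ℝ))) *
        (wt A y * wt B (x.1 - y.1, x.2 - y.2 - ω x.1 y.1)) ∂mu := by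
      refine lintegral_congr fun y => ?_
      rw [← jb_neg_half_mul_wt A y, ← jb_neg_half_mul_wt B]
      ring
    rw [h2]
    refine (sq_lintegral_mul_le (by fun_prop) (by fun_prop)).trans ?_
    gcongr
    · refine le_trans (le_of_eq (lintegral_congr fun y => ?_)) (hS x)
      rw [mul_pow, mul_pow, jb_rpow_sq, jb_rpow_sq]; norm_num
    · rw [mul_pow]
  refine (lintegral_mono h1).trans ?_
  rw [lintegral_const_mul _ (Measurable.lintegral_prod_right' (f := fun p : (ℤ × ℝ) × (ℤ × ℝ) =>
    wt A p.2 ^ 2 * wt B (p.1.1 - p.2.1, p.1.2 - p.2.2 - ω p.1.1 p.2.1) ^ 2) (by fun_prop)),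
    lintegral_lintegral_sub_right (f := fun y => wt A y ^ 2) (g := fun y => wt B y ^ 2)
      (by fun_prop) (by fun_prop)]

/-- The case where `A` has no modulation weight to give, because it has been spent on the resonance.
Cauchy–Schwarz spends the weight of `B` and the output weight, and the supremum of the kernel is
taken over the point of `A`. -/
theorem lintegral_tconv_sq_le_left (hA : Measurable A) (hB : Measurable B) {S : ℝ≥0∞}
    (hS : ∀ y : ℤ × ℝ, ∫⁻ x, κ x.1 y.1 ^ 2 *
      (jb x.2 ^ (-(4 / 5) : ℝ) * jb (x.2 - y.2 - ω x.1 y.1) ^ (-1 : ℝ)) ∂mu ≤ S) :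
    ∫⁻ x, jb x.2 ^ (-(4 / 5) : ℝ) * tconv κ ω A B x ^ 2 ∂mu ≤
      S * ((∫⁻ x, A x ^ 2 ∂mu) * ∫⁻ x, wt B x ^ 2 ∂mu) := by
  have h1 : ∀ x : ℤ × ℝ, jb x.2 ^ (-(4 / 5) : ℝ) * tconv κ ω A B x ^ 2 ≤
      (∫⁻ x, wt B x ^ 2 ∂mu) * ∫⁻ y, A y ^ 2 * (κ x.1 y.1 ^ 2 *
      (jb x.2 ^ (-(4 / 5) : ℝ) * jb (x.2 - y.2 - ω x.1 y.1) ^ (-1 : ℝ))) ∂mu := by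
    intro x
    have h2 : tconv κ ω A B x = ∫⁻ y, wt B (x.1 - y.1, x.2 - y.2 - ω x.1 y.1) *
        (A y * (κ x.1 y.1 * jb (x.2 - y.2 - ω x.1 y.1) ^ (-(1 / 2) : ℝ))) ∂mu := by
      refine lintegral_congr fun y => ?_
      rw [← jb_neg_half_mul_wt B]
      ring
    rw [h2]
    calc _ ≤ jb x.2 ^ (-(4 / 5) : ℝ) * ((∫⁻ y, wt B (x.1 - y.1, x.2 - y.2 - ω x.1 y.1) ^ 2 ∂mu) *
          ∫⁻ y, (A y * (κ x.1 y.1 * jb (x.2 - y.2 - ω x.1 y.1) ^ (-(1 / 2) : ℝ))) ^ 2 ∂mu) := by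
          gcongr
          exact sq_lintegral_mul_le (by fun_prop) (by fun_prop)
      _ = (∫⁻ x, wt B x ^ 2 ∂mu) * (jb x.2 ^ (-(4 / 5) : ℝ) *
          ∫⁻ y, (A y * (κ x.1 y.1 * jb (x.2 - y.2 - ω x.1 y.1) ^ (-(1 / 2) : ℝ))) ^ 2 ∂mu) := by
          rw [lintegral_mu_sub_left (f := fun y => wt B y ^ 2) (by fun_prop) x.1 x.2 (ω x.1)]
          ring
      _ = _ := by
          rw [← lintegral_const_mul _ (by fun_prop)]
          congr 1
          refine lintegral_congr fun y => ?_
          rw [mul_pow, mul_pow, jb_rpow_sq]; norm_num; ring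
  refine (lintegral_mono h1).trans ?_
  rw [lintegral_const_mul _ (Measurable.lintegral_prod_right' (f := fun p : (ℤ × ℝ) × (ℤ × ℝ) =>
    A p.2 ^ 2 * (κ p.1.1 p.2.1 ^ 2 * (jb p.1.2 ^ (-(4 / 5) : ℝ) *
      jb (p.1.2 - p.2.2 - ω p.1.1 p.2.1) ^ (-1 : ℝ)))) (by fun_prop)),
    lintegral_lintegral_swap (Measurable.aemeasurable (by fun_prop))]
  calc _ ≤ (∫⁻ x, wt B x ^ 2 ∂mu) * ∫⁻ y, A y ^ 2 * S ∂mu := by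
        gcongr with y
        simp only
        rw [lintegral_const_mul _ (by fun_prop)]
        gcongr
        exact hS y
    _ = _ := by rw [lintegral_mul_const _ (by fun_prop)]; ring

/-- The mirror image of `lintegral_tconv_sq_le_left`. The supremum is over the point `z` of `B`, so
the outer variable is changed from the output `x` to `z`. -/
theorem lintegral_tconv_sq_le_right (hA : Measurable A) (hB : Measurable B) {S : ℝ≥0∞}
    (hS : ∀ z : ℤ × ℝ, ∫⁻ y, κ (z.1 + y.1) y.1 ^ 2 *
      (jb (z.2 + y.2 + ω (z.1 + y.1) y.1) ^ (-(4 / 5) : ℝ) * jb y.2 ^ (-1 : ℝ)) ∂mu ≤ S) :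
    ∫⁻ x, jb x.2 ^ (-(4 / 5) : ℝ) * tconv κ ω A B x ^ 2 ∂mu ≤
      S * ((∫⁻ x, wt A x ^ 2 ∂mu) * ∫⁻ x, B x ^ 2 ∂mu) := by
  have h1 : ∀ x : ℤ × ℝ, jb x.2 ^ (-(4 / 5) : ℝ) * tconv κ ω A B x ^ 2 ≤
      (∫⁻ x, wt A x ^ 2 ∂mu) * ∫⁻ y, B (x.1 - y.1, x.2 - y.2 - ω x.1 y.1) ^ 2 * (κ x.1 y.1 ^ 2 *
      (jb x.2 ^ (-(4 / 5) : ℝ) * jb y.2 ^ (-1 : ℝ))) ∂mu := by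
    intro x
    have h2 : tconv κ ω A B x = ∫⁻ y, wt A y *
        (B (x.1 - y.1, x.2 - y.2 - ω x.1 y.1) * (κ x.1 y.1 * jb y.2 ^ (-(1 / 2) : ℝ))) ∂mu := by
      refine lintegral_congr fun y => ?_
      rw [← jb_neg_half_mul_wt A]
      ring
    rw [h2]
    calc _ ≤ jb x.2 ^ (-(4 / 5) : ℝ) * ((∫⁻ y, wt A y ^ 2 ∂mu) *
          ∫⁻ y, (B (x.1 - y.1, x.2 - y.2 - ω x.1 y.1) *
            (κ x.1 y.1 * jb y.2 ^ (-(1 / 2) : ℝ))) ^ 2 ∂mu) := by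
          gcongr
          exact sq_lintegral_mul_le (by fun_prop) (by fun_prop)
      _ = (∫⁻ x, wt A x ^ 2 ∂mu) * (jb x.2 ^ (-(4 / 5) : ℝ) *
          ∫⁻ y, (B (x.1 - y.1, x.2 - y.2 - ω x.1 y.1) *
            (κ x.1 y.1 * jb y.2 ^ (-(1 / 2) : ℝ))) ^ 2 ∂mu) := by
          ring
      _ = _ := by
          rw [← lintegral_const_mul _ (by fun_prop)]
          congr 1
          refine lintegral_congr fun y => ?_
          rw [mul_pow, mul_pow, jb_rpow_sq]; norm_num; ring
  have hsub : ∀ y : ℤ × ℝ, ∫⁻ x, B (x.1 - y.1, x.2 - y.2 - ω x.1 y.1) ^ 2 * (κ x.1 y.1 ^ 2 *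
      (jb x.2 ^ (-(4 / 5) : ℝ) * jb y.2 ^ (-1 : ℝ))) ∂mu = ∫⁻ z, B z ^ 2 *
      (κ (z.1 + y.1) y.1 ^ 2 *
        (jb (z.2 + y.2 + ω (z.1 + y.1) y.1) ^ (-(4 / 5) : ℝ) * jb y.2 ^ (-1 : ℝ))) ∂mu := by
    intro y
    rw [← lintegral_mu_sub_right (f := fun z => B z ^ 2 * (κ (z.1 + y.1) y.1 ^ 2 *
        (jb (z.2 + y.2 + ω (z.1 + y.1) y.1) ^ (-(4 / 5) : ℝ) * jb y.2 ^ (-1 : ℝ))))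
        (by fun_prop) y.1 y.2 fun k => ω k y.1]
    refine lintegral_congr fun x => ?_
    simp only [sub_add_cancel]
    congr 5
    ring
  refine (lintegral_mono h1).trans ?_
  rw [lintegral_const_mul _ (Measurable.lintegral_prod_right' (f := fun p : (ℤ × ℝ) × (ℤ × ℝ) =>
    B (p.1.1 - p.2.1, p.1.2 - p.2.2 - ω p.1.1 p.2.1) ^ 2 * (κ p.1.1 p.2.1 ^ 2 *
      (jb p.1.2 ^ (-(4 / 5) : ℝ) * jb p.2.2 ^ (-1 : ℝ)))) (by fun_prop)),
    lintegral_lintegral_swap (Measurable.aemeasurable (by fun_prop))]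
  simp only [hsub]
  rw [lintegral_lintegral_swap (Measurable.aemeasurable (by fun_prop))]
  calc _ ≤ (∫⁻ x, wt A x ^ 2 ∂mu) * ∫⁻ y, B y ^ 2 * S ∂mu := by
        gcongr with z
        rw [lintegral_const_mul _ (by fun_prop)]
        gcongr
        exact hS z
    _ = _ := by rw [lintegral_mul_const _ (by fun_prop)]; ring

theorem lintegral_tconv_eq (hA : Measurable A) (hB : Measurable B) (k : ℤ) :
    ∫⁻ ν : ℝ, tconv κ ω A B (k, ν) =
      ∑' m : ℤ, κ k m * ((∫⁻ σ : ℝ, A (m, σ)) * ∫⁻ ρ : ℝ, B (k - m, ρ)) := by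
  unfold tconv
  rw [lintegral_lintegral_swap (Measurable.aemeasurable (by fun_prop)), lintegral_mu]
  · refine tsum_congr fun m => ?_
    simp only
    have : ∀ σ : ℝ, ∫⁻ ν : ℝ, κ k m * (A (m, σ) * B (k - m, ν - σ - ω k m)) =
        κ k m * (A (m, σ) * ∫⁻ ρ : ℝ, B (k - m, ρ)) := by
      intro σ
      rw [lintegral_const_mul _ (by fun_prop), lintegral_const_mul _ (by fun_prop)]
      congr 2
      rw [← lintegral_sub_right_eq_self (fun ρ => B (k - m, ρ)) (σ + ω k m)]
      simp only [sub_sub]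
    simp only [this]
    rw [lintegral_const_mul _ (by fun_prop), lintegral_mul_const _ (by fun_prop)]
  · exact Measurable.lintegral_prod_left' (f := fun p : ℝ × (ℤ × ℝ) =>
      κ k p.2.1 * (A p.2 * B (k - p.2.1, p.1 - p.2.2 - ω k p.2.1))) (by fun_prop)

end Zakharov

end

noncomputable section

namespace Zakharov

/-! ### The bilinear estimate -/

/-- The weight of an interaction: its coefficient divided by the square root of its resonance. -/
def resWeight (κ : ℤ → ℤ → ℝ≥0∞) (ω : ℤ → ℤ → ℝ) (k m : ℤ) : ℝ≥0∞ :=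
  κ k m * jb (ω k m) ^ (-(1 / 2) : ℝ)

/-- `resWeight` restricted to the nonresonant interactions. -/
def resWeight' (κ : ℤ → ℤ → ℝ≥0∞) (ω : ℤ → ℤ → ℝ) (k m : ℤ) : ℝ≥0∞ :=
  if ω k m = 0 then 0 else resWeight κ ω k m

/-- The three sums over interactions with one of the three frequencies fixed are bounded by `S`. -/
structure InteractionBound (κ : ℤ → ℤ → ℝ≥0∞) (ω : ℤ → ℤ → ℝ) (S : ℝ≥0∞) : Prop where
  out : ∀ (k : ℤ) (s : ℝ), ∑' m, resWeight κ ω k m ^ 2 * jb (s - ω k m) ^ (-(3 / 10) : ℝ) ≤ S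
  left : ∀ (m : ℤ) (s : ℝ), ∑' k, resWeight' κ ω k m ^ 2 * jb (s + ω k m) ^ (-(3 / 10) : ℝ) ≤ S
  right : ∀ (l : ℤ) (s : ℝ), ∑' m, resWeight' κ ω (l + m) m ^ 2 *
    jb (s + ω (l + m) m) ^ (-(3 / 10) : ℝ) ≤ S

variable {κ : ℤ → ℤ → ℝ≥0∞} {ω : ℤ → ℤ → ℝ} {A B : ℤ × ℝ → ℝ≥0∞} {S : ℝ≥0∞}

theorem resWeight'_le (k m : ℤ) : resWeight' κ ω k m ≤ resWeight κ ω k m := by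
  unfold resWeight'; split_ifs <;> simp

theorem resWeight_mul (k m : ℤ) : resWeight κ ω k m * jb (ω k m) ^ (1 / 2 : ℝ) = κ k m := by
  rw [resWeight, mul_assoc, ← jb_rpow_add]; norm_num

theorem InteractionBound.kernel_out (h : InteractionBound κ ω S) (x : ℤ × ℝ) :
    ∫⁻ y, resWeight κ ω x.1 y.1 ^ 2 *
      (jb y.2 ^ (-1 : ℝ) * jb (x.2 - y.2 - ω x.1 y.1) ^ (-1 : ℝ)) ∂mu ≤ 4 * tailMass * S := by
  rw [lintegral_mu (by fun_prop)]
  calc _ ≤ ∑' m, resWeight κ ω x.1 m ^ 2 *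
        (4 * tailMass * jb (x.2 - ω x.1 m) ^ (-(3 / 10) : ℝ)) := by
        gcongr with m
        simp only
        rw [lintegral_const_mul _ (by fun_prop)]
        gcongr
        refine le_trans (lintegral_mono fun σ => ?_) (lintegral_kernel_le _)
        rw [sub_right_comm]
        exact mul_le_mul' (jb_rpow_le _ (by norm_num)) le_rfl
    _ = 4 * tailMass * ∑' m, resWeight κ ω x.1 m ^ 2 * jb (x.2 - ω x.1 m) ^ (-(3 / 10) : ℝ) := by
        rw [← ENNReal.tsum_mul_left]
        exact tsum_congr fun m => by ring
    _ ≤ _ := by gcongr; exact h.out _ _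

theorem InteractionBound.kernel_left (h : InteractionBound κ ω S) (y : ℤ × ℝ) :
    ∫⁻ x, resWeight' κ ω x.1 y.1 ^ 2 *
      (jb x.2 ^ (-(4 / 5) : ℝ) * jb (x.2 - y.2 - ω x.1 y.1) ^ (-1 : ℝ)) ∂mu ≤
      4 * tailMass * S := by
  rw [lintegral_mu (by fun_prop)]
  calc _ ≤ ∑' k, resWeight' κ ω k y.1 ^ 2 *
        (4 * tailMass * jb (y.2 + ω k y.1) ^ (-(3 / 10) : ℝ)) := by
        gcongr with k
        simp only
        rw [lintegral_const_mul _ (by fun_prop)]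
        gcongr
        refine le_trans (lintegral_mono fun σ => ?_) (lintegral_kernel_le _)
        rw [← jb_neg (σ - y.2 - ω k y.1)]
        refine le_of_eq ?_
        congr 3; ring
    _ = 4 * tailMass * ∑' k, resWeight' κ ω k y.1 ^ 2 * jb (y.2 + ω k y.1) ^ (-(3 / 10) : ℝ) := by
        rw [← ENNReal.tsum_mul_left]
        exact tsum_congr fun m => by ring
    _ ≤ _ := by gcongr; exact h.left _ _

theorem InteractionBound.kernel_right (h : InteractionBound κ ω S) (z : ℤ × ℝ) :
    ∫⁻ y, resWeight' κ ω (z.1 + y.1) y.1 ^ 2 *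
      (jb (z.2 + y.2 + ω (z.1 + y.1) y.1) ^ (-(4 / 5) : ℝ) * jb y.2 ^ (-1 : ℝ)) ∂mu ≤
      4 * tailMass * S := by
  rw [lintegral_mu (by fun_prop)]
  calc _ ≤ ∑' m, resWeight' κ ω (z.1 + m) m ^ 2 *
        (4 * tailMass * jb (z.2 + ω (z.1 + m) m) ^ (-(3 / 10) : ℝ)) := by
        gcongr with m
        simp only
        rw [lintegral_const_mul _ (by fun_prop)]
        gcongr
        refine le_trans (le_of_eq ?_) (lintegral_kernel_le _)
        rw [← lintegral_sub_right_eq_self _ (z.2 + ω (z.1 + m) m)]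
        refine lintegral_congr fun σ => ?_
        rw [← jb_neg (σ - _)]
        congr 3 <;> ring
    _ = 4 * tailMass * ∑' m, resWeight' κ ω (z.1 + m) m ^ 2 *
          jb (z.2 + ω (z.1 + m) m) ^ (-(3 / 10) : ℝ) := by
        rw [← ENNReal.tsum_mul_left]
        exact tsum_congr fun m => by ring
    _ ≤ _ := by gcongr; exact h.right _ _

theorem jb_half_add_le (a b c : ℝ) : jb (a + b + c) ^ (1 / 2 : ℝ) ≤
    jb a ^ (1 / 2 : ℝ) + (jb b ^ (1 / 2 : ℝ) + jb c ^ (1 / 2 : ℝ)) := by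
  calc jb (a + b + c) ^ (1 / 2 : ℝ) ≤ (jb a + (jb b + jb c)) ^ (1 / 2 : ℝ) := by
        gcongr
        calc _ ≤ jb (a + b) + jb c := jb_add_le _ _
          _ ≤ jb a + jb b + jb c := by gcongr; exact jb_add_le _ _
          _ = _ := add_assoc _ _ _
    _ ≤ jb a ^ (1 / 2 : ℝ) + (jb b + jb c) ^ (1 / 2 : ℝ) :=
        ENNReal.rpow_add_le_add_rpow _ _ (by norm_num) (by norm_num)
    _ ≤ _ := by
        gcongr
        exact ENNReal.rpow_add_le_add_rpow _ _ (by norm_num) (by norm_num)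

/-- The resonance is the combination `ω = ν - σ - (ν - σ - ω)` of the three modulations, so
`⟨ω⟩^{1/2}` is at most the sum of their square roots. For `ω = 0` the output term alone suffices.
This is why `resWeight'` may drop resonant interactions, and it must do so in `u n → u`, where all
pairs `k = m` are resonant and have the same difference. -/
theorem coeff_le_resWeight (k m : ℤ) (ν σ : ℝ) :
    κ k m ≤ jb ν ^ (1 / 2 : ℝ) * resWeight κ ω k m + (resWeight' κ ω k m * jb σ ^ (1 / 2 : ℝ) +
      resWeight' κ ω k m * jb (ν - σ - ω k m) ^ (1 / 2 : ℝ)) := by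
  by_cases h : ω k m = 0
  · have h1 : κ k m = resWeight κ ω k m := by
      rw [resWeight, h]; simp [jb, bracket]
    rw [h1]
    calc _ = 1 * resWeight κ ω k m := (one_mul _).symm
      _ ≤ jb ν ^ (1 / 2 : ℝ) * resWeight κ ω k m := by gcongr; exact one_le_jb_rpow _ (by norm_num)
      _ ≤ _ := le_self_add
  · rw [resWeight', if_neg h, ← mul_add, mul_comm (jb ν ^ _), ← mul_add]
    conv_lhs => rw [← resWeight_mul (κ := κ) (ω := ω)]
    gcongr
    have := jb_half_add_le ν (-σ) (-(ν - σ - ω k m))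
    rw [jb_neg, jb_neg] at this
    rwa [show ν + -σ + -(ν - σ - ω k m) = ω k m by ring] at this

/-- Either the output modulation controls the resonance, and `⟨ν⟩^{-1}` is exchanged for `⟨ω⟩^{-1}`,
or it can be absorbed and the two input modulations control `⟨ω⟩^{1/2}`. In the second case `ω` is
not zero, so `resWeight'` applies. -/
theorem coeff_div_le (k m : ℤ) (ν σ : ℝ) :
    jb ν ^ (-1 : ℝ) * κ k m ≤ 2 * (κ k m * jb (ω k m) ^ (-1 : ℝ)) +
      2 * (jb ν ^ (-1 : ℝ) * (resWeight' κ ω k m * jb σ ^ (1 / 2 : ℝ) +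
      resWeight' κ ω k m * jb (ν - σ - ω k m) ^ (1 / 2 : ℝ))) := by
  rcases le_or_gt (jb (ω k m)) (2 * jb ν) with h | h
  · have h1 : jb ν ^ (-1 : ℝ) ≤ 2 * jb (ω k m) ^ (-1 : ℝ) := by
      rw [ENNReal.rpow_neg_one, ENNReal.rpow_neg_one, ← div_eq_mul_inv,
        ENNReal.le_div_iff_mul_le (Or.inl (jb_ne_zero _)) (Or.inl (jb_ne_top _)), mul_comm,
        ← div_eq_mul_inv]
      exact ENNReal.div_le_of_le_mul h
    calc _ ≤ 2 * jb (ω k m) ^ (-1 : ℝ) * κ k m := by gcongr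
      _ = 2 * (κ k m * jb (ω k m) ^ (-1 : ℝ)) := by ring
      _ ≤ _ := le_self_add
  · have h0 : ω k m ≠ 0 := by
      intro h0
      have h2 : jb (ω k m) = 1 := by rw [h0]; simp [jb, bracket]
      rw [h2] at h
      have := one_le_jb ν
      refine absurd h (not_lt.2 (this.trans ?_))
      exact le_mul_of_one_le_left' (by norm_num)
    have h1 : jb (ω k m) ≤ jb ν + (jb σ + jb (ν - σ - ω k m)) := by
      calc jb (ω k m) = jb (ν + (-σ + -(ν - σ - ω k m))) := by congr 1; ring
        _ ≤ jb ν + (jb (-σ) + jb (-(ν - σ - ω k m))) :=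
          (jb_add_le _ _).trans (by gcongr; exact jb_add_le _ _)
        _ = _ := by rw [jb_neg, jb_neg]
    have h2 : jb ν ≤ jb σ + jb (ν - σ - ω k m) := by
      have : jb ν + jb ν ≤ jb ν + (jb σ + jb (ν - σ - ω k m)) := by
        rw [← two_mul]; exact h.le.trans h1
      exact (ENNReal.add_le_add_iff_left (jb_ne_top _)).1 this
    have h3 : jb (ω k m) ^ (1 / 2 : ℝ) ≤
        2 * (jb σ ^ (1 / 2 : ℝ) + jb (ν - σ - ω k m) ^ (1 / 2 : ℝ)) := by
      calc _ ≤ (2 * (jb σ + jb (ν - σ - ω k m))) ^ (1 / 2 : ℝ) := by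
            gcongr
            calc _ ≤ _ := h1
              _ ≤ _ := by rw [two_mul]; gcongr
        _ = 2 ^ (1 / 2 : ℝ) * (jb σ + jb (ν - σ - ω k m)) ^ (1 / 2 : ℝ) :=
            ENNReal.mul_rpow_of_nonneg _ _ (by norm_num)
        _ ≤ 2 ^ (1 : ℝ) * (jb σ ^ (1 / 2 : ℝ) + jb (ν - σ - ω k m) ^ (1 / 2 : ℝ)) := by
            refine mul_le_mul' (ENNReal.rpow_le_rpow_of_exponent_le (by norm_num) (by norm_num)) ?_
            exact ENNReal.rpow_add_le_add_rpow _ _ (by norm_num) (by norm_num)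
        _ = _ := by rw [ENNReal.rpow_one]
    refine le_trans ?_ le_add_self
    rw [resWeight', if_neg h0, ← mul_add]
    conv_lhs => rw [← resWeight_mul (κ := κ) (ω := ω)]
    calc _ ≤ jb ν ^ (-1 : ℝ) * (resWeight κ ω k m *
          (2 * (jb σ ^ (1 / 2 : ℝ) + jb (ν - σ - ω k m) ^ (1 / 2 : ℝ)))) := by gcongr
      _ = _ := by ring

theorem tconv_le (hA : Measurable A) (hB : Measurable B) (x : ℤ × ℝ) :
    tconv κ ω A B x ≤ jb x.2 ^ (1 / 2 : ℝ) * tconv (resWeight κ ω) ω A B x +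
      (tconv (resWeight' κ ω) ω (wt A) B x + tconv (resWeight' κ ω) ω A (wt B) x) := by
  unfold tconv
  rw [← lintegral_const_mul _ (by fun_prop), ← lintegral_add_left (by fun_prop),
    ← lintegral_add_left (by fun_prop)]
  refine lintegral_mono fun y => ?_
  simp only [wt]
  calc _ ≤ (jb x.2 ^ (1 / 2 : ℝ) * resWeight κ ω x.1 y.1 +
        (resWeight' κ ω x.1 y.1 * jb y.2 ^ (1 / 2 : ℝ) +
        resWeight' κ ω x.1 y.1 * jb (x.2 - y.2 - ω x.1 y.1) ^ (1 / 2 : ℝ))) *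
        (A y * B (x.1 - y.1, x.2 - y.2 - ω x.1 y.1)) := by
        gcongr; exact coeff_le_resWeight _ _ _ _
    _ = _ := by ring

theorem jb_inv_mul_tconv_le (hA : Measurable A) (hB : Measurable B) (x : ℤ × ℝ) :
    jb x.2 ^ (-1 : ℝ) * tconv κ ω A B x ≤
      2 * tconv (fun k m => κ k m * jb (ω k m) ^ (-1 : ℝ)) ω A B x +
      2 * (jb x.2 ^ (-1 : ℝ) *
        (tconv (resWeight' κ ω) ω (wt A) B x + tconv (resWeight' κ ω) ω A (wt B) x)) := by
  unfold tconv
  rw [← lintegral_add_left (by fun_prop),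
    ← lintegral_const_mul _ (by fun_prop), ← lintegral_const_mul _ (by fun_prop),
    ← lintegral_const_mul _ (by fun_prop), ← lintegral_const_mul _ (by fun_prop),
    ← lintegral_add_left (by fun_prop)]
  refine lintegral_mono fun y => ?_
  simp only [wt]
  calc _ = (jb x.2 ^ (-1 : ℝ) * κ x.1 y.1) * (A y * B (x.1 - y.1, x.2 - y.2 - ω x.1 y.1)) := by
        ring
    _ ≤ _ := mul_le_mul' (coeff_div_le (ω := ω) _ _ _ y.2) le_rfl
    _ = _ := by ring

/-- The `ℓ²L¹` norm. -/
def l2l1 (A : ℤ × ℝ → ℝ≥0∞) : ℝ≥0∞ := l2 Measure.count fun k : ℤ => ∫⁻ τ : ℝ, A (k, τ)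

theorem l2l1_sq (A : ℤ × ℝ → ℝ≥0∞) : l2l1 A ^ 2 = ∑' k : ℤ, (∫⁻ τ : ℝ, A (k, τ)) ^ 2 := by
  rw [l2l1, l2_sq, lintegral_count]

theorem l2l1_mono {A B : ℤ × ℝ → ℝ≥0∞} (h : ∀ x, A x ≤ B x) : l2l1 A ≤ l2l1 B :=
  l2_mono fun _ => lintegral_mono fun _ => h _

theorem l2l1_add_le (hA : Measurable A) (_hB : Measurable B) :
    l2l1 (fun x => A x + B x) ≤ l2l1 A + l2l1 B := by
  refine le_trans (le_of_eq ?_) (l2_add_le (measurable_of_countable _) (measurable_of_countable _))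
  unfold l2l1
  congr 1; ext k
  exact lintegral_add_left (by fun_prop) _

theorem l2l1_const_mul (c : ℝ≥0∞) (hA : Measurable A) :
    l2l1 (fun x => c * A x) = c * l2l1 A := by
  rw [l2l1, l2l1, ← l2_const_mul _ (measurable_of_countable _)]
  congr 1; ext k
  exact lintegral_const_mul _ (by fun_prop)

theorem le_mul_of_sq_le {a c b d s : ℝ≥0∞} (h : a ^ 2 ≤ c ^ 2 * s ^ 2 * (b ^ 2 * d ^ 2)) :
    a ≤ c * s * (b * d) := by
  apply le_of_sq_le_sq
  simpa only [mul_pow] using h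

/-- The square root of the constant of the convolution kernel. -/
def kerConst : ℝ≥0∞ := (4 * tailMass) ^ (1 / 2 : ℝ)

theorem kerConst_sq : kerConst ^ 2 = 4 * tailMass := by
  rw [kerConst, ← ENNReal.rpow_natCast, ← ENNReal.rpow_mul]; norm_num

theorem kerConst_ne_top : kerConst ≠ ∞ :=
  ENNReal.rpow_ne_top_of_nonneg (by norm_num) (ENNReal.mul_ne_top (by simp) tailMass_ne_top)

/-- The part of the interaction where the output modulation pays for the resonance. -/
theorem l2_tconv_resWeight_le {s : ℝ≥0∞} (h : InteractionBound κ ω (s ^ 2)) (hA : Measurable A)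
    (hB : Measurable B) :
    l2 mu (tconv (resWeight κ ω) ω A B) ≤ kerConst * s * (l2 mu (wt A) * l2 mu (wt B)) := by
  apply le_mul_of_sq_le
  rw [l2_sq, l2_sq, l2_sq, kerConst_sq]
  exact lintegral_tconv_sq_le hA hB h.kernel_out

theorem wt_neg_two_fifths_sq (f : ℤ × ℝ → ℝ≥0∞) (x : ℤ × ℝ) :
    (jb x.2 ^ (-(2 / 5) : ℝ) * f x) ^ 2 = jb x.2 ^ (-(4 / 5) : ℝ) * f x ^ 2 := by
  rw [mul_pow, jb_rpow_sq]; norm_num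

theorem l2_tconv_left_le {s : ℝ≥0∞} (h : InteractionBound κ ω (s ^ 2)) (hA : Measurable A)
    (hB : Measurable B) :
    l2 mu (fun x => jb x.2 ^ (-(2 / 5) : ℝ) * tconv (resWeight' κ ω) ω (wt A) B x) ≤
      kerConst * s * (l2 mu (wt A) * l2 mu (wt B)) := by
  apply le_mul_of_sq_le
  rw [l2_sq, l2_sq, l2_sq, kerConst_sq]
  simp only [wt_neg_two_fifths_sq]
  exact lintegral_tconv_sq_le_left (by fun_prop) hB h.kernel_left

theorem l2_tconv_right_le {s : ℝ≥0∞} (h : InteractionBound κ ω (s ^ 2)) (hA : Measurable A)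
    (hB : Measurable B) :
    l2 mu (fun x => jb x.2 ^ (-(2 / 5) : ℝ) * tconv (resWeight' κ ω) ω A (wt B) x) ≤
      kerConst * s * (l2 mu (wt A) * l2 mu (wt B)) := by
  apply le_mul_of_sq_le
  rw [l2_sq, l2_sq, l2_sq, kerConst_sq]
  simp only [wt_neg_two_fifths_sq]
  exact lintegral_tconv_sq_le_right hA (by fun_prop) h.kernel_right

theorem l2_tconv_le {s : ℝ≥0∞} (h : InteractionBound κ ω (s ^ 2)) (hA : Measurable A)
    (hB : Measurable B) :
    l2 mu (fun x => jb x.2 ^ (-(1 / 2) : ℝ) * tconv κ ω A B x) ≤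
      3 * kerConst * s * (l2 mu (wt A) * l2 mu (wt B)) := by
  have m1 := measurable_tconv (κ := resWeight κ ω) (ω := ω) hA hB
  have m2 := measurable_tconv (κ := resWeight' κ ω) (ω := ω) (measurable_wt hA) hB
  have m3 := measurable_tconv (κ := resWeight' κ ω) (ω := ω) hA (measurable_wt hB)
  calc _ ≤ l2 mu (fun x => tconv (resWeight κ ω) ω A B x +
        (jb x.2 ^ (-(2 / 5) : ℝ) * tconv (resWeight' κ ω) ω (wt A) B x +
          jb x.2 ^ (-(2 / 5) : ℝ) * tconv (resWeight' κ ω) ω A (wt B) x)) := by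
        refine l2_mono fun x => ?_
        calc _ ≤ jb x.2 ^ (-(1 / 2) : ℝ) *
              (jb x.2 ^ (1 / 2 : ℝ) * tconv (resWeight κ ω) ω A B x +
              (tconv (resWeight' κ ω) ω (wt A) B x + tconv (resWeight' κ ω) ω A (wt B) x)) :=
              mul_le_mul' le_rfl (tconv_le hA hB x)
          _ = tconv (resWeight κ ω) ω A B x + jb x.2 ^ (-(1 / 2) : ℝ) *
              (tconv (resWeight' κ ω) ω (wt A) B x + tconv (resWeight' κ ω) ω A (wt B) x) := by
              rw [mul_add, ← mul_assoc, ← jb_rpow_add]; norm_num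
          -- The exponent `-1/2` is relaxed to `-2/5`: the left and right estimates hold with this
          -- weaker weight, and the same bounds then serve for the `ℓ²L¹` norm.
          _ ≤ _ := by
              rw [← mul_add]
              exact add_le_add le_rfl (mul_le_mul' (jb_rpow_le _ (by norm_num)) le_rfl)
    _ ≤ kerConst * s * (l2 mu (wt A) * l2 mu (wt B)) +
        (kerConst * s * (l2 mu (wt A) * l2 mu (wt B)) +
          kerConst * s * (l2 mu (wt A) * l2 mu (wt B))) := by
        refine (l2_add_le m1 (by fun_prop)).trans ?_
        refine add_le_add (l2_tconv_resWeight_le h hA hB) ((l2_add_le (by fun_prop)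
          (by fun_prop)).trans ?_)
        exact add_le_add (l2_tconv_left_le h hA hB) (l2_tconv_right_le h hA hB)
    _ = _ := by ring

/-- Cauchy–Schwarz with `⟨τ⟩^{-1} = ⟨τ⟩^{-3/5} ⟨τ⟩^{-2/5}`, where `⟨τ⟩^{-3/5}` is square integrable.
The spare `1/10` in the exponent `-2/5` is used here. -/
theorem l2l1_jb_inv_le {f : ℤ × ℝ → ℝ≥0∞} (hf : Measurable f) :
    l2l1 (fun x => jb x.2 ^ (-1 : ℝ) * f x) ≤
      kerConst * l2 mu (fun x => jb x.2 ^ (-(2 / 5) : ℝ) * f x) := by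
  apply le_of_sq_le_sq
  rw [l2l1_sq, mul_pow, kerConst_sq, l2_sq, lintegral_mu (by fun_prop), ← ENNReal.tsum_mul_left]
  refine ENNReal.tsum_le_tsum fun k => ?_
  calc _ = (∫⁻ τ : ℝ, jb τ ^ (-(3 / 5) : ℝ) * (jb τ ^ (-(2 / 5) : ℝ) * f (k, τ))) ^ 2 := by
        congr 1
        refine lintegral_congr fun τ => ?_
        rw [← mul_assoc, ← jb_rpow_add]; norm_num
    _ ≤ _ := sq_lintegral_mul_le (by fun_prop) (by fun_prop)
    _ = tailMass * ∫⁻ τ : ℝ, (jb τ ^ (-(2 / 5) : ℝ) * f (k, τ)) ^ 2 := by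
        congr 1
        refine lintegral_congr fun τ => ?_
        rw [jb_rpow_sq]; norm_num
    _ ≤ _ := by
        gcongr
        exact le_mul_of_one_le_left' (by norm_num)

theorem sq_tsum_mul_le (f g : ℤ → ℝ≥0∞) : (∑' k, f k * g k) ^ 2 ≤ (∑' k, f k ^ 2) * ∑' k, g k ^ 2 := by
  have := sq_lintegral_mul_le (μ := Measure.count) (measurable_of_countable f)
    (measurable_of_countable g)
  simpa only [lintegral_count] using this

/-- Integration over the output time frequency turns the convolution into a sum over modes of
products of `L¹` norms. Cauchy–Schwarz in `m` then needs the sum of `κ² ⟨ω⟩^{-2}`, which is below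
the output sum of `InteractionBound` at `s = 0`. -/
theorem l2l1_tconv_inv_le {s : ℝ≥0∞} (h : InteractionBound κ ω (s ^ 2)) (hA : Measurable A)
    (hB : Measurable B) :
    l2l1 (tconv (fun k m => κ k m * jb (ω k m) ^ (-1 : ℝ)) ω A B) ≤ s * (l2l1 A * l2l1 B) := by
  rw [← one_mul s]
  apply le_mul_of_sq_le
  rw [one_pow, one_mul, l2l1_sq]
  set a : ℤ → ℝ≥0∞ := fun m => ∫⁻ σ : ℝ, A (m, σ)
  set b : ℤ → ℝ≥0∞ := fun m => ∫⁻ σ : ℝ, B (m, σ)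
  calc _ ≤ ∑' k, s ^ 2 * ∑' m, (a m * b (k - m)) ^ 2 := by
        gcongr with k
        rw [lintegral_tconv_eq hA hB]
        refine (sq_tsum_mul_le _ _).trans ?_
        gcongr
        refine le_trans (ENNReal.tsum_le_tsum fun m => ?_) (h.out k 0)
        rw [resWeight, mul_pow, mul_pow, mul_assoc, jb_rpow_sq, jb_rpow_sq, zero_sub, jb_neg,
          ← jb_rpow_add]
        exact mul_le_mul' le_rfl (jb_rpow_le _ (by norm_num))
    _ = s ^ 2 * (l2l1 A ^ 2 * l2l1 B ^ 2) := by
        rw [ENNReal.tsum_mul_left, ENNReal.tsum_comm, l2l1_sq, l2l1_sq, ← ENNReal.tsum_mul_right]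
        congr 1
        refine tsum_congr fun m => ?_
        simp only [mul_pow]
        rw [ENNReal.tsum_mul_left]
        congr 1
        exact (Equiv.subRight m).tsum_eq fun l => b l ^ 2

theorem l2l1_tconv_le {s : ℝ≥0∞} (h : InteractionBound κ ω (s ^ 2)) (hA : Measurable A)
    (hB : Measurable B) :
    l2l1 (fun x => jb x.2 ^ (-1 : ℝ) * tconv κ ω A B x) ≤
      2 * s * (l2l1 A * l2l1 B) + 4 * kerConst ^ 2 * s * (l2 mu (wt A) * l2 mu (wt B)) := by
  have m1 := measurable_tconv (κ := fun k m => κ k m * jb (ω k m) ^ (-1 : ℝ)) (ω := ω) hA hB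
  have m2 := measurable_tconv (κ := resWeight' κ ω) (ω := ω) (measurable_wt hA) hB
  have m3 := measurable_tconv (κ := resWeight' κ ω) (ω := ω) hA (measurable_wt hB)
  calc _ ≤ _ := l2l1_mono fun x => jb_inv_mul_tconv_le hA hB x
    _ ≤ _ := l2l1_add_le (by fun_prop) (by fun_prop)
    _ ≤ 2 * (s * (l2l1 A * l2l1 B)) + 2 * (kerConst * (kerConst * s * (l2 mu (wt A) * l2 mu (wt B)) +
          kerConst * s * (l2 mu (wt A) * l2 mu (wt B)))) := by
        rw [l2l1_const_mul _ (by fun_prop), l2l1_const_mul _ (by fun_prop)]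
        refine add_le_add (mul_le_mul' le_rfl (l2l1_tconv_inv_le h hA hB)) (mul_le_mul' le_rfl ?_)
        refine (l2l1_jb_inv_le (by fun_prop)).trans (mul_le_mul' le_rfl ?_)
        simp only [mul_add]
        refine (l2_add_le (by fun_prop) (by fun_prop)).trans ?_
        exact add_le_add (l2_tconv_left_le h hA hB) (l2_tconv_right_le h hA hB)
    _ = _ := by ring

end Zakharov

end

noncomputable section

namespace Zakharov

/-! ### Sums over frequencies -/

theorem lintegral_comp_mul_left' {f : ℝ → ℝ≥0∞} (hf : Measurable f) {d : ℝ} (hd : 0 < d) :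
    ∫⁻ x, f (d * x) = ENNReal.ofReal d⁻¹ * ∫⁻ x, f x := by
  rw [← lintegral_map hf (measurable_const_mul d), Real.map_volume_mul_left hd.ne',
    lintegral_smul_measure, abs_of_pos (inv_pos.2 hd), smul_eq_mul]

/-- Comparison with the integral: for `d ≤ 1` the bracket changes by a factor at most `4` over a
unit interval, which costs `4^{6/5} ≤ 16`. Rescaling the integral gives `d⁻¹`. -/
theorem tsum_jb_linear_le {d : ℝ} (hd : 0 < d) (hd1 : d ≤ 1) (r : ℝ) :
    ∑' i : ℤ, jb (d * (i - r)) ^ (-(6 / 5) : ℝ) ≤ 16 * tailMass * ENNReal.ofReal d⁻¹ := by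
  have h1 : ∀ i : ℤ, jb (d * (i - r)) ^ (-(6 / 5) : ℝ) ≤
      ∫⁻ x in Set.Ioc (i : ℝ) (i + 1), 16 * jb (d * (x - r)) ^ (-(6 / 5) : ℝ) := by
    intro i
    have h2 : ∀ x ∈ Set.Ioc (i : ℝ) (i + 1),
        jb (d * (i - r)) ^ (-(6 / 5) : ℝ) ≤ 16 * jb (d * (x - r)) ^ (-(6 / 5) : ℝ) := by
      intro x hx
      have h3 : bracket (d * (x - r)) ≤ 4 * bracket (d * (i - r)) := by
        have h4 : bracket (d * (x - i)) ≤ 2 := by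
          refine (bracket_le_one_add_abs _).trans ?_
          have hx1 : 0 ≤ x - i := by linarith [hx.1]
          have hx2 : x - i ≤ 1 := by linarith [hx.2]
          rw [abs_of_nonneg (by positivity)]
          nlinarith
        have h5 := bracket_add_le_mul (d * (i - r)) (d * (x - i))
        have h6 : d * (i - r) + d * (x - i) = d * (x - r) := by ring
        rw [h6] at h5
        nlinarith [one_le_bracket (d * (i - r))]
      have h7 : bracket (d * (i - r)) ^ (-(6 / 5) : ℝ) ≤
          16 * bracket (d * (x - r)) ^ (-(6 / 5) : ℝ) := by
        have h8 := Real.rpow_le_rpow_of_nonpos (bracket_pos _) h3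
          (show (-(6 / 5) : ℝ) ≤ 0 by norm_num)
        rw [Real.mul_rpow (by norm_num) (bracket_pos _).le] at h8
        have h9 : (1 : ℝ) / 16 ≤ 4 ^ (-(6 / 5) : ℝ) := by
          have : (4 : ℝ) ^ (-2 : ℝ) ≤ 4 ^ (-(6 / 5) : ℝ) :=
            Real.rpow_le_rpow_of_exponent_le (by norm_num) (by norm_num)
          refine le_trans (le_of_eq ?_) this
          rw [Real.rpow_neg (by norm_num)]; norm_num
        have h10 : 0 ≤ bracket (d * (i - r)) ^ (-(6 / 5) : ℝ) := Real.rpow_nonneg (bracket_pos _).le _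
        nlinarith
      rw [jb_rpow, jb_rpow, show (16 : ℝ≥0∞) = ENNReal.ofReal 16 by norm_num,
        ← ENNReal.ofReal_mul (by norm_num)]
      exact ENNReal.ofReal_le_ofReal h7
    calc _ = ∫⁻ x in Set.Ioc (i : ℝ) (i + 1), jb (d * (i - r)) ^ (-(6 / 5) : ℝ) := by
          rw [setLIntegral_const, Real.volume_Ioc]; simp
      _ ≤ _ := setLIntegral_mono' measurableSet_Ioc h2
  calc _ ≤ ∑' i : ℤ, ∫⁻ x in Set.Ioc (i : ℝ) (i + 1), 16 * jb (d * (x - r)) ^ (-(6 / 5) : ℝ) :=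
        ENNReal.tsum_le_tsum h1
    _ = ∫⁻ x, 16 * jb (d * (x - r)) ^ (-(6 / 5) : ℝ) := by
        rw [← lintegral_iUnion (fun _ => measurableSet_Ioc) (Set.pairwise_disjoint_Ioc_intCast ℝ),
          iUnion_Ioc_intCast, setLIntegral_univ]
    _ = 16 * ∫⁻ x, jb (d * x) ^ (-(6 / 5) : ℝ) := by
        rw [lintegral_const_mul _ (by fun_prop),
          lintegral_sub_right_eq_self (fun x => jb (d * x) ^ (-(6 / 5) : ℝ)) r]
    _ = _ := by
        rw [lintegral_comp_mul_left' (f := fun x => jb x ^ (-(6 / 5) : ℝ)) (by fun_prop) hd,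
          tailMass]
        ring

theorem tsum_jb_linear_le' {d x : ℝ} (hd : 0 < d) (hd1 : d ≤ 1) (hx : d ≤ |x|) (y : ℝ) :
    ∑' i : ℤ, jb (x * i + y) ^ (-(6 / 5) : ℝ) ≤ 128 * tailMass * ENNReal.ofReal d⁻¹ := by
  have hx0 : x ≠ 0 := by rintro rfl; simp at hx; linarith
  calc _ ≤ ∑' i : ℤ, jb (d * (i - -y / x)) ^ (-(6 / 5) : ℝ) := by
        refine ENNReal.tsum_le_tsum fun i => rpow_antitone (jb_le_jb ?_) (by norm_num)
        rw [show x * i + y = x * (i - -y / x) by field_simp; ring, abs_mul, abs_mul, abs_of_pos hd]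
        gcongr
    _ ≤ 16 * tailMass * ENNReal.ofReal d⁻¹ := tsum_jb_linear_le hd hd1 _
    _ ≤ _ := by gcongr; norm_num

/-- Completing the square gives `(t + p/2)²` when the discriminant is not positive. Otherwise the
polynomial is a product of two linear factors and is at least the square of the smaller one. -/
theorem exists_quadratic_lower (p q : ℝ) : ∃ r₁ r₂ : ℝ, ∀ t : ℝ,
    (t - r₁) ^ 2 ≤ |t ^ 2 + p * t + q| ∨ (t - r₂) ^ 2 ≤ |t ^ 2 + p * t + q| := by
  rcases le_or_gt 0 (q - p ^ 2 / 4) with h | h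
  · refine ⟨-p / 2, -p / 2, fun t => Or.inl ?_⟩
    refine le_trans ?_ (le_abs_self _)
    nlinarith
  · set e := Real.sqrt (p ^ 2 / 4 - q)
    have he : e ^ 2 = p ^ 2 / 4 - q := Real.sq_sqrt (by linarith)
    refine ⟨-p / 2 + e, -p / 2 - e, fun t => ?_⟩
    have hf : t ^ 2 + p * t + q = (t - (-p / 2 + e)) * (t - (-p / 2 - e)) := by linear_combination he
    rw [hf, abs_mul, ← sq_abs (t - (-p / 2 + e)), ← sq_abs (t - (-p / 2 - e)), sq, sq]
    rcases le_total |t - (-p / 2 + e)| |t - (-p / 2 - e)| with h1 | h1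
    · left; gcongr
    · right; gcongr

/-- Away from its roots a quadratic phase dominates a linear one, because `|t - r| ≤ (t - r)²` once
`|t - r| ≥ 1`, and closer to a root the linear phase is bounded. The sum is thus reduced to linear
phases centred at the roots. -/
theorem tsum_jb_quadratic_le {d x : ℝ} (hd : 0 < d) (hd1 : d ≤ 1) (hx : d ≤ |x|) (p q : ℝ) :
    ∑' i : ℤ, jb (x * ((i : ℝ) ^ 2 + p * i + q)) ^ (-(6 / 5) : ℝ) ≤
      128 * tailMass * ENNReal.ofReal d⁻¹ := by
  obtain ⟨r₁, r₂, hr⟩ := exists_quadratic_lower p q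
  have key : ∀ (i : ℤ) (r : ℝ), ((i : ℝ) - r) ^ 2 ≤ |(i : ℝ) ^ 2 + p * i + q| →
      jb (x * ((i : ℝ) ^ 2 + p * i + q)) ^ (-(6 / 5) : ℝ) ≤
        4 * jb (d * (i - r)) ^ (-(6 / 5) : ℝ) := by
    intro i r h
    have h1 : bracket (d * (i - r)) ≤ 2 * bracket (x * ((i : ℝ) ^ 2 + p * i + q)) := by
      rcases le_total 1 |(i : ℝ) - r| with h2 | h2
      · refine (bracket_le_bracket ?_).trans (by linarith [bracket_pos (x * ((i : ℝ) ^ 2 + p * i + q))])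
        rw [abs_mul, abs_mul, abs_of_pos hd]
        refine mul_le_mul hx (le_trans ?_ h) (abs_nonneg _) (abs_nonneg _)
        rw [← sq_abs]; nlinarith
      · have : bracket (d * (i - r)) ≤ 2 := by
          refine (bracket_le_one_add_abs _).trans ?_
          rw [abs_mul, abs_of_pos hd]
          nlinarith [abs_nonneg ((i : ℝ) - r)]
        linarith [one_le_bracket (x * ((i : ℝ) ^ 2 + p * i + q))]
    have h2 : bracket (x * ((i : ℝ) ^ 2 + p * i + q)) ^ (-(6 / 5) : ℝ) ≤
        4 * bracket (d * (i - r)) ^ (-(6 / 5) : ℝ) := by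
      have h8 := Real.rpow_le_rpow_of_nonpos (bracket_pos _) h1
        (show (-(6 / 5) : ℝ) ≤ 0 by norm_num)
      rw [Real.mul_rpow (by norm_num) (bracket_pos _).le] at h8
      have h9 : (1 : ℝ) / 4 ≤ 2 ^ (-(6 / 5) : ℝ) := by
        have : (2 : ℝ) ^ (-2 : ℝ) ≤ 2 ^ (-(6 / 5) : ℝ) :=
          Real.rpow_le_rpow_of_exponent_le (by norm_num) (by norm_num)
        refine le_trans (le_of_eq ?_) this
        rw [Real.rpow_neg (by norm_num)]; norm_num
      have h10 : 0 ≤ bracket (x * ((i : ℝ) ^ 2 + p * i + q)) ^ (-(6 / 5) : ℝ) :=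
        Real.rpow_nonneg (bracket_pos _).le _
      nlinarith
    rw [jb_rpow, jb_rpow, show (4 : ℝ≥0∞) = ENNReal.ofReal 4 by norm_num,
      ← ENNReal.ofReal_mul (by norm_num)]
    exact ENNReal.ofReal_le_ofReal h2
  calc _ ≤ ∑' i : ℤ, (4 * jb (d * (i - r₁)) ^ (-(6 / 5) : ℝ) +
        4 * jb (d * (i - r₂)) ^ (-(6 / 5) : ℝ)) := by
        refine ENNReal.tsum_le_tsum fun i => ?_
        rcases hr i with h | h
        · exact (key i r₁ h).trans le_self_add
        · exact (key i r₂ h).trans le_add_self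
    _ ≤ 4 * (16 * tailMass * ENNReal.ofReal d⁻¹) + 4 * (16 * tailMass * ENNReal.ofReal d⁻¹) := by
        rw [ENNReal.tsum_add, ENNReal.tsum_mul_left, ENNReal.tsum_mul_left]
        gcongr <;> exact tsum_jb_linear_le hd hd1 _
    _ = _ := by ring

theorem tsum_natShift_inv_le (N : ℕ) :
    ∑' n : ℕ, (if n + 1 ≤ N then ENNReal.ofReal (1 / (n + 1)) else 0) ≤
      ENNReal.ofReal (1 + Real.log N) := by
  rw [tsum_eq_sum (s := Finset.range N)]
  · calc _ = ∑ n ∈ Finset.range N, ENNReal.ofReal (1 / ((n : ℝ) + 1)) := by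
          refine Finset.sum_congr rfl fun n hn => ?_
          rw [if_pos (Nat.succ_le_of_lt (Finset.mem_range.1 hn))]
      _ = ENNReal.ofReal (harmonic N) := by
          rw [← ENNReal.ofReal_sum_of_nonneg fun i _ => by positivity, harmonic]
          push_cast
          simp [one_div]
      _ ≤ _ := ENNReal.ofReal_le_ofReal (harmonic_le_one_add_log N)
  · intro n hn
    rw [if_neg (by simpa using hn)]

/-- The partial harmonic sum over both signs: this is where the logarithm enters. -/
theorem tsum_jb_inv_head_le {L : ℝ} (hL : 1 ≤ L) :
    ∑' n : ℤ, (if bracket n ≤ L then jb n ^ (-1 : ℝ) else 0) ≤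
      ENNReal.ofReal (3 + 2 * Real.log L) := by
  have hlog : 0 ≤ Real.log L := Real.log_nonneg hL
  set N := ⌊L⌋₊
  have hN : Real.log N ≤ Real.log L := by
    apply Real.log_le_log _ (Nat.floor_le (by linarith))
    exact_mod_cast Nat.floor_pos.2 hL
  have hterm : ∀ (z : ℤ) (n : ℕ), |(z : ℝ)| = n + 1 →
      (if bracket z ≤ L then jb z ^ (-1 : ℝ) else 0) ≤
        (if n + 1 ≤ N then ENNReal.ofReal (1 / (n + 1)) else 0) := by
    intro z n hz
    have hz' := abs_le_bracket z
    rw [hz] at hz'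
    split_ifs with h1 h2 h2
    · rw [jb_rpow, Real.rpow_neg_one, one_div]
      refine ENNReal.ofReal_le_ofReal (inv_anti₀ (by positivity) hz')
    · exact absurd (Nat.le_floor (by push_cast; linarith)) h2
    · simp
    · simp
  rw [tsum_of_nat_of_neg_add_one ENNReal.summable ENNReal.summable,
    tsum_eq_zero_add' ENNReal.summable]
  calc _ ≤ 1 + (∑' n : ℕ, (if n + 1 ≤ N then ENNReal.ofReal (1 / (n + 1)) else 0)) +
        ∑' n : ℕ, (if n + 1 ≤ N then ENNReal.ofReal (1 / (n + 1)) else 0) := by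
        gcongr with n n
        · split_ifs
          · exact jb_rpow_le_one _ (by norm_num)
          · simp
        · exact hterm _ n (by push_cast; rw [abs_of_pos (by positivity)])
        · exact hterm _ n (by push_cast; rw [abs_neg, abs_of_pos (by positivity)])
    _ ≤ 1 + ENNReal.ofReal (1 + Real.log L) + ENNReal.ofReal (1 + Real.log L) := by
        have := (tsum_natShift_inv_le N).trans (ENNReal.ofReal_le_ofReal
          (by linarith : 1 + Real.log N ≤ 1 + Real.log L))
        gcongr
    _ = _ := by
        rw [← ENNReal.ofReal_one, ← ENNReal.ofReal_add (by norm_num) (by linarith),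
          ← ENNReal.ofReal_add (by linarith) (by linarith)]
        congr 1; ring

/-- The sum of `⟨n⟩^{-6/5}` over the integers. -/
theorem tsum_jb_int_le : ∑' n : ℤ, jb n ^ (-(6 / 5) : ℝ) ≤ 16 * tailMass := by
  simpa using tsum_jb_linear_le one_pos le_rfl 0

theorem rpow_mul_rpow_le_add {x y : ℝ≥0∞} : x ^ (3 / 4 : ℝ) * y ^ (1 / 4 : ℝ) ≤ x + y := by
  calc _ ≤ (x + y) ^ (3 / 4 : ℝ) * (x + y) ^ (1 / 4 : ℝ) := by
        gcongr
        · exact le_self_add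
        · exact le_add_self
    _ = _ := by
        rw [← ENNReal.rpow_add_of_nonneg _ _ (by norm_num) (by norm_num)]; norm_num

/-- The logarithmic factor `1 + log (1 + 1/δ)`. -/
def logFactor (δ : ℝ) : ℝ := 1 + Real.log (1 + δ⁻¹)

theorem one_le_logFactor {δ : ℝ} (hδ : 0 < δ) : 1 ≤ logFactor δ := by
  have : 0 ≤ Real.log (1 + δ⁻¹) := Real.log_nonneg (by linarith [inv_pos.2 hδ])
  unfold logFactor; linarith

/-- The series of `⟨n⟩^{-1}` diverges logarithmically. It is cut at a power of `Λ = 1 + 1/δ`, so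
that the low frequencies cost `log Λ`. At high frequencies a small power of `⟨n⟩` compensates the
factor `Λ` in the bound for the sum of `⟨θ⟩^{-6/5}`. -/
theorem tsum_weighted_le {δ : ℝ} (hδ : 0 < δ) {n : ℤ → ℤ} (hn : Function.Injective n) {θ : ℤ → ℝ}
    {K : ℝ≥0∞} (hθ : ∑' i, jb (θ i) ^ (-(6 / 5) : ℝ) ≤ K * ENNReal.ofReal (1 + δ⁻¹)) :
    ∑' i, jb (n i) ^ (-1 : ℝ) * jb (θ i) ^ (-(3 / 10) : ℝ) ≤
      (43 + 16 * tailMass + K) * ENNReal.ofReal (logFactor δ) := by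
  set Λ := 1 + δ⁻¹
  have hΛ : 1 ≤ Λ := by have := inv_pos.2 hδ; simp only [Λ]; linarith
  have hΛ0 : 0 < Λ := by linarith
  -- Beyond the cut `Λ^20`, the factor `⟨n⟩^{-1/20}` is at most `Λ⁻¹`. The remaining product
  -- `⟨n⟩^{-19/20} ⟨θ⟩^{-3/10}` is the weighted geometric mean of `⟨n⟩^{-19/15}` and `⟨θ⟩^{-6/5}`
  -- with weights `3/4` and `1/4`.
  have hterm : ∀ i, jb (n i) ^ (-1 : ℝ) * jb (θ i) ^ (-(3 / 10) : ℝ) ≤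
      (if bracket (n i) ≤ Λ ^ 20 then jb (n i) ^ (-1 : ℝ) else 0) +
        ENNReal.ofReal Λ⁻¹ * (jb (n i) ^ (-(6 / 5) : ℝ) + jb (θ i) ^ (-(6 / 5) : ℝ)) := by
    intro i
    split_ifs with h
    · refine le_trans ?_ le_self_add
      exact mul_le_of_le_one_right' (jb_rpow_le_one _ (by norm_num))
    · rw [zero_add]
      push Not at h
      have h1 : jb (n i) ^ (-(1 / 20) : ℝ) ≤ ENNReal.ofReal Λ⁻¹ := by
        rw [jb_rpow]
        refine ENNReal.ofReal_le_ofReal ?_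
        calc _ ≤ (Λ ^ 20) ^ (-(1 / 20) : ℝ) :=
              Real.rpow_le_rpow_of_nonpos (by positivity) h.le (by norm_num)
          _ = Λ⁻¹ := by
              rw [← Real.rpow_natCast, ← Real.rpow_mul hΛ0.le, ← Real.rpow_neg_one]; norm_num
      have h2 : jb (n i) ^ (-(19 / 20) : ℝ) * jb (θ i) ^ (-(3 / 10) : ℝ) ≤
          jb (n i) ^ (-(6 / 5) : ℝ) + jb (θ i) ^ (-(6 / 5) : ℝ) := by
        refine le_trans ?_ ((rpow_mul_rpow_le_add (x := jb (n i) ^ (-(19 / 15) : ℝ))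
          (y := jb (θ i) ^ (-(6 / 5) : ℝ))).trans (by
            gcongr ?_ + _; exact jb_rpow_le _ (by norm_num)))
        rw [← ENNReal.rpow_mul, ← ENNReal.rpow_mul]
        norm_num
      calc _ = jb (n i) ^ (-(1 / 20) : ℝ) *
            (jb (n i) ^ (-(19 / 20) : ℝ) * jb (θ i) ^ (-(3 / 10) : ℝ)) := by
            rw [← mul_assoc, ← jb_rpow_add]; norm_num
        _ ≤ _ := mul_le_mul' h1 h2
  have hl : 0 ≤ Real.log Λ := Real.log_nonneg hΛ
  have hlf : logFactor δ = 1 + Real.log Λ := rfl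
  have h1L : (1 : ℝ≥0∞) ≤ ENNReal.ofReal (logFactor δ) := by
    rw [← ENNReal.ofReal_one]; exact ENNReal.ofReal_le_ofReal (one_le_logFactor hδ)
  calc _ ≤ _ := ENNReal.tsum_le_tsum hterm
    _ = ∑' i, (if bracket (n i) ≤ Λ ^ 20 then jb (n i) ^ (-1 : ℝ) else 0) +
        ENNReal.ofReal Λ⁻¹ * (∑' i, jb (n i) ^ (-(6 / 5) : ℝ) + ∑' i, jb (θ i) ^ (-(6 / 5) : ℝ)) := by
        rw [ENNReal.tsum_add, ENNReal.tsum_mul_left, ENNReal.tsum_add]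
    -- Since `log (Λ^20) = 20 log Λ`, the head is `3 + 40 log Λ`, which explains the constant `43`.
    _ ≤ ENNReal.ofReal (3 + 2 * Real.log (Λ ^ 20)) + (16 * tailMass + K) := by
        refine add_le_add ?_ ?_
        · refine (ENNReal.tsum_comp_le_tsum_of_injective hn
            fun m : ℤ => if bracket m ≤ Λ ^ 20 then jb m ^ (-1 : ℝ) else 0).trans ?_
          exact tsum_jb_inv_head_le (one_le_pow₀ hΛ)
        · rw [mul_add]
          refine add_le_add ?_ ?_
          · calc _ ≤ 1 * ∑' i, jb (n i) ^ (-(6 / 5) : ℝ) := by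
                  gcongr
                  rw [← ENNReal.ofReal_one]
                  exact ENNReal.ofReal_le_ofReal (inv_le_one_of_one_le₀ hΛ)
              _ ≤ _ := by
                  rw [one_mul]
                  exact (ENNReal.tsum_comp_le_tsum_of_injective hn
                    fun m : ℤ => jb m ^ (-(6 / 5) : ℝ)).trans tsum_jb_int_le
          · calc _ ≤ ENNReal.ofReal Λ⁻¹ * (K * ENNReal.ofReal Λ) := by gcongr
              _ = K * ENNReal.ofReal (Λ⁻¹ * Λ) := by
                  rw [ENNReal.ofReal_mul (by positivity)]; ring
              _ = K := by rw [inv_mul_cancel₀ hΛ0.ne']; simp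
    _ ≤ 43 * ENNReal.ofReal (logFactor δ) + (16 * tailMass + K) * ENNReal.ofReal (logFactor δ) := by
        gcongr ?_ + ?_
        · rw [show (43 : ℝ≥0∞) = ENNReal.ofReal 43 by norm_num, ← ENNReal.ofReal_mul (by norm_num)]
          refine ENNReal.ofReal_le_ofReal ?_
          rw [Real.log_pow, hlf]
          push_cast
          linarith
        · exact le_mul_of_one_le_right' h1L
    _ = _ := by ring

end Zakharov

end

noncomputable section

namespace Zakharov

/-! ### Resonance functions of the Zakharov system -/

/-- The resonance function of the interactions `u n → u`; the sign `e = ±1` tells the direction of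
the wave. -/
def schrPhase (α β e : ℝ) (k m : ℤ) : ℝ :=
  α * (k : ℝ) ^ 2 - α * (m : ℝ) ^ 2 + e * (β * |((k - m : ℤ) : ℝ)|)

/-- The resonance function of the interactions `u ū → n`. -/
def wavePhase (α β : ℝ) (k m : ℤ) : ℝ :=
  -(β * |(k : ℝ)|) - α * ((k - m : ℤ) : ℝ) ^ 2 + α * (m : ℝ) ^ 2

/-- The coefficient of the interactions `u n → u`. -/
def schrCoeff (k m : ℤ) : ℂ :=
  -Complex.I * ((bracket ((k - m : ℤ) : ℝ) ^ (1 / 2 : ℝ) / (2 * Real.pi) : ℝ) : ℂ)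

/-- The coefficient of the interactions `u ū → n`. -/
def waveCoeff (β : ℝ) (k : ℤ) : ℂ :=
  Complex.I * ((β * |(k : ℝ)| * bracket (k : ℝ) ^ (-(1 / 2) : ℝ) / (4 * Real.pi) : ℝ) : ℂ)

/-- For large `|n|` the sum `n + γ` grows like `n`. For the remaining `n` it is bounded below by the
distance from `γ` to the integers. This is the only place where non-integrality enters. -/
theorem exists_nonresonance {γ : ℝ} (h : ¬ ∃ m : ℤ, γ = m) :
    ∃ d : ℝ, 0 < d ∧ ∀ n : ℤ, d * bracket n ≤ |n + γ| ∧ d * bracket n ≤ |n - γ| := by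
  have hf : 0 < Int.fract γ :=
    lt_of_le_of_ne (Int.fract_nonneg γ) fun h0 => h ⟨⌊γ⌋, by
      have := Int.floor_add_fract γ; linarith⟩
  have hf1 : Int.fract γ < 1 := Int.fract_lt_one γ
  set d₀ := min (Int.fract γ) (1 - Int.fract γ)
  have hd₀ : 0 < d₀ := lt_min hf (by linarith)
  have hdist : ∀ n : ℤ, d₀ ≤ |n + γ| := by
    intro n
    have hγ : (n : ℝ) + γ = ((n + ⌊γ⌋ : ℤ) : ℝ) + Int.fract γ := by
      have := Int.floor_add_fract γ; push_cast; linarith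
    rw [hγ]
    rcases le_or_gt 0 (n + ⌊γ⌋) with h1 | h1
    · have : (0 : ℝ) ≤ ((n + ⌊γ⌋ : ℤ) : ℝ) := by exact_mod_cast h1
      exact (min_le_left _ _).trans ((by linarith : Int.fract γ ≤ _).trans (le_abs_self _))
    · have : ((n + ⌊γ⌋ : ℤ) : ℝ) ≤ -1 := by exact_mod_cast (by omega : n + ⌊γ⌋ ≤ -1)
      refine (min_le_right _ _).trans (le_trans ?_ (neg_le_abs _))
      linarith
  have hden : 0 < 3 + 2 * |γ| := by positivity
  set d := min (1 / 4) (d₀ / (3 + 2 * |γ|))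
  have hd : 0 < d := lt_min (by norm_num) (by positivity)
  have main : ∀ n : ℤ, d * bracket n ≤ |n + γ| := by
    intro n
    have hb := bracket_le_one_add_abs n
    rcases le_or_gt (2 * |γ| + 2) |(n : ℝ)| with h1 | h1
    · have h2 : |(n : ℝ)| - |γ| ≤ |n + γ| := by
        have := abs_sub_abs_le_abs_sub (n : ℝ) (-γ)
        rwa [abs_neg, sub_neg_eq_add] at this
      have : d * bracket n ≤ 1 / 4 * (1 + |(n : ℝ)|) :=
        mul_le_mul (min_le_left _ _) hb (bracket_pos _).le (by norm_num)
      linarith [abs_nonneg γ]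
    · calc d * bracket n ≤ d₀ / (3 + 2 * |γ|) * (3 + 2 * |γ|) :=
            mul_le_mul (min_le_right _ _) (by linarith) (bracket_pos _).le (by positivity)
        _ = d₀ := by field_simp
        _ ≤ _ := hdist n
  refine ⟨d, hd, fun n => ⟨main n, ?_⟩⟩
  have := main (-n)
  push_cast at this
  rw [bracket_neg] at this
  rwa [← abs_neg, neg_sub, sub_eq_neg_add]

/-- The phase factors as `α (k - m) (k + m + g β/α)` with a sign `g` that combines `e` and the sign
of `k - m`, and the last factor is controlled by `exists_nonresonance`. -/
theorem exists_schrPhase_lower {α β : ℝ} (hα : 0 < α) (h : ¬ ∃ m : ℤ, β / α = m) :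
    ∃ c : ℝ, 0 < c ∧ ∀ e : ℝ, e = 1 ∨ e = -1 → ∀ k m : ℤ,
      c * (|((k - m : ℤ) : ℝ)| * bracket ((k + m : ℤ) : ℝ)) ≤ |schrPhase α β e k m| := by
  obtain ⟨d, hd, hd'⟩ := exists_nonresonance h
  refine ⟨α * d, by positivity, fun e he k m => ?_⟩
  have h1 : ∃ g : ℝ, (g = 1 ∨ g = -1) ∧ |((k - m : ℤ) : ℝ)| * e = ((k - m : ℤ) : ℝ) * g := by
    rcases le_total 0 (((k - m : ℤ) : ℝ)) with h0 | h0
    · exact ⟨e, he, by rw [abs_of_nonneg h0]⟩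
    · refine ⟨-e, ?_, by rw [abs_of_nonpos h0]; ring⟩
      rcases he with rfl | rfl <;> simp
  obtain ⟨g, hg, hge⟩ := h1
  have h2 : schrPhase α β e k m =
      α * (((k - m : ℤ) : ℝ) * (((k + m : ℤ) : ℝ) + g * (β / α))) := by
    have : e * (β * |((k - m : ℤ) : ℝ)|) = β * (((k - m : ℤ) : ℝ) * g) := by rw [← hge]; ring
    rw [schrPhase, this]
    push_cast
    field_simp
    ring
  rw [h2, abs_mul, abs_mul, abs_of_pos hα]
  have h3 : d * bracket ((k + m : ℤ) : ℝ) ≤ |((k + m : ℤ) : ℝ) + g * (β / α)| := by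
    rcases hg with rfl | rfl
    · simpa using (hd' (k + m)).1
    · simpa [sub_eq_add_neg, neg_div] using (hd' (k + m)).2
  calc _ = α * (|((k - m : ℤ) : ℝ)| * (d * bracket ((k + m : ℤ) : ℝ))) := by ring
    _ ≤ _ := by gcongr

/-- Both kinds of interaction involve the same triples of waves: `wavePhase` at `(k, m)` is minus
`schrPhase` with `e = 1` at `(k - m, -m)`. -/
theorem exists_wavePhase_lower {α β : ℝ} (hα : 0 < α) (h : ¬ ∃ m : ℤ, β / α = m) :
    ∃ c : ℝ, 0 < c ∧ ∀ k m : ℤ,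
      c * (|(k : ℝ)| * bracket ((k - 2 * m : ℤ) : ℝ)) ≤ |wavePhase α β k m| := by
  obtain ⟨c, hc, hc'⟩ := exists_schrPhase_lower hα h
  refine ⟨c, hc, fun k m => ?_⟩
  have := hc' 1 (Or.inl rfl) (k - m) (-m)
  rw [show k - m - -m = k by ring, show k - m + -m = k - 2 * m by ring] at this
  refine this.trans (le_of_eq ?_)
  rw [← abs_neg, schrPhase, wavePhase, show k - m - -m = k by ring]
  congr 1
  push_cast
  ring

/-- The coefficient contributes `δ² l` and the resonance `δ l ⟨n⟩`. The factor `l`, which contains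
the derivative loss, cancels, and one power of `δ` is left. -/
theorem resWeight_sq_le {δ C c l : ℝ} (hδ : 0 < δ) (hc : 0 < c) (hC : 0 ≤ C)
    {Ω : ℤ → ℤ → ℝ} {a : ℤ → ℤ → ℂ} {k m n : ℤ} (ha : ‖a k m‖ ^ 2 ≤ C * l)
    (hΩ : c * (l * bracket n) ≤ |Ω k m|) :
    resWeight (fun k m => ENNReal.ofReal δ * ‖a k m‖ₑ) (fun k m => δ * Ω k m) k m ^ 2 ≤
      ENNReal.ofReal (C / c * δ) * jb n ^ (-1 : ℝ) := by
  rw [resWeight, mul_pow, jb_rpow_sq, jb_rpow, jb_rpow, ← ofReal_norm,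
    ← ENNReal.ofReal_mul hδ.le, ← ENNReal.ofReal_pow (by positivity),
    ← ENNReal.ofReal_mul (by positivity), ← ENNReal.ofReal_mul (by positivity)]
  refine ENNReal.ofReal_le_ofReal ?_
  have hb : 2 * (-(1 / 2) : ℝ) = -1 := by norm_num
  rw [hb, Real.rpow_neg_one, Real.rpow_neg_one, ← div_eq_mul_inv, ← div_eq_mul_inv,
    div_le_div_iff₀ (bracket_pos _) (bracket_pos _)]
  have h1 : δ * (c * (l * bracket n)) ≤ bracket (δ * Ω k m) := by
    refine le_trans ?_ (abs_le_bracket _)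
    rw [abs_mul, abs_of_pos hδ]; gcongr
  calc (δ * ‖a k m‖) ^ 2 * bracket n ≤ δ ^ 2 * (C * l) * bracket n := by
        rw [mul_pow]; gcongr; exact (bracket_pos _).le
    _ = C / c * δ * (δ * (c * (l * bracket n))) := by field_simp
    _ ≤ _ := by gcongr

/-- The three sums of `InteractionBound` reduce to `tsum_weighted_le`, with any two frequencies
determining `n`. The term `D` covers the diagonal `m = k`. The alternatives with vanishing weights
cover the fixed frequencies for which the phase is constant, so that its sum would diverge. -/
theorem interactionBound_of {κ : ℤ → ℤ → ℝ≥0∞} {ω : ℤ → ℤ → ℝ} {δ : ℝ} (hδ : 0 < δ)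
    {n : ℤ → ℤ → ℤ} {D E K : ℝ≥0∞}
    (h1 : ∀ k m, resWeight κ ω k m ^ 2 ≤ E * jb (n k m) ^ (-1 : ℝ) + if m = k then D else 0)
    (h2 : ∀ k m, resWeight' κ ω k m ^ 2 ≤ E * jb (n k m) ^ (-1 : ℝ))
    (i1 : ∀ k, Function.Injective fun m => n k m) (i2 : ∀ m, Function.Injective fun k => n k m)
    (i3 : ∀ l, Function.Injective fun m => n (l + m) m)
    (s1 : ∀ k, (∀ m, resWeight κ ω k m = 0) ∨ ∀ s : ℝ,
      ∑' m, jb (s - ω k m) ^ (-(6 / 5) : ℝ) ≤ K * ENNReal.ofReal (1 + δ⁻¹))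
    (s2 : ∀ m, ∀ s : ℝ, ∑' k, jb (s + ω k m) ^ (-(6 / 5) : ℝ) ≤ K * ENNReal.ofReal (1 + δ⁻¹))
    (s3 : ∀ l, (∀ m, resWeight' κ ω (l + m) m = 0) ∨ ∀ s : ℝ,
      ∑' m, jb (s + ω (l + m) m) ^ (-(6 / 5) : ℝ) ≤ K * ENNReal.ofReal (1 + δ⁻¹)) :
    InteractionBound κ ω (E * ((43 + 16 * tailMass + K) * ENNReal.ofReal (logFactor δ)) + D) := by
  refine ⟨fun k s => ?_, fun m s => ?_, fun l s => ?_⟩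
  · rcases s1 k with h0 | hs
    · simp [h0]
    calc _ ≤ ∑' m, (E * (jb (n k m) ^ (-1 : ℝ) * jb (s - ω k m) ^ (-(3 / 10) : ℝ)) +
          if m = k then D else 0) := by
          refine ENNReal.tsum_le_tsum fun m => ?_
          refine (mul_le_mul' (h1 k m) le_rfl).trans ?_
          rw [add_mul, mul_assoc]
          gcongr
          exact mul_le_of_le_one_right' (jb_rpow_le_one _ (by norm_num))
      _ ≤ _ := by
          rw [ENNReal.tsum_add, ENNReal.tsum_mul_left, tsum_ite_eq]
          gcongr
          exact tsum_weighted_le hδ (i1 k) (hs s)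
  · refine le_trans ?_ le_self_add
    calc _ ≤ ∑' k, E * (jb (n k m) ^ (-1 : ℝ) * jb (s + ω k m) ^ (-(3 / 10) : ℝ)) := by
          refine ENNReal.tsum_le_tsum fun k => ?_
          rw [← mul_assoc]
          exact mul_le_mul' (h2 k m) le_rfl
      _ ≤ _ := by
          rw [ENNReal.tsum_mul_left]
          gcongr
          exact tsum_weighted_le hδ (i2 m) (s2 m s)
  · rcases s3 l with h0 | hs
    · simp [h0]
    refine le_trans ?_ le_self_add
    calc _ ≤ ∑' m, E * (jb (n (l + m) m) ^ (-1 : ℝ) * jb (s + ω (l + m) m) ^ (-(3 / 10) : ℝ)) := by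
          refine ENNReal.tsum_le_tsum fun k => ?_
          rw [← mul_assoc]
          exact mul_le_mul' (h2 _ _) le_rfl
      _ ≤ _ := by
          rw [ENNReal.tsum_mul_left]
          gcongr
          exact tsum_weighted_le hδ (i3 l) (hs s)

/-- The minimal leading coefficient of the phases as functions of a frequency. -/
def slope (α δ : ℝ) : ℝ := min 1 α * min 1 δ

theorem slope_pos {α δ : ℝ} (hα : 0 < α) (hδ : 0 < δ) : 0 < slope α δ :=
  mul_pos (lt_min one_pos hα) (lt_min one_pos hδ)

theorem slope_le_one {α δ : ℝ} (hδ : 0 < δ) : slope α δ ≤ 1 :=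
  mul_le_one₀ (min_le_left _ _) (lt_min one_pos hδ).le (min_le_left _ _)

theorem slope_le {α δ x : ℝ} (hα : 0 < α) (hδ : 0 < δ) (hx : α * δ ≤ |x|) : slope α δ ≤ |x| :=
  (mul_le_mul (min_le_right _ _) (min_le_right _ _) (lt_min one_pos hδ).le hα.le).trans hx

/-- The constant in the sums over frequencies. -/
def phaseConst (α : ℝ) : ℝ≥0∞ := 2 * (128 * tailMass * ENNReal.ofReal (min 1 α)⁻¹)

theorem phaseConst_ne_top (α : ℝ) : phaseConst α ≠ ∞ := by
  unfold phaseConst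
  finiteness [tailMass_ne_top]

theorem slope_inv_le {α δ : ℝ} (hα : 0 < α) (hδ : 0 < δ) :
    128 * tailMass * ENNReal.ofReal (slope α δ)⁻¹ ≤
      128 * tailMass * ENNReal.ofReal (min 1 α)⁻¹ * ENNReal.ofReal (1 + δ⁻¹) := by
  have hα' : 0 < min 1 α := lt_min one_pos hα
  rw [mul_assoc _ (ENNReal.ofReal (min 1 α)⁻¹), ← ENNReal.ofReal_mul (by positivity), slope, mul_inv]
  gcongr
  rcases le_total 1 δ with h | h
  · rw [min_eq_left h]; linarith [inv_pos.2 hδ]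
  · rw [min_eq_right h]; linarith

/-- On each side of `-z` the absolute value is affine, so every term coincides with a term of one of
two quadratic sums. -/
theorem tsum_quadratic_abs_le {α δ x : ℝ} (hα : 0 < α) (hδ : 0 < δ) (hx : α * δ ≤ |x|)
    (p q r : ℝ) (z : ℤ) {θ : ℤ → ℝ}
    (hθ : ∀ i : ℤ, θ i = x * ((i : ℝ) ^ 2 + p * i + q) + r * |((i + z : ℤ) : ℝ)|) :
    ∑' i : ℤ, jb (θ i) ^ (-(6 / 5) : ℝ) ≤ phaseConst α * ENNReal.ofReal (1 + δ⁻¹) := by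
  have hx0 : x ≠ 0 := by rintro rfl; simp at hx; nlinarith
  have h1 : ∀ i : ℤ, jb (θ i) ^ (-(6 / 5) : ℝ) ≤
      jb (x * ((i : ℝ) ^ 2 + (p + r / x) * i + (q + r * z / x))) ^ (-(6 / 5) : ℝ) +
      jb (x * ((i : ℝ) ^ 2 + (p - r / x) * i + (q - r * z / x))) ^ (-(6 / 5) : ℝ) := by
    intro i
    rw [hθ i]
    rcases le_total 0 (((i + z : ℤ) : ℝ)) with h0 | h0
    · refine le_trans (le_of_eq ?_) le_self_add
      rw [abs_of_nonneg h0]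
      congr 2
      push_cast
      field_simp
      ring
    · refine le_trans (le_of_eq ?_) le_add_self
      rw [abs_of_nonpos h0]
      congr 2
      push_cast
      field_simp
      ring
  have hq := fun p q => (tsum_jb_quadratic_le (slope_pos hα hδ) (slope_le_one hδ)
    (slope_le hα hδ hx) p q).trans (slope_inv_le hα hδ)
  calc _ ≤ _ := ENNReal.tsum_le_tsum h1
    _ ≤ _ := by
        rw [ENNReal.tsum_add, phaseConst, two_mul, add_mul]
        exact add_le_add (hq _ _) (hq _ _)

theorem tsum_linear_le {α δ x : ℝ} (hα : 0 < α) (hδ : 0 < δ) (hx : α * δ ≤ |x|) (y : ℝ)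
    {θ : ℤ → ℝ} (hθ : ∀ i : ℤ, θ i = x * i + y) :
    ∑' i : ℤ, jb (θ i) ^ (-(6 / 5) : ℝ) ≤ phaseConst α * ENNReal.ofReal (1 + δ⁻¹) := by
  simp only [hθ]
  refine ((tsum_jb_linear_le' (slope_pos hα hδ) (slope_le_one hδ)
    (slope_le hα hδ hx) y).trans (slope_inv_le hα hδ)).trans ?_
  rw [phaseConst]
  exact mul_le_mul' (le_mul_of_one_le_left' one_le_two) le_rfl

/-- The gain of a time interval of length `δ` in the bilinear estimates, squared. -/
def gainSq (δ : ℝ) : ℝ := (δ + δ ^ 2) * logFactor δ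

theorem one_le_abs_of_ne_zero {l : ℤ} (h : l ≠ 0) : (1 : ℝ) ≤ |(l : ℝ)| := by
  exact_mod_cast Int.one_le_abs h

theorem norm_schrCoeff_sq (k m : ℤ) :
    ‖schrCoeff k m‖ ^ 2 = bracket ((k - m : ℤ) : ℝ) / (2 * Real.pi) ^ 2 := by
  have hb := bracket_pos ((k - m : ℤ) : ℝ)
  rw [schrCoeff, norm_mul, norm_neg, Complex.norm_I, one_mul, Complex.norm_real, Real.norm_eq_abs,
    sq_abs, div_pow, ← Real.rpow_natCast, ← Real.rpow_mul hb.le]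
  norm_num

theorem norm_waveCoeff_sq_le {β : ℝ} (hβ : 0 < β) (k : ℤ) : ‖waveCoeff β k‖ ^ 2 ≤ β ^ 2 * |(k : ℝ)| := by
  have hb := bracket_pos (k : ℝ)
  rw [waveCoeff, norm_mul, Complex.norm_I, one_mul, Complex.norm_real, Real.norm_eq_abs,
    sq_abs, div_pow, mul_pow, ← Real.rpow_natCast (bracket _ ^ _), ← Real.rpow_mul hb.le]
  norm_num
  rw [Real.rpow_neg_one]
  have hpi : 1 ≤ (4 * Real.pi) ^ 2 := by nlinarith [Real.pi_gt_three]
  calc _ ≤ (β * |(k : ℝ)|) ^ 2 * (bracket k)⁻¹ := div_le_self (by positivity) hpi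
    _ = β ^ 2 * |(k : ℝ)| * (|(k : ℝ)| * (bracket k)⁻¹) := by ring
    _ ≤ β ^ 2 * |(k : ℝ)| * 1 := by
        gcongr
        rw [← div_eq_mul_inv]
        exact div_le_one_of_le₀ (abs_le_bracket _) hb.le
    _ = _ := mul_one _

/-- Off the diagonal the squared weight is at most `δ / (c ⟨k + m⟩)`. The phase is quadratic up to
an absolute value when `k` or `m` is fixed, and linear in `m` with slope `2αl` when `k - m = l` is
fixed. -/
theorem exists_interactionBound_schr {α β : ℝ} (hα : 0 < α) (h : ¬ ∃ m : ℤ, β / α = m) :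
    ∃ C : ℝ, 0 ≤ C ∧ ∀ e : ℝ, e = 1 ∨ e = -1 → ∀ δ : ℝ, 0 < δ →
      InteractionBound (fun k m => ENNReal.ofReal δ * ‖schrCoeff k m‖ₑ)
        (fun k m => δ * schrPhase α β e k m) (ENNReal.ofReal (C * gainSq δ)) := by
  obtain ⟨c, hc, hc'⟩ := exists_schrPhase_lower hα h
  have hfin : 43 + 16 * tailMass + phaseConst α ≠ ∞ := by
    finiteness [tailMass_ne_top, phaseConst_ne_top α]
  refine ⟨1 / c * (43 + 16 * tailMass + phaseConst α).toReal + 1, by positivity,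
    fun e he δ hδ => ?_⟩
  have hsq : ∀ k m : ℤ, m ≠ k → resWeight (fun k m => ENNReal.ofReal δ * ‖schrCoeff k m‖ₑ)
      (fun k m => δ * schrPhase α β e k m) k m ^ 2 ≤
      ENNReal.ofReal (1 / c * δ) * jb ((k + m : ℤ) : ℝ) ^ (-1 : ℝ) := by
    intro k m hmk
    refine resWeight_sq_le hδ hc zero_le_one ?_ (hc' e he k m)
    rw [norm_schrCoeff_sq, one_mul]
    have h1 := one_le_abs_of_ne_zero (sub_ne_zero.2 hmk.symm)
    have hpi : 4 ≤ (2 * Real.pi) ^ 2 := by nlinarith [Real.pi_gt_three]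
    rw [div_le_iff₀ (by positivity)]
    nlinarith [bracket_le_one_add_abs ((k - m : ℤ) : ℝ)]
  -- The interaction with the mean of the density is exactly resonant, but its coefficient is
  -- bounded. It contributes `δ²`.
  have hdiag : ∀ k : ℤ, resWeight (fun k m => ENNReal.ofReal δ * ‖schrCoeff k m‖ₑ)
      (fun k m => δ * schrPhase α β e k m) k k ^ 2 ≤ ENNReal.ofReal (δ ^ 2) := by
    intro k
    have h0 : schrPhase α β e k k = 0 := by simp [schrPhase]
    rw [resWeight, h0, mul_zero, mul_pow, mul_pow, ← enorm_pow, ← ofReal_norm, norm_pow,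
      norm_schrCoeff_sq, ENNReal.ofReal_pow hδ.le]
    have hpi : 1 ≤ (2 * Real.pi) ^ 2 := by nlinarith [Real.pi_gt_three]
    calc _ ≤ ENNReal.ofReal δ ^ 2 * 1 * 1 := by
          gcongr
          · rw [← ENNReal.ofReal_one]
            refine ENNReal.ofReal_le_ofReal ?_
            simpa [bracket] using inv_le_one_of_one_le₀ hpi
          · exact pow_le_one' (jb_rpow_le_one _ (by norm_num)) _
      _ = _ := by ring
  have := interactionBound_of (κ := fun k m => ENNReal.ofReal δ * ‖schrCoeff k m‖ₑ)
    (ω := fun k m => δ * schrPhase α β e k m) hδ (n := fun k m => k + m)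
    (D := ENNReal.ofReal (δ ^ 2)) (E := ENNReal.ofReal (1 / c * δ)) (K := phaseConst α)
    (fun k m => by
      split_ifs with hmk
      · rw [hmk]; exact (hdiag k).trans le_add_self
      · exact (hsq k m hmk).trans le_self_add)
    (fun k m => by
      rcases eq_or_ne m k with rfl | hmk
      · simp [resWeight', schrPhase]
      · exact (pow_le_pow_left' (resWeight'_le k m) 2).trans (hsq k m hmk))
    (fun k a b hab => by simpa using hab) (fun k a b hab => by simpa using hab)
    (fun k a b hab => by simp only at hab; omega)
    (fun k => Or.inr fun s => tsum_quadratic_abs_le (x := δ * α) hα hδ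
      (by rw [abs_of_pos (by positivity)]; linarith [mul_comm α δ]) 0 (s / (δ * α) - (k : ℝ) ^ 2)
      (-(δ * e * β)) (-k) fun i => by
        rw [schrPhase, show i + -k = -(k - i) by ring, Int.cast_neg, abs_neg]
        field_simp
        ring)
    (fun m s => tsum_quadratic_abs_le (x := δ * α) hα hδ
      (by rw [abs_of_pos (by positivity)]; linarith [mul_comm α δ]) 0 (s / (δ * α) - (m : ℝ) ^ 2)
      (δ * e * β) (-m) fun i => by
        rw [schrPhase, show i + -m = i - m by ring]
        field_simp
        ring)
    (fun l => by
      rcases eq_or_ne l 0 with rfl | hl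
      · left; intro m; simp [resWeight', schrPhase]
      · right
        intro s
        refine tsum_linear_le (x := δ * (2 * α * l)) hα hδ ?_
          (s + δ * (α * (l : ℝ) ^ 2 + e * (β * |(l : ℝ)|))) fun i => ?_
        · rw [abs_mul, abs_mul, abs_of_pos hδ, abs_of_pos (by positivity)]
          have := one_le_abs_of_ne_zero hl
          have : 0 < α * δ := by positivity
          nlinarith
        · rw [schrPhase, add_sub_cancel_right]
          push_cast
          ring)
  refine InteractionBound.mk (fun k s => (this.out k s).trans ?_)
    (fun k s => (this.left k s).trans ?_) (fun k s => (this.right k s).trans ?_)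
  all_goals
    have hL := one_le_logFactor hδ
    calc _ = ENNReal.ofReal (1 / c * δ * ((43 + 16 * tailMass + phaseConst α).toReal * logFactor δ) +
          δ ^ 2) := by
          rw [ENNReal.ofReal_add (by positivity) (by positivity),
            ENNReal.ofReal_mul (p := 1 / c * δ) (by positivity),
            ENNReal.ofReal_mul ENNReal.toReal_nonneg, ENNReal.ofReal_toReal hfin]
      _ ≤ _ := by
          refine ENNReal.ofReal_le_ofReal ?_
          rw [gainSq]
          set T := (43 + 16 * tailMass + phaseConst α).toReal
          have hT : 0 ≤ T := ENNReal.toReal_nonneg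
          have h1 : 0 ≤ 1 / c * T := by positivity
          have h2 : (δ ^ 2) * 1 ≤ δ ^ 2 * logFactor δ := by gcongr
          have h3 : 0 ≤ 1 / c * T * (δ ^ 2 * logFactor δ) := by positivity
          have h4 : 0 ≤ δ * logFactor δ := by positivity
          nlinarith

/-- Here `⟨k - 2m⟩` plays the role of `⟨k + m⟩`. The phase is linear in `m` for fixed output `k` and
quadratic up to an absolute value in the other two cases. The degenerate output `k = 0` has
coefficient zero because of the derivatives on `|u|²`. -/
theorem exists_interactionBound_wave {α β : ℝ} (hα : 0 < α) (hβ : 0 < β)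
    (h : ¬ ∃ m : ℤ, β / α = m) :
    ∃ C : ℝ, 0 ≤ C ∧ ∀ δ : ℝ, 0 < δ →
      InteractionBound (fun k _ => ENNReal.ofReal δ * ‖waveCoeff β k‖ₑ)
        (fun k m => δ * wavePhase α β k m) (ENNReal.ofReal (C * gainSq δ)) := by
  obtain ⟨c, hc, hc'⟩ := exists_wavePhase_lower hα h
  have hfin : 43 + 16 * tailMass + phaseConst α ≠ ∞ := by
    finiteness [tailMass_ne_top, phaseConst_ne_top α]
  refine ⟨β ^ 2 / c * (43 + 16 * tailMass + phaseConst α).toReal, by positivity,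
    fun δ hδ => ?_⟩
  have hsq : ∀ k m : ℤ, resWeight (fun k _ => ENNReal.ofReal δ * ‖waveCoeff β k‖ₑ)
      (fun k m => δ * wavePhase α β k m) k m ^ 2 ≤
      ENNReal.ofReal (β ^ 2 / c * δ) * jb ((k - 2 * m : ℤ) : ℝ) ^ (-1 : ℝ) := fun k m =>
    resWeight_sq_le (a := fun k _ => waveCoeff β k) hδ hc (sq_nonneg β)
      (norm_waveCoeff_sq_le hβ k) (hc' k m)
  have := interactionBound_of (κ := fun k _ => ENNReal.ofReal δ * ‖waveCoeff β k‖ₑ)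
    (ω := fun k m => δ * wavePhase α β k m) hδ (n := fun k m => k - 2 * m)
    (D := 0) (E := ENNReal.ofReal (β ^ 2 / c * δ)) (K := phaseConst α)
    (fun k m => (hsq k m).trans le_self_add)
    (fun k m => (pow_le_pow_left' (resWeight'_le k m) 2).trans (hsq k m))
    (fun k a b hab => by simpa using hab) (fun k a b hab => by simpa using hab)
    (fun k a b hab => by simp only at hab; omega)
    (fun k => by
      rcases eq_or_ne k 0 with rfl | hk
      · left; intro m; simp [resWeight, waveCoeff]
      · right
        intro s
        refine tsum_linear_le (x := -(δ * (2 * α * k))) hα hδ ?_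
          (s + δ * (α * (k : ℝ) ^ 2 + β * |(k : ℝ)|)) fun i => ?_
        · rw [abs_neg, abs_mul, abs_mul, abs_of_pos hδ, abs_of_pos (by positivity)]
          have := one_le_abs_of_ne_zero hk
          have : 0 < α * δ := by positivity
          nlinarith
        · rw [wavePhase]
          push_cast
          ring)
    (fun m s => tsum_quadratic_abs_le (x := -(δ * α)) hα hδ
      (by rw [abs_neg, abs_of_pos (by positivity)]; linarith [mul_comm α δ]) (-(2 * m)) (-(s / (δ * α)))
      (-(δ * β)) 0 fun i => by
        rw [wavePhase, add_zero]
        push_cast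
        field_simp
        ring)
    (fun l => Or.inr fun s => tsum_quadratic_abs_le (x := δ * α) hα hδ
      (by rw [abs_of_pos (by positivity)]; linarith [mul_comm α δ]) 0 (s / (δ * α) - (l : ℝ) ^ 2)
      (-(δ * β)) l fun i => by
        rw [wavePhase, add_comm i l, add_sub_cancel_right]
        field_simp
        ring)
  refine InteractionBound.mk (fun k s => (this.out k s).trans ?_)
    (fun k s => (this.left k s).trans ?_) (fun k s => (this.right k s).trans ?_)
  all_goals
    have hL := one_le_logFactor hδ
    calc _ = ENNReal.ofReal (β ^ 2 / c * δ *
          ((43 + 16 * tailMass + phaseConst α).toReal * logFactor δ)) := by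
          rw [add_zero, ENNReal.ofReal_mul (p := β ^ 2 / c * δ) (by positivity),
            ENNReal.ofReal_mul ENNReal.toReal_nonneg, ENNReal.ofReal_toReal hfin]
      _ ≤ _ := by
          refine ENNReal.ofReal_le_ofReal ?_
          rw [gainSq]
          set T := (43 + 16 * tailMass + phaseConst α).toReal
          have hT : 0 ≤ T := ENNReal.toReal_nonneg
          have h3 : 0 ≤ β ^ 2 / c * T * (δ ^ 2 * logFactor δ) := by positivity
          nlinarith

end Zakharov

end

noncomputable section

namespace Zakharov

/-! ### Square summable sequences -/

/-- The space `ℓ²(ℤ)`. -/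
abbrev L2 := lp (fun _ : ℤ => ℂ) 2

theorem memℓp_two_of_tsum {x : ℤ → ℂ} (h : l2 Measure.count (fun k => ‖x k‖ₑ) ≠ ∞) :
    Memℓp x 2 := by
  refine memℓp_gen ?_
  have h2 : ∑' k, ‖x k‖ₑ ^ 2 ≠ ∞ := by
    rw [← lintegral_count, ← l2_sq]; exact ENNReal.pow_ne_top h
  have h3 : ∑' k, ENNReal.ofReal (‖x k‖ ^ 2) ≠ ∞ := by
    convert h2 using 3 with k
    rw [ENNReal.ofReal_pow (norm_nonneg _), ofReal_norm]
  simpa using ENNReal.summable_toReal h3 |>.congr fun k => by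
    rw [ENNReal.toReal_ofReal (by positivity)]

/-- The element of `ℓ²(ℤ)` with given coefficients. -/
def toL2 (x : ℤ → ℂ) (h : l2 Measure.count (fun k => ‖x k‖ₑ) ≠ ∞) : L2 := ⟨x, memℓp_two_of_tsum h⟩

@[simp] theorem toL2_apply (x : ℤ → ℂ) (h) (k : ℤ) : toL2 x h k = x k := rfl

theorem L2.norm_sq (x : L2) : ‖x‖ ^ 2 = ∑' k, ‖x k‖ ^ 2 := by
  have := lp.norm_rpow_eq_tsum (p := 2) (by norm_num) x
  simpa using this

theorem L2.summable_sq (x : L2) : Summable fun k => ‖x k‖ ^ 2 := by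
  have := (lp.memℓp x).summable (by norm_num)
  simpa using this

theorem L2.ofReal_norm (x : L2) : ENNReal.ofReal ‖x‖ = l2 Measure.count fun k => ‖x k‖ₑ := by
  apply (ENNReal.pow_right_strictMono (n := 2) two_ne_zero).injective
  simp only
  rw [l2_sq, lintegral_count, ← ENNReal.ofReal_pow (norm_nonneg _), L2.norm_sq,
    ENNReal.ofReal_tsum_of_nonneg (fun _ => by positivity) (L2.summable_sq x)]
  refine tsum_congr fun k => ?_
  rw [ENNReal.ofReal_pow (norm_nonneg _), _root_.ofReal_norm]

theorem L2.l2_ne_top (x : L2) : l2 Measure.count (fun k => ‖x k‖ₑ) ≠ ∞ := by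
  rw [← L2.ofReal_norm]; exact ENNReal.ofReal_ne_top

theorem L2.norm_le_of {x : L2} {a : ℤ → ℝ≥0∞} {C : ℝ} (hC : 0 ≤ C) (h : ∀ k, ‖x k‖ₑ ≤ a k)
    (ha : l2 Measure.count a ≤ ENNReal.ofReal C) : ‖x‖ ≤ C := by
  rw [← ENNReal.ofReal_le_ofReal_iff hC, L2.ofReal_norm]
  exact (l2_mono h).trans ha

theorem L2.norm_apply_le (x : L2) (k : ℤ) : ‖x k‖ ≤ ‖x‖ := lp.norm_apply_le_norm (by norm_num) x k

/-! ### The space `Y` in interaction variables -/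

/-- The norm of `Y`. -/
def yn (A : ℤ × ℝ → ℝ≥0∞) : ℝ≥0∞ := l2 mu (wt A) + l2l1 A

variable {A B : ℤ × ℝ → ℝ≥0∞}

theorem yn_mono (h : ∀ x, A x ≤ B x) : yn A ≤ yn B :=
  add_le_add (l2_mono fun x => mul_le_mul' le_rfl (h x)) (l2l1_mono h)

theorem ae_mu_section {P : ℤ × ℝ → Prop} (h : ∀ᵐ x ∂mu, P x) (k : ℤ) : ∀ᵐ τ : ℝ, P (k, τ) := by
  have := Measure.ae_ae_of_ae_prod h
  rw [Measure.ae_count_iff] at this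
  exact this k

theorem yn_mono_ae (h : A ≤ᵐ[mu] B) : yn A ≤ yn B := by
  refine add_le_add (l2_mono_ae ?_) (l2_mono fun k => lintegral_mono_ae (ae_mu_section h k))
  filter_upwards [h] with x hx using mul_le_mul' le_rfl hx

theorem yn_add_le (hA : Measurable A) (hB : Measurable B) :
    yn (fun x => A x + B x) ≤ yn A + yn B := by
  have h1 : l2 mu (wt fun x => A x + B x) ≤ l2 mu (wt A) + l2 mu (wt B) := by
    refine le_trans (le_of_eq ?_) (l2_add_le (measurable_wt hA) (measurable_wt hB))
    congr 1; ext x; simp only [wt, mul_add]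
  calc _ ≤ _ := add_le_add h1 (l2l1_add_le hA hB)
    _ = _ := by unfold yn; ring

theorem yn_tsum_le {A : ℕ → ℤ × ℝ → ℝ≥0∞} (hA : ∀ n, Measurable (A n)) :
    yn (fun x => ∑' n, A n x) ≤ ∑' n, yn (A n) := by
  have h1 : l2 mu (wt fun x => ∑' n, A n x) ≤ ∑' n, l2 mu (wt (A n)) := by
    refine le_trans (le_of_eq ?_) (l2_tsum_le fun n => measurable_wt (hA n))
    congr 1; ext x; simp only [wt, ENNReal.tsum_mul_left]
  have h2 : l2l1 (fun x => ∑' n, A n x) ≤ ∑' n, l2l1 (A n) := by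
    refine le_trans (le_of_eq ?_) (l2_tsum_le fun n => measurable_of_countable _)
    unfold l2l1
    congr 1; ext k
    exact lintegral_tsum fun n => (by have := hA n; fun_prop)
  exact (add_le_add h1 h2).trans (le_of_eq ENNReal.tsum_add.symm)

theorem yn_zero : yn (fun _ => 0) = 0 := by simp [yn, l2, l2l1, wt]

/-- The functions on `ℤ × ℝ` with finite `Y` norm. -/
def ySubgroup : AddSubgroup (ℤ × ℝ → ℂ) where
  carrier := {F | Measurable F ∧ yn (fun x => ‖F x‖ₑ) ≠ ∞}
  zero_mem' := ⟨measurable_const, by simp [yn_zero]⟩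
  add_mem' := by
    rintro F G ⟨hF, hF'⟩ ⟨hG, hG'⟩
    refine ⟨hF.add hG, ne_top_of_le_ne_top (ENNReal.add_ne_top.2 ⟨hF', hG'⟩) ?_⟩
    exact (yn_mono fun x => enorm_add_le _ _).trans (yn_add_le (by fun_prop) (by fun_prop))
  neg_mem' := by
    rintro F ⟨hF, hF'⟩
    exact ⟨hF.neg, by simpa using hF'⟩

/-- The space `Y` in interaction variables. -/
def YSpace : Type := ySubgroup

namespace YSpace

instance : AddCommGroup YSpace := inferInstanceAs (AddCommGroup ySubgroup)

instance : CoeFun YSpace fun _ => ℤ × ℝ → ℂ := ⟨fun F => F.1⟩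

@[fun_prop]
theorem measurable (F : YSpace) : Measurable F := F.2.1

theorem yn_ne_top (F : YSpace) : yn (fun x => ‖F x‖ₑ) ≠ ∞ := F.2.2

theorem add_apply (F G : YSpace) (x : ℤ × ℝ) : (F + G) x = F x + G x := rfl
theorem sub_apply (F G : YSpace) (x : ℤ × ℝ) : (F - G) x = F x - G x := rfl
theorem neg_apply (F : YSpace) (x : ℤ × ℝ) : (-F) x = -F x := rfl

/-- The norm of `Y` as a seminorm. -/
def seminorm : AddGroupSeminorm YSpace where
  toFun F := (yn fun x => ‖F x‖ₑ).toReal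
  map_zero' := by
    have : (fun x => ‖(0 : YSpace) x‖ₑ) = fun _ => 0 := by
      ext x; exact enorm_zero
    rw [this, yn_zero]; rfl
  add_le' F G := by
    rw [← ENNReal.toReal_add F.yn_ne_top G.yn_ne_top]
    refine ENNReal.toReal_mono (ENNReal.add_ne_top.2 ⟨F.yn_ne_top, G.yn_ne_top⟩) ?_
    exact (yn_mono fun x => enorm_add_le _ _).trans (yn_add_le (by fun_prop) (by fun_prop))
  neg' F := by simp only [neg_apply, enorm_neg]

/-- Functions that agree almost everywhere are not identified, so this is a seminorm only. Equations
in `Y` are therefore stated as the vanishing of the norm of a difference, which implies equality of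
the values at all times. -/
instance : SeminormedAddCommGroup YSpace := seminorm.toSeminormedAddCommGroup

theorem norm_def (F : YSpace) : ‖F‖ = (yn fun x => ‖F x‖ₑ).toReal := rfl

theorem ofReal_norm' (F : YSpace) : ENNReal.ofReal ‖F‖ = yn fun x => ‖F x‖ₑ := by
  rw [norm_def, ENNReal.ofReal_toReal F.yn_ne_top]

/-- The element of `Y` given by a function. -/
def mk (F : ℤ × ℝ → ℂ) (hF : Measurable F) (h : yn (fun x => ‖F x‖ₑ) ≠ ∞) : YSpace := ⟨F, hF, h⟩

@[simp] theorem mk_apply (F : ℤ × ℝ → ℂ) (hF) (h) (x : ℤ × ℝ) : mk F hF h x = F x := rfl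

theorem norm_le_of {F : YSpace} {C : ℝ} (hC : 0 ≤ C)
    (h : yn (fun x => ‖F x‖ₑ) ≤ ENNReal.ofReal C) : ‖F‖ ≤ C := by
  rwa [← ENNReal.ofReal_le_ofReal_iff hC, ofReal_norm']

theorem l2_le (F : YSpace) : l2 mu (wt fun x => ‖F x‖ₑ) ≤ ENNReal.ofReal ‖F‖ := by
  rw [ofReal_norm']; exact le_self_add

theorem l2l1_le (F : YSpace) : l2l1 (fun x => ‖F x‖ₑ) ≤ ENNReal.ofReal ‖F‖ := by
  rw [ofReal_norm']; exact le_add_self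

theorem integrable (F : YSpace) (k : ℤ) : Integrable fun τ => F (k, τ) := by
  refine ⟨(F.measurable.comp measurable_prodMk_left).aestronglyMeasurable, ?_⟩
  rw [hasFiniteIntegral_iff_enorm]
  have h := ne_top_of_le_ne_top ENNReal.ofReal_ne_top F.l2l1_le
  have h2 := ENNReal.pow_ne_top (n := 2) h
  rw [l2l1_sq] at h2
  have h3 := ENNReal.ne_top_of_tsum_ne_top h2 k
  exact lt_top_iff_ne_top.2 fun h4 => by simp [h4] at h3

/-- A sequence in `Y` with geometrically decaying increments has a limit. -/
theorem exists_limit (F : ℕ → YSpace) {C : ℝ} (hC : 0 ≤ C)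
    (h : ∀ n, ‖F (n + 1) - F n‖ ≤ C * (1 / 2) ^ n) :
    ∃ G : YSpace, ∀ n, ‖G - F n‖ ≤ 2 * C * (1 / 2) ^ n := by
  set d : ℕ → ℤ × ℝ → ℝ≥0∞ := fun n x => ‖F (n + 1) x - F n x‖ₑ
  have hd : ∀ n, Measurable (d n) := fun n => by simp only [d]; fun_prop
  have hyn : ∀ n, yn (d n) ≤ ENNReal.ofReal (C * (1 / 2) ^ n) := fun n => by
    have := ENNReal.ofReal_le_ofReal (h n)
    rwa [ofReal_norm'] at this
  have htail : ∀ n, ∑' i, yn (d (n + i)) ≤ ENNReal.ofReal (2 * C * (1 / 2) ^ n) := by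
    intro n
    calc _ ≤ ∑' i, ENNReal.ofReal (C * (1 / 2) ^ n * (1 / 2) ^ i) := by
          refine ENNReal.tsum_le_tsum fun i => (hyn (n + i)).trans (le_of_eq ?_)
          rw [pow_add, mul_assoc]
      _ = ENNReal.ofReal (∑' i : ℕ, C * (1 / 2) ^ n * (1 / 2) ^ i) :=
          (ENNReal.ofReal_tsum_of_nonneg (fun i => by positivity)
            (summable_geometric_two.mul_left _)).symm
      _ = _ := by
          rw [tsum_mul_left, tsum_geometric_two]; congr 1; ring
  -- As in the Riesz–Fischer theorem, the sum of the increments has finite weighted `L²` norm, hence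
  -- is finite almost everywhere.
  have hsum : ∀ᵐ x ∂mu, ∑' n, d n x ≠ ∞ := by
    have h0 : l2 mu (wt fun x => ∑' n, d n x) ≤ ENNReal.ofReal (2 * C * (1 / 2) ^ 0) :=
      (le_self_add.trans (yn_tsum_le hd)).trans (by simpa using htail 0)
    have := ae_lt_top_of_l2 (measurable_wt (Measurable.tsum hd))
      (ne_top_of_le_ne_top ENNReal.ofReal_ne_top h0)
    filter_upwards [this] with x hx
    intro htop
    simp only [wt, htop] at hx
    rw [ENNReal.mul_top (jb_rpow_ne_zero _ _)] at hx
    exact lt_irrefl _ hx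
  -- Replacing the sequence by zero off this set of full measure makes the pointwise limit exist
  -- everywhere and be measurable.
  set s : Set (ℤ × ℝ) := {x | ∑' n, d n x ≠ ∞}
  have hs : MeasurableSet s :=
    (measurableSet_eq_fun (Measurable.tsum hd) measurable_const).compl
  have hdist : ∀ x n, edist (F n x) (F (n + 1) x) ≤ d n x := fun x n => by
    rw [edist_comm, edist_eq_enorm_sub]
  have hlim : ∀ x, ∃ y, Tendsto (fun n => s.indicator (fun z => F n z) x) atTop (𝓝 y) := by
    intro x
    by_cases hx : x ∈ s
    · simp only [Set.indicator_of_mem hx]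
      exact cauchySeq_tendsto_of_complete
        (cauchySeq_of_edist_le_of_tsum_ne_top (fun n => d n x) (hdist x) hx)
    · simp only [Set.indicator_of_notMem hx]
      exact ⟨0, tendsto_const_nhds⟩
  choose G hG using hlim
  have hGm : Measurable G := measurable_of_tendsto_metrizable
    (fun n => (F n).measurable.indicator hs) (tendsto_pi_nhds.2 hG)
  have hle : ∀ n, (fun x => ‖G x - F n x‖ₑ) ≤ᵐ[mu] fun x => ∑' i, d (n + i) x := by
    intro n
    filter_upwards [hsum] with x hx
    have hx' : x ∈ s := hx
    have h1 := hG x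
    simp only [Set.indicator_of_mem hx'] at h1
    rw [← edist_eq_enorm_sub, edist_comm]
    exact edist_le_tsum_of_edist_le_of_tendsto (fun n => d n x) (hdist x) h1 n
  have hyG : ∀ n, yn (fun x => ‖G x - F n x‖ₑ) ≤ ENNReal.ofReal (2 * C * (1 / 2) ^ n) := fun n =>
    (yn_mono_ae (hle n)).trans ((yn_tsum_le fun i => hd (n + i)).trans (htail n))
  have hyG' : yn (fun x => ‖G x‖ₑ) ≠ ∞ := by
    refine ne_top_of_le_ne_top (ENNReal.add_ne_top.2
      ⟨ne_top_of_le_ne_top ENNReal.ofReal_ne_top (hyG 0), (F 0).yn_ne_top⟩) ?_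
    refine (yn_mono fun x => ?_).trans (yn_add_le (by fun_prop) (by fun_prop))
    calc ‖G x‖ₑ = ‖(G x - F 0 x) + F 0 x‖ₑ := by rw [sub_add_cancel]
      _ ≤ _ := enorm_add_le _ _
  exact ⟨mk G hGm hyG', fun n => norm_le_of (by positivity) (hyG n)⟩

/-! ### Evaluation at a time -/

theorem enorm_exp_mul (a t : ℝ) (z : ℂ) : ‖Complex.exp (Complex.I * a * t) * z‖ₑ = ‖z‖ₑ := by
  rw [enorm_mul]
  have : ‖Complex.exp (Complex.I * a * t)‖ = 1 := by
    rw [show Complex.I * a * t = ((a * t : ℝ) : ℂ) * Complex.I by push_cast; ring,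
      Complex.norm_exp_ofReal_mul_I]
  rw [← ofReal_norm, this]; simp

/-- The `k`-th coefficient at time `t` of the function with space-time Fourier transform `F`. -/
def evc (F : YSpace) (t : ℝ) (k : ℤ) : ℂ := ∫ τ : ℝ, Complex.exp (Complex.I * τ * t) * F (k, τ)

theorem integrable_exp_mul (F : YSpace) (t : ℝ) (k : ℤ) :
    Integrable fun τ : ℝ => Complex.exp (Complex.I * τ * t) * F (k, τ) := by
  refine (F.integrable k).norm.mono' (by have := F.measurable; fun_prop) (Eventually.of_forall fun τ => ?_)
  have := enorm_exp_mul τ t (F (k, τ))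
  rw [← ofReal_norm, ← ofReal_norm, ENNReal.ofReal_eq_ofReal_iff (norm_nonneg _) (norm_nonneg _)] at this
  exact this.le

theorem enorm_evc_le (F : YSpace) (t : ℝ) (k : ℤ) : ‖evc F t k‖ₑ ≤ ∫⁻ τ : ℝ, ‖F (k, τ)‖ₑ := by
  refine (enorm_integral_le_lintegral_enorm _).trans (le_of_eq ?_)
  simp only [enorm_exp_mul]

theorem l2_evc_le (F : YSpace) (t : ℝ) :
    l2 Measure.count (fun k => ‖evc F t k‖ₑ) ≤ ENNReal.ofReal ‖F‖ :=
  (l2_mono fun k => enorm_evc_le F t k).trans F.l2l1_le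

/-- The value at time `t` of the function with space-time Fourier transform `F`. -/
def ev (F : YSpace) (t : ℝ) : L2 :=
  toL2 (evc F t) (ne_top_of_le_ne_top ENNReal.ofReal_ne_top (l2_evc_le F t))

theorem ev_apply (F : YSpace) (t : ℝ) (k : ℤ) :
    ev F t k = ∫ τ : ℝ, Complex.exp (Complex.I * τ * t) * F (k, τ) := rfl

theorem norm_ev_le (F : YSpace) (t : ℝ) : ‖ev F t‖ ≤ ‖F‖ :=
  L2.norm_le_of (norm_nonneg _) (fun _ => le_rfl) (l2_evc_le F t)

theorem ev_add (F G : YSpace) (t : ℝ) : ev (F + G) t = ev F t + ev G t := by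
  ext k
  rw [lp.coeFn_add, Pi.add_apply, ev_apply, ev_apply, ev_apply,
    ← integral_add (integrable_exp_mul F t k) (integrable_exp_mul G t k)]
  simp only [add_apply, mul_add]

theorem ev_sub (F G : YSpace) (t : ℝ) : ev (F - G) t = ev F t - ev G t := by
  rw [eq_sub_iff_add_eq, ← ev_add, sub_add_cancel]

theorem ev_eq_of_norm_sub_eq_zero {F G : YSpace} (h : ‖F - G‖ = 0) (t : ℝ) : ev F t = ev G t := by
  have := norm_ev_le (F - G) t
  rw [h, ev_sub] at this
  exact sub_eq_zero.1 (norm_le_zero_iff.1 this)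

theorem continuous_evc (F : YSpace) (k : ℤ) : Continuous fun t => ev F t k := by
  simp only [ev_apply]
  refine continuous_of_dominated (bound := fun τ => ‖F (k, τ)‖)
    (fun t => (integrable_exp_mul F t k).aestronglyMeasurable) (fun t => ?_) (F.integrable k).norm ?_
  · refine Eventually.of_forall fun τ => ?_
    have := enorm_exp_mul τ t (F (k, τ))
    rw [← ofReal_norm, ← ofReal_norm, ENNReal.ofReal_eq_ofReal_iff (norm_nonneg _) (norm_nonneg _)] at this
    exact this.le
  · exact Eventually.of_forall fun τ => by fun_prop

/-- Each coefficient is continuous by dominated convergence, and the coefficients are dominated at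
all times by the square summable `L¹` norms of the sections. The modulation weight of order `1/2`
alone would not give this. -/
theorem continuous_ev (F : YSpace) : Continuous (ev F) := by
  rw [continuous_iff_continuousAt]
  intro t
  rw [ContinuousAt, tendsto_iff_norm_sub_tendsto_zero]
  have hsq : Tendsto (fun s => ‖ev F s - ev F t‖ ^ 2) (𝓝 t) (𝓝 0) := by
    simp only [L2.norm_sq]
    have hbound : Summable fun k => (2 * (∫ τ : ℝ, ‖F (k, τ)‖)) ^ 2 := by
      have h := ENNReal.pow_ne_top (n := 2) (ne_top_of_le_ne_top ENNReal.ofReal_ne_top F.l2l1_le)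
      rw [l2l1_sq] at h
      have h2 := (ENNReal.summable_toReal h).mul_left 4
      refine h2.congr fun k => ?_
      rw [ENNReal.toReal_pow, integral_norm_eq_lintegral_enorm (F.integrable k).aestronglyMeasurable]
      ring
    rw [← tsum_zero (β := ℤ)]
    refine tendsto_tsum_of_dominated_convergence hbound (fun k => ?_) (Eventually.of_forall fun s k => ?_)
    · have h1 := ((continuous_evc F k).tendsto t).sub_const (ev F t k)
      rw [sub_self] at h1
      have h2 := (h1.norm).pow 2
      simpa using h2
    · have hk : ∀ r, ‖ev F r k‖ ≤ ∫ τ : ℝ, ‖F (k, τ)‖ := fun r => by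
        have := enorm_evc_le F r k
        rw [integral_norm_eq_lintegral_enorm (F.integrable k).aestronglyMeasurable,
          ← toReal_enorm]
        exact ENNReal.toReal_mono (F.integrable k).2.ne this
      rw [lp.coeFn_sub, Pi.sub_apply, norm_pow, norm_norm]
      gcongr
      exact (norm_sub_le _ _).trans (by linarith [hk s, hk t])
  have := hsq.sqrt
  simpa [Real.sqrt_sq (norm_nonneg _)] using this

end YSpace

end Zakharov

end

noncomputable section

namespace Zakharov

/-! ### Fourier kernels of smooth compactly supported functions -/

/-- Fourier inversion, with the frequency rescaled by `2π` to pass to the kernel `e^{iτt}`. -/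
theorem exists_schwartz_kernel (φ : SchwartzMap ℝ ℂ) :
    ∃ p : SchwartzMap ℝ ℂ, ∀ t : ℝ, ∫ τ : ℝ, Complex.exp (Complex.I * τ * t) * p τ = φ t := by
  have h0 : (2 * Real.pi)⁻¹ ≠ 0 := by positivity
  let e : ℝ ≃L[ℝ] ℝ := ContinuousLinearEquiv.unitsEquivAut ℝ (Units.mk0 _ h0)
  let q : SchwartzMap ℝ ℂ := FourierTransform.fourier φ
  refine ⟨((2 * Real.pi)⁻¹ : ℂ) • SchwartzMap.compCLMOfContinuousLinearEquiv ℂ e q, fun t => ?_⟩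
  have h1 : ∀ τ : ℝ, Complex.exp (Complex.I * τ * t) *
      (((2 * Real.pi)⁻¹ : ℂ) • SchwartzMap.compCLMOfContinuousLinearEquiv ℂ e q) τ =
      (fun v : ℝ => ((2 * Real.pi)⁻¹ : ℂ) *
        (Complex.exp (((2 * Real.pi * (v * t) : ℝ) : ℂ) * Complex.I) * q v))
        ((2 * Real.pi)⁻¹ * τ) := by
    intro τ
    have h2 : e τ = (2 * Real.pi)⁻¹ * τ := by
      rw [mul_comm]; rfl
    simp only [smul_apply, SchwartzMap.compCLMOfContinuousLinearEquiv_apply,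
      Function.comp_apply, h2, smul_eq_mul]
    have h3 : Complex.I * τ * t = ((2 * Real.pi * ((2 * Real.pi)⁻¹ * τ * t) : ℝ) : ℂ) * Complex.I := by
      have : 2 * Real.pi * ((2 * Real.pi)⁻¹ * τ * t) = τ * t := by field_simp
      rw [this]; push_cast; ring
    rw [h3]; ring
  simp only [h1]
  rw [Measure.integral_comp_mul_left (fun v : ℝ => ((2 * Real.pi)⁻¹ : ℂ) *
        (Complex.exp (((2 * Real.pi * (v * t) : ℝ) : ℂ) * Complex.I) * q v)),
        integral_const_mul]
  have h4 : ∫ v : ℝ, Complex.exp (((2 * Real.pi * (v * t) : ℝ) : ℂ) * Complex.I) * q v = φ t := by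
    have h5 : FourierTransformInv.fourierInv q = φ := FourierTransform.fourierInv_fourier_eq φ
    have h6 := congrArg (fun f : SchwartzMap ℝ ℂ => f t) h5
    simp only [SchwartzMap.fourierInv_coe] at h6
    rw [Real.fourierInv_eq'] at h6
    rw [← h6]
    refine integral_congr_ae (Eventually.of_forall fun v => ?_)
    simp [mul_comm]
  rw [h4, inv_inv, abs_of_pos (by positivity), Complex.real_smul]
  push_cast
  have : (Real.pi : ℂ) ≠ 0 := by exact_mod_cast Real.pi_ne_zero
  field_simp

theorem schwartz_decay (p : SchwartzMap ℝ ℂ) :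
    ∃ C : ℝ, 0 ≤ C ∧ ∀ τ, ‖p τ‖ ≤ C * bracket τ ^ (-2 : ℝ) := by
  obtain ⟨C₀, h₀, hC₀⟩ := p.decay 0 0
  obtain ⟨C₂, h₂, hC₂⟩ := p.decay 2 0
  refine ⟨C₀ + C₂, by positivity, fun τ => ?_⟩
  have e1 := hC₀ τ
  have e2 := hC₂ τ
  simp only [norm_iteratedFDeriv_zero, pow_zero, one_mul, Real.norm_eq_abs, sq_abs] at e1 e2
  rw [Real.rpow_neg (bracket_pos τ).le, ← div_eq_mul_inv, le_div_iff₀ (Real.rpow_pos_of_pos (bracket_pos τ) _)]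
  rw [show (2 : ℝ) = ((2 : ℕ) : ℝ) by norm_num, Real.rpow_natCast, bracket_sq]
  linarith

/-- `p` is a Fourier kernel of `φ`, with quantitative decay. -/
structure IsKernel (φ p : ℝ → ℂ) (C : ℝ) : Prop where
  nonneg : 0 ≤ C
  continuous : Continuous p
  integral : ∀ t : ℝ, ∫ τ : ℝ, Complex.exp (Complex.I * τ * t) * p τ = φ t
  decay : ∀ τ, ‖p τ‖ ≤ C * bracket τ ^ (-2 : ℝ)
  diff : ∀ τ ν, ‖p (τ - ν) - p τ‖ ≤
    C * |ν| * bracket ν ^ (-1 : ℝ) * (bracket (τ - ν) ^ (-2 : ℝ) + bracket τ ^ (-2 : ℝ))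

/-- The difference bound is what later cancels the singularity of the integration kernel at `ν = 0`.
For `|ν| ≥ 1` it follows from the decay of `p`, and for `|ν| ≤ 1` from the mean value inequality and
the decay of `p'`. -/
theorem exists_isKernel (φ : SchwartzMap ℝ ℂ) : ∃ p C, IsKernel φ p C := by
  obtain ⟨p, hp⟩ := exists_schwartz_kernel φ
  obtain ⟨C₀, h₀, hC₀⟩ := schwartz_decay p
  obtain ⟨C₁, h₁, hC₁⟩ := schwartz_decay (SchwartzMap.derivCLM ℂ ℂ p)
  refine ⟨p, 2 * C₀ + 8 * C₁, by positivity, p.continuous, hp, fun τ => ?_, fun τ ν => ?_⟩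
  · have := Real.rpow_nonneg (bracket_pos τ).le (-2 : ℝ)
    nlinarith [hC₀ τ]
  have hb : ∀ x : ℝ, 0 < bracket x ^ (-2 : ℝ) := fun x => Real.rpow_pos_of_pos (bracket_pos x) _
  have hν : 0 < bracket ν := bracket_pos ν
  have hbr : bracket ν ≤ 1 + |ν| := bracket_le_one_add_abs ν
  rw [Real.rpow_neg_one, ← div_eq_mul_inv, div_mul_eq_mul_div, le_div_iff₀ hν]
  rcases le_total 1 |ν| with h | h
  · calc ‖p (τ - ν) - p τ‖ * bracket ν
        ≤ (C₀ * bracket (τ - ν) ^ (-2 : ℝ) + C₀ * bracket τ ^ (-2 : ℝ)) * (2 * |ν|) := by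
          gcongr
          · exact add_nonneg (mul_nonneg h₀ (hb _).le) (mul_nonneg h₀ (hb _).le)
          · exact (norm_sub_le _ _).trans (add_le_add (hC₀ _) (hC₀ _))
          · linarith
      _ = 2 * C₀ * |ν| * (bracket (τ - ν) ^ (-2 : ℝ) + bracket τ ^ (-2 : ℝ)) := by ring
      _ ≤ _ := by
          gcongr
          · exact (add_pos (hb _) (hb _)).le
          · linarith
  · have hmv : ‖p (τ - ν) - p τ‖ ≤ 4 * C₁ * bracket τ ^ (-2 : ℝ) * |ν| := by
      have hd : ∀ x ∈ Metric.closedBall τ 1, ‖deriv p x‖ ≤ 4 * C₁ * bracket τ ^ (-2 : ℝ) := by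
        intro x hx
        rw [Metric.mem_closedBall, Real.dist_eq] at hx
        have e1 := hC₁ x
        rw [SchwartzMap.derivCLM_apply] at e1
        refine e1.trans ?_
        have : bracket x ^ (-2 : ℝ) ≤ 4 * bracket τ ^ (-2 : ℝ) := by
          rw [Real.rpow_neg (bracket_pos x).le, Real.rpow_neg (bracket_pos τ).le, ← div_eq_mul_inv,
            inv_le_iff_one_le_mul₀ (Real.rpow_pos_of_pos (bracket_pos x) _), div_mul_eq_mul_div,
            le_div_iff₀ (Real.rpow_pos_of_pos (bracket_pos τ) _)]
          rw [show (2 : ℝ) = ((2 : ℕ) : ℝ) by norm_num, Real.rpow_natCast, Real.rpow_natCast,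
            bracket_sq, bracket_sq]
          obtain ⟨h1, h2⟩ := abs_le.1 hx
          nlinarith [sq_nonneg (x + (x - τ))]
        calc _ ≤ C₁ * (4 * bracket τ ^ (-2 : ℝ)) := by gcongr
          _ = _ := by ring
      have := (convex_closedBall τ 1).norm_image_sub_le_of_norm_deriv_le
        (fun x _ => p.differentiableAt) hd (x := τ) (y := τ - ν) (by simp)
        (by simpa [Metric.mem_closedBall, Real.dist_eq] using h)
      simpa using this
    calc ‖p (τ - ν) - p τ‖ * bracket ν ≤ 4 * C₁ * bracket τ ^ (-2 : ℝ) * |ν| * 2 := by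
          gcongr
          · exact mul_nonneg (mul_nonneg (by positivity) (hb τ).le) (abs_nonneg _)
          · linarith
      _ = (8 * C₁) * |ν| * (bracket τ ^ (-2 : ℝ)) := by ring
      _ ≤ _ := by
          gcongr
          · exact (hb _).le
          · linarith
          · linarith [hb (τ - ν)]

theorem exists_isKernel_of_contDiff {φ : ℝ → ℂ} (h : ContDiff ℝ (⊤ : ℕ∞) φ)
    (hs : HasCompactSupport φ) : ∃ p C, IsKernel φ p C :=
  exists_isKernel (hs.toSchwartzMap h)

/-! ### Integral operators in the time frequency -/

/-- Schur's test: Cauchy–Schwarz after writing `K = K^{1/2} K^{1/2}`. -/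
theorem lintegral_sq_kernel_le {K : ℝ → ℝ → ℝ≥0∞} (hK : Measurable (Function.uncurry K))
    {f : ℝ → ℝ≥0∞} (hf : Measurable f) {a b : ℝ≥0∞} (ha : ∀ τ, ∫⁻ σ, K τ σ ≤ a)
    (hb : ∀ σ, ∫⁻ τ, K τ σ ≤ b) :
    ∫⁻ τ, (∫⁻ σ, K τ σ * f σ) ^ 2 ≤ a * b * ∫⁻ σ, f σ ^ 2 := by
  have hK1 : ∀ τ, Measurable (K τ) := fun τ => hK.comp measurable_prodMk_left
  have hK2 : ∀ σ, Measurable fun τ => K τ σ := fun σ => hK.comp measurable_prodMk_right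
  have key : ∀ x : ℝ≥0∞, (x ^ (1 / 2 : ℝ)) ^ 2 = x := fun x => by
    rw [← ENNReal.rpow_natCast, ← ENNReal.rpow_mul]; norm_num
  have hle : ∀ τ, (∫⁻ σ, K τ σ * f σ) ^ 2 ≤ a * ∫⁻ σ, K τ σ * f σ ^ 2 := by
    intro τ
    have h1 := sq_lintegral_mul_le (μ := volume) (f := fun σ => K τ σ ^ (1 / 2 : ℝ))
      (g := fun σ => K τ σ ^ (1 / 2 : ℝ) * f σ) ((hK1 τ).pow_const _)
      (((hK1 τ).pow_const _).mul hf)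
    simp only [mul_pow, key] at h1
    refine le_trans (le_of_eq ?_) (h1.trans (mul_le_mul' (ha τ) le_rfl))
    congr 1
    refine lintegral_congr fun σ => ?_
    rw [← mul_assoc, ← sq, key]
  calc _ ≤ ∫⁻ τ, a * ∫⁻ σ, K τ σ * f σ ^ 2 := lintegral_mono hle
    _ = a * ∫⁻ τ, ∫⁻ σ, K τ σ * f σ ^ 2 := by
        refine lintegral_const_mul _ ?_
        exact Measurable.lintegral_prod_right' (f := fun p : ℝ × ℝ => K p.1 p.2 * f p.2 ^ 2)
          (hK.mul (by fun_prop))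
    _ = a * ∫⁻ σ, ∫⁻ τ, K τ σ * f σ ^ 2 := by
        rw [lintegral_lintegral_swap]
        exact Measurable.aemeasurable (hK.mul (by fun_prop))
    _ ≤ a * ∫⁻ σ, b * f σ ^ 2 := by
        gcongr with σ
        rw [lintegral_mul_const _ (hK2 σ)]
        gcongr
        exact hb σ
    _ = _ := by rw [lintegral_const_mul _ (by fun_prop), mul_assoc]

/-- The bound from `L¹` to `L²` for a kernel that is uniformly square integrable in the output:
Cauchy–Schwarz after writing `f = f^{1/2} f^{1/2}`. -/
theorem lintegral_sq_kernel_le' {K : ℝ → ℝ → ℝ≥0∞} (hK : Measurable (Function.uncurry K))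
    {f : ℝ → ℝ≥0∞} (hf : Measurable f) {b : ℝ≥0∞} (hb : ∀ σ, ∫⁻ τ, K τ σ ^ 2 ≤ b) :
    ∫⁻ τ, (∫⁻ σ, K τ σ * f σ) ^ 2 ≤ b * (∫⁻ σ, f σ) ^ 2 := by
  have hK1 : ∀ τ, Measurable (K τ) := fun τ => hK.comp measurable_prodMk_left
  have hK2 : ∀ σ, Measurable fun τ => K τ σ := fun σ => hK.comp measurable_prodMk_right
  have key : ∀ x : ℝ≥0∞, (x ^ (1 / 2 : ℝ)) ^ 2 = x := fun x => by
    rw [← ENNReal.rpow_natCast, ← ENNReal.rpow_mul]; norm_num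
  have hle : ∀ τ, (∫⁻ σ, K τ σ * f σ) ^ 2 ≤ (∫⁻ σ, f σ) * ∫⁻ σ, K τ σ ^ 2 * f σ := by
    intro τ
    have h1 := sq_lintegral_mul_le (μ := volume) (f := fun σ => f σ ^ (1 / 2 : ℝ))
      (g := fun σ => K τ σ * f σ ^ (1 / 2 : ℝ)) (hf.pow_const _)
      ((hK1 τ).mul (hf.pow_const _))
    simp only [mul_pow, key] at h1
    refine le_trans (le_of_eq ?_) h1
    congr 1
    refine lintegral_congr fun σ => ?_
    rw [mul_left_comm, ← sq, key]
  calc _ ≤ ∫⁻ τ, (∫⁻ σ, f σ) * ∫⁻ σ, K τ σ ^ 2 * f σ := lintegral_mono hle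
    _ = (∫⁻ σ, f σ) * ∫⁻ τ, ∫⁻ σ, K τ σ ^ 2 * f σ := by
        refine lintegral_const_mul _ ?_
        exact Measurable.lintegral_prod_right' (f := fun p : ℝ × ℝ => K p.1 p.2 ^ 2 * f p.2)
          ((hK.pow_const 2).mul (by fun_prop))
    _ = (∫⁻ σ, f σ) * ∫⁻ σ, ∫⁻ τ, K τ σ ^ 2 * f σ := by
        rw [lintegral_lintegral_swap]
        exact Measurable.aemeasurable ((hK.pow_const 2).mul (by fun_prop))
    _ ≤ (∫⁻ σ, f σ) * ∫⁻ σ, b * f σ := by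
        gcongr with σ
        rw [lintegral_mul_const _ ((hK2 σ).pow_const 2)]
        gcongr
        exact hb σ
    _ = _ := by rw [lintegral_const_mul _ hf]; ring

/-- The mass of `⟨τ⟩^{-3/2}`. -/
def kerMass : ℝ≥0∞ := ∫⁻ τ : ℝ, jb τ ^ (-(3 / 2) : ℝ)

theorem kerMass_ne_top : kerMass ≠ ∞ := lintegral_jb_rpow_ne_top (by norm_num)

theorem lintegral_jb_le_kerMass {a : ℝ} (ha : a ≤ -(3 / 2)) : ∫⁻ τ : ℝ, jb τ ^ a ≤ kerMass :=
  lintegral_mono fun _ => jb_rpow_le _ ha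

theorem lintegral_jb_sub_le_kerMass {a : ℝ} (ha : a ≤ -(3 / 2)) (s : ℝ) :
    ∫⁻ τ : ℝ, jb (τ - s) ^ a ≤ kerMass := by
  rw [lintegral_sub_right_eq_self (fun τ => jb τ ^ a)]
  exact lintegral_jb_le_kerMass ha

theorem l2_mu_le_of_sections {f : ℤ × ℝ → ℝ≥0∞} (hf : Measurable f) {g : ℤ → ℝ≥0∞}
    (h : ∀ k, ∫⁻ τ : ℝ, f (k, τ) ^ 2 ≤ g k) : l2 mu f ^ 2 ≤ ∑' k, g k := by
  rw [l2_sq, lintegral_mu (by fun_prop)]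
  exact ENNReal.tsum_le_tsum h

theorem jb_half_mul_le (x y : ℝ) :
    jb (x + y) ^ (1 / 2 : ℝ) ≤ 2 * (jb x ^ (1 / 2 : ℝ) * jb y ^ (1 / 2 : ℝ)) := by
  calc _ ≤ (2 * (jb x * jb y)) ^ (1 / 2 : ℝ) := by gcongr; exact jb_add_le_mul x y
    _ = 2 ^ (1 / 2 : ℝ) * (jb x ^ (1 / 2 : ℝ) * jb y ^ (1 / 2 : ℝ)) := by
        rw [ENNReal.mul_rpow_of_nonneg _ _ (by norm_num), ENNReal.mul_rpow_of_nonneg _ _ (by norm_num)]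
    _ ≤ 2 ^ (1 : ℝ) * (jb x ^ (1 / 2 : ℝ) * jb y ^ (1 / 2 : ℝ)) := by
        gcongr
        · norm_num
        · norm_num
    _ = _ := by rw [ENNReal.rpow_one]

end Zakharov

end

noncomputable section

namespace Zakharov

/-! ### The time-integration operator -/

/-- The kernel of the operator `h ↦ φ(t) ∫₀ᵗ h(s) ds` on the Fourier side. -/
def theta (p : ℝ → ℂ) (τ ν : ℝ) : ℂ := (p (τ - ν) - p τ) / (Complex.I * ν)

variable {φ p : ℝ → ℂ} {C : ℝ}

/-- The integral over `[0, t]` of `e^{iνs}` is `(e^{iνt} - 1)/(iν)`; the factor `φ(t)` turns the two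
terms into `p(τ - ν)` and `p(τ)`. Their difference is `O(|ν|)` near `ν = 0`, so division by `ν`
leaves a factor `⟨ν⟩^{-1}`. -/
theorem IsKernel.enorm_theta_le (h : IsKernel φ p C) (τ ν : ℝ) :
    ‖theta p τ ν‖ₑ ≤ ENNReal.ofReal C *
      (jb ν ^ (-1 : ℝ) * (jb (τ - ν) ^ (-2 : ℝ) + jb τ ^ (-2 : ℝ))) := by
  have hb : ∀ x a : ℝ, 0 < bracket x ^ a := fun x a => Real.rpow_pos_of_pos (bracket_pos x) _
  simp only [jb_rpow]
  rw [← ENNReal.ofReal_add (hb _ _).le (hb _ _).le, ← ENNReal.ofReal_mul (hb _ _).le,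
    ← ENNReal.ofReal_mul h.nonneg, ← ofReal_norm]
  apply ENNReal.ofReal_le_ofReal
  rw [theta, norm_div, norm_mul, Complex.norm_I, one_mul, Complex.norm_real, Real.norm_eq_abs]
  rcases eq_or_ne ν 0 with h0 | h0
  · subst h0
    simp only [abs_zero, div_zero]
    have := h.nonneg
    have h1 := hb 0 (-1)
    have h2 := hb (τ - 0) (-2)
    have h3 := hb τ (-2)
    positivity
  · rw [div_le_iff₀ (abs_pos.2 h0)]
    refine (h.diff τ ν).trans (le_of_eq ?_)
    ring

theorem IsKernel.measurable_theta (h : IsKernel φ p C) :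
    Measurable fun x : ℝ × ℝ => theta p x.1 x.2 := by
  unfold theta
  have := h.continuous.measurable
  fun_prop

/-- The majorant of the time-integration operator. -/
def thetaBound (T : ℤ × ℝ → ℝ≥0∞) (x : ℤ × ℝ) : ℝ≥0∞ :=
  ∫⁻ ν : ℝ, jb ν ^ (-1 : ℝ) * (jb (x.2 - ν) ^ (-2 : ℝ) + jb x.2 ^ (-2 : ℝ)) * T (x.1, ν)

theorem measurable_thetaBound {T : ℤ × ℝ → ℝ≥0∞} (hT : Measurable T) :
    Measurable (thetaBound T) := by
  unfold thetaBound
  exact Measurable.lintegral_prod_right' (f := fun q : (ℤ × ℝ) × ℝ =>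
    jb q.2 ^ (-1 : ℝ) * (jb (q.1.2 - q.2) ^ (-2 : ℝ) + jb q.1.2 ^ (-2 : ℝ)) * T (q.1.1, q.2))
    (by fun_prop)

theorem l2l1_thetaBound_le {T : ℤ × ℝ → ℝ≥0∞} (hT : Measurable T) :
    l2l1 (thetaBound T) ≤ 2 * kerMass * l2l1 fun x => jb x.2 ^ (-1 : ℝ) * T x := by
  rw [← l2l1_const_mul _ (by fun_prop)]
  refine l2_mono fun k => ?_
  calc ∫⁻ τ : ℝ, thetaBound T (k, τ)
      = ∫⁻ ν : ℝ, ∫⁻ τ : ℝ, jb ν ^ (-1 : ℝ) * (jb (τ - ν) ^ (-2 : ℝ) + jb τ ^ (-2 : ℝ)) * T (k, ν) := by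
        simp only [thetaBound]
        rw [lintegral_lintegral_swap (Measurable.aemeasurable (by fun_prop))]
    _ ≤ ∫⁻ ν : ℝ, 2 * kerMass * (jb ν ^ (-1 : ℝ) * T (k, ν)) := by
        gcongr with ν
        rw [lintegral_mul_const _ (by fun_prop), lintegral_const_mul _ (by fun_prop),
          lintegral_add_left (by fun_prop)]
        calc _ ≤ jb ν ^ (-1 : ℝ) * (kerMass + kerMass) * T (k, ν) := by
              gcongr
              · exact lintegral_jb_sub_le_kerMass (by norm_num) ν
              · exact lintegral_jb_le_kerMass (by norm_num)
          _ = _ := by ring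

/-- In the term with `⟨τ - ν⟩^{-2}` the weight `⟨τ⟩^{1/2}` is distributed over `τ - ν` and `ν`, and
Schur's test applies. The term with `⟨τ⟩^{-2}` comes from subtracting the value at time `0`, and
sees only the `L¹` size of `⟨ν⟩^{-1} T`, so this norm must be estimated as well. -/
theorem l2_wt_thetaBound_le {T : ℤ × ℝ → ℝ≥0∞} (hT : Measurable T) :
    l2 mu (wt (thetaBound T)) ≤
      2 * kerMass * l2 mu (fun x => jb x.2 ^ (-(1 / 2) : ℝ) * T x) +
      kerMass ^ (1 / 2 : ℝ) * l2l1 fun x => jb x.2 ^ (-1 : ℝ) * T x := by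
  set P : ℤ × ℝ → ℝ≥0∞ := fun x =>
    ∫⁻ ν : ℝ, jb (x.2 - ν) ^ (-(3 / 2) : ℝ) * (jb ν ^ (-(1 / 2) : ℝ) * T (x.1, ν)) with hP
  set Q : ℤ × ℝ → ℝ≥0∞ := fun x =>
    ∫⁻ ν : ℝ, jb x.2 ^ (-(3 / 2) : ℝ) * (jb ν ^ (-1 : ℝ) * T (x.1, ν)) with hQ
  have hPm : Measurable P := Measurable.lintegral_prod_right' (f := fun q : (ℤ × ℝ) × ℝ =>
    jb (q.1.2 - q.2) ^ (-(3 / 2) : ℝ) * (jb q.2 ^ (-(1 / 2) : ℝ) * T (q.1.1, q.2))) (by fun_prop)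
  have hQm : Measurable Q := Measurable.lintegral_prod_right' (f := fun q : (ℤ × ℝ) × ℝ =>
    jb q.1.2 ^ (-(3 / 2) : ℝ) * (jb q.2 ^ (-1 : ℝ) * T (q.1.1, q.2))) (by fun_prop)
  have hle : ∀ x, wt (thetaBound T) x ≤ 2 * P x + Q x := by
    intro x
    rw [wt, thetaBound, hP, hQ, ← lintegral_const_mul _ (by fun_prop),
      ← lintegral_const_mul _ (by fun_prop), ← lintegral_add_left (by fun_prop)]
    refine lintegral_mono fun ν => ?_
    have h1 : jb x.2 ^ (1 / 2 : ℝ) ≤ 2 * (jb (x.2 - ν) ^ (1 / 2 : ℝ) * jb ν ^ (1 / 2 : ℝ)) := by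
      simpa using jb_half_mul_le (x.2 - ν) ν
    calc jb x.2 ^ (1 / 2 : ℝ) * (jb ν ^ (-1 : ℝ) *
          (jb (x.2 - ν) ^ (-2 : ℝ) + jb x.2 ^ (-2 : ℝ)) * T (x.1, ν))
        = jb x.2 ^ (1 / 2 : ℝ) * (jb (x.2 - ν) ^ (-2 : ℝ) * jb ν ^ (-1 : ℝ) * T (x.1, ν)) +
          (jb x.2 ^ (1 / 2 : ℝ) * jb x.2 ^ (-2 : ℝ)) * (jb ν ^ (-1 : ℝ) * T (x.1, ν)) := by ring
      _ ≤ 2 * (jb (x.2 - ν) ^ (1 / 2 : ℝ) * jb ν ^ (1 / 2 : ℝ)) *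
            (jb (x.2 - ν) ^ (-2 : ℝ) * jb ν ^ (-1 : ℝ) * T (x.1, ν)) +
          (jb x.2 ^ (1 / 2 : ℝ) * jb x.2 ^ (-2 : ℝ)) * (jb ν ^ (-1 : ℝ) * T (x.1, ν)) := by
          gcongr
      _ = 2 * ((jb (x.2 - ν) ^ (1 / 2 : ℝ) * jb (x.2 - ν) ^ (-2 : ℝ)) *
            ((jb ν ^ (1 / 2 : ℝ) * jb ν ^ (-1 : ℝ)) * T (x.1, ν))) +
          (jb x.2 ^ (1 / 2 : ℝ) * jb x.2 ^ (-2 : ℝ)) * (jb ν ^ (-1 : ℝ) * T (x.1, ν)) := by ring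
      _ = _ := by
          simp only [← jb_rpow_add]; norm_num
  have h1 : l2 mu P ≤ kerMass * l2 mu (fun x => jb x.2 ^ (-(1 / 2) : ℝ) * T x) := by
    apply le_of_sq_le_sq
    rw [mul_pow, l2_sq (f := fun x : ℤ × ℝ => jb x.2 ^ (-(1 / 2) : ℝ) * T x), lintegral_mu (by fun_prop), ← ENNReal.tsum_mul_left]
    refine l2_mu_le_of_sections hPm fun k => ?_
    rw [sq]
    refine lintegral_sq_kernel_le (K := fun τ ν => jb (τ - ν) ^ (-(3 / 2) : ℝ))
      (f := fun ν => jb ν ^ (-(1 / 2) : ℝ) * T (k, ν))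
      (by unfold Function.uncurry; fun_prop) (by fun_prop) (fun τ => ?_) (fun σ => ?_)
    · rw [lintegral_sub_left_eq_self (fun ν => jb ν ^ (-(3 / 2) : ℝ))]
      exact le_rfl
    · exact lintegral_jb_sub_le_kerMass le_rfl σ
  have h2 : l2 mu Q ≤ kerMass ^ (1 / 2 : ℝ) * l2l1 fun x => jb x.2 ^ (-1 : ℝ) * T x := by
    apply le_of_sq_le_sq
    rw [mul_pow, l2l1_sq, ← ENNReal.tsum_mul_left]
    refine l2_mu_le_of_sections hQm fun k => ?_
    rw [← ENNReal.rpow_natCast, ← ENNReal.rpow_mul]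
    norm_num only [ENNReal.rpow_one]
    refine lintegral_sq_kernel_le' (K := fun τ ν => jb τ ^ (-(3 / 2) : ℝ))
      (f := fun ν => jb ν ^ (-1 : ℝ) * T (k, ν))
      (by unfold Function.uncurry; fun_prop) (by fun_prop) (fun σ => ?_)
    simp only [jb_rpow_sq]
    exact lintegral_jb_le_kerMass (by norm_num)
  calc _ ≤ l2 mu (fun x => 2 * P x + Q x) := l2_mono hle
    _ ≤ l2 mu (fun x => 2 * P x) + l2 mu Q := l2_add_le (by fun_prop) hQm
    _ = 2 * l2 mu P + l2 mu Q := by rw [l2_const_mul _ hPm]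
    _ ≤ 2 * (kerMass * l2 mu (fun x => jb x.2 ^ (-(1 / 2) : ℝ) * T x)) +
        kerMass ^ (1 / 2 : ℝ) * l2l1 (fun x => jb x.2 ^ (-1 : ℝ) * T x) := by gcongr
    _ = _ := by rw [mul_assoc]

/-! ### Rescaling and localisation in time -/

theorem l2l1_rescale_le {A : ℤ × ℝ → ℝ≥0∞} (hA : Measurable A) {δ : ℝ} :
    l2l1 (fun x => ∫⁻ σ : ℝ, jb (x.2 - δ * σ) ^ (-2 : ℝ) * A (x.1, σ)) ≤ kerMass * l2l1 A := by
  rw [← l2l1_const_mul _ hA]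
  refine l2_mono fun k => ?_
  simp only
  rw [lintegral_lintegral_swap (Measurable.aemeasurable (by fun_prop))]
  gcongr with σ
  rw [lintegral_mul_const _ (by fun_prop)]
  gcongr
  exact lintegral_jb_sub_le_kerMass (by norm_num) _

theorem jb_mul_half_le {δ : ℝ} (hδ : 0 < δ) (σ : ℝ) :
    jb (δ * σ) ^ (1 / 2 : ℝ) ≤ 1 + ENNReal.ofReal δ ^ (1 / 2 : ℝ) * jb σ ^ (1 / 2 : ℝ) := by
  have h1 : jb (δ * σ) ≤ 1 + ENNReal.ofReal δ * jb σ := by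
    rw [jb, jb, ← ENNReal.ofReal_mul hδ.le, ← ENNReal.ofReal_one,
      ← ENNReal.ofReal_add zero_le_one (mul_nonneg hδ.le (bracket_pos _).le)]
    apply ENNReal.ofReal_le_ofReal
    refine (bracket_le_one_add_abs _).trans ?_
    rw [abs_mul, abs_of_pos hδ]
    gcongr
    exact abs_le_bracket σ
  calc _ ≤ (1 + ENNReal.ofReal δ * jb σ) ^ (1 / 2 : ℝ) := by gcongr
    _ ≤ 1 ^ (1 / 2 : ℝ) + (ENNReal.ofReal δ * jb σ) ^ (1 / 2 : ℝ) :=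
        ENNReal.rpow_add_le_add_rpow _ _ (by norm_num) (by norm_num)
    _ = _ := by rw [ENNReal.one_rpow, ENNReal.mul_rpow_of_nonneg _ _ (by norm_num)]

/-- Dilation of the time frequency by `δ` gives `⟨δσ⟩^{1/2} ≤ 1 + δ^{1/2} ⟨σ⟩^{1/2}`. The first part
is absorbed by the `ℓ²L¹` norm. In the second the factor `δ` in the square cancels the `δ⁻¹` of
Schur's test. Hence the bound is uniform in `δ`. -/
theorem l2_wt_rescale_le {A : ℤ × ℝ → ℝ≥0∞} (hA : Measurable A) {δ : ℝ} (hδ : 0 < δ) :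
    l2 mu (wt fun x => ∫⁻ σ : ℝ, jb (x.2 - δ * σ) ^ (-2 : ℝ) * A (x.1, σ)) ≤
      2 * kerMass ^ (1 / 2 : ℝ) * l2l1 A + 2 * kerMass * l2 mu (wt A) := by
  set P : ℤ × ℝ → ℝ≥0∞ := fun x =>
    ∫⁻ σ : ℝ, jb (x.2 - δ * σ) ^ (-(3 / 2) : ℝ) * A (x.1, σ) with hP
  set Q : ℤ × ℝ → ℝ≥0∞ := fun x => ∫⁻ σ : ℝ, jb (x.2 - δ * σ) ^ (-(3 / 2) : ℝ) *
    (ENNReal.ofReal δ ^ (1 / 2 : ℝ) * (jb σ ^ (1 / 2 : ℝ) * A (x.1, σ))) with hQ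
  have hPm : Measurable P := Measurable.lintegral_prod_right' (f := fun q : (ℤ × ℝ) × ℝ =>
    jb (q.1.2 - δ * q.2) ^ (-(3 / 2) : ℝ) * A (q.1.1, q.2)) (by fun_prop)
  have hQm : Measurable Q := Measurable.lintegral_prod_right' (f := fun q : (ℤ × ℝ) × ℝ =>
    jb (q.1.2 - δ * q.2) ^ (-(3 / 2) : ℝ) *
    (ENNReal.ofReal δ ^ (1 / 2 : ℝ) * (jb q.2 ^ (1 / 2 : ℝ) * A (q.1.1, q.2)))) (by fun_prop)
  have hle : ∀ x, wt (fun x => ∫⁻ σ : ℝ, jb (x.2 - δ * σ) ^ (-2 : ℝ) * A (x.1, σ)) x ≤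
      2 * P x + 2 * Q x := by
    intro x
    rw [wt, hP, hQ, ← lintegral_const_mul _ (by fun_prop), ← lintegral_const_mul _ (by fun_prop),
      ← lintegral_const_mul _ (by fun_prop), ← lintegral_add_left (by fun_prop)]
    refine lintegral_mono fun σ => ?_
    have h1 : jb x.2 ^ (1 / 2 : ℝ) ≤
        2 * (jb (x.2 - δ * σ) ^ (1 / 2 : ℝ) * jb (δ * σ) ^ (1 / 2 : ℝ)) := by
      simpa using jb_half_mul_le (x.2 - δ * σ) (δ * σ)
    calc jb x.2 ^ (1 / 2 : ℝ) * (jb (x.2 - δ * σ) ^ (-2 : ℝ) * A (x.1, σ))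
        ≤ 2 * (jb (x.2 - δ * σ) ^ (1 / 2 : ℝ) *
            (1 + ENNReal.ofReal δ ^ (1 / 2 : ℝ) * jb σ ^ (1 / 2 : ℝ))) *
            (jb (x.2 - δ * σ) ^ (-2 : ℝ) * A (x.1, σ)) := by
          gcongr
          refine h1.trans ?_
          gcongr
          exact jb_mul_half_le hδ σ
      _ = 2 * ((jb (x.2 - δ * σ) ^ (1 / 2 : ℝ) * jb (x.2 - δ * σ) ^ (-2 : ℝ)) * A (x.1, σ)) +
          2 * ((jb (x.2 - δ * σ) ^ (1 / 2 : ℝ) * jb (x.2 - δ * σ) ^ (-2 : ℝ)) *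
            (ENNReal.ofReal δ ^ (1 / 2 : ℝ) * (jb σ ^ (1 / 2 : ℝ) * A (x.1, σ)))) := by ring
      _ = _ := by
          simp only [← jb_rpow_add]; norm_num
  have hsub : ∀ a s : ℝ, a ≤ -(3 / 2) → ∫⁻ τ : ℝ, jb (τ - δ * s) ^ a ≤ kerMass := fun a s ha =>
    lintegral_jb_sub_le_kerMass ha _
  have h1 : l2 mu P ≤ kerMass ^ (1 / 2 : ℝ) * l2l1 A := by
    apply le_of_sq_le_sq
    rw [mul_pow, l2l1_sq, ← ENNReal.tsum_mul_left]
    refine l2_mu_le_of_sections hPm fun k => ?_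
    rw [← ENNReal.rpow_natCast, ← ENNReal.rpow_mul]
    norm_num only [ENNReal.rpow_one]
    refine lintegral_sq_kernel_le' (K := fun τ σ => jb (τ - δ * σ) ^ (-(3 / 2) : ℝ))
      (f := fun σ => A (k, σ))
      (by unfold Function.uncurry; fun_prop) (by fun_prop) (fun σ => ?_)
    simp only [jb_rpow_sq]
    exact hsub _ _ (by norm_num)
  have h2 : l2 mu Q ≤ kerMass * l2 mu (wt A) := by
    apply le_of_sq_le_sq
    rw [mul_pow, l2_sq (f := wt A), lintegral_mu (by fun_prop), ← ENNReal.tsum_mul_left]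
    refine l2_mu_le_of_sections hQm fun k => ?_
    refine (lintegral_sq_kernel_le (K := fun τ σ => jb (τ - δ * σ) ^ (-(3 / 2) : ℝ))
      (f := fun σ => ENNReal.ofReal δ ^ (1 / 2 : ℝ) * (jb σ ^ (1 / 2 : ℝ) * A (k, σ)))
      (a := ENNReal.ofReal δ⁻¹ * kerMass) (b := kerMass)
      (by unfold Function.uncurry; fun_prop) (by fun_prop) (fun τ => ?_)
      (fun σ => hsub _ _ le_rfl)).trans ?_
    · rw [lintegral_comp_mul_left' (f := fun x => jb (τ - x) ^ (-(3 / 2) : ℝ)) (by fun_prop) hδ,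
        lintegral_sub_left_eq_self (fun ν => jb ν ^ (-(3 / 2) : ℝ))]
      exact le_rfl
    · simp only [mul_pow (ENNReal.ofReal δ ^ (1 / 2 : ℝ))]
      rw [lintegral_const_mul _ (by fun_prop), ← ENNReal.rpow_natCast (ENNReal.ofReal δ ^ (1 / 2 : ℝ)), ← ENNReal.rpow_mul]
      norm_num only [ENNReal.rpow_one]
      simp only [wt]
      have : ENNReal.ofReal δ⁻¹ * ENNReal.ofReal δ = 1 := by
        rw [← ENNReal.ofReal_mul (by positivity), inv_mul_cancel₀ hδ.ne', ENNReal.ofReal_one]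
      calc _ = (ENNReal.ofReal δ⁻¹ * ENNReal.ofReal δ) * (kerMass ^ 2 * ∫⁻ σ : ℝ, (jb σ ^ (1 / 2 : ℝ) * A (k, σ)) ^ 2) := by
            ring
        _ ≤ _ := by rw [this, one_mul]
  calc _ ≤ l2 mu (fun x => 2 * P x + 2 * Q x) := l2_mono hle
    _ ≤ l2 mu (fun x => 2 * P x) + l2 mu (fun x => 2 * Q x) := l2_add_le (by fun_prop) (by fun_prop)
    _ = 2 * l2 mu P + 2 * l2 mu Q := by rw [l2_const_mul _ hPm, l2_const_mul _ hQm]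
    _ ≤ 2 * (kerMass ^ (1 / 2 : ℝ) * l2l1 A) + 2 * (kerMass * l2 mu (wt A)) := by gcongr
    _ = _ := by ring

end Zakharov

end

/-! ### Cut-off free solutions and localisation in `Y` -/

noncomputable section

namespace Zakharov

/-- A numerical constant. -/
def kerC : ℝ := (kerMass ^ (1 / 2 : ℝ) + kerMass).toReal

theorem kerC_nonneg : 0 ≤ kerC := ENNReal.toReal_nonneg

theorem ofReal_kerC : ENNReal.ofReal kerC = kerMass ^ (1 / 2 : ℝ) + kerMass :=
  ENNReal.ofReal_toReal (ENNReal.add_ne_top.2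
    ⟨ENNReal.rpow_ne_top_of_nonneg (by norm_num) kerMass_ne_top, kerMass_ne_top⟩)

theorem yn_const_mul (c : ℝ≥0∞) {A : ℤ × ℝ → ℝ≥0∞} (hA : Measurable A) :
    yn (fun x => c * A x) = c * yn A := by
  rw [yn, yn, l2l1_const_mul c hA, mul_add, ← l2_const_mul c (measurable_wt hA)]
  congr 2; ext x; simp only [wt]; ring

variable {φ p : ℝ → ℂ} {C : ℝ}

theorem IsKernel.enorm_le (h : IsKernel φ p C) (τ : ℝ) :
    ‖p τ‖ₑ ≤ ENNReal.ofReal C * jb τ ^ (-2 : ℝ) := by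
  rw [jb_rpow, ← ENNReal.ofReal_mul h.nonneg, ← ofReal_norm]
  exact ENNReal.ofReal_le_ofReal (h.decay τ)

@[fun_prop]
theorem IsKernel.measurable (h : IsKernel φ p C) : Measurable p := h.continuous.measurable

theorem IsKernel.lintegral_le (h : IsKernel φ p C) :
    ∫⁻ τ : ℝ, ‖p τ‖ₑ ≤ ENNReal.ofReal C * kerMass := by
  calc _ ≤ ∫⁻ τ : ℝ, ENNReal.ofReal C * jb τ ^ (-2 : ℝ) := lintegral_mono h.enorm_le
    _ = ENNReal.ofReal C * ∫⁻ τ : ℝ, jb τ ^ (-2 : ℝ) := lintegral_const_mul _ (by fun_prop)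
    _ ≤ _ := by gcongr; exact lintegral_jb_le_kerMass (by norm_num)

theorem IsKernel.integrable (h : IsKernel φ p C) : Integrable p :=
  ⟨h.continuous.aestronglyMeasurable, lt_of_le_of_lt h.lintegral_le
    (ENNReal.mul_lt_top ENNReal.ofReal_lt_top kerMass_ne_top.lt_top)⟩

theorem norm_exp_I_mul (a t : ℝ) : ‖Complex.exp (Complex.I * a * t)‖ = 1 := by
  rw [show Complex.I * a * t = ((a * t : ℝ) : ℂ) * Complex.I by push_cast; ring,
      Complex.norm_exp_ofReal_mul_I]

theorem integrable_exp_I_mul {f : ℝ → ℂ} (hf : Integrable f) (t : ℝ) :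
    Integrable fun τ : ℝ => Complex.exp (Complex.I * τ * t) * f τ := by
  refine hf.bdd_mul (c := 1) (by fun_prop) (Eventually.of_forall fun τ => ?_)
  rw [norm_exp_I_mul]

theorem IsKernel.integral_sub (h : IsKernel φ p C) (t s : ℝ) :
    ∫ τ : ℝ, Complex.exp (Complex.I * τ * t) * p (τ - s) = Complex.exp (Complex.I * s * t) * φ t := by
  have h1 : ∀ τ : ℝ, Complex.exp (Complex.I * τ * t) * p (τ - s) =
      (fun τ : ℝ => Complex.exp (Complex.I * s * t) * (Complex.exp (Complex.I * τ * t) * p τ)) (τ - s) := by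
    intro τ
    simp only
    rw [← mul_assoc, ← Complex.exp_add]
    congr 2; push_cast; ring
  simp only [h1]
  rw [integral_sub_right_eq_self (fun τ : ℝ => Complex.exp (Complex.I * s * t) *
    (Complex.exp (Complex.I * τ * t) * p τ)), integral_const_mul, h.integral]

namespace YSpace

theorem measurable_data (h : IsKernel φ p C) (x : L2) :
    Measurable fun y : ℤ × ℝ => x y.1 * p y.2 :=
  ((measurable_of_countable fun k => x k).comp measurable_fst).mul
    (h.measurable.comp measurable_snd)

theorem yn_data_le (h : IsKernel φ p C) (x : L2) :
    yn (fun y : ℤ × ℝ => ‖x y.1 * p y.2‖ₑ) ≤ ENNReal.ofReal (C * kerC * ‖x‖) := by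
  have hp := h.measurable
  have hxp : Measurable fun y : ℤ × ℝ => x y.1 * p y.2 := measurable_data h x
  have h1 : l2 mu (wt fun y : ℤ × ℝ => ‖x y.1 * p y.2‖ₑ) ≤
      ENNReal.ofReal C * kerMass ^ (1 / 2 : ℝ) * l2 Measure.count fun k => ‖x k‖ₑ := by
    apply le_of_sq_le_sq
    rw [mul_pow, mul_pow, l2_sq (f := fun k => ‖x k‖ₑ), lintegral_count, ← ENNReal.tsum_mul_left]
    refine l2_mu_le_of_sections (measurable_wt hxp.enorm) fun k => ?_
    rw [← ENNReal.rpow_natCast (kerMass ^ (1 / 2 : ℝ)), ← ENNReal.rpow_mul]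
    norm_num only [ENNReal.rpow_one]
    calc ∫⁻ τ : ℝ, wt (fun y : ℤ × ℝ => ‖x y.1 * p y.2‖ₑ) (k, τ) ^ 2
        ≤ ∫⁻ τ : ℝ, ENNReal.ofReal C ^ 2 * ‖x k‖ₑ ^ 2 * jb τ ^ (-3 : ℝ) := by
          gcongr with τ
          simp only [wt]
          calc (jb τ ^ (1 / 2 : ℝ) * ‖x k * p τ‖ₑ) ^ 2 ≤
                (jb τ ^ (1 / 2 : ℝ) * (‖x k‖ₑ * (ENNReal.ofReal C * jb τ ^ (-2 : ℝ)))) ^ 2 := by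
                rw [enorm_mul]; gcongr; exact h.enorm_le τ
            _ = ENNReal.ofReal C ^ 2 * ‖x k‖ₑ ^ 2 * (jb τ ^ (1 / 2 : ℝ) * jb τ ^ (-2 : ℝ)) ^ 2 := by
                ring
            _ = _ := by rw [← jb_rpow_add, jb_rpow_sq]; norm_num
      _ = ENNReal.ofReal C ^ 2 * ‖x k‖ₑ ^ 2 * ∫⁻ τ : ℝ, jb τ ^ (-3 : ℝ) :=
          lintegral_const_mul _ (by fun_prop)
      _ ≤ ENNReal.ofReal C ^ 2 * ‖x k‖ₑ ^ 2 * kerMass := by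
          gcongr; exact lintegral_jb_le_kerMass (by norm_num)
      _ = _ := by ring
  have h2 : l2l1 (fun y : ℤ × ℝ => ‖x y.1 * p y.2‖ₑ) ≤
      ENNReal.ofReal C * kerMass * l2 Measure.count fun k => ‖x k‖ₑ := by
    rw [← l2_const_mul _ (measurable_of_countable _)]
    refine l2_mono fun k => ?_
    simp only [enorm_mul]
    rw [lintegral_const_mul _ hp.enorm, mul_comm]
    gcongr
    exact h.lintegral_le
  calc _ ≤ _ := add_le_add h1 h2
    _ = _ := by
      rw [← L2.ofReal_norm, ENNReal.ofReal_mul (mul_nonneg h.nonneg kerC_nonneg),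
        ENNReal.ofReal_mul h.nonneg, ofReal_kerC]; ring

/-- The element `φ(t) x` of `Y`. -/
def data (h : IsKernel φ p C) (x : L2) : YSpace :=
  mk (fun y => x y.1 * p y.2) (measurable_data h x)
    (ne_top_of_le_ne_top ENNReal.ofReal_ne_top (yn_data_le h x))

theorem norm_data_le (h : IsKernel φ p C) (x : L2) : ‖data h x‖ ≤ C * kerC * ‖x‖ :=
  norm_le_of (mul_nonneg (mul_nonneg h.nonneg kerC_nonneg) (norm_nonneg _)) (yn_data_le h x)

theorem ev_data (h : IsKernel φ p C) (x : L2) (t : ℝ) : ev (data h x) t = φ t • x := by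
  ext k
  rw [ev_apply, lp.coeFn_smul, Pi.smul_apply, smul_eq_mul, ← h.integral t, ← integral_mul_const]
  refine integral_congr_ae (Eventually.of_forall fun τ => ?_)
  simp only [data, mk_apply]; ring

theorem data_sub (h : IsKernel φ p C) (x y : L2) : data h x - data h y = data h (x - y) := by
  apply Subtype.ext
  ext z
  change x z.1 * p z.2 - y z.1 * p z.2 = (x - y) z.1 * p z.2
  rw [lp.coeFn_sub, Pi.sub_apply]; ring

/-- Localisation in time by a cutoff, after an affine change of the time variable. The bound does
not depend on the scaling factor. -/
theorem exists_cut (h : IsKernel φ p C) (A : YSpace) {δ : ℝ} (hδ : 0 < δ) (t₀ : ℝ) :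
    ∃ B : YSpace, ‖B‖ ≤ 3 * C * kerC * ‖A‖ ∧ ∀ t, ev B t = φ t • ev A (δ * t + t₀) := by
  have hp := h.measurable
  -- A mode `e^{iσt}` at time `δt + t₀` is `e^{iσt₀} e^{iδσt}`, and multiplication by `φ` smears the
  -- frequency `δσ` by `p`.
  set F : ℤ × ℝ → ℂ := fun x => ∫ σ : ℝ, p (x.2 - δ * σ) *
    (Complex.exp (Complex.I * σ * t₀) * A (x.1, σ)) with hF
  have hFm : Measurable F := by
    refine (StronglyMeasurable.integral_prod_right' (f := fun q : (ℤ × ℝ) × ℝ =>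
      p (q.1.2 - δ * q.2) * (Complex.exp (Complex.I * q.2 * t₀) * A (q.1.1, q.2))) ?_).measurable
    exact Measurable.stronglyMeasurable (by fun_prop)
  have hle : ∀ x, ‖F x‖ₑ ≤ ENNReal.ofReal C *
      ∫⁻ σ : ℝ, jb (x.2 - δ * σ) ^ (-2 : ℝ) * ‖A (x.1, σ)‖ₑ := by
    intro x
    rw [← lintegral_const_mul _ (by fun_prop)]
    refine (enorm_integral_le_lintegral_enorm _).trans (lintegral_mono fun σ => ?_)
    rw [enorm_mul, enorm_exp_mul, ← mul_assoc]
    gcongr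
    exact h.enorm_le _
  have hyn : yn (fun x => ‖F x‖ₑ) ≤ ENNReal.ofReal (3 * C * kerC * ‖A‖) := by
    refine (yn_mono hle).trans ?_
    have hm : Measurable fun x : ℤ × ℝ => ∫⁻ σ : ℝ, jb (x.2 - δ * σ) ^ (-2 : ℝ) * ‖A (x.1, σ)‖ₑ :=
      Measurable.lintegral_prod_right' (f := fun q : (ℤ × ℝ) × ℝ =>
        jb (q.1.2 - δ * q.2) ^ (-2 : ℝ) * ‖A (q.1.1, q.2)‖ₑ) (by fun_prop)
    rw [yn_const_mul _ hm, ENNReal.ofReal_mul (by have := h.nonneg; have := kerC_nonneg; positivity),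
      ENNReal.ofReal_mul (by have := h.nonneg; positivity), ENNReal.ofReal_mul (by norm_num),
      ofReal_kerC, ofReal_norm']
    have h1 := l2_wt_rescale_le (A := fun x => ‖A x‖ₑ) (by fun_prop) hδ
    have h2 := l2l1_rescale_le (A := fun x => ‖A x‖ₑ) (by fun_prop) (δ := δ)
    simp only [ENNReal.ofReal_ofNat]
    unfold yn
    set a := l2 mu (wt fun x => ‖A x‖ₑ)
    set b := l2l1 fun x => ‖A x‖ₑ
    set K := kerMass ^ (1 / 2 : ℝ)
    calc _ ≤ ENNReal.ofReal C * ((2 * K * b + 2 * kerMass * a) + kerMass * b) := by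
          gcongr
      _ ≤ ENNReal.ofReal C * ((2 * K * b + 2 * kerMass * a) + kerMass * b) +
          ENNReal.ofReal C * (K * b + 2 * kerMass * b + kerMass * a + 3 * K * a) := le_self_add
      _ = _ := by ring
  refine ⟨mk F hFm (ne_top_of_le_ne_top ENNReal.ofReal_ne_top hyn), norm_le_of
    (by have := h.nonneg; have := kerC_nonneg; positivity) hyn, fun t => ?_⟩
  ext k
  rw [ev_apply, lp.coeFn_smul, Pi.smul_apply, smul_eq_mul, ev_apply]
  simp only [mk_apply, hF, ← integral_const_mul]
  have hint : Integrable (Function.uncurry fun τ σ : ℝ => Complex.exp (Complex.I * τ * t) *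
      (p (τ - δ * σ) * (Complex.exp (Complex.I * σ * t₀) * A (k, σ)))) (volume.prod volume) := by
    refine ⟨Measurable.aestronglyMeasurable (by unfold Function.uncurry; fun_prop), ?_⟩
    rw [hasFiniteIntegral_iff_enorm, lintegral_prod_symm _ (Measurable.aemeasurable (by unfold Function.uncurry; fun_prop))]
    simp only [Function.uncurry]
    calc _ ≤ ∫⁻ σ : ℝ, (ENNReal.ofReal C * kerMass) * ‖A (k, σ)‖ₑ := by
          gcongr with σ
          simp only [enorm_exp_mul, enorm_mul (p _)]
          rw [lintegral_mul_const _ (by fun_prop), lintegral_sub_right_eq_self (fun τ => ‖p τ‖ₑ)]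
          gcongr
          exact h.lintegral_le
      _ < ∞ := by
          rw [lintegral_const_mul _ (by fun_prop)]
          have h1 : ∫⁻ σ : ℝ, ‖A (k, σ)‖ₑ ≠ ∞ := (A.integrable k).2.ne
          have h2 := kerMass_ne_top
          exact lt_top_iff_ne_top.2 (by finiteness)
  rw [integral_integral_swap hint]
  refine integral_congr_ae (Eventually.of_forall fun σ => ?_)
  simp only [← mul_assoc]
  rw [integral_mul_const, integral_mul_const, h.integral_sub]
  have : Complex.exp (Complex.I * σ * ((δ * t + t₀ : ℝ) : ℂ)) =
      Complex.exp (Complex.I * ((δ * σ : ℝ) : ℂ) * t) * Complex.exp (Complex.I * σ * t₀) := by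
    rw [← Complex.exp_add]; congr 1; push_cast; ring
  rw [this]; ring

end YSpace

end Zakharov

end

/-! ### Bilinear Duhamel operators on `Y` -/

noncomputable section

namespace Zakharov

/-- A bilinear interaction with coefficients `c k m` and phases `ω k m`, of strength `ε`. -/
structure Coupling where
  /-- The coefficients. -/
  c : ℤ → ℤ → ℂ
  /-- The phases. -/
  ω : ℤ → ℤ → ℝ
  /-- The strength. -/
  ε : ℝ
  nonneg : 0 ≤ ε
  bound : InteractionBound (fun k m => ‖c k m‖ₑ) ω (ENNReal.ofReal ε ^ 2)

/-- The constant in the bilinear estimate. -/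
def duhC : ℝ := 3 * kerC * (2 + 3 * kerConst.toReal + 4 * kerConst.toReal ^ 2)

theorem duhC_nonneg : 0 ≤ duhC := by
  have := kerC_nonneg
  have := ENNReal.toReal_nonneg (a := kerConst)
  unfold duhC; positivity

namespace Coupling

variable (Q : Coupling) (A B : YSpace)

/-- The majorant of the interaction of two functions. -/
def maj : ℤ × ℝ → ℝ≥0∞ :=
  tconv (fun k m => ‖Q.c k m‖ₑ) Q.ω (fun x => ‖A x‖ₑ) fun x => ‖B x‖ₑ

/-- The interaction of two functions, on the Fourier side. -/
def prod (x : ℤ × ℝ) : ℂ :=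
  ∫ y, Q.c x.1 y.1 * (A y * B (x.1 - y.1, x.2 - y.2 - Q.ω x.1 y.1)) ∂mu

@[fun_prop]
theorem measurable_maj : Measurable (Q.maj A B) :=
  measurable_tconv (by fun_prop) (by fun_prop)

theorem measurable_integrand : Measurable fun q : (ℤ × ℝ) × (ℤ × ℝ) =>
    Q.c q.1.1 q.2.1 * (A q.2 * B (q.1.1 - q.2.1, q.1.2 - q.2.2 - Q.ω q.1.1 q.2.1)) := by
  fun_prop

@[fun_prop]
theorem measurable_prod : Measurable (Q.prod A B) :=
  (StronglyMeasurable.integral_prod_right' (measurable_integrand Q A B).stronglyMeasurable).measurable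

theorem enorm_prod_le (x : ℤ × ℝ) : ‖Q.prod A B x‖ₑ ≤ Q.maj A B x := by
  refine (enorm_integral_le_lintegral_enorm _).trans (le_of_eq ?_)
  simp only [enorm_mul]; rfl

theorem l2_maj_le : l2 mu (fun x => jb x.2 ^ (-(1 / 2) : ℝ) * Q.maj A B x) ≤
    3 * kerConst * ENNReal.ofReal Q.ε * (ENNReal.ofReal ‖A‖ * ENNReal.ofReal ‖B‖) := by
  refine (l2_tconv_le Q.bound (by fun_prop) (by fun_prop)).trans ?_
  gcongr
  · exact A.l2_le
  · exact B.l2_le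

theorem l2l1_maj_le : l2l1 (fun x => jb x.2 ^ (-1 : ℝ) * Q.maj A B x) ≤
    (2 + 4 * kerConst ^ 2) * ENNReal.ofReal Q.ε * (ENNReal.ofReal ‖A‖ * ENNReal.ofReal ‖B‖) := by
  refine (l2l1_tconv_le Q.bound (by fun_prop) (by fun_prop)).trans ?_
  calc _ ≤ 2 * ENNReal.ofReal Q.ε * (ENNReal.ofReal ‖A‖ * ENNReal.ofReal ‖B‖) +
        4 * kerConst ^ 2 * ENNReal.ofReal Q.ε * (ENNReal.ofReal ‖A‖ * ENNReal.ofReal ‖B‖) := by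
        gcongr
        · exact A.l2l1_le
        · exact B.l2l1_le
        · exact A.l2_le
        · exact B.l2_le
    _ = _ := by ring

theorem lintegral_maj_ne_top (k : ℤ) : ∫⁻ ν : ℝ, jb ν ^ (-1 : ℝ) * Q.maj A B (k, ν) ≠ ∞ := by
  have h1 := kerConst_ne_top
  have h := ne_top_of_le_ne_top (by finiteness) (Q.l2l1_maj_le A B)
  have h2 := ENNReal.pow_ne_top (n := 2) h
  rw [l2l1_sq] at h2
  have h3 := ENNReal.ne_top_of_tsum_ne_top h2 k
  exact fun h4 => by simp [h4] at h3

/-- The interaction integral converges only for almost every output frequency, since just `⟨ν⟩^{-1}`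
times the majorant is known to be integrable. Additivity of `prod` therefore holds almost
everywhere, and that of `duh` everywhere. -/
theorem ae_maj_lt_top (k : ℤ) : ∀ᵐ ν : ℝ, Q.maj A B (k, ν) < ∞ := by
  filter_upwards [ae_lt_top (by fun_prop) (Q.lintegral_maj_ne_top A B k)] with ν hν
  by_contra h
  rw [not_lt_top_iff.1 h, ENNReal.mul_top (jb_rpow_ne_zero _ _)] at hν
  exact lt_irrefl _ hν

theorem integrable_of_maj_lt_top {x : ℤ × ℝ} (h : Q.maj A B x < ∞) :
    Integrable (fun y : ℤ × ℝ => Q.c x.1 y.1 * (A y * B (x.1 - y.1, x.2 - y.2 - Q.ω x.1 y.1))) mu := by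
  refine ⟨(Measurable.aestronglyMeasurable
    ((measurable_integrand Q A B).comp measurable_prodMk_left)), ?_⟩
  rw [hasFiniteIntegral_iff_enorm]
  simp only [enorm_mul]
  exact h

theorem prod_add_left (A' : YSpace) (k : ℤ) :
    ∀ᵐ ν : ℝ, Q.prod (A + A') B (k, ν) = Q.prod A B (k, ν) + Q.prod A' B (k, ν) := by
  filter_upwards [Q.ae_maj_lt_top A B k, Q.ae_maj_lt_top A' B k] with ν h1 h2
  rw [prod, prod, prod, ← integral_add (Q.integrable_of_maj_lt_top A B h1)
    (Q.integrable_of_maj_lt_top A' B h2)]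
  simp only [YSpace.add_apply, add_mul, mul_add]

theorem prod_add_right (B' : YSpace) (k : ℤ) :
    ∀ᵐ ν : ℝ, Q.prod A (B + B') (k, ν) = Q.prod A B (k, ν) + Q.prod A B' (k, ν) := by
  filter_upwards [Q.ae_maj_lt_top A B k, Q.ae_maj_lt_top A B' k] with ν h1 h2
  rw [prod, prod, prod, ← integral_add (Q.integrable_of_maj_lt_top A B h1)
    (Q.integrable_of_maj_lt_top A B' h2)]
  simp only [YSpace.add_apply, mul_add]

variable {φ p : ℝ → ℂ} {C : ℝ}

theorem measurable_theta_mul (h : IsKernel φ p C) : Measurable fun q : (ℤ × ℝ) × ℝ =>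
    theta p q.1.2 q.2 * Q.prod A B (q.1.1, q.2) := by
  have h1 : Measurable fun q : (ℤ × ℝ) × ℝ => theta p q.1.2 q.2 :=
    h.measurable_theta.comp (by fun_prop : Measurable fun q : (ℤ × ℝ) × ℝ => (q.1.2, q.2))
  exact h1.mul ((Q.measurable_prod A B).comp (by fun_prop))

theorem enorm_theta_mul_le (h : IsKernel φ p C) (x : ℤ × ℝ) (ν : ℝ) :
    ‖theta p x.2 ν * Q.prod A B (x.1, ν)‖ₑ ≤ ENNReal.ofReal C *
      (jb ν ^ (-1 : ℝ) * (jb (x.2 - ν) ^ (-2 : ℝ) + jb x.2 ^ (-2 : ℝ)) * Q.maj A B (x.1, ν)) := by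
  rw [enorm_mul, ← mul_assoc]
  exact mul_le_mul' (h.enorm_theta_le _ _) (Q.enorm_prod_le A B _)

theorem enorm_integral_theta_le (h : IsKernel φ p C) (x : ℤ × ℝ) :
    ‖∫ ν : ℝ, theta p x.2 ν * Q.prod A B (x.1, ν)‖ₑ ≤
      ENNReal.ofReal C * thetaBound (Q.maj A B) x := by
  rw [thetaBound, ← lintegral_const_mul _ (by fun_prop)]
  exact (enorm_integral_le_lintegral_enorm _).trans
    (lintegral_mono fun ν => Q.enorm_theta_mul_le A B h x ν)

theorem integrable_theta_mul (h : IsKernel φ p C) (x : ℤ × ℝ) :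
    Integrable fun ν : ℝ => theta p x.2 ν * Q.prod A B (x.1, ν) := by
  refine ⟨((Q.measurable_theta_mul A B h).comp measurable_prodMk_left).aestronglyMeasurable, ?_⟩
  rw [hasFiniteIntegral_iff_enorm]
  calc _ ≤ ∫⁻ ν : ℝ, ENNReal.ofReal C * (2 * (jb ν ^ (-1 : ℝ) * Q.maj A B (x.1, ν))) := by
        refine lintegral_mono fun ν => (Q.enorm_theta_mul_le A B h x ν).trans ?_
        calc _ ≤ ENNReal.ofReal C * (jb ν ^ (-1 : ℝ) * (1 + 1) * Q.maj A B (x.1, ν)) := by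
              gcongr
              · exact jb_rpow_le_one _ (by norm_num)
              · exact jb_rpow_le_one _ (by norm_num)
          _ = _ := by ring
    _ < ∞ := by
        rw [lintegral_const_mul _ (by fun_prop), lintegral_const_mul _ (by fun_prop)]
        have := Q.lintegral_maj_ne_top A B x.1
        exact lt_top_iff_ne_top.2 (by finiteness)

/-- Time integration gains one power of the modulation, from `⟨ν⟩^{-1/2}` to `⟨τ⟩^{1/2}` in `L²` and
from `⟨ν⟩^{-1}` to `1` in `L¹`. The two bilinear estimates have exactly these negative weights on
their outputs. -/
theorem yn_duh_le (h : IsKernel φ p C) :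
    yn (fun x => ‖∫ ν : ℝ, theta p x.2 ν * Q.prod A B (x.1, ν)‖ₑ) ≤
      ENNReal.ofReal (C * duhC * Q.ε * (‖A‖ * ‖B‖)) := by
  refine (yn_mono (Q.enorm_integral_theta_le A B h)).trans ?_
  rw [yn_const_mul _ (measurable_thetaBound (by fun_prop))]
  have h1 := l2_wt_thetaBound_le (Q.measurable_maj A B)
  have h2 := l2l1_thetaBound_le (Q.measurable_maj A B)
  have h3 := Q.l2_maj_le A B
  have h4 := Q.l2l1_maj_le A B
  have hC := h.nonneg
  have hK : ENNReal.ofReal kerConst.toReal = kerConst := ENNReal.ofReal_toReal kerConst_ne_top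
  have hK0 := ENNReal.toReal_nonneg (a := kerConst)
  have hε := Q.nonneg
  have hd : ENNReal.ofReal (C * duhC * Q.ε * (‖A‖ * ‖B‖)) = ENNReal.ofReal C *
      (3 * (kerMass ^ (1 / 2 : ℝ) + kerMass) * (2 + 3 * kerConst + 4 * kerConst ^ 2)) *
      ENNReal.ofReal Q.ε * (ENNReal.ofReal ‖A‖ * ENNReal.ofReal ‖B‖) := by
    have h0 := kerC_nonneg
    rw [ENNReal.ofReal_mul (mul_nonneg (mul_nonneg hC duhC_nonneg) hε),
      ENNReal.ofReal_mul (mul_nonneg hC duhC_nonneg), ENNReal.ofReal_mul hC,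
      ENNReal.ofReal_mul (norm_nonneg A), duhC, ENNReal.ofReal_mul (by positivity),
      ENNReal.ofReal_mul (by norm_num), ofReal_kerC, ENNReal.ofReal_add (by positivity) (by positivity),
      ENNReal.ofReal_add (by positivity) (by positivity), ENNReal.ofReal_mul (by norm_num),
      ENNReal.ofReal_mul (by norm_num), ENNReal.ofReal_pow hK0, hK]
    norm_num
  rw [hd]
  set a := l2 mu fun x => jb x.2 ^ (-(1 / 2) : ℝ) * Q.maj A B x
  set b := l2l1 fun x => jb x.2 ^ (-1 : ℝ) * Q.maj A B x
  set K := kerMass ^ (1 / 2 : ℝ)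
  set N := ENNReal.ofReal ‖A‖ * ENNReal.ofReal ‖B‖
  set e := ENNReal.ofReal Q.ε
  calc _ ≤ ENNReal.ofReal C * ((2 * kerMass * a + K * b) + 2 * kerMass * b) := by
        unfold yn; gcongr
    _ ≤ ENNReal.ofReal C * (3 * (K + kerMass) * (a + b)) := by
        gcongr
        calc _ ≤ (2 * kerMass * a + K * b) + 2 * kerMass * b +
              (3 * K * a + kerMass * a + 2 * K * b + kerMass * b) := le_self_add
          _ = _ := by ring
    _ ≤ ENNReal.ofReal C * (3 * (K + kerMass) *
          (3 * kerConst * e * N + (2 + 4 * kerConst ^ 2) * e * N)) := by gcongr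
    _ = _ := by ring

/-- The function `φ(t) ∫₀ᵗ ∑ₘ c e^{iωs} A(s) B(s) ds`. -/
def duh (h : IsKernel φ p C) : YSpace :=
  YSpace.mk (fun x => ∫ ν : ℝ, theta p x.2 ν * Q.prod A B (x.1, ν))
    (StronglyMeasurable.integral_prod_right'
      (Q.measurable_theta_mul A B h).stronglyMeasurable).measurable
    (ne_top_of_le_ne_top ENNReal.ofReal_ne_top (Q.yn_duh_le A B h))

theorem norm_duh_le (h : IsKernel φ p C) :
    ‖Q.duh A B h‖ ≤ C * duhC * Q.ε * (‖A‖ * ‖B‖) := by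
  refine YSpace.norm_le_of ?_ (Q.yn_duh_le A B h)
  have := h.nonneg; have := duhC_nonneg; have := Q.nonneg; positivity

theorem duh_add_left (A' : YSpace) (h : IsKernel φ p C) :
    Q.duh (A + A') B h = Q.duh A B h + Q.duh A' B h := by
  apply Subtype.ext
  ext x
  change ∫ ν : ℝ, theta p x.2 ν * Q.prod (A + A') B (x.1, ν) =
    (∫ ν : ℝ, theta p x.2 ν * Q.prod A B (x.1, ν)) + ∫ ν : ℝ, theta p x.2 ν * Q.prod A' B (x.1, ν)
  rw [← integral_add (Q.integrable_theta_mul A B h x) (Q.integrable_theta_mul A' B h x)]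
  refine integral_congr_ae ?_
  filter_upwards [Q.prod_add_left A B A' x.1] with ν hν
  rw [hν, mul_add]

theorem duh_add_right (B' : YSpace) (h : IsKernel φ p C) :
    Q.duh A (B + B') h = Q.duh A B h + Q.duh A B' h := by
  apply Subtype.ext
  ext x
  change ∫ ν : ℝ, theta p x.2 ν * Q.prod A (B + B') (x.1, ν) =
    (∫ ν : ℝ, theta p x.2 ν * Q.prod A B (x.1, ν)) + ∫ ν : ℝ, theta p x.2 ν * Q.prod A B' (x.1, ν)
  rw [← integral_add (Q.integrable_theta_mul A B h x) (Q.integrable_theta_mul A B' h x)]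
  refine integral_congr_ae ?_
  filter_upwards [Q.prod_add_right A B B' x.1] with ν hν
  rw [hν, mul_add]

theorem duh_sub (A' B' : YSpace) (h : IsKernel φ p C) :
    Q.duh A B h - Q.duh A' B' h = Q.duh (A - A') B h + Q.duh A' (B - B') h := by
  have h1 := Q.duh_add_left (A - A') B A' h
  have h2 := Q.duh_add_right A' (B - B') B' h
  rw [sub_add_cancel] at h1 h2
  rw [h1, h2]; abel

end Coupling

end Zakharov

end

/-! ### Values in time of the Duhamel operators -/

noncomputable section

namespace Zakharov

variable {φ p : ℝ → ℂ} {C : ℝ}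

/-- The Fourier multiplier of the time-integration operator, evaluated at the time `t`. -/
def duhMul (φ : ℝ → ℂ) (t ν : ℝ) : ℂ :=
  (Complex.exp (Complex.I * ν * t) * φ t - φ t) / (Complex.I * ν)

theorem measurable_duhMul (t : ℝ) : Measurable (duhMul φ t) := by
  unfold duhMul; fun_prop

theorem IsKernel.measurable_theta_left (h : IsKernel φ p C) (ν : ℝ) :
    Measurable fun τ => theta p τ ν := h.measurable_theta.comp measurable_prodMk_right

theorem IsKernel.lintegral_theta_le (h : IsKernel φ p C) (ν : ℝ) :
    ∫⁻ τ : ℝ, ‖theta p τ ν‖ₑ ≤ ENNReal.ofReal C * (2 * kerMass) * jb ν ^ (-1 : ℝ) := by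
  calc _ ≤ ∫⁻ τ : ℝ, ENNReal.ofReal C *
        (jb ν ^ (-1 : ℝ) * (jb (τ - ν) ^ (-2 : ℝ) + jb τ ^ (-2 : ℝ))) :=
        lintegral_mono fun τ => h.enorm_theta_le τ ν
    _ = ENNReal.ofReal C * (jb ν ^ (-1 : ℝ) *
          ((∫⁻ τ : ℝ, jb (τ - ν) ^ (-2 : ℝ)) + ∫⁻ τ : ℝ, jb τ ^ (-2 : ℝ))) := by
        rw [lintegral_const_mul _ (by fun_prop), lintegral_const_mul _ (by fun_prop),
          lintegral_add_left (by fun_prop)]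
    _ ≤ ENNReal.ofReal C * (jb ν ^ (-1 : ℝ) * (kerMass + kerMass)) := by
        gcongr
        · exact lintegral_jb_sub_le_kerMass (by norm_num) ν
        · exact lintegral_jb_le_kerMass (by norm_num)
    _ = _ := by ring

theorem IsKernel.integral_theta (h : IsKernel φ p C) (t ν : ℝ) :
    ∫ τ : ℝ, Complex.exp (Complex.I * τ * t) * theta p τ ν = duhMul φ t ν := by
  have h1 : ∀ τ : ℝ, Complex.exp (Complex.I * τ * t) * theta p τ ν =
      (Complex.exp (Complex.I * τ * t) * p (τ - ν) - Complex.exp (Complex.I * τ * t) * p τ) /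
        (Complex.I * ν) := fun τ => by unfold theta; ring
  simp only [h1]
  rw [integral_div, MeasureTheory.integral_sub (integrable_exp_I_mul (h.integrable.comp_sub_right ν) t)
    (integrable_exp_I_mul h.integrable t), h.integral_sub, h.integral, duhMul]

theorem IsKernel.enorm_duhMul_le (h : IsKernel φ p C) (t ν : ℝ) :
    ‖duhMul φ t ν‖ₑ ≤ ENNReal.ofReal C * (2 * kerMass) * jb ν ^ (-1 : ℝ) := by
  rw [← h.integral_theta]
  refine (enorm_integral_le_lintegral_enorm _).trans (le_trans (le_of_eq ?_) (h.lintegral_theta_le ν))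
  simp only [YSpace.enorm_exp_mul]

theorem duhMul_eq_integral {t ν : ℝ} (ht : φ t = 1) (hν : ν ≠ 0) :
    duhMul φ t ν = ∫ s in (0 : ℝ)..t, Complex.exp (Complex.I * ν * s) := by
  rw [integral_exp_mul_complex (mul_ne_zero Complex.I_ne_zero (by exact_mod_cast hν)), duhMul, ht]
  simp

theorem ae_ne_zero : ∀ᵐ ν : ℝ, ν ≠ 0 := by
  simp [ae_iff]

namespace Coupling

variable (Q : Coupling) (A B : YSpace)

/-- The interaction of the mode `m` of `A` with the mode `k - m` of `B`. -/
def mode (k m : ℤ) (ν : ℝ) : ℂ := ∫ σ : ℝ, A (m, σ) * B (k - m, ν - σ - Q.ω k m)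

/-- The majorant of `mode`. -/
def modeMaj (k m : ℤ) (ν : ℝ) : ℝ≥0∞ := ∫⁻ σ : ℝ, ‖A (m, σ)‖ₑ * ‖B (k - m, ν - σ - Q.ω k m)‖ₑ

theorem measurable_modeMaj (k m : ℤ) : Measurable (Q.modeMaj A B k m) :=
  Measurable.lintegral_prod_right' (f := fun q : ℝ × ℝ =>
    ‖A (m, q.2)‖ₑ * ‖B (k - m, q.1 - q.2 - Q.ω k m)‖ₑ) (by fun_prop)

@[fun_prop]
theorem measurable_mode (k m : ℤ) : Measurable (Q.mode A B k m) := by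
  refine (StronglyMeasurable.integral_prod_right' (f := fun q : ℝ × ℝ =>
    A (m, q.2) * B (k - m, q.1 - q.2 - Q.ω k m)) ?_).measurable
  exact Measurable.stronglyMeasurable (by fun_prop)

theorem enorm_mode_le (k m : ℤ) (ν : ℝ) : ‖Q.mode A B k m ν‖ₑ ≤ Q.modeMaj A B k m ν := by
  refine (enorm_integral_le_lintegral_enorm _).trans (le_of_eq ?_)
  simp only [enorm_mul]; rfl

theorem maj_eq (k : ℤ) (ν : ℝ) :
    Q.maj A B (k, ν) = ∑' m, ‖Q.c k m‖ₑ * Q.modeMaj A B k m ν := by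
  rw [maj, tconv, lintegral_mu (by fun_prop)]
  refine tsum_congr fun m => ?_
  rw [modeMaj, ← lintegral_const_mul _ (by fun_prop)]

/-- Wherever the majorant is finite, Fubini's theorem separates the sum over modes from the
convolution in the time frequency. -/
theorem ae_prod_eq (k : ℤ) :
    ∀ᵐ ν : ℝ, Q.prod A B (k, ν) = ∑' m, Q.c k m * Q.mode A B k m ν := by
  filter_upwards [Q.ae_maj_lt_top A B k] with ν hν
  have hi := Q.integrable_of_maj_lt_top A B hν
  rw [prod, integral_prod _ hi, integral_countable hi.integral_prod_left]
  refine tsum_congr fun m => ?_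
  simp only [Measure.real, Measure.count_singleton, ENNReal.toReal_one, one_smul]
  rw [mode, ← integral_const_mul]

theorem integrable_mode_uncurry (k m : ℤ) : Integrable (Function.uncurry fun ν σ : ℝ =>
    A (m, σ) * B (k - m, ν - σ - Q.ω k m)) (volume.prod volume) := by
  refine ⟨Measurable.aestronglyMeasurable (by unfold Function.uncurry; fun_prop), ?_⟩
  rw [hasFiniteIntegral_iff_enorm, lintegral_prod_symm _
    (Measurable.aemeasurable (by unfold Function.uncurry; fun_prop))]
  simp only [Function.uncurry, enorm_mul]
  have h1 : ∀ σ : ℝ, ∫⁻ ν : ℝ, ‖A (m, σ)‖ₑ * ‖B (k - m, ν - σ - Q.ω k m)‖ₑ =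
      ‖A (m, σ)‖ₑ * ∫⁻ ν : ℝ, ‖B (k - m, ν)‖ₑ := by
    intro σ
    rw [lintegral_const_mul _ (by fun_prop)]
    congr 1
    simp only [sub_sub]
    exact lintegral_sub_right_eq_self (fun ν => ‖B (k - m, ν)‖ₑ) (σ + Q.ω k m)
  simp only [h1]
  rw [lintegral_mul_const _ (by fun_prop)]
  exact ENNReal.mul_lt_top (A.integrable m).2 (B.integrable (k - m)).2

theorem integrable_mode (k m : ℤ) : Integrable (Q.mode A B k m) :=
  (Q.integrable_mode_uncurry A B k m).integral_prod_left

/-- The twisted convolution is the Fourier side of a product: the shift by `ω` becomes the factor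
`e^{iωs}`. -/
theorem integral_exp_mode (k m : ℤ) (s : ℝ) :
    ∫ ν : ℝ, Complex.exp (Complex.I * ν * s) * Q.mode A B k m ν =
      Complex.exp (Complex.I * Q.ω k m * s) * (YSpace.ev A s m * YSpace.ev B s (k - m)) := by
  have hint : Integrable (Function.uncurry fun ν σ : ℝ => Complex.exp (Complex.I * ν * s) *
      (A (m, σ) * B (k - m, ν - σ - Q.ω k m))) (volume.prod volume) := by
    refine (Q.integrable_mode_uncurry A B k m).bdd_mul (c := 1)
      (f := fun x : ℝ × ℝ => Complex.exp (Complex.I * x.1 * s)) (by fun_prop) (Eventually.of_forall fun x => ?_)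
    rw [norm_exp_I_mul]
  simp only [mode, ← integral_const_mul]
  rw [integral_integral_swap hint, YSpace.ev_apply, ← integral_mul_const, ← integral_const_mul]
  refine integral_congr_ae (Eventually.of_forall fun σ => ?_)
  simp only
  have h1 : ∀ ν : ℝ, Complex.exp (Complex.I * ν * s) * (A (m, σ) * B (k - m, ν - σ - Q.ω k m)) =
      (fun ρ : ℝ => (Complex.exp (Complex.I * Q.ω k m * s) * (Complex.exp (Complex.I * σ * s) * A (m, σ))) *
        (Complex.exp (Complex.I * ρ * s) * B (k - m, ρ))) (ν - (σ + Q.ω k m)) := by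
    intro ν
    simp only
    have : Complex.exp (Complex.I * ν * s) = Complex.exp (Complex.I * Q.ω k m * s) *
        Complex.exp (Complex.I * σ * s) * Complex.exp (Complex.I * ((ν - (σ + Q.ω k m) : ℝ) : ℂ) * s) := by
      rw [← Complex.exp_add, ← Complex.exp_add]; congr 1; push_cast; ring
    rw [this, sub_sub]; ring
  simp only [h1]
  rw [integral_sub_right_eq_self (fun ρ : ℝ => (Complex.exp (Complex.I * Q.ω k m * s) *
    (Complex.exp (Complex.I * σ * s) * A (m, σ))) *
        (Complex.exp (Complex.I * ρ * s) * B (k - m, ρ))), integral_const_mul, ← YSpace.ev_apply]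
  ring

/-- Where the cutoff equals `1`, the multiplier is the integral of `e^{iνs}` over `[0, t]`, except
at the null point `ν = 0`. For a single pair of modes everything is absolutely integrable and the
two integrals can be exchanged. -/
theorem integral_duhMul_mode {t : ℝ} (ht : φ t = 1) (k m : ℤ) :
    ∫ ν : ℝ, duhMul φ t ν * (Q.c k m * Q.mode A B k m ν) =
      ∫ s in (0 : ℝ)..t, Q.c k m * (Complex.exp (Complex.I * Q.ω k m * s) *
        (YSpace.ev A s m * YSpace.ev B s (k - m))) := by
  have hint : Integrable (Function.uncurry fun ν s : ℝ => Complex.exp (Complex.I * ν * s) *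
      Q.mode A B k m ν) (volume.prod (volume.restrict (Set.uIoc 0 t))) := by
    have h1 : Integrable (fun x : ℝ × ℝ => Q.mode A B k m x.1 * 1)
        (volume.prod (volume.restrict (Set.uIoc 0 t))) :=
      (Q.integrable_mode A B k m).mul_prod (g := fun _ : ℝ => (1 : ℂ)) (by
        rw [integrable_const_iff]; right
        exact isFiniteMeasure_restrict.2 (by simp [Set.uIoc]))
    simp only [mul_one] at h1
    refine h1.bdd_mul (c := 1)
      (f := fun x : ℝ × ℝ => Complex.exp (Complex.I * x.1 * x.2)) (by fun_prop) (Eventually.of_forall fun x => ?_)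
    rw [norm_exp_I_mul]
  calc _ = ∫ ν : ℝ, Q.c k m * ((if 0 ≤ t then (1 : ℝ) else -1) • ∫ s in Set.uIoc 0 t,
        Complex.exp (Complex.I * ν * s) * Q.mode A B k m ν) := by
        refine integral_congr_ae ?_
        filter_upwards [ae_ne_zero] with ν hν
        rw [duhMul_eq_integral ht hν, intervalIntegral.intervalIntegral_eq_integral_uIoc,
          integral_mul_const, Complex.real_smul, Complex.real_smul]
        ring
    _ = Q.c k m * ((if 0 ≤ t then (1 : ℝ) else -1) • ∫ s in Set.uIoc 0 t, ∫ ν : ℝ,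
        Complex.exp (Complex.I * ν * s) * Q.mode A B k m ν) := by
        rw [integral_const_mul, integral_smul, integral_integral_swap hint]
    _ = _ := by
        rw [← intervalIntegral.intervalIntegral_eq_integral_uIoc, ← intervalIntegral.integral_const_mul]
        simp only [Q.integral_exp_mode]

/-- The multiplier decays like `⟨ν⟩^{-1}`, so the `ℓ²L¹` bilinear estimate bounds the sum. This
makes the series over interactions converge after the integration in time, although it may diverge
at a fixed time. -/
theorem lintegral_duhMul_maj_ne_top (h : IsKernel φ p C) (t : ℝ) (k : ℤ) :
    ∑' m, ∫⁻ ν : ℝ, ‖duhMul φ t ν * (Q.c k m * Q.mode A B k m ν)‖ₑ ≠ ∞ := by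
  have hm := fun m => Q.measurable_modeMaj A B k m
  have : ∑' m, ∫⁻ ν : ℝ, ‖duhMul φ t ν * (Q.c k m * Q.mode A B k m ν)‖ₑ ≤
      ENNReal.ofReal C * (2 * kerMass) * ∫⁻ ν : ℝ, jb ν ^ (-1 : ℝ) * Q.maj A B (k, ν) := by
    simp only [maj_eq, ← ENNReal.tsum_mul_left]
    rw [lintegral_tsum fun m => by have := hm m; fun_prop, ← ENNReal.tsum_mul_left]
    gcongr with m
    rw [← lintegral_const_mul _ (by have := hm m; fun_prop)]
    gcongr with ν
    rw [enorm_mul, enorm_mul, ← mul_assoc _ (jb ν ^ _)]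
    gcongr
    · exact h.enorm_duhMul_le t ν
    · exact Q.enorm_mode_le A B k m ν
  refine ne_top_of_le_ne_top ?_ this
  have h1 := Q.lintegral_maj_ne_top A B k
  have h2 := kerMass_ne_top
  finiteness

theorem ev_duh (h : IsKernel φ p C) (t : ℝ) (k : ℤ) :
    YSpace.ev (Q.duh A B h) t k = ∫ ν : ℝ, duhMul φ t ν * Q.prod A B (k, ν) := by
  have hm := h.measurable_theta
  have hint : Integrable (Function.uncurry fun τ ν : ℝ => Complex.exp (Complex.I * τ * t) *
      (theta p τ ν * Q.prod A B (k, ν))) (volume.prod volume) := by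
    have hmeas : Measurable (Function.uncurry fun τ ν : ℝ => Complex.exp (Complex.I * τ * t) *
      (theta p τ ν * Q.prod A B (k, ν))) := by
      unfold Function.uncurry
      exact Measurable.mul (by fun_prop) (hm.mul (by fun_prop))
    refine ⟨hmeas.aestronglyMeasurable, ?_⟩
    rw [hasFiniteIntegral_iff_enorm, lintegral_prod_symm _ hmeas.enorm.aemeasurable]
    simp only [Function.uncurry, YSpace.enorm_exp_mul]
    simp only [enorm_mul]
    calc _ ≤ ∫⁻ ν : ℝ, ENNReal.ofReal C * (2 * kerMass) * (jb ν ^ (-1 : ℝ) * Q.maj A B (k, ν)) := by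
          gcongr with ν
          rw [lintegral_mul_const _ (h.measurable_theta_left ν).enorm, ← mul_assoc]
          gcongr
          · exact h.lintegral_theta_le ν
          · exact Q.enorm_prod_le A B _
      _ < ∞ := by
          rw [lintegral_const_mul _ (by fun_prop)]
          have h1 := Q.lintegral_maj_ne_top A B k
          have h2 := kerMass_ne_top
          exact lt_top_iff_ne_top.2 (by finiteness)
  rw [YSpace.ev_apply]
  simp only [duh, YSpace.mk_apply, ← integral_const_mul]
  rw [integral_integral_swap hint]
  refine integral_congr_ae (Eventually.of_forall fun ν => ?_)
  simp only [← mul_assoc]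
  rw [integral_mul_const, h.integral_theta]

/-- The values of `duh`, as convergent sums over the interacting modes. -/
theorem hasSum_ev_duh (h : IsKernel φ p C) {t : ℝ} (ht : φ t = 1) (k : ℤ) :
    HasSum (fun m => ∫ s in (0 : ℝ)..t, Q.c k m * (Complex.exp (Complex.I * Q.ω k m * s) *
        (YSpace.ev A s m * YSpace.ev B s (k - m)))) (YSpace.ev (Q.duh A B h) t k) := by
  have hmul := measurable_duhMul (φ := φ) t
  have hmeas : ∀ m, Measurable fun ν => duhMul φ t ν * (Q.c k m * Q.mode A B k m ν) :=
    fun m => by fun_prop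
  have hfin := Q.lintegral_duhMul_maj_ne_top A B h t k
  have hi : ∀ m, Integrable fun ν => duhMul φ t ν * (Q.c k m * Q.mode A B k m ν) := fun m =>
    ⟨(hmeas m).aestronglyMeasurable, by
      rw [hasFiniteIntegral_iff_enorm]
      exact lt_top_iff_ne_top.2 (ENNReal.ne_top_of_tsum_ne_top hfin m)⟩
  have hs : Summable fun m => ∫ ν : ℝ, ‖duhMul φ t ν * (Q.c k m * Q.mode A B k m ν)‖ := by
    refine (ENNReal.summable_toReal hfin).congr fun m => ?_
    rw [integral_norm_eq_lintegral_enorm (hi m).aestronglyMeasurable]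
  have h1 := hasSum_integral_of_summable_integral_norm hi hs
  simp only [Q.integral_duhMul_mode A B ht] at h1
  have h2 : ∫ ν : ℝ, duhMul φ t ν * Q.prod A B (k, ν) =
      ∫ ν : ℝ, ∑' m, duhMul φ t ν * (Q.c k m * Q.mode A B k m ν) := by
    refine integral_congr_ae ?_
    filter_upwards [Q.ae_prod_eq A B k] with ν hν
    rw [hν, tsum_mul_left]
  rwa [Q.ev_duh A B h t k, h2]

/-- The values of `duh` depend on the values of its arguments between `0` and `t` only. -/
theorem ev_duh_congr (h : IsKernel φ p C) {t : ℝ} (ht : φ t = 1) {A' B' : YSpace}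
    (hA : ∀ s ∈ Set.uIcc 0 t, YSpace.ev A s = YSpace.ev A' s)
    (hB : ∀ s ∈ Set.uIcc 0 t, YSpace.ev B s = YSpace.ev B' s) :
    YSpace.ev (Q.duh A B h) t = YSpace.ev (Q.duh A' B' h) t := by
  ext k
  refine HasSum.unique (Q.hasSum_ev_duh A B h ht k) ?_
  have h1 := Q.hasSum_ev_duh A' B' h ht k
  have h2 : (fun m => ∫ s in (0 : ℝ)..t, Q.c k m * (Complex.exp (Complex.I * Q.ω k m * s) *
        (YSpace.ev A s m * YSpace.ev B s (k - m)))) =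
      fun m => ∫ s in (0 : ℝ)..t, Q.c k m * (Complex.exp (Complex.I * Q.ω k m * s) *
        (YSpace.ev A' s m * YSpace.ev B' s (k - m))) := by
    funext m
    apply intervalIntegral.integral_congr
    intro s hs
    simp only [hA s hs, hB s hs]
  rwa [h2]

end Coupling

end Zakharov

end

noncomputable section

namespace Zakharov

/-! ### Reflections and projections -/

/-- The sequence of Fourier coefficients of the complex conjugate. -/
def L2.refl (x : L2) : L2 := toL2 (fun k => starRingEnd ℂ (x (-k))) (by
  have h : l2 Measure.count (fun k : ℤ => ‖starRingEnd ℂ (x (-k))‖ₑ) =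
      l2 Measure.count fun k => ‖x k‖ₑ := by
    unfold l2
    congr 1
    rw [lintegral_count, lintegral_count, ← (Equiv.neg ℤ).tsum_eq fun k => ‖x k‖ₑ ^ (2 : ℕ)]
    simp
  rw [h]; exact L2.l2_ne_top x)

@[simp] theorem L2.refl_apply (x : L2) (k : ℤ) : L2.refl x k = starRingEnd ℂ (x (-k)) := rfl

theorem L2.refl_sub (x y : L2) : L2.refl (x - y) = L2.refl x - L2.refl y := by
  ext k
  rw [lp.coeFn_sub, Pi.sub_apply, L2.refl_apply, L2.refl_apply, L2.refl_apply, lp.coeFn_sub,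
    Pi.sub_apply, map_sub]

theorem L2.norm_refl (x : L2) : ‖L2.refl x‖ = ‖x‖ := by
  have h : ‖L2.refl x‖ ^ 2 = ‖x‖ ^ 2 := by
    rw [L2.norm_sq, L2.norm_sq, ← (Equiv.neg ℤ).tsum_eq fun k => ‖x k‖ ^ 2]
    simp
  exact (pow_left_inj₀ (norm_nonneg _) (norm_nonneg _) two_ne_zero).1 h

theorem L2.continuous_refl : Continuous L2.refl := by
  refine (LipschitzWith.of_dist_le_mul (K := 1) fun x y => ?_).continuous
  rw [dist_eq_norm, dist_eq_norm, ← L2.refl_sub, L2.norm_refl]; simp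

theorem L2.continuous_apply {X : Type*} [TopologicalSpace X] {f : X → L2} (hf : Continuous f) (k : ℤ) :
    Continuous fun t => f t k := by
  have h : LipschitzWith 1 fun x : L2 => x k := LipschitzWith.of_dist_le_mul fun x y => by
    rw [dist_eq_norm, dist_eq_norm, ← Pi.sub_apply, ← lp.coeFn_sub]
    simpa using L2.norm_apply_le (x - y) k
  exact h.continuous.comp hf

theorem yn_refl (A : ℤ × ℝ → ℝ≥0∞) (hA : Measurable A) : yn (fun x => A (-x.1, -x.2)) = yn A := by
  have h1 : l2 mu (wt fun x => A (-x.1, -x.2)) = l2 mu (wt A) := by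
    unfold l2
    congr 1
    rw [lintegral_mu (by have : Measurable fun x : ℤ × ℝ => A (-x.1, -x.2) := by fun_prop
                         have := measurable_wt this; fun_prop), lintegral_mu (by fun_prop),
      ← (Equiv.neg ℤ).tsum_eq fun k => ∫⁻ τ : ℝ, wt A (k, τ) ^ 2]
    refine tsum_congr fun k => ?_
    rw [← lintegral_neg_eq_self (fun τ => wt A (_, τ) ^ 2)]
    simp [wt, jb_neg]
  have h2 : l2l1 (fun x => A (-x.1, -x.2)) = l2l1 A := by
    unfold l2l1 l2
    congr 1
    rw [lintegral_count, lintegral_count, ← (Equiv.neg ℤ).tsum_eq fun k => (∫⁻ τ : ℝ, A (k, τ)) ^ 2]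
    refine tsum_congr fun k => ?_
    simp only [Equiv.neg_apply]
    rw [← lintegral_neg_eq_self (fun τ => A (_, τ))]
  rw [yn, yn, h1, h2]

namespace YSpace

theorem yn_refl_eq (F : YSpace) :
    yn (fun x => ‖starRingEnd ℂ (F (-x.1, -x.2))‖ₑ) = yn fun x => ‖F x‖ₑ := by
  rw [← yn_refl (fun x => ‖F x‖ₑ) (by fun_prop)]
  simp [← ofReal_norm]

/-- The complex conjugate. -/
def refl (F : YSpace) : YSpace :=
  mk (fun x => starRingEnd ℂ (F (-x.1, -x.2)))
    (Complex.continuous_conj.measurable.comp (F.measurable.comp (by fun_prop)))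
    (by rw [yn_refl_eq]; exact F.yn_ne_top)

theorem norm_refl (F : YSpace) : ‖refl F‖ = ‖F‖ := congrArg ENNReal.toReal (yn_refl_eq F)

theorem refl_sub (F G : YSpace) : refl (F - G) = refl F - refl G := by
  apply Subtype.ext
  ext x
  exact map_sub _ _ _

theorem ev_refl (F : YSpace) (t : ℝ) : ev (refl F) t = L2.refl (ev F t) := by
  ext k
  rw [ev_apply, L2.refl_apply, ev_apply, ← integral_conj, ← integral_neg_eq_self]
  refine integral_congr_ae (Eventually.of_forall fun τ => ?_)
  simp only [refl, mk_apply, map_mul, ← Complex.exp_conj, Complex.conj_I, Complex.conj_ofReal, neg_neg]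
  congr 2
  push_cast; ring

/-- The projection to a finite set of frequencies. -/
def proj (S : Finset ℤ) (F : YSpace) : YSpace :=
  mk (fun x => if x.1 ∈ S then F x else 0)
    (measurable_mu fun k => by
      by_cases hk : k ∈ S
      · simp only [hk, if_true]; fun_prop
      · simp only [hk, if_false]; fun_prop)
    (ne_top_of_le_ne_top F.yn_ne_top (yn_mono fun x => by split_ifs <;> simp))

theorem proj_apply (S : Finset ℤ) (F : YSpace) (x : ℤ × ℝ) :
    proj S F x = if x.1 ∈ S then F x else 0 := rfl

theorem norm_proj_le (S : Finset ℤ) (F : YSpace) : ‖proj S F‖ ≤ ‖F‖ :=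
  ENNReal.toReal_mono F.yn_ne_top (yn_mono fun x => by
    simp only [proj_apply]; split_ifs <;> simp)

theorem proj_sub (S : Finset ℤ) (F G : YSpace) : proj S (F - G) = proj S F - proj S G := by
  apply Subtype.ext
  ext x
  change (if x.1 ∈ S then F x - G x else 0) =
    (if x.1 ∈ S then F x else 0) - (if x.1 ∈ S then G x else 0)
  split_ifs <;> simp

theorem ev_proj (S : Finset ℤ) (F : YSpace) (t : ℝ) (k : ℤ) :
    ev (proj S F) t k = if k ∈ S then ev F t k else 0 := by
  rw [ev_apply, ev_apply]
  simp only [proj_apply]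
  split_ifs <;> simp

/-- Both parts of the norm are square sums over the spatial frequency, and the squared norms of the
difference are the tails of convergent series. -/
theorem tendsto_proj (F : YSpace) : Tendsto (fun S => ‖F - proj S F‖) atTop (𝓝 0) := by
  have key : ∀ (f : ℤ → ℝ≥0∞) (S : Finset ℤ), (∑' k, if k ∈ S then 0 else f k) =
      ∑' k : {k // k ∉ S}, f k := by
    intro f S
    rw [show (∑' k : {k // k ∉ S}, f k) = ∑' k : ({k | k ∉ S} : Set ℤ), f k from rfl,
      tsum_subtype ({k | k ∉ S} : Set ℤ) f]
    refine tsum_congr fun k => ?_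
    by_cases hk : k ∈ S <;> simp [hk]
  have hsqrt : ∀ (g : Finset ℤ → ℝ≥0∞), Tendsto g atTop (𝓝 0) →
      Tendsto (fun S => g S ^ (1 / 2 : ℝ)) atTop (𝓝 0) := fun g hg => by
    have h1 := (ENNReal.continuous_rpow_const (y := 1 / 2)).tendsto 0
    rw [ENNReal.zero_rpow_of_pos (by norm_num)] at h1
    exact h1.comp hg
  have hdiff : ∀ (S : Finset ℤ) (x : ℤ × ℝ), ‖(F - proj S F) x‖ₑ = if x.1 ∈ S then 0 else ‖F x‖ₑ := by
    intro S x
    rw [sub_apply, proj_apply]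
    split_ifs <;> simp
  have h1 : Tendsto (fun S => l2 mu (wt fun x => ‖(F - proj S F) x‖ₑ)) atTop (𝓝 0) := by
    refine hsqrt _ ?_
    have hfin := ENNReal.pow_ne_top (n := 2) (ne_top_of_le_ne_top ENNReal.ofReal_ne_top F.l2_le)
    rw [l2_sq, lintegral_mu (by fun_prop)] at hfin
    refine (ENNReal.tendsto_tsum_compl_atTop_zero hfin).congr fun S => ?_
    rw [lintegral_mu (Measurable.pow_const (measurable_wt (by fun_prop)) 2)]
    refine (key (fun k => ∫⁻ τ : ℝ, wt (fun x => ‖F x‖ₑ) (k, τ) ^ 2) S).symm.trans ?_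
    refine tsum_congr fun k => ?_
    by_cases hk : k ∈ S
    · simp [wt, hdiff, hk]
    · simp [wt, hdiff, hk]
  have h2 : Tendsto (fun S => l2l1 (fun x => ‖(F - proj S F) x‖ₑ)) atTop (𝓝 0) := by
    refine hsqrt _ ?_
    have hfin := ENNReal.pow_ne_top (n := 2) (ne_top_of_le_ne_top ENNReal.ofReal_ne_top F.l2l1_le)
    rw [l2l1_sq] at hfin
    refine (ENNReal.tendsto_tsum_compl_atTop_zero hfin).congr fun S => ?_
    rw [lintegral_count]
    refine (key (fun k => (∫⁻ τ : ℝ, ‖F (k, τ)‖ₑ) ^ 2) S).symm.trans ?_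
    refine tsum_congr fun k => ?_
    by_cases hk : k ∈ S
    · simp [hdiff, hk]
    · simp [hdiff, hk]
  have h3 : Tendsto (fun S => yn (fun x => ‖(F - proj S F) x‖ₑ)) atTop (𝓝 0) := by
    have := h1.add h2
    rwa [add_zero] at this
  exact (ENNReal.tendsto_toReal ENNReal.zero_ne_top).comp h3

end YSpace

end Zakharov

end

noncomputable section

namespace Zakharov

/-! ### Cutoffs -/

theorem exists_cutoff_of_contDiff {χ : ℝ → ℝ} (h : ContDiff ℝ (⊤ : ℕ∞) χ) (a b : ℝ) :
    ∃ φ p C, IsKernel φ p C ∧ ∀ t ∈ Set.Icc a b, φ t = χ t := by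
  let f : ContDiffBump ((a + b) / 2 : ℝ) :=
    { rIn := |b - a| / 2 + 1, rOut := |b - a| / 2 + 2, rIn_pos := by positivity, rIn_lt_rOut := by linarith }
  have hc : ContDiff ℝ (⊤ : ℕ∞) fun t => ((f t * χ t : ℝ) : ℂ) :=
    Complex.ofRealCLM.contDiff.comp (f.contDiff.mul h)
  have hs : HasCompactSupport fun t => ((f t * χ t : ℝ) : ℂ) := by
    have h1 : HasCompactSupport fun t => f t * χ t := f.hasCompactSupport.mul_right
    exact h1.comp_left (g := fun x : ℝ => (x : ℂ)) (by simp)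
  obtain ⟨p, C, hp⟩ := exists_isKernel_of_contDiff hc hs
  refine ⟨_, p, C, hp, fun t ht => ?_⟩
  have : f t = 1 := by
    apply f.one_of_mem_closedBall
    rw [Metric.mem_closedBall, Real.dist_eq, abs_le]
    have h1 := le_abs_self (b - a)
    constructor <;> simp only [f] <;> linarith [ht.1, ht.2]
  rw [this, one_mul]

theorem exists_cutoff : ∃ φ p C, IsKernel φ p C ∧ ∀ t ∈ Set.Icc (-1 : ℝ) 1, φ t = 1 := by
  simpa using exists_cutoff_of_contDiff (χ := fun _ => 1) contDiff_const (-1) 1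

theorem exists_linear_cutoff : ∃ φ p C, IsKernel φ p C ∧ ∀ t ∈ Set.Icc (-1 : ℝ) 1, φ t = t :=
  exists_cutoff_of_contDiff (χ := fun t => t) contDiff_id (-1) 1

/-- A cutoff, its Fourier kernel and the corresponding constant. -/
def cutFun : ℝ → ℂ := exists_cutoff.choose
/-- The kernel of `cutFun`. -/
def cutKer : ℝ → ℂ := exists_cutoff.choose_spec.choose
/-- The constant of `cutFun`. -/
def cutC : ℝ := exists_cutoff.choose_spec.choose_spec.choose
theorem isKernel_cut : IsKernel cutFun cutKer cutC :=
  exists_cutoff.choose_spec.choose_spec.choose_spec.1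
theorem cutFun_eq {t : ℝ} (ht : t ∈ Set.Icc (-1 : ℝ) 1) : cutFun t = 1 :=
  exists_cutoff.choose_spec.choose_spec.choose_spec.2 t ht

/-- The product of a cutoff with the time variable, its Fourier kernel and the corresponding
constant. -/
def linFun : ℝ → ℂ := exists_linear_cutoff.choose
/-- The kernel of `linFun`. -/
def linKer : ℝ → ℂ := exists_linear_cutoff.choose_spec.choose
/-- The constant of `linFun`. -/
def linC : ℝ := exists_linear_cutoff.choose_spec.choose_spec.choose
theorem isKernel_lin : IsKernel linFun linKer linC :=
  exists_linear_cutoff.choose_spec.choose_spec.choose_spec.1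
theorem linFun_eq {t : ℝ} (ht : t ∈ Set.Icc (-1 : ℝ) 1) : linFun t = t :=
  exists_linear_cutoff.choose_spec.choose_spec.choose_spec.2 t ht

/-- The constant in the bilinear estimate for the fixed cutoff. -/
def bilC : ℝ := cutC * duhC

theorem bilC_nonneg : 0 ≤ bilC := mul_nonneg isKernel_cut.nonneg duhC_nonneg

/-! ### Contractions of `Y` -/

/-- Picard iteration from `0`. The increments halve at each step, so `YSpace.exists_limit` applies.
Because the norm is a seminorm, the fixed point is obtained up to norm zero. -/
theorem YSpace.exists_fixed_point (Φ : YSpace → YSpace) {r : ℝ} (hr : 0 ≤ r)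
    (hmaps : ∀ F, ‖F‖ ≤ r → ‖Φ F‖ ≤ r)
    (hlip : ∀ F F', ‖F‖ ≤ r → ‖F'‖ ≤ r → ‖Φ F - Φ F'‖ ≤ 1 / 2 * ‖F - F'‖) :
    ∃ F, ‖F‖ ≤ r ∧ ‖F - Φ F‖ = 0 := by
  let u : ℕ → YSpace := fun n => Φ^[n] 0
  have hu : ∀ n, u (n + 1) = Φ (u n) := fun n => Function.iterate_succ_apply' Φ n 0
  have hur : ∀ n, ‖u n‖ ≤ r := by
    intro n
    induction n with
    | zero => simpa [u] using hr
    | succ n ih => rw [hu]; exact hmaps _ ih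
  have hd : ∀ n, ‖u (n + 1) - u n‖ ≤ ‖u 1 - u 0‖ * (1 / 2) ^ n := by
    intro n
    induction n with
    | zero => simp
    | succ n ih =>
      rw [hu (n + 1), hu n]
      refine (hlip _ _ (hu n ▸ hur (n + 1)) (hur n)).trans ?_
      rw [← hu n, pow_succ]; linarith
  obtain ⟨G, hG⟩ := YSpace.exists_limit u (norm_nonneg _) hd
  have hlim : Tendsto (fun n : ℕ => 2 * ‖u 1 - u 0‖ * (1 / 2) ^ n) atTop (𝓝 0) := by
    simpa using (tendsto_pow_atTop_nhds_zero_of_lt_one (by norm_num : (0 : ℝ) ≤ 1 / 2)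
      (by norm_num)).const_mul (2 * ‖u 1 - u 0‖)
  have hGr : ‖G‖ ≤ r := by
    have hlim2 := hlim.add_const r
    rw [zero_add] at hlim2
    refine ge_of_tendsto' hlim2 fun n => ?_
    calc ‖G‖ = ‖(G - u n) + u n‖ := by rw [sub_add_cancel]
      _ ≤ _ := (norm_add_le _ _).trans (add_le_add (hG n) (hur n))
  refine ⟨G, hGr, le_antisymm ?_ (norm_nonneg _)⟩
  have hlim2 := hlim.mul_const 2
  rw [zero_mul] at hlim2
  refine ge_of_tendsto' hlim2 fun n => ?_
  have h1 : G - Φ G = (G - u (n + 1)) + (Φ (u n) - Φ G) := by rw [hu]; abel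
  rw [h1]
  refine (norm_add_le _ _).trans ?_
  have h2 := hlip (u n) G (hur n) hGr
  rw [norm_sub_rev (u n) G] at h2
  have h3 := hG n
  have h4 := hG (n + 1)
  have h5 : 0 ≤ ‖u 1 - u 0‖ * (1 / 2) ^ n := by positivity
  rw [pow_succ] at h4
  nlinarith

/-! ### The system on a unit time interval -/

/-- A rescaled version of the system in interaction variables. -/
structure LocalSystem where
  /-- The interaction of the Schrödinger part with the wave part. -/
  Q₁ : Coupling
  /-- The interaction of the Schrödinger part with the conjugate wave part. -/
  Q₂ : Coupling
  /-- The interaction of the Schrödinger part with its conjugate. -/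
  Q₃ : Coupling
  /-- The strength. -/
  ε : ℝ
  h₁ : Q₁.ε = ε
  h₂ : Q₂.ε = ε
  h₃ : Q₃.ε = ε
  conj_c : ∀ k m, starRingEnd ℂ (Q₁.c k m) = -Q₂.c m k
  ω_symm : ∀ k m, Q₂.ω m k = -Q₁.ω k m

namespace LocalSystem

variable (S : LocalSystem)

theorem ε_nonneg : 0 ≤ S.ε := S.h₁ ▸ S.Q₁.nonneg

/-- The size of the bilinear operators. -/
def κ : ℝ := bilC * S.ε

theorem κ_nonneg : 0 ≤ S.κ := mul_nonneg bilC_nonneg S.ε_nonneg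

/-- The bilinear operator in the Schrödinger equation. -/
def D (F G : YSpace) : YSpace :=
  S.Q₁.duh F G isKernel_cut + S.Q₂.duh F (YSpace.refl G) isKernel_cut

/-- The bilinear operator in the wave equation. -/
def E (F F' : YSpace) : YSpace := S.Q₃.duh (YSpace.refl F) F' isKernel_cut

theorem D_sub (F G F' G' : YSpace) : S.D F G - S.D F' G' = S.D (F - F') G + S.D F' (G - G') := by
  have h1 := S.Q₁.duh_sub F G F' G' isKernel_cut
  have h2 := S.Q₂.duh_sub F (YSpace.refl G) F' (YSpace.refl G') isKernel_cut
  rw [D, D, D, D, YSpace.refl_sub, add_sub_add_comm, h1, h2]; abel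

theorem E_sub (F G F' G' : YSpace) : S.E F G - S.E F' G' = S.E (F - F') G + S.E F' (G - G') := by
  have h1 := S.Q₃.duh_sub (YSpace.refl F) G (YSpace.refl F') G' isKernel_cut
  rw [E, E, E, E, h1, YSpace.refl_sub]

theorem norm_D_le (F G : YSpace) : ‖S.D F G‖ ≤ 2 * S.κ * (‖F‖ * ‖G‖) := by
  have h1 := S.Q₁.norm_duh_le F G isKernel_cut
  have h2 := S.Q₂.norm_duh_le F (YSpace.refl G) isKernel_cut
  rw [YSpace.norm_refl, S.h₂] at h2
  rw [S.h₁] at h1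
  rw [D, κ, bilC]
  refine (norm_add_le _ _).trans ?_
  linarith

theorem norm_E_le (F G : YSpace) : ‖S.E F G‖ ≤ S.κ * (‖F‖ * ‖G‖) := by
  have h1 := S.Q₃.norm_duh_le (YSpace.refl F) G isKernel_cut
  rw [YSpace.norm_refl, S.h₃] at h1
  exact h1

theorem norm_D_sub_le (F G F' G' : YSpace) :
    ‖S.D F G - S.D F' G'‖ ≤ 2 * S.κ * (‖F - F'‖ * ‖G‖ + ‖F'‖ * ‖G - G'‖) := by
  rw [D_sub, mul_add]
  exact (norm_add_le _ _).trans (add_le_add (S.norm_D_le _ _) (S.norm_D_le _ _))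

theorem norm_E_sub_le (F G F' G' : YSpace) :
    ‖S.E F G - S.E F' G'‖ ≤ S.κ * (‖F - F'‖ * ‖G‖ + ‖F'‖ * ‖G - G'‖) := by
  rw [E_sub, mul_add]
  exact (norm_add_le _ _).trans (add_le_add (S.norm_E_le _ _) (S.norm_E_le _ _))

/-- `(F, G)` solves the system with inhomogeneities `a`, `b`. -/
structure IsFixed (a b F G : YSpace) : Prop where
  schr : ‖F - (a + S.D F G)‖ = 0
  wave : ‖G - (b + S.E F F)‖ = 0

variable {S} {R : ℝ}

/-- The wave equation gives `G` explicitly in terms of `F`. Eliminating `G` leaves a cubic fixed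
point problem for `F` alone on the ball of radius `2R`. -/
theorem exists_isFixed (hR : 0 ≤ R) (hκ : 16 * S.κ * R ≤ 1) {a b : YSpace} (ha : ‖a‖ ≤ R)
    (hb : ‖b‖ ≤ R) : ∃ F G, ‖F‖ ≤ 2 * R ∧ ‖G‖ ≤ 2 * R ∧ S.IsFixed a b F G := by
  have hk := S.κ_nonneg
  have hkR : 0 ≤ S.κ * R := by positivity
  have hG : ∀ F, ‖F‖ ≤ 2 * R → ‖b + S.E F F‖ ≤ 2 * R := by
    intro F hF
    calc _ ≤ ‖b‖ + ‖S.E F F‖ := norm_add_le _ _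
      _ ≤ R + S.κ * ((2 * R) * (2 * R)) := by
          refine add_le_add hb ((S.norm_E_le F F).trans ?_); gcongr
      _ ≤ 2 * R := by nlinarith
  obtain ⟨F, hF, hfix⟩ := YSpace.exists_fixed_point (fun F => a + S.D F (b + S.E F F))
    (r := 2 * R) (by positivity) (fun F hF => by
      calc _ ≤ ‖a‖ + ‖S.D F (b + S.E F F)‖ := norm_add_le _ _
        _ ≤ R + 2 * S.κ * ((2 * R) * (2 * R)) := by
            refine add_le_add ha ((S.norm_D_le _ _).trans ?_); gcongr; exact hG F hF
        _ ≤ 2 * R := by nlinarith)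
    (fun F F' hF hF' => by
      have h1 : ‖(b + S.E F F) - (b + S.E F' F')‖ ≤ S.κ * (4 * R) * ‖F - F'‖ := by
        rw [add_sub_add_left_eq_sub]
        refine (S.norm_E_sub_le _ _ _ _).trans ?_
        calc _ ≤ S.κ * (‖F - F'‖ * (2 * R) + (2 * R) * ‖F - F'‖) := by gcongr
          _ = _ := by ring
      rw [add_sub_add_left_eq_sub]
      refine (S.norm_D_sub_le _ _ _ _).trans ?_
      calc _ ≤ 2 * S.κ * (‖F - F'‖ * (2 * R) + (2 * R) * (S.κ * (4 * R) * ‖F - F'‖)) := by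
            gcongr; exact hG F hF
        _ = 4 * (S.κ * R) * (1 + 4 * (S.κ * R)) * ‖F - F'‖ := by ring
        _ ≤ 1 / 2 * ‖F - F'‖ := by
            gcongr
            nlinarith)
  exact ⟨F, b + S.E F F, hF, hG F hF, hfix, by simp⟩

/-- The Schrödinger equation is linear in `F`, with the bilinear term at most `‖F‖/4`, so it is
absorbed. The bound contains only `a`, which makes the growth of the wave part depend on the
conserved norm alone. -/
theorem IsFixed.norm_schr_le {a b F G : YSpace} (h : S.IsFixed a b F G) (hκ : 16 * S.κ * R ≤ 1)
    (hG : ‖G‖ ≤ 2 * R) : ‖F‖ ≤ 2 * ‖a‖ := by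
  have h1 : ‖F‖ ≤ ‖F - (a + S.D F G)‖ + (‖a‖ + ‖S.D F G‖) := by
    calc ‖F‖ = ‖(F - (a + S.D F G)) + (a + S.D F G)‖ := by rw [sub_add_cancel]
      _ ≤ _ := (norm_add_le _ _).trans (add_le_add le_rfl (norm_add_le _ _))
  rw [h.schr] at h1
  have h2 := S.norm_D_le F G
  have h3 : 2 * S.κ * (‖F‖ * ‖G‖) ≤ 2 * S.κ * (‖F‖ * (2 * R)) := by
    have := S.κ_nonneg; gcongr
  nlinarith [norm_nonneg F, norm_nonneg a]

/-- Lipschitz dependence on the inhomogeneities. -/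
theorem IsFixed.norm_sub_le {a b F G a' b' F' G' : YSpace} (h : S.IsFixed a b F G)
    (h' : S.IsFixed a' b' F' G') (hκ : 16 * S.κ * R ≤ 1) (hF : ‖F‖ ≤ 2 * R) (hG : ‖G‖ ≤ 2 * R)
    (hF' : ‖F'‖ ≤ 2 * R) :
    ‖F - F'‖ + ‖G - G'‖ ≤ 2 * (‖a - a'‖ + ‖b - b'‖) := by
  have hk := S.κ_nonneg
  have h1 : ‖F - F'‖ ≤ ‖a - a'‖ + ‖S.D F G - S.D F' G'‖ := by
    have e : F - F' = (F - (a + S.D F G)) - (F' - (a' + S.D F' G')) +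
        ((a - a') + (S.D F G - S.D F' G')) := by abel
    rw [e]
    refine (norm_add_le _ _).trans ?_
    have := _root_.norm_sub_le (F - (a + S.D F G)) (F' - (a' + S.D F' G'))
    rw [h.schr, h'.schr] at this
    linarith [norm_add_le (a - a') (S.D F G - S.D F' G')]
  have h2 : ‖G - G'‖ ≤ ‖b - b'‖ + ‖S.E F F - S.E F' F'‖ := by
    have e : G - G' = (G - (b + S.E F F)) - (G' - (b' + S.E F' F')) +
        ((b - b') + (S.E F F - S.E F' F')) := by abel
    rw [e]
    refine (norm_add_le _ _).trans ?_
    have := _root_.norm_sub_le (G - (b + S.E F F)) (G' - (b' + S.E F' F'))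
    rw [h.wave, h'.wave] at this
    linarith [norm_add_le (b - b') (S.E F F - S.E F' F')]
  have h3 : ‖S.D F G - S.D F' G'‖ ≤ 2 * S.κ * (‖F - F'‖ * (2 * R) + (2 * R) * ‖G - G'‖) :=
    (S.norm_D_sub_le _ _ _ _).trans (by gcongr)
  have h4 : ‖S.E F F - S.E F' F'‖ ≤ S.κ * (‖F - F'‖ * (2 * R) + (2 * R) * ‖F - F'‖) :=
    (S.norm_E_sub_le _ _ _ _).trans (by gcongr)
  nlinarith [norm_nonneg (F - F'), norm_nonneg (G - G')]

/-- Two solutions on a time interval with the same initial values coincide. -/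
theorem norm_ev_sub_halving {I : Set ℝ} {A A' B B' : YSpace}
    (hκ : 16 * S.κ * R ≤ 1) (hA : ‖A‖ ≤ 2 * R) (hA' : ‖A'‖ ≤ 2 * R)
    (hB : ‖B‖ ≤ 2 * R)
    (hI : ∀ t ∈ I, Set.uIcc 0 t ⊆ I) (hI1 : I ⊆ Set.Icc (-1) 1)
    (hf : ∀ t ∈ I, YSpace.ev A t - YSpace.ev A' t = YSpace.ev (S.D A B) t - YSpace.ev (S.D A' B') t)
    (hg : ∀ t ∈ I, YSpace.ev B t - YSpace.ev B' t = YSpace.ev (S.E A A) t - YSpace.ev (S.E A' A') t) :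
    ∀ t ∈ I, YSpace.ev A t = YSpace.ev A' t ∧ YSpace.ev B t = YSpace.ev B' t := by
  have hk := S.κ_nonneg
  -- The differences have many extensions from `I` to `Y`. Inserting one pair of extensions in the
  -- right-hand side of the equations gives another pair, because the Duhamel terms depend only on
  -- values in `I`, with total norm at most half as large. The supremum over `I` of the difference
  -- is thus below every `2^{-n}` multiple of the initial norm.
  have key : ∀ n : ℕ, ∃ W V : YSpace, (∀ t ∈ I, YSpace.ev W t = YSpace.ev A t - YSpace.ev A' t) ∧
      (∀ t ∈ I, YSpace.ev V t = YSpace.ev B t - YSpace.ev B' t) ∧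
      ‖W‖ + ‖V‖ ≤ (1 / 2) ^ n * (‖A - A'‖ + ‖B - B'‖) := by
    intro n
    induction n with
    | zero => exact ⟨A - A', B - B', fun t _ => YSpace.ev_sub _ _ _, fun t _ => YSpace.ev_sub _ _ _, by simp⟩
    | succ n ih =>
      obtain ⟨W, V, hW, hV, hn⟩ := ih
      refine ⟨S.D W B + S.D A' V, S.E W A + S.E A' W, fun t ht => ?_, fun t ht => ?_, ?_⟩
      · rw [hf t ht, ← YSpace.ev_sub, D_sub, YSpace.ev_add, YSpace.ev_add]
        have hW' : ∀ s ∈ Set.uIcc 0 t, YSpace.ev W s = YSpace.ev (A - A') s := fun s hs => by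
          rw [YSpace.ev_sub]; exact hW s (hI t ht hs)
        have hV' : ∀ s ∈ Set.uIcc 0 t, YSpace.ev V s = YSpace.ev (B - B') s := fun s hs => by
          rw [YSpace.ev_sub]; exact hV s (hI t ht hs)
        have hV'' : ∀ s ∈ Set.uIcc 0 t,
            YSpace.ev (YSpace.refl V) s = YSpace.ev (YSpace.refl (B - B')) s := fun s hs => by
          rw [YSpace.ev_refl, YSpace.ev_refl, hV' s hs]
        have h1 := cutFun_eq (hI1 ht)
        simp only [D, YSpace.ev_add]
        rw [S.Q₁.ev_duh_congr W B isKernel_cut h1 hW' (fun _ _ => rfl),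
          S.Q₂.ev_duh_congr W (YSpace.refl B) isKernel_cut h1 hW' (fun _ _ => rfl),
          S.Q₁.ev_duh_congr A' V isKernel_cut h1 (fun _ _ => rfl) hV',
          S.Q₂.ev_duh_congr A' (YSpace.refl V) isKernel_cut h1 (fun _ _ => rfl) hV'']
      · rw [hg t ht, ← YSpace.ev_sub, E_sub, YSpace.ev_add, YSpace.ev_add]
        have hW' : ∀ s ∈ Set.uIcc 0 t, YSpace.ev W s = YSpace.ev (A - A') s := fun s hs => by
          rw [YSpace.ev_sub]; exact hW s (hI t ht hs)
        have hW'' : ∀ s ∈ Set.uIcc 0 t,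
            YSpace.ev (YSpace.refl W) s = YSpace.ev (YSpace.refl (A - A')) s := fun s hs => by
          rw [YSpace.ev_refl, YSpace.ev_refl, hW' s hs]
        have h1 := cutFun_eq (hI1 ht)
        simp only [E]
        rw [S.Q₃.ev_duh_congr (YSpace.refl W) A isKernel_cut h1 hW'' (fun _ _ => rfl),
          S.Q₃.ev_duh_congr (YSpace.refl A') W isKernel_cut h1 (fun _ _ => rfl) hW']
      · have e1 : ‖S.D W B + S.D A' V‖ ≤ 2 * S.κ * (‖W‖ * (2 * R)) + 2 * S.κ * ((2 * R) * ‖V‖) :=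
          (norm_add_le _ _).trans (add_le_add ((S.norm_D_le _ _).trans (by gcongr))
            ((S.norm_D_le _ _).trans (by gcongr)))
        have e2 : ‖S.E W A + S.E A' W‖ ≤ S.κ * (‖W‖ * (2 * R)) + S.κ * ((2 * R) * ‖W‖) :=
          (norm_add_le _ _).trans (add_le_add ((S.norm_E_le _ _).trans (by gcongr))
            ((S.norm_E_le _ _).trans (by gcongr)))
        rw [pow_succ]
        nlinarith [norm_nonneg W, norm_nonneg V]
  intro t ht
  have hlim : Tendsto (fun n : ℕ => (1 / 2 : ℝ) ^ n * (‖A - A'‖ + ‖B - B'‖)) atTop (𝓝 0) := by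
    simpa using (tendsto_pow_atTop_nhds_zero_of_lt_one (by norm_num : (0 : ℝ) ≤ 1 / 2)
      (by norm_num)).mul_const (‖A - A'‖ + ‖B - B'‖)
  constructor
  · rw [← sub_eq_zero, ← norm_le_zero_iff]
    refine ge_of_tendsto' hlim fun n => ?_
    obtain ⟨W, V, hW, hV, hn⟩ := key n
    rw [← hW t ht]
    linarith [YSpace.norm_ev_le W t, norm_nonneg V]
  · rw [← sub_eq_zero, ← norm_le_zero_iff]
    refine ge_of_tendsto' hlim fun n => ?_
    obtain ⟨W, V, hW, hV, hn⟩ := key n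
    rw [← hV t ht]
    linarith [YSpace.norm_ev_le V t, norm_nonneg W]

end LocalSystem

end Zakharov

end

/-! ### Conservation of the `L²` norm by frequency truncation -/

noncomputable section

namespace Zakharov

/-- The integrand of an oscillatory interaction. -/
def osc (c : ℤ → ℤ → ℂ) (ω : ℤ → ℤ → ℝ) (f g : ℝ → L2) (k m : ℤ) (s : ℝ) : ℂ :=
  c k m * (Complex.exp (Complex.I * ω k m * s) * (f s m * g s (k - m)))

theorem continuousOn_osc {c : ℤ → ℤ → ℂ} {ω : ℤ → ℤ → ℝ} {f g : ℝ → L2} {I : Set ℝ}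
    (hf : ContinuousOn f I) (hg : ContinuousOn g I) (k m : ℤ) :
    ContinuousOn (osc c ω f g k m) I := by
  have h1 : ContinuousOn (fun s => f s m) I :=
    (L2.continuous_apply continuous_id m).comp_continuousOn hf
  have h2 : ContinuousOn (fun s => g s (k - m)) I :=
    (L2.continuous_apply continuous_id (k - m)).comp_continuousOn hg
  unfold osc
  exact continuousOn_const.mul (ContinuousOn.mul (by fun_prop) (h1.mul h2))

theorem continuous_osc {c : ℤ → ℤ → ℂ} {ω : ℤ → ℤ → ℝ} {f g : ℝ → L2}
    (hf : Continuous f) (hg : Continuous g) (k m : ℤ) : Continuous (osc c ω f g k m) := by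
  rw [← continuousOn_univ] at *
  exact continuousOn_osc hf hg k m

namespace LocalSystem

variable {S : LocalSystem} {R : ℝ}

theorem hasSum_ev_D (S : LocalSystem) (F G : YSpace) {t : ℝ} (ht : t ∈ Set.Icc (-1 : ℝ) 1) (k : ℤ) :
    HasSum (fun m => (∫ s in (0 : ℝ)..t, osc S.Q₁.c S.Q₁.ω (YSpace.ev F) (YSpace.ev G) k m s) +
      ∫ s in (0 : ℝ)..t, osc S.Q₂.c S.Q₂.ω (YSpace.ev F) (fun r => L2.refl (YSpace.ev G r)) k m s)
      (YSpace.ev (S.D F G) t k) := by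
  have h1 := S.Q₁.hasSum_ev_duh F G isKernel_cut (cutFun_eq ht) k
  have h2 := S.Q₂.hasSum_ev_duh F (YSpace.refl G) isKernel_cut (cutFun_eq ht) k
  simp only [YSpace.ev_refl] at h2
  have h3 := h1.add h2
  rw [D, YSpace.ev_add, lp.coeFn_add, Pi.add_apply]
  exact h3

theorem hasSum_ev_E (S : LocalSystem) (F F' : YSpace) {t : ℝ} (ht : t ∈ Set.Icc (-1 : ℝ) 1) (k : ℤ) :
    HasSum (fun m => ∫ s in (0 : ℝ)..t,
      osc S.Q₃.c S.Q₃.ω (fun r => L2.refl (YSpace.ev F r)) (YSpace.ev F') k m s)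
      (YSpace.ev (S.E F F') t k) := by
  have h1 := S.Q₃.hasSum_ev_duh (YSpace.refl F) F' isKernel_cut (cutFun_eq ht) k
  simp only [YSpace.ev_refl] at h1
  exact h1

/-- The density is real, so the interaction matrix acting on `f` is antihermitian. By `conj_c` and
`ω_symm`, conjugation and exchange of `k` and `m` turn the terms of `Q₁` into minus those of `Q₂`
and conversely. -/
theorem antihermitian_form (S : LocalSystem) (T : Finset ℤ) (f g : ℝ → L2) (s : ℝ) :
    (∑ k ∈ T, starRingEnd ℂ (f s k) * ∑ m ∈ T, (osc S.Q₁.c S.Q₁.ω f g k m s +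
      osc S.Q₂.c S.Q₂.ω f (fun r => L2.refl (g r)) k m s)).re = 0 := by
  set X := ∑ k ∈ T, starRingEnd ℂ (f s k) * ∑ m ∈ T, (osc S.Q₁.c S.Q₁.ω f g k m s +
      osc S.Q₂.c S.Q₂.ω f (fun r => L2.refl (g r)) k m s) with hX
  have hc2 : ∀ k m, starRingEnd ℂ (S.Q₂.c k m) = -S.Q₁.c m k := fun k m => by
    have := congrArg (starRingEnd ℂ) (S.conj_c m k)
    rw [Complex.conj_conj, map_neg] at this
    rw [this, neg_neg]
  have hexp : ∀ a : ℝ, starRingEnd ℂ (Complex.exp (Complex.I * a * s)) =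
      Complex.exp (Complex.I * ((-a : ℝ) : ℂ) * s) := fun a => by
    rw [← Complex.exp_conj]
    congr 1
    simp
  have h : starRingEnd ℂ X = -X := by
    rw [hX]
    simp only [map_sum, map_mul, Complex.conj_conj, Finset.mul_sum, map_add]
    rw [Finset.sum_comm, ← Finset.sum_neg_distrib]
    refine Finset.sum_congr rfl fun m _ => ?_
    rw [← Finset.sum_neg_distrib]
    refine Finset.sum_congr rfl fun k _ => ?_
    simp only [osc, map_mul, L2.refl_apply, S.conj_c, hc2, hexp, ← S.ω_symm, Complex.conj_conj, neg_sub]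
    rw [show -S.Q₂.ω k m = S.Q₁.ω m k by rw [S.ω_symm]; ring]
    ring
  have := congrArg Complex.re h
  rw [Complex.conj_re, Complex.neg_re] at this
  linarith

/-- The modes in `T` solve a finite linear system of ordinary differential equations with
antihermitian matrix, and the other modes are constant. -/
theorem norm_eq_of_finite_system (S : LocalSystem) (T : Finset ℤ) {f g : ℝ → L2}
    (hf : Continuous f) (hg : Continuous g) (x : L2)
    (hx : ∀ t ∈ Set.Icc (-1 : ℝ) 1, ∀ k ∉ T, f t k = x k)
    (hT : ∀ t ∈ Set.Icc (-1 : ℝ) 1, ∀ k ∈ T, f t k = x k + ∫ s in (0 : ℝ)..t, ∑ m ∈ T,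
      (osc S.Q₁.c S.Q₁.ω f g k m s + osc S.Q₂.c S.Q₂.ω f (fun r => L2.refl (g r)) k m s)) :
    ∀ t ∈ Set.Icc (-1 : ℝ) 1, ‖f t‖ = ‖x‖ := by
  set A : ℤ → ℝ → ℂ := fun k s => ∑ m ∈ T,
      (osc S.Q₁.c S.Q₁.ω f g k m s + osc S.Q₂.c S.Q₂.ω f (fun r => L2.refl (g r)) k m s) with hA
  have hAc : ∀ k, Continuous (A k) := fun k => continuous_finsetSum _ fun m _ =>
    (continuous_osc hf hg k m).add (continuous_osc hf (L2.continuous_refl.comp hg) k m)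
  set q : ℝ → ℝ := fun t => ∑ k ∈ T, ‖f t k‖ ^ 2 with hq
  have hderiv : ∀ t ∈ Set.Icc (-1 : ℝ) 1, HasDerivWithinAt q 0 (Set.Icc (-1) 1) t := by
    intro t ht
    have h1 : ∀ k ∈ T, HasDerivWithinAt (fun t => f t k) (A k t) (Set.Icc (-1) 1) t := by
      intro k hk
      have h2 : HasDerivAt (fun t => x k + ∫ s in (0 : ℝ)..t, A k s) (A k t) t :=
        (intervalIntegral.integral_hasDerivAt_right ((hAc k).intervalIntegrable _ _)
          (hAc k).stronglyMeasurable.stronglyMeasurableAtFilter (hAc k).continuousAt).const_add _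
      exact h2.hasDerivWithinAt.congr (fun s hs => hT s hs k hk) (hT t ht k hk)
    have h2 : HasDerivWithinAt q (∑ k ∈ T, 2 * inner ℝ (f t k) (A k t)) (Set.Icc (-1) 1) t :=
      HasDerivWithinAt.fun_sum fun k hk => (h1 k hk).norm_sq
    have h3 : ∑ k ∈ T, 2 * inner ℝ (f t k) (A k t) = 0 := by
      have h4 := S.antihermitian_form T f g t
      rw [Complex.re_sum] at h4
      rw [← Finset.mul_sum]
      have : ∀ k, inner ℝ (f t k) (A k t) = (starRingEnd ℂ (f t k) * A k t).re := fun k => by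
        rw [Complex.inner, mul_comm]
      simp only [this]
      rw [h4, mul_zero]
    rwa [h3] at h2
  have hconst : ∀ t ∈ Set.Icc (-1 : ℝ) 1, q t = q 0 := by
    intro t ht
    have h0 : (0 : ℝ) ∈ Set.Icc (-1 : ℝ) 1 := by simp
    have := (convex_Icc (-1 : ℝ) 1).norm_image_sub_le_of_norm_hasDerivWithin_le
      (C := 0) hderiv (fun s _ => by simp) h0 ht
    rw [zero_mul] at this
    exact sub_eq_zero.1 (norm_le_zero_iff.1 this)
  intro t ht
  have h0 : (0 : ℝ) ∈ Set.Icc (-1 : ℝ) 1 := by simp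
  have hq0 : q 0 = ∑ k ∈ T, ‖x k‖ ^ 2 := by
    refine Finset.sum_congr rfl fun k hk => ?_
    rw [hT 0 h0 k hk]; simp
  have h1 : ‖f t‖ ^ 2 - ‖x‖ ^ 2 = 0 := by
    rw [L2.norm_sq, L2.norm_sq, ← (L2.summable_sq _).tsum_sub (L2.summable_sq _),
      tsum_eq_sum (s := T) fun k hk => by rw [hx t ht k hk]; ring, Finset.sum_sub_distrib, ← hq0,
      ← hconst t ht, sub_self]
  exact (pow_left_inj₀ (norm_nonneg _) (norm_nonneg _) two_ne_zero).1 (by linarith)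

/-- For fixed `G` the equation is linear in `F`, so truncating `F` before and after the operator
keeps both the contraction and the antihermitian structure. No truncation of `G` is needed. -/
theorem exists_galerkin (hκ : 16 * S.κ * R ≤ 1) (a : YSpace) {G : YSpace} (hG : ‖G‖ ≤ 2 * R)
    (T : Finset ℤ) :
    ∃ F, ‖F - (a + YSpace.proj T (S.D (YSpace.proj T F) G))‖ = 0 := by
  have hk := S.κ_nonneg
  have hle : ∀ W, 2 * S.κ * (‖YSpace.proj T W‖ * ‖G‖) ≤ 1 / 2 * ‖W‖ := fun W => by
    calc _ ≤ 2 * S.κ * (‖W‖ * (2 * R)) := by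
          gcongr
          · exact YSpace.norm_proj_le T W
      _ ≤ _ := by nlinarith [norm_nonneg W]
  obtain ⟨F, -, hF⟩ := YSpace.exists_fixed_point
    (fun F => a + YSpace.proj T (S.D (YSpace.proj T F) G)) (r := 2 * ‖a‖) (by positivity)
    (fun F hF => by
      refine (norm_add_le _ _).trans ?_
      have := (YSpace.norm_proj_le T _).trans ((S.norm_D_le (YSpace.proj T F) G).trans (hle F))
      linarith)
    (fun F F' _ _ => by
      rw [add_sub_add_left_eq_sub, ← YSpace.proj_sub, D_sub, sub_self]
      have h0 : ‖S.D (YSpace.proj T F') 0‖ = 0 := le_antisymm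
        ((S.norm_D_le _ _).trans (by simp)) (norm_nonneg _)
      refine (YSpace.norm_proj_le T _).trans ((norm_add_le _ _).trans ?_)
      rw [h0, add_zero, ← YSpace.proj_sub]
      exact (S.norm_D_le _ _).trans (hle _))
  exact ⟨F, hF⟩

/-- The consistency error of the truncation consists of tails of `F` and of `D F G`; the rest
contracts by a factor `1/2` and is absorbed on the left. -/
theorem norm_galerkin_sub_le (hκ : 16 * S.κ * R ≤ 1) {a F F' G : YSpace} (hG : ‖G‖ ≤ 2 * R)
    (T : Finset ℤ) (hF : ‖F - (a + S.D F G)‖ = 0)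
    (hF' : ‖F' - (a + YSpace.proj T (S.D (YSpace.proj T F') G))‖ = 0) :
    ‖F - F'‖ ≤ 2 * (‖S.D F G - YSpace.proj T (S.D F G)‖ + ‖F - YSpace.proj T F‖) := by
  have hk := S.κ_nonneg
  have hle : ∀ W, ‖S.D W G‖ ≤ 1 / 2 * ‖W‖ := fun W => by
    refine (S.norm_D_le W G).trans ?_
    calc _ ≤ 2 * S.κ * (‖W‖ * (2 * R)) := by gcongr
      _ ≤ _ := by nlinarith [norm_nonneg W]
  have hD : ∀ W W', ‖S.D W G - S.D W' G‖ ≤ 1 / 2 * ‖W - W'‖ := fun W W' => by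
    rw [D_sub, sub_self]
    have h0 : ‖S.D W' 0‖ = 0 := le_antisymm ((S.norm_D_le _ _).trans (by simp)) (norm_nonneg _)
    refine (norm_add_le _ _).trans ?_
    rw [h0, add_zero]
    exact hle _
  have e : F - F' = (F - (a + S.D F G)) - (F' - (a + YSpace.proj T (S.D (YSpace.proj T F') G))) +
      ((S.D F G - YSpace.proj T (S.D F G)) + (YSpace.proj T (S.D F G - S.D (YSpace.proj T F) G) +
        YSpace.proj T (S.D (YSpace.proj T F) G - S.D (YSpace.proj T F') G))) := by
    rw [YSpace.proj_sub, YSpace.proj_sub]; abel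
  have h1 : ‖F - F'‖ ≤ ‖S.D F G - YSpace.proj T (S.D F G)‖ + (1 / 2 * ‖F - YSpace.proj T F‖ +
      1 / 2 * ‖F - F'‖) := by
    rw [e]
    refine (norm_add_le _ _).trans ?_
    have h2 := norm_sub_le (F - (a + S.D F G)) (F' - (a + YSpace.proj T (S.D (YSpace.proj T F') G)))
    rw [hF, hF'] at h2
    have h3 := norm_add_le (S.D F G - YSpace.proj T (S.D F G))
      (YSpace.proj T (S.D F G - S.D (YSpace.proj T F) G) +
        YSpace.proj T (S.D (YSpace.proj T F) G - S.D (YSpace.proj T F') G))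
    have h4 := norm_add_le (YSpace.proj T (S.D F G - S.D (YSpace.proj T F) G))
        (YSpace.proj T (S.D (YSpace.proj T F) G - S.D (YSpace.proj T F') G))
    have h5 := (YSpace.norm_proj_le T _).trans (hD F (YSpace.proj T F))
    have h6 := (YSpace.norm_proj_le T _).trans (hD (YSpace.proj T F) (YSpace.proj T F'))
    rw [← YSpace.proj_sub] at h6
    have h7 := YSpace.norm_proj_le T (F - F')
    rw [← e]
    linarith
  linarith [norm_nonneg (F - YSpace.proj T F), norm_nonneg (S.D F G - YSpace.proj T (S.D F G))]

/-- Conservation of the `L²` norm. -/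
theorem norm_ev_eq (hκ : 16 * S.κ * R ≤ 1) {F G : YSpace} (hG : ‖G‖ ≤ 2 * R) (x : L2)
    (hF : ‖F - (YSpace.data isKernel_cut x + S.D F G)‖ = 0) {t : ℝ} (ht : t ∈ Set.Icc (-1 : ℝ) 1) :
    ‖YSpace.ev F t‖ = ‖x‖ := by
  choose F' hF' using fun T => exists_galerkin hκ (YSpace.data isKernel_cut x) hG T
  have hnorm : ∀ T, ‖YSpace.ev (F' T) t‖ = ‖x‖ := by
    intro T
    have hev : ∀ t ∈ Set.Icc (-1 : ℝ) 1, ∀ k, YSpace.ev (F' T) t k = x k +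
        if k ∈ T then YSpace.ev (S.D (YSpace.proj T (F' T)) G) t k else 0 := by
      intro t ht k
      rw [YSpace.ev_eq_of_norm_sub_eq_zero (hF' T), YSpace.ev_add, lp.coeFn_add, Pi.add_apply,
        YSpace.ev_data, cutFun_eq ht, one_smul, YSpace.ev_proj]
    refine S.norm_eq_of_finite_system T (YSpace.continuous_ev _) (YSpace.continuous_ev G) x
      (fun t ht k hk => ?_) (fun t ht k hk => ?_) t ht
    · rw [hev t ht k, if_neg hk, add_zero]
    · rw [hev t ht k, if_pos hk]
      congr 1
      have h1 := S.hasSum_ev_D (YSpace.proj T (F' T)) G ht k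
      -- Truncation of the input makes the series over interactions finite, so that it may be
      -- exchanged with the time integral.
      have h2 := h1.unique (hasSum_sum_of_ne_finset_zero (s := T) fun m hm => by
        simp [osc, YSpace.ev_proj, hm])
      have hc1 : ∀ m, IntervalIntegrable (fun s => osc S.Q₁.c S.Q₁.ω (YSpace.ev (F' T))
          (YSpace.ev G) k m s) volume 0 t := fun m => (continuous_osc
        (YSpace.continuous_ev (F' T)) (YSpace.continuous_ev G) k m).intervalIntegrable _ _
      have hc2 : ∀ m, IntervalIntegrable (fun s => osc S.Q₂.c S.Q₂.ω (YSpace.ev (F' T))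
          (fun r => L2.refl (YSpace.ev G r)) k m s) volume 0 t := fun m => (continuous_osc
        (YSpace.continuous_ev (F' T)) (L2.continuous_refl.comp (YSpace.continuous_ev G))
        k m).intervalIntegrable _ _
      rw [h2, intervalIntegral.integral_finsetSum fun m _ => (hc1 m).add (hc2 m)]
      refine Finset.sum_congr rfl fun m hm => ?_
      rw [intervalIntegral.integral_add (hc1 m) (hc2 m)]
      congr 1 <;> (apply intervalIntegral.integral_congr; intro s _; simp [osc, YSpace.ev_proj, hm])
  have hlim : Tendsto (fun T => 2 * (‖S.D F G - YSpace.proj T (S.D F G)‖ + ‖F - YSpace.proj T F‖))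
      atTop (𝓝 0) := by
    simpa using ((YSpace.tendsto_proj (S.D F G)).add (YSpace.tendsto_proj F)).const_mul 2
  have hle : |‖YSpace.ev F t‖ - ‖x‖| ≤ 0 := by
    refine ge_of_tendsto' hlim fun T => ?_
    rw [← hnorm T]
    refine (abs_norm_sub_norm_le _ _).trans ?_
    rw [← YSpace.ev_sub]
    exact (YSpace.norm_ev_le _ _).trans (norm_galerkin_sub_le hκ hG T hF (hF' T))
  linarith [abs_le.1 hle]

end LocalSystem

end Zakharov

end

/-! ### Rescaling in time -/

noncomputable section

namespace Zakharov

theorem InteractionBound.mono {κ : ℤ → ℤ → ℝ≥0∞} {ω : ℤ → ℤ → ℝ} {s s' : ℝ≥0∞}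
    (h : InteractionBound κ ω s) (hs : s ≤ s') : InteractionBound κ ω s' :=
  ⟨fun k a => (h.out k a).trans hs, fun k a => (h.left k a).trans hs,
    fun k a => (h.right k a).trans hs⟩

theorem gainSq_nonneg {δ : ℝ} (hδ : 0 < δ) : 0 ≤ gainSq δ := by
  have := one_le_logFactor hδ
  unfold gainSq; positivity

/-- The coefficients of the system with a rescaled and translated time variable. -/
def scaleCoeff (c : ℤ → ℤ → ℂ) (ω : ℤ → ℤ → ℝ) (δ t₀ : ℝ) (k m : ℤ) : ℂ :=
  δ * (c k m * Complex.exp (Complex.I * ω k m * t₀))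

theorem enorm_scaleCoeff (c : ℤ → ℤ → ℂ) (ω : ℤ → ℤ → ℝ) {δ : ℝ} (hδ : 0 < δ) (t₀ : ℝ) (k m : ℤ) :
    ‖scaleCoeff c ω δ t₀ k m‖ₑ = ENNReal.ofReal δ * ‖c k m‖ₑ := by
  rw [scaleCoeff, enorm_mul, mul_comm (c k m), YSpace.enorm_exp_mul, ← ofReal_norm (δ : ℂ),
    Complex.norm_real, Real.norm_of_nonneg hδ.le]

/-- The substitution `r = δs + t₀` multiplies the phases by `δ`. The Jacobian `δ` and the constant
factor `e^{iωt₀}` go into the coefficients, whose absolute values do not see the translation. -/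
theorem integral_osc_scale (c : ℤ → ℤ → ℂ) (ω : ℤ → ℤ → ℝ) (f g : ℝ → L2) {δ : ℝ} (hδ : 0 < δ)
    (t₀ a b : ℝ) (k m : ℤ) :
    ∫ s in a..b, osc (scaleCoeff c ω δ t₀) (fun k m => δ * ω k m) (fun s => f (δ * s + t₀))
      (fun s => g (δ * s + t₀)) k m s =
    ∫ r in δ * a + t₀..δ * b + t₀, osc c ω f g k m r := by
  have h1 : ∀ s, osc (scaleCoeff c ω δ t₀) (fun k m => δ * ω k m) (fun s => f (δ * s + t₀))
      (fun s => g (δ * s + t₀)) k m s = δ • osc c ω f g k m (δ * s + t₀) := by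
    intro s
    have : Complex.exp (Complex.I * ω k m * ((δ * s + t₀ : ℝ) : ℂ)) =
        Complex.exp (Complex.I * ω k m * t₀) * Complex.exp (Complex.I * ((δ * ω k m : ℝ) : ℂ) * s) := by
      rw [← Complex.exp_add]; congr 1; push_cast; ring
    simp only [osc, scaleCoeff, this, Complex.real_smul]
    ring
  simp only [h1]
  rw [intervalIntegral.integral_smul, intervalIntegral.integral_comp_mul_add _ hδ.ne', smul_smul,
    mul_inv_cancel₀ hδ.ne', one_smul]

/-- `S` is the system with a rescaled and translated time variable. -/
structure LocalSystem.IsScaled (S : LocalSystem) (α β δ t₀ : ℝ) : Prop where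
  c₁ : S.Q₁.c = scaleCoeff schrCoeff (schrPhase α β 1) δ t₀
  ω₁ : S.Q₁.ω = fun k m => δ * schrPhase α β 1 k m
  c₂ : S.Q₂.c = scaleCoeff schrCoeff (schrPhase α β (-1)) δ t₀
  ω₂ : S.Q₂.ω = fun k m => δ * schrPhase α β (-1) k m
  c₃ : S.Q₃.c = scaleCoeff (fun k _ => waveCoeff β k) (wavePhase α β) δ t₀
  ω₃ : S.Q₃.ω = fun k m => δ * wavePhase α β k m

theorem schrPhase_symm (α β : ℝ) (k m : ℤ) : schrPhase α β (-1) m k = -schrPhase α β 1 k m := by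
  unfold schrPhase
  rw [show ((m - k : ℤ) : ℝ) = -((k - m : ℤ) : ℝ) by push_cast; ring, abs_neg]; ring

theorem conj_schrCoeff (k m : ℤ) : starRingEnd ℂ (schrCoeff k m) = -schrCoeff m k := by
  unfold schrCoeff
  rw [show ((m - k : ℤ) : ℝ) = -((k - m : ℤ) : ℝ) by push_cast; ring, bracket_neg, map_mul, map_neg, Complex.conj_I,
    Complex.conj_ofReal]
  ring

/-- The constant does not depend on `t₀`, and `δ` is an arbitrary positive length; smallness is only
required by the contraction. -/
theorem exists_localSystem {α β : ℝ} (hα : 0 < α) (hβ : 0 < β) (h : ¬ ∃ m : ℤ, β / α = m) :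
    ∃ C : ℝ, 0 ≤ C ∧ ∀ δ : ℝ, 0 < δ → ∀ t₀ : ℝ, ∃ S : LocalSystem,
      S.ε = C * Real.sqrt (gainSq δ) ∧ S.IsScaled α β δ t₀ := by
  obtain ⟨C₁, h₁, hC₁⟩ := exists_interactionBound_schr hα h
  obtain ⟨C₂, h₂, hC₂⟩ := exists_interactionBound_wave hα hβ h
  refine ⟨Real.sqrt (C₁ + C₂), Real.sqrt_nonneg _, fun δ hδ t₀ => ?_⟩
  have hg := gainSq_nonneg hδ
  have hsq : ENNReal.ofReal (Real.sqrt (C₁ + C₂) * Real.sqrt (gainSq δ)) ^ 2 =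
      ENNReal.ofReal ((C₁ + C₂) * gainSq δ) := by
    rw [← ENNReal.ofReal_pow (by positivity), mul_pow, Real.sq_sqrt (by positivity), Real.sq_sqrt hg]
  have hS : ∀ e : ℝ, e = 1 ∨ e = -1 → InteractionBound
      (fun k m => ‖scaleCoeff schrCoeff (schrPhase α β e) δ t₀ k m‖ₑ)
      (fun k m => δ * schrPhase α β e k m)
      (ENNReal.ofReal (Real.sqrt (C₁ + C₂) * Real.sqrt (gainSq δ)) ^ 2) := fun e he => by
    simp only [enorm_scaleCoeff _ _ hδ, hsq]
    exact (hC₁ e he δ hδ).mono (ENNReal.ofReal_le_ofReal (by gcongr; linarith))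
  have hW : InteractionBound
      (fun k m => ‖scaleCoeff (fun k _ => waveCoeff β k) (wavePhase α β) δ t₀ k m‖ₑ)
      (fun k m => δ * wavePhase α β k m)
      (ENNReal.ofReal (Real.sqrt (C₁ + C₂) * Real.sqrt (gainSq δ)) ^ 2) := by
    simp only [enorm_scaleCoeff _ _ hδ, hsq]
    exact (hC₂ δ hδ).mono (ENNReal.ofReal_le_ofReal (by gcongr; linarith))
  refine ⟨{ Q₁ := ⟨_, _, _, by positivity, hS 1 (Or.inl rfl)⟩
            Q₂ := ⟨_, _, _, by positivity, hS (-1) (Or.inr rfl)⟩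
            Q₃ := ⟨_, _, _, by positivity, hW⟩
            ε := Real.sqrt (C₁ + C₂) * Real.sqrt (gainSq δ)
            h₁ := rfl, h₂ := rfl, h₃ := rfl
            conj_c := fun k m => ?_
            ω_symm := fun k m => ?_ }, rfl, rfl, rfl, rfl, rfl, rfl, rfl⟩
  · simp only [scaleCoeff, map_mul, conj_schrCoeff, Complex.conj_ofReal, ← Complex.exp_conj,
      Complex.conj_I, schrPhase_symm]
    push_cast
    ring_nf
  · simp only [schrPhase_symm]; ring

/-! ### The system in interaction variables -/

/-- `f` agrees on `[a, b]` with an element of `Y`. -/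
def HasExt (a b : ℝ) (f : ℝ → L2) : Prop := ∃ A : YSpace, ∀ t ∈ Set.Icc a b, YSpace.ev A t = f t

theorem HasExt.continuousOn {a b : ℝ} {f : ℝ → L2} (h : HasExt a b f) :
    ContinuousOn f (Set.Icc a b) := by
  obtain ⟨A, hA⟩ := h
  exact (YSpace.continuous_ev A).continuousOn.congr fun t ht => (hA t ht).symm

theorem HasExt.mono {a b a' b' : ℝ} {f : ℝ → L2} (h : HasExt a b f)
    (hs : Set.Icc a' b' ⊆ Set.Icc a b) : HasExt a' b' f := by
  obtain ⟨A, hA⟩ := h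
  exact ⟨A, fun t ht => hA t (hs ht)⟩

theorem HasExt.congr {a b : ℝ} {f f' : ℝ → L2} (h : HasExt a b f)
    (hs : ∀ t ∈ Set.Icc a b, f t = f' t) : HasExt a b f' := by
  obtain ⟨A, hA⟩ := h
  exact ⟨A, fun t ht => (hA t ht).trans (hs t ht)⟩

/-- The integrated contribution of one interaction in the Schrödinger equation. -/
def schrTerm (α β : ℝ) (f g : ℝ → L2) (s t : ℝ) (k m : ℤ) : ℂ :=
  (∫ r in s..t, osc schrCoeff (schrPhase α β 1) f g k m r) +
    ∫ r in s..t, osc schrCoeff (schrPhase α β (-1)) f (fun r => L2.refl (g r)) k m r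

/-- The integrated contribution of one interaction in the wave equation. -/
def waveTerm (α β : ℝ) (f : ℝ → L2) (s t : ℝ) (k m : ℤ) : ℂ :=
  ∫ r in s..t, osc (fun k _ => waveCoeff β k) (wavePhase α β) (fun r => L2.refl (f r)) f k m r

/-- `(f, g)` solves the system in interaction variables on `[a, b]`; the mean of the wave part has
drift `-ρ`. -/
structure Sys (α β ρ a b : ℝ) (f g : ℝ → L2) : Prop where
  ext_f : HasExt a b f
  ext_g : HasExt a b g
  schr : ∀ s ∈ Set.Icc a b, ∀ t ∈ Set.Icc a b, ∀ k, HasSum (schrTerm α β f g s t k) (f t k - f s k)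
  wave : ∀ s ∈ Set.Icc a b, ∀ t ∈ Set.Icc a b, ∀ k, HasSum (waveTerm α β f s t k)
    (g t k - g s k + if k = 0 then (((t - s) * ρ : ℝ) : ℂ) else 0)

variable {α β ρ a b δ t₀ : ℝ} {f g f' g' : ℝ → L2} {S : LocalSystem}

theorem schrTerm_congr {s t : ℝ} (hf : ∀ r ∈ Set.uIcc s t, f r = f' r)
    (hg : ∀ r ∈ Set.uIcc s t, g r = g' r) : schrTerm α β f g s t = schrTerm α β f' g' s t := by
  ext k m
  unfold schrTerm
  congr 1 <;> (apply intervalIntegral.integral_congr; intro r hr; simp only [osc, hf r hr, hg r hr])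

theorem waveTerm_congr {s t : ℝ} (hf : ∀ r ∈ Set.uIcc s t, f r = f' r) :
    waveTerm α β f s t = waveTerm α β f' s t := by
  ext k m
  unfold waveTerm
  apply intervalIntegral.integral_congr; intro r hr; simp only [osc, hf r hr]

theorem schrTerm_add {s u t : ℝ} {I : Set ℝ} (hI : I.OrdConnected) (hs : s ∈ I) (hu : u ∈ I)
    (ht : t ∈ I) (hf : ContinuousOn f I) (hg : ContinuousOn g I) (k m : ℤ) :
    schrTerm α β f g s u k m + schrTerm α β f g u t k m = schrTerm α β f g s t k m := by
  have h1 := fun (x y : ℝ) (hx : x ∈ I) (hy : y ∈ I) => ((continuousOn_osc (c := schrCoeff)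
    (ω := schrPhase α β 1) hf hg k m).mono (hI.uIcc_subset hx hy)).intervalIntegrable (μ := volume)
  have h2 := fun (x y : ℝ) (hx : x ∈ I) (hy : y ∈ I) => ((continuousOn_osc (c := schrCoeff)
    (ω := schrPhase α β (-1)) hf (L2.continuous_refl.comp_continuousOn hg) k m).mono
      (hI.uIcc_subset hx hy)).intervalIntegrable (μ := volume)
  unfold schrTerm
  rw [← intervalIntegral.integral_add_adjacent_intervals (h1 s u hs hu) (h1 u t hu ht)]
  have := intervalIntegral.integral_add_adjacent_intervals (h2 s u hs hu) (h2 u t hu ht)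
  simp only [Function.comp_def] at this
  rw [← this]; ring

theorem waveTerm_add {s u t : ℝ} {I : Set ℝ} (hI : I.OrdConnected) (hs : s ∈ I) (hu : u ∈ I)
    (ht : t ∈ I) (hf : ContinuousOn f I) (k m : ℤ) :
    waveTerm α β f s u k m + waveTerm α β f u t k m = waveTerm α β f s t k m := by
  have h1 := fun (x y : ℝ) (hx : x ∈ I) (hy : y ∈ I) => ((continuousOn_osc
    (c := fun k _ => waveCoeff β k) (ω := wavePhase α β) (L2.continuous_refl.comp_continuousOn hf)
      hf k m).mono (hI.uIcc_subset hx hy)).intervalIntegrable (μ := volume)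
  exact intervalIntegral.integral_add_adjacent_intervals (h1 s u hs hu) (h1 u t hu ht)

theorem Sys.mono {a' b' : ℝ} (h : Sys α β ρ a b f g) (hs : Set.Icc a' b' ⊆ Set.Icc a b) :
    Sys α β ρ a' b' f g :=
  ⟨h.ext_f.mono hs, h.ext_g.mono hs, fun s hs' t ht => h.schr s (hs hs') t (hs ht),
    fun s hs' t ht => h.wave s (hs hs') t (hs ht)⟩

theorem Sys.congr (h : Sys α β ρ a b f g) (hf : ∀ t ∈ Set.Icc a b, f t = f' t)
    (hg : ∀ t ∈ Set.Icc a b, g t = g' t) : Sys α β ρ a b f' g' := by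
  refine ⟨h.ext_f.congr hf, h.ext_g.congr hg, fun s hs t ht k => ?_, fun s hs t ht k => ?_⟩
  · have hI : Set.uIcc s t ⊆ Set.Icc a b := Set.OrdConnected.uIcc_subset Set.ordConnected_Icc hs ht
    rw [← hf s hs, ← hf t ht, ← schrTerm_congr (fun r hr => hf r (hI hr)) fun r hr => hg r (hI hr)]
    exact h.schr s hs t ht k
  · have hI : Set.uIcc s t ⊆ Set.Icc a b := Set.OrdConnected.uIcc_subset Set.ordConnected_Icc hs ht
    rw [← hg s hs, ← hg t ht, ← waveTerm_congr (fun r hr => hf r (hI hr))]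
    exact h.wave s hs t ht k

theorem LocalSystem.IsScaled.hasSum_D (hS : S.IsScaled α β δ t₀) (hδ : 0 < δ) (F G : YSpace)
    {t : ℝ} (ht : t ∈ Set.Icc (-1 : ℝ) 1)
    (hf : ∀ s ∈ Set.uIcc 0 t, YSpace.ev F s = f (δ * s + t₀))
    (hg : ∀ s ∈ Set.uIcc 0 t, YSpace.ev G s = g (δ * s + t₀)) (k : ℤ) :
    HasSum (schrTerm α β f g t₀ (δ * t + t₀) k) (YSpace.ev (S.D F G) t k) := by
  have h1 := S.hasSum_ev_D F G ht k
  rw [hS.c₁, hS.c₂, hS.ω₁, hS.ω₂] at h1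
  convert h1 using 1
  ext m
  have e1 := integral_osc_scale schrCoeff (schrPhase α β 1) f g hδ t₀ 0 t k m
  have e2 := integral_osc_scale schrCoeff (schrPhase α β (-1)) f (fun r => L2.refl (g r)) hδ t₀ 0 t k m
  rw [mul_zero, zero_add] at e1 e2
  rw [schrTerm, ← e1, ← e2]
  congr 1 <;> (apply intervalIntegral.integral_congr; intro r hr; simp only [osc, hf r hr, hg r hr])

theorem LocalSystem.IsScaled.hasSum_E (hS : S.IsScaled α β δ t₀) (hδ : 0 < δ) (F : YSpace)
    {t : ℝ} (ht : t ∈ Set.Icc (-1 : ℝ) 1)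
    (hf : ∀ s ∈ Set.uIcc 0 t, YSpace.ev F s = f (δ * s + t₀)) (k : ℤ) :
    HasSum (waveTerm α β f t₀ (δ * t + t₀) k) (YSpace.ev (S.E F F) t k) := by
  have h1 := S.hasSum_ev_E F F ht k
  rw [hS.c₃, hS.ω₃] at h1
  convert h1 using 1
  ext m
  have e1 := integral_osc_scale (fun k _ => waveCoeff β k) (wavePhase α β) (fun r => L2.refl (f r)) f
    hδ t₀ 0 t k m
  rw [mul_zero, zero_add] at e1
  rw [waveTerm, ← e1]
  apply intervalIntegral.integral_congr; intro r hr; simp only [osc, hf r hr]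

/-- Functions in `Y` after an affine change of time. -/
theorem exists_affine (F : YSpace) (hδ : 0 < δ) (t₀ a b : ℝ) :
    HasExt a b (fun t => YSpace.ev F (δ * t + t₀)) := by
  obtain ⟨φ, p, C, hp, hφ⟩ := exists_cutoff_of_contDiff (χ := fun _ => 1) contDiff_const a b
  obtain ⟨B, -, hB⟩ := YSpace.exists_cut hp F hδ t₀
  exact ⟨B, fun t ht => by rw [hB, hφ t ht]; simp⟩

end Zakharov

end

noncomputable section

namespace Zakharov

/-! ### The choice of the time step -/

/-- The time step for data of size `E^{1/2}`. -/
def timeStep (θ E : ℝ) : ℝ := θ ^ 2 / (E * (1 + Real.log E))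

theorem timeStep_pos {θ E : ℝ} (hθ : 0 < θ) (hE : 1 ≤ E) : 0 < timeStep θ E := by
  have := Real.log_nonneg hE
  unfold timeStep; positivity

theorem timeStep_le {θ E : ℝ} (hθ : 0 < θ) (hE : 1 ≤ E) : timeStep θ E * E ≤ θ ^ 2 := by
  have := Real.log_nonneg hE
  have h1 : timeStep θ E * E = θ ^ 2 / (1 + Real.log E) := by unfold timeStep; field_simp
  rw [h1]
  exact div_le_self (by positivity) (by linarith)

/-- The time step is polynomial in `E⁻¹` up to a logarithm, so its logarithmic factor is at most a
multiple of `(1 + log E)/θ`. The denominator `1 + log E` in `timeStep` cancels it, and a factor `θ`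
remains. -/
theorem gainSq_timeStep_le {θ E : ℝ} (hθ : 0 < θ) (hθ1 : θ ≤ 1) (hE : 1 ≤ E) :
    gainSq (timeStep θ E) * E ≤ 4 * θ := by
  have hl := Real.log_nonneg hE
  have hδ := timeStep_pos hθ hE
  have hδ1 : timeStep θ E ≤ 1 := by nlinarith [timeStep_le hθ hE]
  have hlE : 1 + Real.log E ≤ E := by linarith [Real.log_le_sub_one_of_pos (by linarith : 0 < E)]
  have hinv : 1 + (timeStep θ E)⁻¹ ≤ 2 * E ^ 2 / θ ^ 2 := by
    rw [timeStep, inv_div, le_div_iff₀ (by positivity), add_mul, div_mul_cancel₀ _ (by positivity)]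
    nlinarith [mul_le_mul_of_nonneg_left hlE (by linarith : 0 ≤ E)]
  have hlog : Real.log (1 + (timeStep θ E)⁻¹) ≤ 2 * Real.log E + 2 / θ - 1 := by
    refine (Real.log_le_log (by positivity) hinv).trans ?_
    rw [Real.log_div (by positivity) (by positivity), Real.log_mul (by norm_num) (by positivity),
      Real.log_pow, Real.log_pow]
    have h2 : Real.log 2 ≤ 1 := by linarith [Real.log_le_sub_one_of_pos (by norm_num : (0 : ℝ) < 2)]
    have h3 := Real.log_le_sub_one_of_pos (inv_pos.2 hθ)
    rw [Real.log_inv] at h3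
    have : 2 / θ = 2 * θ⁻¹ := div_eq_mul_inv _ _
    push_cast
    linarith
  have hL : logFactor (timeStep θ E) ≤ 2 / θ * (1 + Real.log E) := by
    have h1 : 2 ≤ 2 / θ := by rw [le_div_iff₀ hθ]; linarith
    unfold logFactor
    nlinarith
  calc gainSq (timeStep θ E) * E
      ≤ (2 * timeStep θ E) * (2 / θ * (1 + Real.log E)) * E := by
        unfold gainSq
        gcongr
        · exact (one_le_logFactor hδ).trans' zero_le_one
        · nlinarith
    _ = 4 * θ := by unfold timeStep; field_simp; norm_num

theorem sqrt_gainSq_mul_le {θ M : ℝ} (hθ : 0 < θ) (hθ1 : θ ≤ 1) (hM : 1 ≤ M) :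
    Real.sqrt (gainSq (timeStep (θ ^ 2) (M ^ 2))) * M ≤ 2 * θ := by
  have h := gainSq_timeStep_le (θ := θ ^ 2) (by positivity) (pow_le_one₀ hθ.le hθ1)
    (one_le_pow₀ hM (n := 2))
  have hg := gainSq_nonneg (timeStep_pos (θ := θ ^ 2) (by positivity) (one_le_pow₀ hM (n := 2)))
  refine (pow_le_pow_iff_left₀ (by positivity) (by positivity) two_ne_zero).1 ?_
  rw [mul_pow, Real.sq_sqrt hg]
  linarith

theorem exists_small_step {L : ℝ} (hL : 0 ≤ L) : ∃ δ, 0 < δ ∧ δ ≤ 1 ∧ L * Real.sqrt (gainSq δ) ≤ 1 := by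
  have hθ : 0 < 1 / (1 + 2 * L) := by positivity
  have hθ1 : 1 / (1 + 2 * L) ≤ 1 := by rw [div_le_one (by positivity)]; linarith
  refine ⟨timeStep ((1 / (1 + 2 * L)) ^ 2) (1 ^ 2), timeStep_pos (by positivity) (by norm_num),
    ?_, ?_⟩
  · have := timeStep_le (θ := (1 / (1 + 2 * L)) ^ 2) (E := 1 ^ 2) (by positivity) (by norm_num)
    have h1 : ((1 / (1 + 2 * L)) ^ 2) ^ 2 ≤ 1 := pow_le_one₀ (by positivity) (pow_le_one₀ hθ.le hθ1)
    linarith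
  have h := sqrt_gainSq_mul_le hθ hθ1 (le_refl (1 : ℝ))
  rw [mul_one] at h
  calc _ ≤ L * (2 * (1 / (1 + 2 * L))) := by gcongr
    _ = 2 * L / (1 + 2 * L) := by ring
    _ ≤ 1 := by rw [div_le_one (by positivity)]; linarith

/-! ### Uniqueness -/

variable {α β ρ a b δ t₀ : ℝ} {f g f' g' : ℝ → L2} {S : LocalSystem}

/-- Both solutions are localised around `t₀` and rescaled. The norms of the localised extensions do
not depend on `δ`, so a short interval makes the bilinear operators contract on them. The drift `ρ`
is common and cancels in the difference. -/
theorem Sys.unique_step (h : Sys α β ρ a b f g) (h' : Sys α β ρ a b f' g') {A A' B B' : YSpace}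
    (hA : ∀ t ∈ Set.Icc a b, YSpace.ev A t = f t) (hA' : ∀ t ∈ Set.Icc a b, YSpace.ev A' t = f' t)
    (hB : ∀ t ∈ Set.Icc a b, YSpace.ev B t = g t) (hB' : ∀ t ∈ Set.Icc a b, YSpace.ev B' t = g' t)
    (hδ : 0 < δ) (hS : S.IsScaled α β δ t₀)
    (hκ : 24 * S.κ * (cutC * kerC * (‖A‖ + ‖A'‖ + ‖B‖)) ≤ 1)
    (ht₀ : t₀ ∈ Set.Icc a b) (hf : f t₀ = f' t₀) (hg : g t₀ = g' t₀) :
    ∀ t ∈ Set.Icc a b, |t - t₀| ≤ δ → f t = f' t ∧ g t = g' t := by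
  -- The interval in rescaled time may be cut off by the endpoints of `[a, b]`, so `t₀` need not be
  -- an interior point.
  set I : Set ℝ := {s | s ∈ Set.Icc (-1 : ℝ) 1 ∧ δ * s + t₀ ∈ Set.Icc a b} with hI
  have hIc : I.OrdConnected := by
    refine ⟨fun x hx y hy z hz => ⟨⟨hx.1.1.trans hz.1, hz.2.trans hy.1.2⟩, ?_, ?_⟩⟩
    · exact hx.2.1.trans (by gcongr; exact hz.1)
    · exact le_trans (by gcongr; exact hz.2) hy.2.2
  have h0 : (0 : ℝ) ∈ I := ⟨by simp, by simpa using ht₀⟩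
  have hsub : ∀ t ∈ I, Set.uIcc 0 t ⊆ I := fun t ht => hIc.uIcc_subset h0 ht
  have key : ∀ {W : YSpace} {w : ℝ → L2}, (∀ t ∈ Set.Icc a b, YSpace.ev W t = w t) →
      ∃ V : YSpace, ‖V‖ ≤ 3 * cutC * kerC * ‖W‖ ∧ ∀ s ∈ I, YSpace.ev V s = w (δ * s + t₀) := by
    intro W w hW
    obtain ⟨V, hV, hV'⟩ := YSpace.exists_cut isKernel_cut W hδ t₀
    exact ⟨V, hV, fun s hs => by rw [hV', cutFun_eq hs.1, one_smul, hW _ hs.2]⟩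
  obtain ⟨a₁, hn₁, ha₁⟩ := key hA
  obtain ⟨a₂, hn₂, ha₂⟩ := key hA'
  obtain ⟨b₁, hm₁, hb₁⟩ := key hB
  obtain ⟨b₂, hm₂, hb₂⟩ := key hB'
  have hD : ∀ t ∈ I, ∀ k, YSpace.ev (S.D a₁ b₁) t k = f (δ * t + t₀) k - f t₀ k := fun t ht k =>
    (hS.hasSum_D hδ a₁ b₁ ht.1 (fun s hs => ha₁ s (hsub t ht hs)) (fun s hs => hb₁ s (hsub t ht hs)) k).unique
      (h.schr t₀ ht₀ _ ht.2 k)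
  have hD' : ∀ t ∈ I, ∀ k, YSpace.ev (S.D a₂ b₂) t k = f' (δ * t + t₀) k - f' t₀ k := fun t ht k =>
    (hS.hasSum_D hδ a₂ b₂ ht.1 (fun s hs => ha₂ s (hsub t ht hs)) (fun s hs => hb₂ s (hsub t ht hs)) k).unique
      (h'.schr t₀ ht₀ _ ht.2 k)
  have hE := fun t (ht : t ∈ I) k =>
    (hS.hasSum_E hδ a₁ ht.1 (fun s hs => ha₁ s (hsub t ht hs)) k).unique (h.wave t₀ ht₀ _ ht.2 k)
  have hE' := fun t (ht : t ∈ I) k =>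
    (hS.hasSum_E hδ a₂ ht.1 (fun s hs => ha₂ s (hsub t ht hs)) k).unique (h'.wave t₀ ht₀ _ ht.2 k)
  have hC : 0 ≤ cutC * kerC := mul_nonneg isKernel_cut.nonneg kerC_nonneg
  have hle : ∀ x ∈ ({‖A‖, ‖A'‖, ‖B‖} : Set ℝ), 3 * cutC * kerC * x ≤
      2 * (3 / 2 * (cutC * kerC * (‖A‖ + ‖A'‖ + ‖B‖))) := by
    intro x hx
    have : x ≤ ‖A‖ + ‖A'‖ + ‖B‖ := by
      have h1 := norm_nonneg A
      have h2 := norm_nonneg A'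
      have h3 := norm_nonneg B
      simp only [Set.mem_insert_iff, Set.mem_singleton_iff] at hx
      rcases hx with rfl | rfl | rfl <;> linarith
    nlinarith
  -- The localisation constant `3 cutC kerC` is written as `2 · (3/2)` to fit balls of radius `2R`;
  -- this is the origin of `24 = 16 · 3/2` in `hκ`.
  have main := LocalSystem.norm_ev_sub_halving (S := S) (I := I)
    (R := 3 / 2 * (cutC * kerC * (‖A‖ + ‖A'‖ + ‖B‖))) (A := a₁) (A' := a₂) (B := b₁) (B' := b₂)
    (by linarith) (hn₁.trans (hle _ (by simp))) (hn₂.trans (hle _ (by simp)))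
    (hm₁.trans (hle _ (by simp))) hsub (fun t ht => ht.1)
    (fun t ht => by
      ext k
      rw [lp.coeFn_sub, Pi.sub_apply, lp.coeFn_sub, Pi.sub_apply, hD t ht, hD' t ht, ha₁ t ht,
        ha₂ t ht, hf]; ring)
    (fun t ht => by
      ext k
      rw [lp.coeFn_sub, Pi.sub_apply, lp.coeFn_sub, Pi.sub_apply, hE t ht, hE' t ht, hb₁ t ht,
        hb₂ t ht, hg]; ring)
  intro t ht htδ
  have hs : (t - t₀) / δ ∈ I := by
    have e : δ * ((t - t₀) / δ) + t₀ = t := by field_simp; ring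
    refine ⟨?_, by rwa [e]⟩
    rw [Set.mem_Icc, ← abs_le, abs_div, abs_of_pos hδ, div_le_one hδ]
    exact htδ
  have e : δ * ((t - t₀) / δ) + t₀ = t := by field_simp; ring
  have := main _ hs
  rwa [ha₁ _ hs, ha₂ _ hs, hb₁ _ hs, hb₂ _ hs, e] at this

/-- The segment from `t₀` to `t` is divided into equal parts. The index counts the steps, so that
estimates which worsen at each step can be propagated. -/
theorem forall_of_steps {P : ℕ → ℝ → Prop} {I : Set ℝ} (hI : I.OrdConnected) {δ : ℝ} {t₀ : ℝ}
    (h₀ : t₀ ∈ I) (hP : P 0 t₀)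
    (hstep : ∀ n, ∀ s ∈ I, P n s → ∀ t ∈ I, |t - s| ≤ δ → P (n + 1) t) (n : ℕ) :
    ∀ t ∈ I, |t - t₀| ≤ n * δ → P n t := by
  induction n with
  | zero =>
    intro t _ h
    have : t = t₀ := by
      rw [Nat.cast_zero, zero_mul] at h
      exact sub_eq_zero.1 (abs_nonpos_iff.1 h)
    rwa [this]
  | succ n ih =>
    intro t ht h
    have hn : (0 : ℝ) < n + 1 := by positivity
    push_cast at h
    set s := t₀ + (t - t₀) * (n / (n + 1)) with hs
    have hfr : (n : ℝ) / (n + 1) ≤ 1 := by rw [div_le_one hn]; linarith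
    have hfr0 : 0 ≤ (n : ℝ) / (n + 1) := by positivity
    have hsI : s ∈ I := by
      refine hI.uIcc_subset h₀ ht ?_
      rw [Set.mem_uIcc]
      rcases le_total t₀ t with h1 | h1
      · left; constructor <;> nlinarith
      · right; constructor <;> nlinarith
    refine hstep n s hsI (ih s hsI ?_) t ht ?_
    · rw [hs, add_sub_cancel_left, abs_mul, abs_of_nonneg hfr0]
      calc |t - t₀| * (n / (n + 1)) ≤ ((n + 1) * δ) * (n / (n + 1)) := by gcongr
        _ = n * δ := by field_simp
    · have : t - s = (t - t₀) * (1 / (n + 1)) := by rw [hs]; field_simp; ring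
      rw [this, abs_mul, abs_of_pos (by positivity : (0 : ℝ) < 1 / (n + 1))]
      calc |t - t₀| * (1 / (n + 1)) ≤ ((n + 1) * δ) * (1 / (n + 1)) := by gcongr
        _ = δ := by field_simp

theorem forall_of_step {P : ℝ → Prop} {I : Set ℝ} (hI : I.OrdConnected) {δ : ℝ} (hδ : 0 < δ) {t₀ : ℝ}
    (h₀ : t₀ ∈ I) (hP : P t₀) (hstep : ∀ s ∈ I, P s → ∀ t ∈ I, |t - s| ≤ δ → P t) :
    ∀ t ∈ I, P t := by
  intro t ht
  obtain ⟨n, hn⟩ := exists_nat_ge (|t - t₀| / δ)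
  exact forall_of_steps (P := fun _ => P) hI h₀ hP (fun _ => hstep) n t ht
    (by rwa [div_le_iff₀ hδ] at hn)

/-- Uniqueness for the system in interaction variables. -/
theorem Sys.unique (hα : 0 < α) (hβ : 0 < β) (hαβ : ¬ ∃ m : ℤ, β / α = m)
    (h : Sys α β ρ a b f g) (h' : Sys α β ρ a b f' g')
    (ht₀ : t₀ ∈ Set.Icc a b) (hf : f t₀ = f' t₀) (hg : g t₀ = g' t₀) :
    ∀ t ∈ Set.Icc a b, f t = f' t ∧ g t = g' t := by
  obtain ⟨C, hC, hsys⟩ := exists_localSystem hα hβ hαβ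
  obtain ⟨A, hA⟩ := h.ext_f
  obtain ⟨A', hA'⟩ := h'.ext_f
  obtain ⟨B, hB⟩ := h.ext_g
  obtain ⟨B', hB'⟩ := h'.ext_g
  have hK : 0 ≤ cutC * kerC := mul_nonneg isKernel_cut.nonneg kerC_nonneg
  have hb := bilC_nonneg
  -- The norms are those of extensions on the whole of `[a, b]`, so a single step length serves at
  -- every base time.
  obtain ⟨δ, hδ, -, hsmall⟩ := exists_small_step
    (L := 24 * (bilC * C) * (cutC * kerC * (‖A‖ + ‖A'‖ + ‖B‖))) (by positivity)
  refine forall_of_step Set.ordConnected_Icc hδ ht₀ ⟨hf, hg⟩ fun s hs hP t ht hst => ?_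
  obtain ⟨S, hε, hS⟩ := hsys δ hδ s
  refine h.unique_step h' hA hA' hB hB' hδ hS ?_ hs hP.1 hP.2 t ht hst
  rw [LocalSystem.κ, hε]
  linarith

/-! ### The local flow -/

/-- The inhomogeneity of the wave equation. -/
def waveData (y : L2) (r : ℝ) : YSpace :=
  YSpace.data isKernel_cut y + YSpace.data isKernel_lin (lp.single 2 0 (-(r : ℂ)))

/-- A constant bounding the inhomogeneities. -/
def datC : ℝ := (cutC + linC) * kerC

theorem datC_nonneg : 0 ≤ datC :=
  mul_nonneg (add_nonneg isKernel_cut.nonneg isKernel_lin.nonneg) kerC_nonneg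

theorem norm_data_le_datC (x : L2) : ‖YSpace.data isKernel_cut x‖ ≤ datC * ‖x‖ := by
  refine (YSpace.norm_data_le isKernel_cut x).trans ?_
  unfold datC
  have := kerC_nonneg
  gcongr
  linarith [isKernel_lin.nonneg]

theorem norm_single_ofReal (r : ℝ) : ‖(lp.single 2 0 (-(r : ℂ)) : L2)‖ = |r| := by
  rw [lp.norm_single (by norm_num), norm_neg, Complex.norm_real, Real.norm_eq_abs]

theorem waveData_sub (y y' : L2) (r r' : ℝ) :
    waveData y r - waveData y' r' = waveData (y - y') (r - r') := by
  have : (lp.single 2 0 (-(r : ℂ)) : L2) - lp.single 2 0 (-(r' : ℂ)) =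
      lp.single 2 0 (-((r - r' : ℝ) : ℂ)) := by
    rw [sub_eq_add_neg, ← lp.single_neg, ← lp.single_add]; push_cast; congr 1; ring
  rw [waveData, waveData, waveData, add_sub_add_comm, YSpace.data_sub, YSpace.data_sub, this]

theorem norm_waveData_le (y : L2) (r : ℝ) : ‖waveData y r‖ ≤ datC * (‖y‖ + |r|) := by
  have h1 := YSpace.norm_data_le isKernel_cut y
  have h2 := YSpace.norm_data_le isKernel_lin (lp.single 2 0 (-(r : ℂ)))
  rw [norm_single_ofReal] at h2
  have h3 : 0 ≤ linC * kerC * ‖y‖ :=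
    mul_nonneg (mul_nonneg isKernel_lin.nonneg kerC_nonneg) (norm_nonneg _)
  have h4 : 0 ≤ cutC * kerC * |r| :=
    mul_nonneg (mul_nonneg isKernel_cut.nonneg kerC_nonneg) (abs_nonneg _)
  unfold waveData datC
  refine (norm_add_le _ _).trans ?_
  linarith

theorem ev_waveData (y : L2) (r : ℝ) {t : ℝ} (ht : t ∈ Set.Icc (-1 : ℝ) 1) :
    YSpace.ev (waveData y r) t = y + (t : ℂ) • (lp.single 2 0 (-(r : ℂ)) : L2) := by
  rw [waveData, YSpace.ev_add, YSpace.ev_data, YSpace.ev_data, cutFun_eq ht, linFun_eq ht, one_smul]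

end Zakharov

end

/-! ### From fixed points to the local flow -/

noncomputable section

namespace Zakharov

variable {α β ρ a b δ t₀ : ℝ} {f g f' g' : ℝ → L2} {S : LocalSystem}

theorem mem_Icc_of_affine (hδ : 0 < δ) {t : ℝ} (ht : t ∈ Set.Icc (t₀ - δ) (t₀ + δ)) :
    (t - t₀) / δ ∈ Set.Icc (-1 : ℝ) 1 := by
  rw [Set.mem_Icc, ← abs_le, abs_div, abs_of_pos hδ, div_le_one hδ, abs_le]
  constructor <;> linarith [ht.1, ht.2]

/-- Each interaction integral is additive in the time interval, so the equations between arbitrary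
times follow by subtraction from those with one base time. -/
theorem Sys.of_base {u : ℝ} {x y : L2} (hu : u ∈ Set.Icc a b) (hf : HasExt a b f) (hg : HasExt a b g)
    (h1 : ∀ t ∈ Set.Icc a b, ∀ k, HasSum (schrTerm α β f g u t k) (f t k - x k))
    (h2 : ∀ t ∈ Set.Icc a b, ∀ k, HasSum (waveTerm α β f u t k)
      (g t k - y k + if k = 0 then (((t - u) * ρ : ℝ) : ℂ) else 0)) :
    Sys α β ρ a b f g := by
  refine ⟨hf, hg, fun s hs t ht k => ?_, fun s hs t ht k => ?_⟩
  · have e1 : schrTerm α β f g s t k =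
        fun m => schrTerm α β f g u t k m - schrTerm α β f g u s k m := funext fun m => by
      rw [← schrTerm_add Set.ordConnected_Icc hu hs ht hf.continuousOn hg.continuousOn k m]; ring
    rw [e1, show f t k - f s k = f t k - x k - (f s k - x k) by ring]
    exact (h1 t ht k).sub (h1 s hs k)
  · have e1 : waveTerm α β f s t k =
        fun m => waveTerm α β f u t k m - waveTerm α β f u s k m := funext fun m => by
      rw [← waveTerm_add Set.ordConnected_Icc hu hs ht hf.continuousOn k m]; ring
    have e2 : (g t k - g s k + if k = 0 then (((t - s) * ρ : ℝ) : ℂ) else 0) =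
        (g t k - y k + if k = 0 then (((t - u) * ρ : ℝ) : ℂ) else 0) -
          (g s k - y k + if k = 0 then (((s - u) * ρ : ℝ) : ℂ) else 0) := by
      split_ifs <;> push_cast <;> ring
    rw [e1, e2]
    exact (h2 t ht k).sub (h2 s hs k)

/-- A fixed point gives a solution of the system in interaction variables. -/
theorem LocalSystem.IsFixed.sys (hS : S.IsScaled α β δ t₀) (hδ : 0 < δ) {x y : L2} {F G : YSpace}
    (h : S.IsFixed (YSpace.data isKernel_cut x) (waveData y (δ * ρ)) F G) :
    Sys α β ρ (t₀ - δ) (t₀ + δ) (fun t => YSpace.ev F ((t - t₀) / δ))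
      (fun t => YSpace.ev G ((t - t₀) / δ)) := by
  have hext : ∀ W : YSpace, HasExt (t₀ - δ) (t₀ + δ) (fun t => YSpace.ev W ((t - t₀) / δ)) := by
    intro W
    refine (exists_affine W (inv_pos.2 hδ) (-(t₀ / δ)) _ _).congr fun t _ => ?_
    congr 1; ring
  set f : ℝ → L2 := fun t => YSpace.ev F ((t - t₀) / δ) with hf
  set g : ℝ → L2 := fun t => YSpace.ev G ((t - t₀) / δ) with hg
  have hfs : ∀ s, YSpace.ev F s = f (δ * s + t₀) := fun s => by
    simp only [hf]; congr 1; field_simp; ring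
  have hgs : ∀ s, YSpace.ev G s = g (δ * s + t₀) := fun s => by
    simp only [hg]; congr 1; field_simp; ring
  have e : ∀ t, δ * ((t - t₀) / δ) + t₀ = t := fun t => by field_simp; ring
  have hmem : t₀ ∈ Set.Icc (t₀ - δ) (t₀ + δ) := ⟨by linarith, by linarith⟩
  have h1 : ∀ t ∈ Set.Icc (t₀ - δ) (t₀ + δ), ∀ k, HasSum (schrTerm α β f g t₀ t k) (f t k - x k) := by
    intro t ht k
    have ht' := mem_Icc_of_affine hδ ht
    have h2 := hS.hasSum_D hδ F G ht' (fun s _ => hfs s) (fun s _ => hgs s) k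
    have h3 : f t = x + YSpace.ev (S.D F G) ((t - t₀) / δ) := by
      simp only [hf]
      rw [YSpace.ev_eq_of_norm_sub_eq_zero h.schr, YSpace.ev_add, YSpace.ev_data, cutFun_eq ht',
        one_smul]
    rwa [e, show YSpace.ev (S.D F G) ((t - t₀) / δ) k = f t k - x k by
      rw [h3, lp.coeFn_add, Pi.add_apply]; ring] at h2
  have h1' : ∀ t ∈ Set.Icc (t₀ - δ) (t₀ + δ), ∀ k, HasSum (waveTerm α β f t₀ t k)
      (g t k - y k + if k = 0 then (((t - t₀) * ρ : ℝ) : ℂ) else 0) := by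
    intro t ht k
    have ht' := mem_Icc_of_affine hδ ht
    have h2 := hS.hasSum_E hδ F ht' (fun s _ => hfs s) k
    have h3 : g t = y + (((t - t₀) / δ : ℝ) : ℂ) • (lp.single 2 0 (-((δ * ρ : ℝ) : ℂ)) : L2) +
        YSpace.ev (S.E F F) ((t - t₀) / δ) := by
      simp only [hg]
      rw [YSpace.ev_eq_of_norm_sub_eq_zero h.wave, YSpace.ev_add, ev_waveData y _ ht']
    rwa [e, show YSpace.ev (S.E F F) ((t - t₀) / δ) k =
        g t k - y k + if k = 0 then (((t - t₀) * ρ : ℝ) : ℂ) else 0 by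
      rw [h3, lp.coeFn_add, Pi.add_apply, lp.coeFn_add, Pi.add_apply, lp.coeFn_smul, Pi.smul_apply,
        lp.single_apply, Pi.single_apply]
      split_ifs with hk
      · have : (δ : ℂ) ≠ 0 := by exact_mod_cast hδ.ne'
        rw [smul_eq_mul]; push_cast; field_simp; ring
      · rw [smul_zero]; ring] at h2
  exact Sys.of_base hmem (hext F) (hext G) h1 h1'

/-- The local flow around the time `t₀`, for data bounded by `R`. -/
theorem exists_local_flow (hα : 0 < α) (hβ : 0 < β) (hαβ : ¬ ∃ m : ℤ, β / α = m) :
    ∃ K : ℝ, 1 ≤ K ∧ ∀ R δ t₀ : ℝ, 0 ≤ R → 0 < δ → K * (R * Real.sqrt (gainSq δ)) ≤ 1 →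
      ∃ f g : L2 → L2 → ℝ → ℝ → L2,
        (∀ x y ρ, ‖x‖ ≤ R → ‖y‖ + δ * |ρ| ≤ R →
          Sys α β ρ (t₀ - δ) (t₀ + δ) (f x y ρ) (g x y ρ) ∧ f x y ρ t₀ = x ∧ g x y ρ t₀ = y ∧
          ∀ t ∈ Set.Icc (t₀ - δ) (t₀ + δ), ‖f x y ρ t‖ = ‖x‖ ∧
            ‖g x y ρ t‖ ≤ ‖y‖ + δ * |ρ| + K * Real.sqrt (gainSq δ) * ‖x‖ ^ 2) ∧
        (∀ x y ρ x' y' ρ', ‖x‖ ≤ R → ‖y‖ + δ * |ρ| ≤ R → ‖x'‖ ≤ R → ‖y'‖ + δ * |ρ'| ≤ R →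
          ∀ t ∈ Set.Icc (t₀ - δ) (t₀ + δ), ‖f x y ρ t - f x' y' ρ' t‖ + ‖g x y ρ t - g x' y' ρ' t‖ ≤
            K * (‖x - x'‖ + ‖y - y'‖ + δ * |ρ - ρ'|)) := by
  obtain ⟨C, hC, hsys⟩ := exists_localSystem hα hβ hαβ
  have hb := bilC_nonneg
  have hd := datC_nonneg
  -- One constant for three purposes: the contraction, the growth of the wave part, and the
  -- Lipschitz bound.
  set K : ℝ := 1 + 16 * bilC * C * datC + 4 * bilC * C * datC ^ 2 + 2 * datC with hK
  have hK1 : 1 ≤ K := by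
    have : 0 ≤ 16 * bilC * C * datC + 4 * bilC * C * datC ^ 2 + 2 * datC := by positivity
    linarith
  have hKa : 16 * bilC * C * datC ≤ K := by
    have : 0 ≤ 4 * bilC * C * datC ^ 2 + 2 * datC := by positivity
    linarith
  have hKb : 4 * bilC * C * datC ^ 2 ≤ K := by
    have : 0 ≤ 16 * bilC * C * datC + 2 * datC := by positivity
    linarith
  have hKc : 2 * datC ≤ K := by
    have : 0 ≤ 16 * bilC * C * datC + 4 * bilC * C * datC ^ 2 := by positivity
    linarith
  refine ⟨K, hK1, fun R δ t₀ hR hδ hsmall => ?_⟩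
  obtain ⟨S, hε, hS⟩ := hsys δ hδ t₀
  set q := Real.sqrt (gainSq δ) with hq
  have hq0 : 0 ≤ q := Real.sqrt_nonneg _
  have hκ : 16 * S.κ * (datC * R) ≤ 1 := by
    rw [LocalSystem.κ, hε]
    calc 16 * (bilC * (C * q)) * (datC * R) = (16 * bilC * C * datC) * (R * q) := by ring
      _ ≤ K * (R * q) := by gcongr
      _ ≤ 1 := hsmall
  have hex : ∀ x y ρ, ∃ F G : YSpace, ‖x‖ ≤ R → ‖y‖ + δ * |ρ| ≤ R →
      ‖F‖ ≤ 2 * (datC * R) ∧ ‖G‖ ≤ 2 * (datC * R) ∧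
      S.IsFixed (YSpace.data isKernel_cut x) (waveData y (δ * ρ)) F G := by
    intro x y ρ
    by_cases hxy : ‖x‖ ≤ R ∧ ‖y‖ + δ * |ρ| ≤ R
    · obtain ⟨F, G, h⟩ := LocalSystem.exists_isFixed (S := S) (R := datC * R) (by positivity) hκ
        (a := YSpace.data isKernel_cut x) (b := waveData y (δ * ρ))
        ((norm_data_le_datC x).trans (by gcongr; exact hxy.1))
        ((norm_waveData_le y _).trans (by
          rw [abs_mul, abs_of_pos hδ]; gcongr; exact hxy.2))
      exact ⟨F, G, fun _ _ => h⟩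
    · exact ⟨0, 0, fun h1 h2 => absurd ⟨h1, h2⟩ hxy⟩
  choose F G hFG using hex
  refine ⟨fun x y ρ t => YSpace.ev (F x y ρ) ((t - t₀) / δ),
    fun x y ρ t => YSpace.ev (G x y ρ) ((t - t₀) / δ), fun x y ρ hx hy => ?_,
    fun x y ρ x' y' ρ' hx hy hx' hy' t ht => ?_⟩
  · obtain ⟨hF, hG, hfix⟩ := hFG x y ρ hx hy
    have h0 : (0 : ℝ) ∈ Set.Icc (-1 : ℝ) 1 := by simp
    have hzero : ∀ k, YSpace.ev (S.D (F x y ρ) (G x y ρ)) 0 k = 0 := fun k =>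
      (S.hasSum_ev_D _ _ h0 k).unique (by simp)
    have hzero' : ∀ k, YSpace.ev (S.E (F x y ρ) (F x y ρ)) 0 k = 0 := fun k =>
      (S.hasSum_ev_E _ _ h0 k).unique (by simp)
    refine ⟨hfix.sys hS hδ, ?_, ?_, fun t ht => ⟨?_, ?_⟩⟩
    · ext k
      simp only [sub_self, zero_div]
      rw [YSpace.ev_eq_of_norm_sub_eq_zero hfix.schr, YSpace.ev_add, YSpace.ev_data, cutFun_eq h0,
        one_smul, lp.coeFn_add, Pi.add_apply, hzero, add_zero]
    · ext k
      simp only [sub_self, zero_div]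
      rw [YSpace.ev_eq_of_norm_sub_eq_zero hfix.wave, YSpace.ev_add, ev_waveData y _ h0,
        lp.coeFn_add, Pi.add_apply, hzero', add_zero]
      simp
    · exact LocalSystem.norm_ev_eq hκ hG x hfix.schr (mem_Icc_of_affine hδ ht)
    · have ht' := mem_Icc_of_affine hδ ht
      simp only
      rw [YSpace.ev_eq_of_norm_sub_eq_zero hfix.wave, YSpace.ev_add, ev_waveData y _ ht']
      have h1 : ‖(((t - t₀) / δ : ℝ) : ℂ) • (lp.single 2 0 (-((δ * ρ : ℝ) : ℂ)) : L2)‖ ≤ δ * |ρ| := by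
        rw [norm_smul, norm_single_ofReal, Complex.norm_real, Real.norm_eq_abs, abs_mul δ,
          abs_of_pos hδ]
        have := abs_le.2 ht'
        have h0 : 0 ≤ δ * |ρ| := by positivity
        nlinarith
      -- Bounding `F` by its own data, rather than by the radius of the ball, makes the increment of
      -- the wave part independent of `y`.
      have h2 : ‖S.E (F x y ρ) (F x y ρ)‖ ≤ K * q * ‖x‖ ^ 2 := by
        have h3 := hfix.norm_schr_le hκ hG
        have h4 := norm_data_le_datC x
        have h5 : ‖F x y ρ‖ ≤ 2 * (datC * ‖x‖) := by linarith
        calc _ ≤ S.κ * (‖F x y ρ‖ * ‖F x y ρ‖) := S.norm_E_le _ _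
          _ ≤ S.κ * ((2 * (datC * ‖x‖)) * (2 * (datC * ‖x‖))) := by
              have := S.κ_nonneg; gcongr
          _ = (4 * bilC * C * datC ^ 2) * q * ‖x‖ ^ 2 := by rw [LocalSystem.κ, hε]; ring
          _ ≤ _ := by gcongr
      refine (norm_add_le _ _).trans (add_le_add ((norm_add_le _ _).trans (by gcongr)) ?_)
      exact (YSpace.norm_ev_le _ _).trans h2
  · obtain ⟨hF, hG, hfix⟩ := hFG x y ρ hx hy
    obtain ⟨hF', hG', hfix'⟩ := hFG x' y' ρ' hx' hy'
    have h1 := hfix.norm_sub_le hfix' hκ hF hG hF'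
    have h2 := norm_data_le_datC (x - x')
    have h3 := norm_waveData_le (y - y') (δ * ρ - δ * ρ')
    rw [← YSpace.data_sub] at h2
    rw [← waveData_sub, ← mul_sub, abs_mul, abs_of_pos hδ] at h3
    simp only [← YSpace.ev_sub]
    refine (add_le_add (YSpace.norm_ev_le _ _) (YSpace.norm_ev_le _ _)).trans (h1.trans ?_)
    calc _ ≤ 2 * (datC * ‖x - x'‖ + datC * (‖y - y'‖ + δ * |ρ - ρ'|)) := by gcongr
      _ = (2 * datC) * (‖x - x'‖ + ‖y - y'‖ + δ * |ρ - ρ'|) := by ring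
      _ ≤ _ := by gcongr

end Zakharov

end

noncomputable section

namespace Zakharov

variable {α β ρ a b c δ t₀ : ℝ} {f g f' g' : ℝ → L2}

/-! ### Gluing -/

/-- A smooth partition of unity with transition on the overlap `[a', b]`; multiplication by each
cutoff preserves `Y`. -/
theorem HasExt.glue {a' : ℝ} (h : HasExt a b f) (h' : HasExt a' c f) (hab : a' < b) :
    HasExt a c f := by
  obtain ⟨A, hA⟩ := h
  obtain ⟨A', hA'⟩ := h'
  have hχ : ContDiff ℝ (⊤ : ℕ∞) fun t => Real.smoothTransition ((b - t) / (b - a')) :=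
    Real.smoothTransition.contDiff.comp (by fun_prop)
  obtain ⟨φ, p, C, hp, hφ⟩ := exists_cutoff_of_contDiff hχ a c
  obtain ⟨φ', p', C', hp', hφ'⟩ := exists_cutoff_of_contDiff (contDiff_const.sub hχ : ContDiff ℝ (⊤ : ℕ∞)
    fun t => (1 : ℝ) - Real.smoothTransition ((b - t) / (b - a'))) a c
  obtain ⟨B, -, hB⟩ := YSpace.exists_cut hp A one_pos 0
  obtain ⟨B', -, hB'⟩ := YSpace.exists_cut hp' A' one_pos 0
  refine ⟨B + B', fun t ht => ?_⟩
  have hpos : 0 < b - a' := by linarith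
  rw [YSpace.ev_add, hB, hB', hφ t ht, hφ' t ht, one_mul, add_zero]
  rcases le_or_gt t b with h1 | h1
  · rw [hA t ⟨ht.1, h1⟩]
    rcases le_or_gt a' t with h2 | h2
    · rw [hA' t ⟨h2, ht.2⟩, ← add_smul]
      push_cast
      rw [add_sub_cancel, one_smul]
    · have : Real.smoothTransition ((b - t) / (b - a')) = 1 :=
        Real.smoothTransition.one_of_one_le (by rw [le_div_iff₀ hpos]; linarith)
      simp [this]
  · have : Real.smoothTransition ((b - t) / (b - a')) = 0 :=
      Real.smoothTransition.zero_of_nonpos (div_nonpos_of_nonpos_of_nonneg (by linarith) hpos.le)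
    rw [hA' t ⟨by linarith, ht.2⟩]
    simp [this]

/-- By uniqueness the two solutions agree on the whole overlap, which has positive length as
required by `HasExt.glue`. -/
theorem Sys.glue (hα : 0 < α) (hβ : 0 < β) (hαβ : ¬ ∃ m : ℤ, β / α = m) {a' u : ℝ}
    (h : Sys α β ρ a b f g) (h' : Sys α β ρ a' c f' g') (haa : a ≤ a') (hab : a' < b) (hbc : b ≤ c)
    (hu : u ∈ Set.Icc a' b) (hf : f u = f' u) (hg : g u = g' u) :
    ∃ F G, Sys α β ρ a c F G ∧ (∀ t ∈ Set.Icc a b, F t = f t ∧ G t = g t) ∧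
      ∀ t ∈ Set.Icc a' c, F t = f' t ∧ G t = g' t := by
  have huniq := (h.mono (Set.Icc_subset_Icc haa le_rfl)).unique hα hβ hαβ
    (h'.mono (Set.Icc_subset_Icc le_rfl hbc)) hu hf hg
  set F : ℝ → L2 := fun t => if t ≤ b then f t else f' t with hF
  set G : ℝ → L2 := fun t => if t ≤ b then g t else g' t with hG
  have e1 : ∀ t ∈ Set.Icc a b, F t = f t ∧ G t = g t := fun t ht => by
    simp only [hF, hG, if_pos ht.2, and_self]
  have e2 : ∀ t ∈ Set.Icc a' c, F t = f' t ∧ G t = g' t := fun t ht => by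
    simp only [hF, hG]
    split_ifs with h1
    · exact huniq t ⟨ht.1, h1⟩
    · exact ⟨rfl, rfl⟩
  have s1 : Sys α β ρ a b F G := h.congr (fun t ht => (e1 t ht).1.symm) fun t ht => (e1 t ht).2.symm
  have s2 : Sys α β ρ a' c F G := h'.congr (fun t ht => (e2 t ht).1.symm) fun t ht => (e2 t ht).2.symm
  refine ⟨F, G, ?_, e1, e2⟩
  have ha'1 : a' ∈ Set.Icc a b := ⟨haa, hab.le⟩
  have ha'2 : a' ∈ Set.Icc a' c := ⟨le_rfl, hab.le.trans hbc⟩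
  refine Sys.of_base (u := a') (x := F a') (y := G a') ⟨haa, hab.le.trans hbc⟩
    (s1.ext_f.glue s2.ext_f hab) (s1.ext_g.glue s2.ext_g hab) (fun t ht k => ?_) fun t ht k => ?_
  · rcases le_total t b with h1 | h1
    · exact s1.schr a' ha'1 t ⟨ht.1, h1⟩ k
    · exact s2.schr a' ha'2 t ⟨by linarith, ht.2⟩ k
  · rcases le_total t b with h1 | h1
    · exact s1.wave a' ha'1 t ⟨ht.1, h1⟩ k
    · exact s2.wave a' ha'2 t ⟨by linarith, ht.2⟩ k

/-! ### Divergence of the sum of the time steps -/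

/-- The steps behave like `1/(n log n)`. They dominate the increments of `log (1 + log E)`, whose
derivative is `1/(E (1 + log E))`, and this function tends to infinity. -/
theorem exists_sum_timeStep_ge {θ E₀ L : ℝ} (hθ : 0 < θ) (hE : 1 ≤ E₀) (hL : 0 < L) (T : ℝ) :
    ∃ n : ℕ, T ≤ ∑ i ∈ Finset.range n, timeStep θ (E₀ + i * L) := by
  have hEi : ∀ i : ℕ, 1 ≤ E₀ + i * L := fun i => by
    have : 0 ≤ (i : ℝ) * L := by positivity
    linarith
  have hstep : ∀ i : ℕ, Real.log (1 + Real.log (E₀ + (i + 1 : ℕ) * L)) -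
      Real.log (1 + Real.log (E₀ + i * L)) ≤ L / θ ^ 2 * timeStep θ (E₀ + i * L) := by
    intro i
    set E := E₀ + i * L with hEdef
    have hE1 : 1 ≤ E := hEi i
    have e : E₀ + (i + 1 : ℕ) * L = E + L := by push_cast; rw [hEdef]; ring
    rw [e]
    have hl := Real.log_nonneg hE1
    have hl' : 0 ≤ Real.log (E + L) := Real.log_nonneg (by linarith)
    rw [← Real.log_div (by linarith) (by linarith)]
    refine (Real.log_le_sub_one_of_pos (by positivity)).trans ?_
    have h1 : Real.log (E + L) - Real.log E ≤ L / E := by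
      rw [← Real.log_div (by linarith) (by linarith)]
      refine (Real.log_le_sub_one_of_pos (by positivity)).trans (le_of_eq ?_)
      field_simp; ring
    have h2 : (1 + Real.log (E + L)) / (1 + Real.log E) - 1 =
        (Real.log (E + L) - Real.log E) / (1 + Real.log E) := by field_simp; ring
    rw [h2]
    calc _ ≤ (L / E) / (1 + Real.log E) := by gcongr
      _ = _ := by unfold timeStep; field_simp
  have hsum : ∀ n : ℕ, Real.log (1 + Real.log (E₀ + n * L)) - Real.log (1 + Real.log E₀) ≤
      L / θ ^ 2 * ∑ i ∈ Finset.range n, timeStep θ (E₀ + i * L) := by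
    intro n
    rw [Finset.mul_sum]
    refine le_trans (le_of_eq ?_) (Finset.sum_le_sum fun i _ => hstep i)
    rw [Finset.sum_range_sub (fun i : ℕ => Real.log (1 + Real.log (E₀ + i * L)))]
    simp
  have hlim : Tendsto (fun n : ℕ => Real.log (1 + Real.log (E₀ + n * L))) atTop atTop := by
    refine Real.tendsto_log_atTop.comp (tendsto_atTop_add_const_left _ _
      (Real.tendsto_log_atTop.comp (tendsto_atTop_add_const_left _ _ ?_)))
    exact tendsto_natCast_atTop_atTop.atTop_mul_const hL
  obtain ⟨n, hn⟩ := (hlim.eventually_ge_atTop (Real.log (1 + Real.log E₀) + L / θ ^ 2 * T)).exists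
  refine ⟨n, ?_⟩
  have h1 := hsum n
  have h2 : L / θ ^ 2 * T ≤ L / θ ^ 2 * ∑ i ∈ Finset.range n, timeStep θ (E₀ + i * L) := by linarith
  exact le_of_mul_le_mul_left h2 (by positivity)

/-! ### Global solutions -/

/-- Existence on `[-T, T]`, with bounds depending on the size of the data only. -/
theorem exists_sys_bound (hα : 0 < α) (hβ : 0 < β) (hαβ : ¬ ∃ m : ℤ, β / α = m) {R : ℝ} (hR : 1 ≤ R)
    (T : ℝ) :
    ∃ B : ℝ, R ≤ B ∧ ∀ x y ρ, ‖x‖ ≤ R → ‖y‖ ≤ R → |ρ| ≤ R →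
      ∃ f g, Sys α β ρ (-T) T f g ∧ f 0 = x ∧ g 0 = y ∧
        ∀ t ∈ Set.Icc (-T) T, ‖f t‖ ≤ B ∧ ‖g t‖ ≤ B := by
  obtain ⟨K, hK, hflow⟩ := exists_local_flow hα hβ hαβ
  -- With this `θ` the smallness condition of the local flow holds for the radius `2 M n`, which
  -- leaves room for the drift term `d n * |ρ|`.
  set θ : ℝ := 1 / (4 * K) with hθdef
  have hθ : 0 < θ := by positivity
  have hθ1 : θ ≤ 1 := by rw [hθdef, div_le_one (by positivity)]; linarith
  have hKθ : K * (4 * θ) = 1 := by rw [hθdef]; field_simp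
  -- In one step the wave part grows by at most `J / M n`, with `R` from the drift and `R²` from the
  -- source. The number `L` bounds the resulting increase of the square of the bound.
  set J : ℝ := R + R ^ 2 with hJ
  have hJ0 : 0 < J := by positivity
  set L : ℝ := 2 * J + J ^ 2 with hL
  have hL0 : 0 < L := by positivity
  set E : ℕ → ℝ := fun n => R ^ 2 + n * L with hEdef
  set M : ℕ → ℝ := fun n => Real.sqrt (E n) with hMdef
  set d : ℕ → ℝ := fun n => timeStep (θ ^ 2) (E n) with hd
  set τ : ℕ → ℝ := fun n => ∑ i ∈ Finset.range n, d i with hτ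
  have hER : ∀ n, R ^ 2 ≤ E n := fun n => by
    have : 0 ≤ (n : ℝ) * L := by positivity
    simp only [hEdef]; linarith
  have hE1 : ∀ n, 1 ≤ E n := fun n => (one_le_pow₀ hR).trans (hER n)
  have hMsq : ∀ n, M n ^ 2 = E n := fun n => Real.sq_sqrt (by linarith [hE1 n])
  have hMR : ∀ n, R ≤ M n := fun n => Real.le_sqrt_of_sq_le (hER n)
  have hM1 : ∀ n, 1 ≤ M n := fun n => hR.trans (hMR n)
  have hdpos : ∀ n, 0 < d n := fun n => timeStep_pos (by positivity) (hE1 n)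
  have hτsucc : ∀ n, τ (n + 1) = τ n + d n := fun n => Finset.sum_range_succ _ _
  have hdE : ∀ n, d n * E n ≤ 1 := fun n =>
    (timeStep_le (by positivity) (hE1 n)).trans (pow_le_one₀ (by positivity) (pow_le_one₀ hθ.le hθ1))
  have hd1 : ∀ n, d n ≤ 1 := fun n => by nlinarith [hdE n, hE1 n, hdpos n]
  have hq : ∀ n, Real.sqrt (gainSq (d n)) * M n ≤ 2 * θ := fun n => by
    have := sqrt_gainSq_mul_le hθ hθ1 (hM1 n)
    rwa [hMsq] at this
  have hsmall : ∀ n, K * (2 * M n * Real.sqrt (gainSq (d n))) ≤ 1 := fun n => by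
    calc _ = K * (2 * (Real.sqrt (gainSq (d n)) * M n)) := by ring
      _ ≤ K * (2 * (2 * θ)) := by have := hq n; gcongr
      _ = 1 := by rw [← hKθ]; ring
  have hgrow : ∀ n, M n + d n * R + K * Real.sqrt (gainSq (d n)) * R ^ 2 ≤ M (n + 1) := by
    intro n
    have hMn : 0 < M n := by linarith [hM1 n]
    have h1 : d n * R ≤ R / M n := by
      rw [le_div_iff₀ hMn]
      have : d n * M n ≤ d n * E n := by
        have := hdpos n
        rw [← hMsq]; gcongr; nlinarith [hM1 n]
      nlinarith [hdE n]
    have h2 : K * Real.sqrt (gainSq (d n)) * R ^ 2 ≤ R ^ 2 / M n := by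
      rw [le_div_iff₀ hMn]
      have h3 : K * (Real.sqrt (gainSq (d n)) * M n) ≤ 1 := by
        calc _ ≤ K * (2 * θ) := by have := hq n; gcongr
          _ ≤ 1 := by nlinarith
      nlinarith [sq_nonneg R]
    -- The square of the left side is `M n ^ 2 + 2J + J²/M n ^ 2`, and `M n ≥ 1`, so the increase is
    -- at most `L = 2J + J²`.
    have h4 : M n + J / M n ≤ M (n + 1) := by
      refine Real.le_sqrt_of_sq_le ?_
      have h5 : (M n + J / M n) ^ 2 = M n ^ 2 + 2 * J + J ^ 2 / M n ^ 2 := by field_simp; ring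
      have h6 : J ^ 2 / M n ^ 2 ≤ J ^ 2 := div_le_self (by positivity) (by nlinarith [hM1 n])
      have h7 : E (n + 1) = E n + L := by simp only [hEdef]; push_cast; ring
      rw [h5, hMsq, h7]
      rw [hMsq] at h6
      linarith
    calc _ ≤ M n + R / M n + R ^ 2 / M n := by linarith
      _ = M n + J / M n := by rw [hJ]; ring
      _ ≤ _ := h4
  have main : ∀ n : ℕ, ∀ x y ρ, ‖x‖ ≤ R → ‖y‖ ≤ R → |ρ| ≤ R →
      ∃ f g, Sys α β ρ (-τ (n + 1)) (τ (n + 1)) f g ∧ f 0 = x ∧ g 0 = y ∧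
        ∀ t ∈ Set.Icc (-τ (n + 1)) (τ (n + 1)), ‖f t‖ = ‖x‖ ∧ ‖g t‖ ≤ M (n + 1) := by
    intro n x y ρ hx hy hρ
    have hloc : ∀ n t₀ x' y', ‖x'‖ = ‖x‖ → ‖y'‖ ≤ M n → ∃ f g,
        Sys α β ρ (t₀ - d n) (t₀ + d n) f g ∧ f t₀ = x' ∧ g t₀ = y' ∧
        ∀ t ∈ Set.Icc (t₀ - d n) (t₀ + d n), ‖f t‖ = ‖x‖ ∧ ‖g t‖ ≤ M (n + 1) := by
      intro n t₀ x' y' hx' hy'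
      have hM0 := hM1 n
      obtain ⟨f, g, h1, -⟩ := hflow (2 * M n) (d n) t₀ (by positivity) (hdpos n) (hsmall n)
      have hdρ : d n * |ρ| ≤ d n * R := by have := hdpos n; gcongr
      have hb1 : ‖x'‖ ≤ 2 * M n := by rw [hx']; linarith [hMR n]
      have hb2 : ‖y'‖ + d n * |ρ| ≤ 2 * M n := by
        have : d n * R ≤ 1 * R := by have := hd1 n; gcongr
        linarith [hMR n]
      obtain ⟨hs, e1, e2, hb⟩ := h1 x' y' ρ hb1 hb2
      refine ⟨_, _, hs, e1, e2, fun t ht => ?_⟩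
      obtain ⟨e3, e4⟩ := hb t ht
      refine ⟨e3.trans hx', e4.trans ((le_trans ?_ (hgrow n)))⟩
      rw [hx']
      gcongr
    induction n with
    | zero =>
      have h0 : τ (0 + 1) = d 0 := by simp [hτ]
      obtain ⟨f, g, hs, e1, e2, hb⟩ := hloc 0 0 x y rfl (hy.trans (hMR 0))
      rw [h0]
      rw [zero_sub, zero_add] at hs hb
      exact ⟨f, g, hs, e1, e2, hb⟩
    | succ n ih =>
      obtain ⟨f, g, hs, e1, e2, hb⟩ := ih
      set r := τ (n + 1) with hr
      set δ := d (n + 1) with hδ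
      have hδ0 : 0 < δ := hdpos _
      have hr0 : 0 < r := by
        rw [hr, hτsucc]
        have : 0 ≤ τ n := Finset.sum_nonneg fun i _ => (hdpos i).le
        linarith [hdpos n]
      rw [hτsucc (n + 1), ← hr, ← hδ]
      have hMmono : M (n + 1) ≤ M (n + 1 + 1) := by
        have h1 := hgrow (n + 1)
        have h2 : 0 ≤ d (n + 1) * R := mul_nonneg hδ0.le (by linarith)
        have h3 : 0 ≤ K * Real.sqrt (gainSq (d (n + 1))) * R ^ 2 := by positivity
        linarith
      have mr : r ∈ Set.Icc (-r) r := ⟨by linarith, le_rfl⟩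
      have ml : -r ∈ Set.Icc (-r) r := ⟨le_rfl, by linarith⟩
      obtain ⟨f₁, g₁, hs₁, p₁, q₁, hb₁⟩ := hloc (n + 1) r (f r) (g r) (hb r mr).1 (hb r mr).2
      obtain ⟨f₂, g₂, hs₂, p₂, q₂, hb₂⟩ := hloc (n + 1) (-r) (f (-r)) (g (-r)) (hb _ ml).1 (hb _ ml).2
      -- The local solution around `r` extends to the left as far as `r - δ`. It is restricted so as
      -- not to start before `-r`.
      obtain ⟨F, G, hS, hFG, hFG₁⟩ := hs.glue hα hβ hαβ (a' := max (-r) (r - δ)) (u := r)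
        (hs₁.mono (Set.Icc_subset_Icc (le_max_right _ _) le_rfl)) (le_max_left _ _)
        (max_lt (by linarith) (by linarith)) (by linarith)
        ⟨max_le (by linarith) (by linarith), le_rfl⟩ p₁.symm q₁.symm
      obtain ⟨F', G', hS', hFG', hFG₁'⟩ := hs₂.glue hα hβ hαβ (a' := -r) (u := -r) hS (by linarith)
        (by linarith) (by linarith) ⟨le_rfl, by linarith⟩ (p₂.trans (hFG _ ml).1.symm)
        (q₂.trans (hFG _ ml).2.symm)
      have m0 : (0 : ℝ) ∈ Set.Icc (-r) r := ⟨by linarith, hr0.le⟩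
      have m0' : (0 : ℝ) ∈ Set.Icc (-r) (r + δ) := ⟨by linarith, by linarith⟩
      rw [show -(r + δ) = -r - δ by ring]
      refine ⟨F', G', hS', ?_, ?_, fun t ht => ?_⟩
      · rw [(hFG₁' 0 m0').1, (hFG 0 m0).1, e1]
      · rw [(hFG₁' 0 m0').2, (hFG 0 m0).2, e2]
      · rcases le_total t (-r) with h1 | h1
        · have ht' : t ∈ Set.Icc (-r - δ) (-r + δ) := ⟨ht.1, by linarith⟩
          rw [(hFG' t ht').1, (hFG' t ht').2]
          exact hb₂ t ht'
        · rw [(hFG₁' t ⟨h1, ht.2⟩).1, (hFG₁' t ⟨h1, ht.2⟩).2]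
          rcases le_total t r with h2 | h2
          · rw [(hFG t ⟨h1, h2⟩).1, (hFG t ⟨h1, h2⟩).2]
            exact ⟨(hb t ⟨h1, h2⟩).1, (hb t ⟨h1, h2⟩).2.trans hMmono⟩
          · have ht' : t ∈ Set.Icc (max (-r) (r - δ)) (r + δ) :=
              ⟨max_le (by linarith) (by linarith), ht.2⟩
            rw [(hFG₁ t ht').1, (hFG₁ t ht').2]
            exact hb₁ t ⟨by linarith, ht.2⟩
  obtain ⟨n, hn⟩ := exists_sum_timeStep_ge (θ := θ ^ 2) (E₀ := R ^ 2) (by positivity)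
    (one_le_pow₀ hR) hL0 T
  have hTn : T ≤ τ (n + 1) := by rw [hτsucc]; linarith [hdpos n, show T ≤ τ n from hn]
  refine ⟨M (n + 1), hMR _, fun x y ρ hx hy hρ => ?_⟩
  obtain ⟨f, g, hs, e1, e2, hb⟩ := main n x y ρ hx hy hρ
  have hsub : Set.Icc (-T) T ⊆ Set.Icc (-τ (n + 1)) (τ (n + 1)) :=
    Set.Icc_subset_Icc (by linarith) hTn
  exact ⟨f, g, hs.mono hsub, e1, e2, fun t ht =>
    ⟨(hb t (hsub ht)).1.le.trans (hx.trans (hMR _)), (hb t (hsub ht)).2⟩⟩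

/-- Lipschitz dependence on the data, for bounded solutions. -/
theorem exists_sys_lipschitz (hα : 0 < α) (hβ : 0 < β) (hαβ : ¬ ∃ m : ℤ, β / α = m) {B : ℝ}
    (hB : 1 ≤ B) {T : ℝ} (hT : 0 < T) :
    ∃ L : ℝ, 0 ≤ L ∧ ∀ ρ ρ' f g f' g', Sys α β ρ (-T) T f g → Sys α β ρ' (-T) T f' g' → |ρ| ≤ B →
      |ρ'| ≤ B → (∀ t ∈ Set.Icc (-T) T, ‖f t‖ ≤ B ∧ ‖g t‖ ≤ B) →
      (∀ t ∈ Set.Icc (-T) T, ‖f' t‖ ≤ B ∧ ‖g' t‖ ≤ B) → ∀ t ∈ Set.Icc (-T) T,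
      ‖f t - f' t‖ + ‖g t - g' t‖ ≤ L * (‖f 0 - f' 0‖ + ‖g 0 - g' 0‖ + |ρ - ρ'|) := by
  obtain ⟨K, hK, hflow⟩ := exists_local_flow hα hβ hαβ
  -- The solutions stay below `B`, so one step length works on all of `[-T, T]`. The radius `2B`
  -- leaves room for `δ |ρ|`, as `δ ≤ 1`.
  obtain ⟨δ, hδ, hδ1, hsmall⟩ := exists_small_step (L := K * (2 * B)) (by positivity)
  obtain ⟨n, hn⟩ := exists_nat_ge (T / δ)
  rw [div_le_iff₀ hδ] at hn
  refine ⟨(K + 1) ^ n, by positivity, fun ρ ρ' f g f' g' h h' hρ hρ' hb hb' t ht => ?_⟩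
  have key : ∀ ρ f g, Sys α β ρ (-T) T f g → ∀ s ∈ Set.Icc (-T) T, ∀ t ∈ Set.Icc (-T) T, |t - s| ≤ δ →
      ∀ f₁ g₁, Sys α β ρ (s - δ) (s + δ) f₁ g₁ → f₁ s = f s → g₁ s = g s → f₁ t = f t ∧ g₁ t = g t := by
    intro ρ f g h s hs t ht hst f₁ g₁ h₁ e1 e2
    have h3 := abs_le.1 hst
    exact (h₁.mono (Set.Icc_subset_Icc (le_max_right (-T) _) (min_le_right T _))).unique hα hβ hαβ
      (h.mono (Set.Icc_subset_Icc (le_max_left _ (s - δ)) (min_le_left _ (s + δ)))) (t₀ := s)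
      ⟨max_le hs.1 (by linarith), le_min hs.2 (by linarith)⟩ e1 e2 t
      ⟨max_le ht.1 (by linarith), le_min ht.2 (by linarith)⟩
  have hδρ : ∀ r : ℝ, δ * |r| ≤ |r| := fun r => mul_le_of_le_one_left (abs_nonneg r) hδ1
  -- The difference of the drifts is carried along in the propagated quantity; this is why the
  -- factor per step is `K + 1` and not `K`.
  have main := forall_of_steps (I := Set.Icc (-T) T) (δ := δ) (t₀ := 0)
    (P := fun n t => ‖f t - f' t‖ + ‖g t - g' t‖ + |ρ - ρ'| ≤
      (K + 1) ^ n * (‖f 0 - f' 0‖ + ‖g 0 - g' 0‖ + |ρ - ρ'|)) Set.ordConnected_Icc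
      ⟨by linarith, hT.le⟩ (by simp) (fun n s hs hP t ht hst => by
        obtain ⟨f₁, g₁, hex, hlip⟩ := hflow (2 * B) δ s (by positivity) hδ (by linarith)
        have c1 : ‖f s‖ ≤ 2 * B := by linarith [(hb s hs).1]
        have c2 : ‖g s‖ + δ * |ρ| ≤ 2 * B := by linarith [(hb s hs).2, hδρ ρ]
        have c1' : ‖f' s‖ ≤ 2 * B := by linarith [(hb' s hs).1]
        have c2' : ‖g' s‖ + δ * |ρ'| ≤ 2 * B := by linarith [(hb' s hs).2, hδρ ρ']
        obtain ⟨k1, k2, k3, -⟩ := hex (f s) (g s) ρ c1 c2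
        obtain ⟨k1', k2', k3', -⟩ := hex (f' s) (g' s) ρ' c1' c2'
        have h3 := abs_le.1 hst
        have l := hlip (f s) (g s) ρ (f' s) (g' s) ρ' c1 c2 c1' c2' t ⟨by linarith, by linarith⟩
        obtain ⟨j1, j2⟩ := key ρ f g h s hs t ht hst _ _ k1 k2 k3
        obtain ⟨j1', j2'⟩ := key ρ' f' g' h' s hs t ht hst _ _ k1' k2' k3'
        rw [j1, j2, j1', j2'] at l
        have l2 : K * (‖f s - f' s‖ + ‖g s - g' s‖ + δ * |ρ - ρ'|) ≤
            K * (‖f s - f' s‖ + ‖g s - g' s‖ + |ρ - ρ'|) := by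
          gcongr; exact hδρ _
        have l3 : (K + 1) * (‖f s - f' s‖ + ‖g s - g' s‖ + |ρ - ρ'|) ≤
            (K + 1) * ((K + 1) ^ n * (‖f 0 - f' 0‖ + ‖g 0 - g' 0‖ + |ρ - ρ'|)) := by gcongr
        rw [pow_succ]
        linarith [norm_nonneg (f s - f' s), norm_nonneg (g s - g' s)]) n t ht
      (by rw [sub_zero]; exact (abs_le.2 ht).trans hn)
  linarith [abs_nonneg (ρ - ρ')]

end Zakharov

end

noncomputable section

namespace Zakharov

/-! ### Diagonal unitary groups -/

theorem enorm_exp_I_mul (a t : ℝ) (z : ℂ) : ‖Complex.exp (Complex.I * a * t) * z‖ₑ = ‖z‖ₑ :=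
  YSpace.enorm_exp_mul a t z

/-- The action at time `t` of the unitary group on `ℓ²(ℤ)` with frequencies `θ`. -/
def L2.rot (θ : ℤ → ℝ) (t : ℝ) (x : L2) : L2 :=
  toL2 (fun k => Complex.exp (Complex.I * θ k * t) * x k) (by
    simp only [enorm_exp_I_mul]; exact L2.l2_ne_top x)

theorem L2.rot_apply (θ : ℤ → ℝ) (t : ℝ) (x : L2) (k : ℤ) :
    L2.rot θ t x k = Complex.exp (Complex.I * θ k * t) * x k := rfl

theorem L2.norm_rot (θ : ℤ → ℝ) (t : ℝ) (x : L2) : ‖L2.rot θ t x‖ = ‖x‖ := by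
  have h : ENNReal.ofReal ‖L2.rot θ t x‖ = ENNReal.ofReal ‖x‖ := by
    rw [L2.ofReal_norm, L2.ofReal_norm]
    simp only [L2.rot_apply, enorm_exp_I_mul]
  rwa [ENNReal.ofReal_eq_ofReal_iff (norm_nonneg _) (norm_nonneg _)] at h

theorem L2.rot_sub (θ : ℤ → ℝ) (t : ℝ) (x y : L2) :
    L2.rot θ t (x - y) = L2.rot θ t x - L2.rot θ t y := by
  ext k
  rw [lp.coeFn_sub, Pi.sub_apply, L2.rot_apply, L2.rot_apply, L2.rot_apply, lp.coeFn_sub,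
    Pi.sub_apply, mul_sub]

theorem L2.rot_zero (θ : ℤ → ℝ) (x : L2) : L2.rot θ 0 x = x := by
  ext k; simp [L2.rot_apply]

/-- The group is isometric, and strongly continuous by dominated convergence in the coefficients. It
is not norm continuous in general, so the variation of the vector and that of the group are treated
separately. -/
theorem L2.continuous_rot (θ : ℤ → ℝ) {f : ℝ → L2} (hf : Continuous f) :
    Continuous fun t => L2.rot θ t (f t) := by
  rw [continuous_iff_continuousAt]
  intro t
  have h1 : Tendsto (fun s => ‖f s - f t‖) (𝓝 t) (𝓝 0) := by
    have := ((hf.tendsto t).sub_const (f t)).norm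
    simpa using this
  have h2 : Tendsto (fun s => ‖L2.rot θ s (f t) - L2.rot θ t (f t)‖) (𝓝 t) (𝓝 0) := by
    have hsq : Tendsto (fun s => ‖L2.rot θ s (f t) - L2.rot θ t (f t)‖ ^ 2) (𝓝 t) (𝓝 0) := by
      simp only [L2.norm_sq]
      rw [← tsum_zero (β := ℤ)]
      refine tendsto_tsum_of_dominated_convergence ((L2.summable_sq (f t)).mul_left 4) (fun k => ?_)
        (Eventually.of_forall fun s k => ?_)
      · have h : Continuous fun s : ℝ => L2.rot θ s (f t) k - L2.rot θ t (f t) k := by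
          simp only [L2.rot_apply]; fun_prop
        have h3 := ((h.tendsto t).norm).pow 2
        simpa [lp.coeFn_sub] using h3
      · have hk : ∀ r, ‖L2.rot θ r (f t) k‖ = ‖f t k‖ := fun r => by
          rw [L2.rot_apply, norm_mul, norm_exp_I_mul, one_mul]
        rw [lp.coeFn_sub, Pi.sub_apply, norm_pow, norm_norm]
        have h4 : ‖L2.rot θ s (f t) k - L2.rot θ t (f t) k‖ ≤ 2 * ‖f t k‖ :=
          (norm_sub_le _ _).trans (by rw [hk, hk]; linarith)
        calc _ ≤ (2 * ‖f t k‖) ^ 2 := by gcongr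
          _ = _ := by ring
    have := hsq.sqrt
    simpa [Real.sqrt_sq (norm_nonneg _)] using this
  rw [ContinuousAt, tendsto_iff_norm_sub_tendsto_zero]
  refine squeeze_zero (fun _ => norm_nonneg _) (fun s => ?_) (by simpa using h1.add h2)
  calc ‖L2.rot θ s (f s) - L2.rot θ t (f t)‖
      = ‖L2.rot θ s (f s - f t) + (L2.rot θ s (f t) - L2.rot θ t (f t))‖ := by
        rw [L2.rot_sub]; congr 1; abel
    _ ≤ _ := (norm_add_le _ _).trans (by rw [L2.norm_rot])

/-! ### Sobolev norms -/

/-- The normalisation of the Sobolev norms. -/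
def sobC : ℝ := (2 * Real.pi) ^ (-(1 / 2) : ℝ)

theorem sobC_pos : 0 < sobC := by unfold sobC; positivity

theorem sobC_le_one : sobC ≤ 1 := by
  refine Real.rpow_le_one_of_one_le_of_nonpos ?_ (by norm_num)
  linarith [Real.pi_gt_three]

theorem sobolevNorm_eq (s : ℝ) (f : Coeffs) :
    sobolevNorm s f = ENNReal.ofReal sobC *
      l2 Measure.count fun k : ℤ => ENNReal.ofReal (bracket k ^ s * ‖f k‖) := by
  unfold sobolevNorm l2 sobC
  rw [lintegral_count]
  congr 3
  ext k
  beta_reduce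
  rw [ENNReal.ofReal_mul (p := bracket k ^ s) (by have := bracket_pos k; positivity), mul_pow, _root_.ofReal_norm,
    ← ENNReal.ofReal_pow (by have := bracket_pos k; positivity), ← Real.rpow_natCast,
    ← Real.rpow_mul (bracket_pos _).le, show s * ((2 : ℕ) : ℝ) = 2 * s by push_cast; ring]

theorem sobolevNorm_le (s : ℝ) {f : Coeffs} {x : L2} {C : ℝ} (hC : 0 ≤ C)
    (h : ∀ k : ℤ, bracket k ^ s * ‖f k‖ ≤ C * ‖x k‖) : sobolevNorm s f ≤ ENNReal.ofReal (C * ‖x‖) := by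
  rw [sobolevNorm_eq, ENNReal.ofReal_mul hC, L2.ofReal_norm,
    ← l2_const_mul (ENNReal.ofReal C) (measurable_of_countable _)]
  have h1 : ENNReal.ofReal sobC ≤ 1 := ENNReal.ofReal_le_one.2 sobC_le_one
  refine (mul_le_mul' h1 (l2_mono (g := fun k => ENNReal.ofReal C * ‖x k‖ₑ) fun k => ?_)).trans
    (one_mul _).le
  rw [← _root_.ofReal_norm, ← ENNReal.ofReal_mul hC]
  exact ENNReal.ofReal_le_ofReal (h k)

theorem l2_le_sobolevNorm (s : ℝ) {f x : Coeffs} {C : ℝ} (hC : 0 ≤ C)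
    (h : ∀ k : ℤ, ‖x k‖ ≤ C * (bracket k ^ s * ‖f k‖)) :
    l2 Measure.count (fun k => ‖x k‖ₑ) ≤ ENNReal.ofReal (C / sobC) * sobolevNorm s f := by
  have h1 := sobC_pos
  rw [sobolevNorm_eq, ← mul_assoc, ← ENNReal.ofReal_mul (by positivity), div_mul_cancel₀ _ h1.ne',
    ← l2_const_mul (ENNReal.ofReal C) (measurable_of_countable _)]
  refine l2_mono fun k => ?_
  rw [← _root_.ofReal_norm, ← ENNReal.ofReal_mul hC]
  exact ENNReal.ofReal_le_ofReal (h k)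

/-! ### The first order form of the system -/

/-- The frequency of the wave flow, with the value `1` at the zero mode. -/
def waveFreq (β : ℝ) (k : ℤ) : ℝ := if k = 0 then 1 else β * |(k : ℝ)|

theorem waveFreq_pos {β : ℝ} (hβ : 0 < β) (k : ℤ) : 0 < waveFreq β k := by
  unfold waveFreq
  split_ifs with h
  · exact one_pos
  · have : (k : ℝ) ≠ 0 := by exact_mod_cast h
    positivity

theorem waveFreq_neg (β : ℝ) (k : ℤ) : waveFreq β (-k) = waveFreq β k := by
  simp [waveFreq]

theorem waveFreq_le {β : ℝ} (hβ : 0 < β) (k : ℤ) : waveFreq β k ≤ (1 + β) * bracket k := by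
  have h1 := one_le_bracket (k : ℝ)
  have h2 := abs_le_bracket (k : ℝ)
  unfold waveFreq
  split_ifs with h
  · nlinarith
  · nlinarith

theorem bracket_le_waveFreq {β : ℝ} (hβ : 0 < β) (k : ℤ) :
    bracket k ≤ (1 + 2 / β) * waveFreq β k := by
  unfold waveFreq
  split_ifs with h
  · have : 0 < 2 / β := by positivity
    simp [h, bracket]; linarith
  · have h1 : (1 : ℝ) ≤ |(k : ℝ)| := by exact_mod_cast Int.one_le_abs h
    have h2 := bracket_le_one_add_abs (k : ℝ)
    have h3 : (1 + 2 / β) * (β * |(k : ℝ)|) = β * |(k : ℝ)| + 2 * |(k : ℝ)| := by field_simp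
    rw [h3]
    nlinarith [mul_pos hβ (by linarith : (0 : ℝ) < |(k : ℝ)|)]

/-- The density with first order wave component `w`. -/
def density (w : Coeffs) (k : ℤ) : ℂ :=
  ((bracket k ^ (1 / 2 : ℝ) : ℝ) : ℂ) * (w k + starRingEnd ℂ (w (-k)))

/-- The time derivative of the density with first order wave component `w`. -/
def densityDeriv (β : ℝ) (w : Coeffs) (k : ℤ) : ℂ :=
  Complex.I * ((waveFreq β k * bracket k ^ (1 / 2 : ℝ) : ℝ) : ℂ) * (w k - starRingEnd ℂ (w (-k)))

/-- The triple with first component `v` and first order wave component `w`. -/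
def ofHalfWave (β : ℝ) (v w : L2) : Triple := (v, density w, densityDeriv β w)

theorem ofHalfWave_sub (β : ℝ) (v w v' w' : L2) :
    ofHalfWave β v w - ofHalfWave β v' w' = ofHalfWave β (v - v') (w - w') := by
  unfold ofHalfWave
  refine Prod.ext ?_ (Prod.ext ?_ ?_) <;> funext k <;>
    simp only [density, densityDeriv, Prod.fst_sub, Prod.snd_sub, Pi.sub_apply, lp.coeFn_sub, map_sub] <;> ring

theorem bracket_rpow_mul_half {s : ℝ} (k : ℤ) :
    bracket k ^ s * bracket k ^ (1 / 2 : ℝ) = bracket k ^ (s + 1 / 2) :=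
  (Real.rpow_add (bracket_pos _) _ _).symm

theorem phaseNorm_ofHalfWave_le {β : ℝ} (hβ : 0 < β) (v w : L2) :
    phaseNorm (ofHalfWave β v w) ≤ ENNReal.ofReal ((4 + 2 * β) * (‖v‖ + ‖w‖)) := by
  have hb : ∀ k : ℤ, 0 < bracket k := fun k => bracket_pos _
  have h1 : sobolevNorm 0 (ofHalfWave β v w).1 ≤ ENNReal.ofReal (1 * ‖v‖) :=
    sobolevNorm_le 0 zero_le_one fun k => by simp [ofHalfWave]
  have h2 : sobolevNorm (-(1 / 2)) (ofHalfWave β v w).2.1 ≤ ENNReal.ofReal (1 * ‖w + L2.refl w‖) :=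
    sobolevNorm_le _ zero_le_one fun k => by
      have := hb k
      simp only [ofHalfWave, density]
      rw [norm_mul, Complex.norm_real, Real.norm_of_nonneg (by positivity), ← mul_assoc,
        bracket_rpow_mul_half, lp.coeFn_add, Pi.add_apply, L2.refl_apply]
      norm_num
  have h3 : sobolevNorm (-(3 / 2)) (ofHalfWave β v w).2.2 ≤
      ENNReal.ofReal ((1 + β) * ‖w - L2.refl w‖) :=
    sobolevNorm_le _ (by positivity) fun k => by
      have := hb k
      have hf := waveFreq_pos hβ k
      simp only [ofHalfWave, densityDeriv]
      rw [norm_mul, norm_mul, Complex.norm_I, Complex.norm_real,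
        Real.norm_of_nonneg (by positivity), ← mul_assoc, one_mul, lp.coeFn_sub, Pi.sub_apply,
        L2.refl_apply]
      gcongr
      rw [mul_comm (waveFreq β k), ← mul_assoc, bracket_rpow_mul_half,
        show (-(3 / 2) + 1 / 2 : ℝ) = -1 by norm_num, Real.rpow_neg_one, inv_mul_le_iff₀ this,
        mul_comm (bracket _)]
      exact waveFreq_le hβ k
  have h4 : ‖w + L2.refl w‖ ≤ 2 * ‖w‖ := (norm_add_le _ _).trans (by rw [L2.norm_refl]; linarith)
  have h5 : ‖w - L2.refl w‖ ≤ 2 * ‖w‖ := (norm_sub_le _ _).trans (by rw [L2.norm_refl]; linarith)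
  unfold phaseNorm
  refine (add_le_add (add_le_add h1 h2) h3).trans ?_
  rw [← ENNReal.ofReal_add (by positivity) (by positivity),
    ← ENNReal.ofReal_add (by positivity) (by positivity)]
  refine ENNReal.ofReal_le_ofReal ?_
  nlinarith [norm_nonneg v, norm_nonneg w, mul_nonneg hβ.le (norm_nonneg v)]

theorem ofHalfWave_mem {β : ℝ} (hβ : 0 < β) (v w : L2) : ofHalfWave β v w ∈ PhaseSpace := by
  refine ⟨(phaseNorm_ofHalfWave_le hβ v w).trans_lt ENNReal.ofReal_lt_top, fun k => ?_, fun k => ?_⟩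
  · simp only [ofHalfWave, density, map_mul, map_add, Complex.conj_conj, Complex.conj_ofReal, neg_neg,
      Int.cast_neg, bracket_neg]
    ring
  · simp only [ofHalfWave, densityDeriv, map_mul, map_sub, Complex.conj_conj, Complex.conj_ofReal, neg_neg,
      Int.cast_neg, bracket_neg, waveFreq_neg, Complex.conj_I]
    ring

/-- The coefficients of the first order wave component. -/
def halfWave (β : ℝ) (n m : Coeffs) (k : ℤ) : ℂ :=
  ((bracket k ^ (-(1 / 2) : ℝ) / 2 : ℝ) : ℂ) * (n k - Complex.I * m k / (waveFreq β k : ℂ))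

/-- In `n - i m / ω` the reflected half wave cancels and `2 ⟨k⟩^{1/2} w` is left. The convention `ω
= 1` at the zero mode makes the inversion valid there too. -/
theorem halfWave_density {β : ℝ} (hβ : 0 < β) (w : Coeffs) (k : ℤ) :
    halfWave β (density w) (densityDeriv β w) k = w k := by
  have h1 : (waveFreq β k : ℂ) ≠ 0 := by exact_mod_cast (waveFreq_pos hβ k).ne'
  have h2 : ((bracket k ^ (-(1 / 2) : ℝ) : ℝ) : ℂ) * ((bracket k ^ (1 / 2 : ℝ) : ℝ) : ℂ) = 1 := by
    rw [← Complex.ofReal_mul, bracket_rpow_mul_half]; norm_num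
  set z := w k
  set z' := starRingEnd ℂ (w (-k)) with hz'
  have h3 : Complex.I * (Complex.I * ((waveFreq β k * bracket k ^ (1 / 2 : ℝ) : ℝ) : ℂ) * (z - z')) /
      (waveFreq β k : ℂ) = -((bracket k ^ (1 / 2 : ℝ) : ℝ) : ℂ) * (z - z') := by
    push_cast
    field_simp
    rw [Complex.I_sq]; ring
  simp only [halfWave, density, densityDeriv]
  rw [h3]
  push_cast at h2 ⊢
  linear_combination z * h2

theorem norm_halfWave_le {β : ℝ} (hβ : 0 < β) (n m : Coeffs) (k : ℤ) :
    ‖halfWave β n m k‖ ≤ bracket k ^ (-(1 / 2) : ℝ) * ‖n k‖ +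
      (1 + 2 / β) * (bracket k ^ (-(3 / 2) : ℝ) * ‖m k‖) := by
  have hb := bracket_pos (k : ℝ)
  have hf := waveFreq_pos hβ k
  have h1 : ‖n k - Complex.I * m k / (waveFreq β k : ℂ)‖ ≤ ‖n k‖ + ‖m k‖ / waveFreq β k := by
    refine (norm_sub_le _ _).trans (le_of_eq ?_)
    rw [norm_div, norm_mul, Complex.norm_I, one_mul, Complex.norm_real, Real.norm_of_nonneg hf.le]
  have h2 : bracket k ^ (-(1 / 2) : ℝ) / waveFreq β k ≤
      (1 + 2 / β) * bracket k ^ (-(3 / 2) : ℝ) := by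
    rw [div_le_iff₀ hf, show (-(1 / 2) : ℝ) = -(3 / 2) + 1 by norm_num, Real.rpow_add hb,
      Real.rpow_one]
    have := bracket_le_waveFreq hβ k
    have h3 : (0 : ℝ) ≤ bracket k ^ (-(3 / 2) : ℝ) := by positivity
    nlinarith
  rw [halfWave, norm_mul, Complex.norm_real, Real.norm_of_nonneg (by positivity)]
  calc _ ≤ bracket k ^ (-(1 / 2) : ℝ) * (‖n k‖ + ‖m k‖ / waveFreq β k) := by
        gcongr
        linarith [Real.rpow_pos_of_pos hb (-(1 / 2))]
    _ = bracket k ^ (-(1 / 2) : ℝ) * ‖n k‖ + bracket k ^ (-(1 / 2) : ℝ) / waveFreq β k * ‖m k‖ := by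
        ring
    _ ≤ _ := by
        rw [← mul_assoc]
        gcongr

theorem l2_halfWave_le {β : ℝ} (hβ : 0 < β) (z : Triple) :
    l2 Measure.count (fun k => ‖z.1 k‖ₑ) + l2 Measure.count (fun k => ‖halfWave β z.2.1 z.2.2 k‖ₑ) ≤
      ENNReal.ofReal ((1 + 2 / β) / sobC) * phaseNorm z := by
  have hβ' : 0 < 2 / β := by positivity
  have hc := sobC_pos
  have h1 := l2_le_sobolevNorm 0 (f := z.1) (x := z.1) zero_le_one fun k => by simp
  have h2 := l2_le_sobolevNorm (-(1 / 2)) (f := z.2.1) (C := 1)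
    (x := fun k => ((bracket k ^ (-(1 / 2) : ℝ) : ℝ) : ℂ) * z.2.1 k) zero_le_one fun k => by
      have := bracket_pos (k : ℝ)
      rw [norm_mul, Complex.norm_real, Real.norm_of_nonneg (by positivity), one_mul]
  have h3 := l2_le_sobolevNorm (-(3 / 2)) (f := z.2.2) (C := 1 + 2 / β)
    (x := fun k => (((1 + 2 / β) * bracket k ^ (-(3 / 2) : ℝ) : ℝ) : ℂ) * z.2.2 k) (by positivity)
    fun k => by
      have := bracket_pos (k : ℝ)
      rw [norm_mul, Complex.norm_real, Real.norm_of_nonneg (by positivity), mul_assoc]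
  have h4 : l2 Measure.count (fun k => ‖halfWave β z.2.1 z.2.2 k‖ₑ) ≤
      l2 Measure.count (fun k : ℤ => ‖((bracket k ^ (-(1 / 2) : ℝ) : ℝ) : ℂ) * z.2.1 k‖ₑ) +
      l2 Measure.count
        (fun k : ℤ => ‖(((1 + 2 / β) * bracket k ^ (-(3 / 2) : ℝ) : ℝ) : ℂ) * z.2.2 k‖ₑ) := by
    refine le_trans (l2_mono fun k => ?_)
      (l2_add_le (measurable_of_countable _) (measurable_of_countable _))
    have := bracket_pos (k : ℝ)
    rw [← _root_.ofReal_norm, ← _root_.ofReal_norm, ← _root_.ofReal_norm,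
      ← ENNReal.ofReal_add (norm_nonneg _) (norm_nonneg _), norm_mul, norm_mul, Complex.norm_real,
      Complex.norm_real, Real.norm_of_nonneg (by positivity), Real.norm_of_nonneg (by positivity),
      mul_assoc]
    exact ENNReal.ofReal_le_ofReal (norm_halfWave_le hβ _ _ k)
  have h5 : ENNReal.ofReal (1 / sobC) ≤ ENNReal.ofReal ((1 + 2 / β) / sobC) :=
    ENNReal.ofReal_le_ofReal (by gcongr; linarith)
  unfold phaseNorm
  rw [mul_add, mul_add, add_assoc]
  exact add_le_add (h1.trans (mul_le_mul' h5 le_rfl))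
    (h4.trans (add_le_add (h2.trans (mul_le_mul' h5 le_rfl)) h3))

/-- The equivalence constant of the norms. -/
def phaseC (β : ℝ) : ℝ := (1 + 2 / β) / sobC

theorem phaseC_nonneg {β : ℝ} (hβ : 0 < β) : 0 ≤ phaseC β := by
  have := sobC_pos
  unfold phaseC; positivity

theorem norm_le_phaseNorm_ofHalfWave {β : ℝ} (hβ : 0 < β) (v w : L2) :
    ENNReal.ofReal (‖v‖ + ‖w‖) ≤ ENNReal.ofReal (phaseC β) * phaseNorm (ofHalfWave β v w) := by
  have h := l2_halfWave_le hβ (ofHalfWave β v w)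
  simp only [ofHalfWave, halfWave_density hβ] at h
  rw [ENNReal.ofReal_add (norm_nonneg _) (norm_nonneg _), L2.ofReal_norm, L2.ofReal_norm]
  exact h

/-- Reality of `n` and `m` makes the reflected half wave equal to `n + i m / ω` up to the common
weight, so `n` and `m` are recovered from a single sequence `w`. -/
theorem exists_ofHalfWave {β : ℝ} (hβ : 0 < β) {z : Triple} (hz : z ∈ PhaseSpace) :
    ∃ v w, z = ofHalfWave β v w := by
  have hfin := ne_top_of_le_ne_top (ENNReal.mul_ne_top ENNReal.ofReal_ne_top hz.1.ne)
    (l2_halfWave_le hβ z)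
  obtain ⟨h1, h2⟩ := ENNReal.add_ne_top.1 hfin
  refine ⟨toL2 z.1 h1, toL2 (halfWave β z.2.1 z.2.2) h2, ?_⟩
  have hre : ∀ k, starRingEnd ℂ (halfWave β z.2.1 z.2.2 (-k)) =
      ((bracket k ^ (-(1 / 2) : ℝ) / 2 : ℝ) : ℂ) *
        (z.2.1 k + Complex.I * z.2.2 k / (waveFreq β k : ℂ)) := fun k => by
    have e1 := hz.2.1 (-k)
    have e2 := hz.2.2 (-k)
    rw [neg_neg] at e1 e2
    rw [e1, e2]
    simp only [halfWave, map_mul, map_sub, map_div₀, Complex.conj_ofReal, Complex.conj_I,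
      Int.cast_neg, bracket_neg, waveFreq_neg]
    ring
  have hone : ∀ k : ℤ, ((bracket k ^ (1 / 2 : ℝ) : ℝ) : ℂ) *
      ((bracket k ^ (-(1 / 2) : ℝ) : ℝ) : ℂ) = 1 := fun k => by
    rw [mul_comm, ← Complex.ofReal_mul, bracket_rpow_mul_half]; norm_num
  refine Prod.ext rfl (Prod.ext (funext fun k => ?_) (funext fun k => ?_))
  · simp only [ofHalfWave, density, toL2_apply]
    rw [hre, halfWave]
    have := hone k
    push_cast at this ⊢
    linear_combination -z.2.1 k * this
  · simp only [ofHalfWave, densityDeriv, toL2_apply]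
    rw [hre, halfWave]
    have := hone k
    have h3 : (waveFreq β k : ℂ) ≠ 0 := by exact_mod_cast (waveFreq_pos hβ k).ne'
    push_cast at this ⊢
    have h4 : ∀ a b X : ℂ, Complex.I * ((waveFreq β k : ℂ) * a) * (b / 2 * (X -
        Complex.I * z.2.2 k / (waveFreq β k : ℂ)) - b / 2 * (X + Complex.I * z.2.2 k / (waveFreq β k : ℂ)))
        = a * b * z.2.2 k := fun a b X => by
      field_simp
      ring_nf
      rw [Complex.I_sq]; ring
    rw [h4, this, one_mul]

end Zakharov

end

noncomputable section

namespace Zakharov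

/-! ### Bourgain spaces and interaction variables -/

theorem l2_mu_translate {B : ℤ × ℝ → ℝ≥0∞} (hB : Measurable B) (θ : ℤ → ℝ) :
    l2 mu (fun x => B (x.1, x.2 - θ x.1)) = l2 mu B := by
  have h : Measurable fun x : ℤ × ℝ => B (x.1, x.2 - θ x.1) :=
    measurable_mu fun k => by fun_prop
  unfold l2
  rw [lintegral_mu (h.pow_const 2), lintegral_mu (hB.pow_const 2)]
  congr 1
  refine tsum_congr fun k => ?_
  exact lintegral_sub_right_eq_self (fun τ => B (k, τ) ^ 2) (θ k)

/-- Passing to interaction variables translates the time frequency by `θ k`, and `Y` measures the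
distance to the translated point. Two frequencies are allowed because the density is the sum of
waves travelling in opposite directions. -/
theorem yNorm_le {w : ℤ → ℝ → ℝ} {s : ℝ} {F : ℤ → ℝ → ℂ} {A A' : ℤ × ℝ → ℝ≥0∞} {θ θ' : ℤ → ℝ}
    (hA : Measurable A) (hA' : Measurable A') (hw : ∀ k τ, |w k τ| ≤ |τ - θ k|)
    (hw' : ∀ k τ, |w k τ| ≤ |τ - θ' k|)
    (hF : ∀ (k : ℤ) (τ : ℝ), ENNReal.ofReal (bracket k ^ s) * ‖F k τ‖ₑ ≤ A (k, τ - θ k) + A' (k, τ - θ' k)) :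
    yNorm w s F ≤ yn A + yn A' := by
  have hm : ∀ {B : ℤ × ℝ → ℝ≥0∞}, Measurable B → ∀ θ : ℤ → ℝ,
      Measurable fun x : ℤ × ℝ => B (x.1, x.2 - θ x.1) := fun hB θ =>
    measurable_mu fun k => by fun_prop
  have h1 : bourgainNorm w s (1 / 2) F ≤ l2 mu (wt A) + l2 mu (wt A') := by
    rw [← l2_mu_translate (measurable_wt hA) θ, ← l2_mu_translate (measurable_wt hA') θ']
    refine le_trans ?_ (l2_add_le (hm (measurable_wt hA) θ) (hm (measurable_wt hA') θ'))
    unfold bourgainNorm l2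
    have hm2 : Measurable fun x : ℤ × ℝ =>
        (wt A (x.1, x.2 - θ x.1) + wt A' (x.1, x.2 - θ' x.1)) ^ 2 :=
      ((hm (measurable_wt hA) θ).add (hm (measurable_wt hA') θ')).pow_const 2
    rw [lintegral_mu hm2]
    refine ENNReal.rpow_le_rpow (ENNReal.tsum_le_tsum fun k => lintegral_mono fun τ => ?_) (by norm_num)
    have hb := bracket_pos (k : ℝ)
    have e : ENNReal.ofReal (bracket k ^ (2 * s) * bracket (w k τ) ^ (2 * (1 / 2) : ℝ)) * ‖F k τ‖ₑ ^ 2 =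
        (jb (w k τ) ^ (1 / 2 : ℝ) * (ENNReal.ofReal (bracket k ^ s) * ‖F k τ‖ₑ)) ^ 2 := by
      rw [mul_pow, mul_pow, jb_half_sq, ENNReal.ofReal_mul (by positivity),
        ← ENNReal.ofReal_pow (by positivity), ← Real.rpow_natCast, ← Real.rpow_mul hb.le,
        show s * ((2 : ℕ) : ℝ) = 2 * s by push_cast; ring]
      norm_num [jb]
      ring
    rw [e]
    refine pow_le_pow_left' ?_ 2
    have e1 := ENNReal.rpow_le_rpow (jb_le_jb (hw k τ)) (by norm_num : (0 : ℝ) ≤ 1 / 2)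
    have e2 := ENNReal.rpow_le_rpow (jb_le_jb (hw' k τ)) (by norm_num : (0 : ℝ) ≤ 1 / 2)
    calc _ ≤ jb (w k τ) ^ (1 / 2 : ℝ) * (A (k, τ - θ k) + A' (k, τ - θ' k)) := by
          gcongr; exact hF k τ
      _ ≤ _ := by
          rw [mul_add]
          exact add_le_add (mul_le_mul' e1 le_rfl) (mul_le_mul' e2 le_rfl)
  have h2 : (∑' k : ℤ, (∫⁻ τ : ℝ, ENNReal.ofReal (bracket k ^ s) * ‖F k τ‖ₑ) ^ 2) ^ (1 / 2 : ℝ) ≤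
      l2l1 A + l2l1 A' := by
    refine le_trans ?_ (l2_add_le (measurable_of_countable _) (measurable_of_countable _))
    unfold l2
    rw [lintegral_count]
    refine ENNReal.rpow_le_rpow (ENNReal.tsum_le_tsum fun k => pow_le_pow_left' ?_ 2) (by norm_num)
    refine (lintegral_mono fun τ => hF k τ).trans (le_of_eq ?_)
    rw [lintegral_add_left (by fun_prop)]
    exact congrArg₂ (· + ·) (lintegral_sub_right_eq_self (fun τ => A (k, τ)) (θ k))
      (lintegral_sub_right_eq_self (fun τ => A' (k, τ)) (θ' k))
  unfold yNorm yn
  refine (add_le_add h1 h2).trans (le_of_eq ?_)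
  ring

theorem YSpace.integral_translate (A : YSpace) (θ t : ℝ) (k : ℤ) :
    ∫ τ : ℝ, Complex.exp (Complex.I * τ * t) * A (k, τ - θ) =
      Complex.exp (Complex.I * θ * t) * ev A t k := by
  rw [ev_apply, ← integral_const_mul,
    ← integral_sub_right_eq_self (fun τ : ℝ => Complex.exp (Complex.I * θ * t) *
      (Complex.exp (Complex.I * τ * t) * A (k, τ))) θ]
  refine integral_congr_ae (Eventually.of_forall fun τ => ?_)
  simp only
  rw [← mul_assoc, ← Complex.exp_add]
  congr 2
  push_cast; ring

/-- Elements of `Y` in interaction variables give elements of the Bourgain spaces. -/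
theorem memY_of_ev {w : ℤ → ℝ → ℝ} {s a b : ℝ} {f : ℝ → Coeffs} {θ θ' : ℤ → ℝ} (A A' : YSpace)
    (hw : ∀ k τ, |w k τ| ≤ |τ - θ k|) (hw' : ∀ k τ, |w k τ| ≤ |τ - θ' k|)
    (hf : ∀ t ∈ Set.Icc a b, ∀ k : ℤ, f t k = ((bracket k ^ (-s) : ℝ) : ℂ) *
      (Complex.exp (Complex.I * θ k * t) * YSpace.ev A t k +
        Complex.exp (Complex.I * θ' k * t) * YSpace.ev A' t k)) : MemY w s a b f := by
  have hA := A.measurable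
  have hA' := A'.measurable
  refine ⟨fun k τ => (2 * Real.pi : ℂ) * (((bracket k ^ (-s) : ℝ) : ℂ) *
    (A (k, τ - θ k) + A' (k, τ - θ' k))), fun k => ?_, ?_, fun t ht k => ?_⟩
  · exact Measurable.aestronglyMeasurable (by fun_prop)
  · refine lt_of_le_of_lt (yNorm_le (A := fun x => ENNReal.ofReal (2 * Real.pi) * ‖A x‖ₑ)
      (A' := fun x => ENNReal.ofReal (2 * Real.pi) * ‖A' x‖ₑ) (by fun_prop) (by fun_prop)
      hw hw' fun k τ => ?_) ?_
    · have hb := bracket_pos (k : ℝ)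
      have h1 : ‖(2 * Real.pi : ℂ)‖ₑ = ENNReal.ofReal (2 * Real.pi) := by
        rw [← _root_.ofReal_norm, show (2 * Real.pi : ℂ) = ((2 * Real.pi : ℝ) : ℂ) by push_cast; ring,
          Complex.norm_real, Real.norm_of_nonneg (by positivity)]
      have h2 : ENNReal.ofReal (bracket k ^ s) * ‖((bracket k ^ (-s) : ℝ) : ℂ)‖ₑ = 1 := by
        rw [← _root_.ofReal_norm, Complex.norm_real, Real.norm_of_nonneg (by positivity),
          ← ENNReal.ofReal_mul (by positivity), ← Real.rpow_add hb]
        simp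
      rw [enorm_mul (2 * Real.pi : ℂ), enorm_mul ((bracket k ^ (-s) : ℝ) : ℂ), h1]
      calc _ = ENNReal.ofReal (2 * Real.pi) * ((ENNReal.ofReal (bracket k ^ s) *
            ‖((bracket k ^ (-s) : ℝ) : ℂ)‖ₑ) * ‖A (k, τ - θ k) + A' (k, τ - θ' k)‖ₑ) := by ring
        _ ≤ _ := by
            rw [h2, one_mul, ← mul_add]
            gcongr
            exact enorm_add_le _ _
    · rw [yn_const_mul _ (by fun_prop), yn_const_mul _ (by fun_prop)]
      exact ENNReal.add_lt_top.2 ⟨ENNReal.mul_lt_top ENNReal.ofReal_lt_top A.yn_ne_top.lt_top,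
        ENNReal.mul_lt_top ENNReal.ofReal_lt_top A'.yn_ne_top.lt_top⟩
  · have h1 : ∀ τ : ℝ, Complex.exp (Complex.I * τ * t) * ((2 * Real.pi : ℂ) *
        (((bracket k ^ (-s) : ℝ) : ℂ) * (A (k, τ - θ k) + A' (k, τ - θ' k)))) =
        (2 * Real.pi : ℂ) * (((bracket k ^ (-s) : ℝ) : ℂ) *
          (Complex.exp (Complex.I * τ * t) * A (k, τ - θ k) +
            Complex.exp (Complex.I * τ * t) * A' (k, τ - θ' k))) := fun τ => by ring
    have h2 : ∀ (B : YSpace) (r : ℝ), Integrable fun τ : ℝ =>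
        Complex.exp (Complex.I * τ * t) * B (k, τ - r) := fun B r =>
      integrable_exp_I_mul ((B.integrable k).comp_sub_right r) t
    simp only [h1]
    rw [integral_const_mul, integral_const_mul, integral_add (h2 A _) (h2 A' _),
      A.integral_translate, A'.integral_translate, hf t ht k, ← mul_assoc, inv_mul_cancel₀, one_mul]
    have := Real.pi_pos
    exact_mod_cast (by positivity : (2 * Real.pi) ≠ 0)

/-- For the Schrödinger weight the translation is exact, so the converse of `memY_of_ev` holds. The
given transform is only almost everywhere measurable and is first replaced by a measurable
representative. -/
theorem exists_ev_of_memY {α a b : ℝ} {u : ℝ → Coeffs} (h : MemY (schrodingerWeight α) 0 a b u) :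
    ∃ A : YSpace, ∀ t ∈ Set.Icc a b, ∀ k : ℤ,
      u t k = Complex.exp (Complex.I * (-(α * (k : ℝ) ^ 2) : ℝ) * t) * YSpace.ev A t k := by
  obtain ⟨F, hF, hn, hu⟩ := h
  set θ : ℤ → ℝ := fun k => -(α * (k : ℝ) ^ 2) with hθ
  set G : ℤ → ℝ → ℂ := fun k => (hF k).mk (F k) with hG
  have hGm : ∀ k, Measurable (G k) := fun k => (hF k).stronglyMeasurable_mk.measurable
  have hae : ∀ k, F k =ᵐ[volume] G k := fun k => (hF k).ae_eq_mk
  set B : ℤ × ℝ → ℂ := fun x => (2 * Real.pi : ℂ)⁻¹ * G x.1 (x.2 + θ x.1) with hB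
  have hBm : Measurable B := measurable_mu fun k => by
    have := hGm k
    simp only [hB]; fun_prop
  set c : ℝ≥0∞ := ‖(2 * Real.pi : ℂ)⁻¹‖ₑ with hc
  have hctop : c ≠ ∞ := enorm_ne_top
  have h1 : l2 mu (wt fun x => ‖B x‖ₑ) = c * bourgainNorm (schrodingerWeight α) 0 (1 / 2) F := by
    have e1 : (wt fun x => ‖B x‖ₑ) = fun x => c * (jb x.2 ^ (1 / 2 : ℝ) * ‖G x.1 (x.2 + θ x.1)‖ₑ) := by
      ext x; simp only [wt, hB, enorm_mul]; ring
    have hm : Measurable fun x : ℤ × ℝ => jb x.2 ^ (1 / 2 : ℝ) * ‖G x.1 (x.2 + θ x.1)‖ₑ :=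
      measurable_mu fun k =>
      (measurable_jb.pow_const _).mul ((hGm k).comp (measurable_add_const (θ k))).enorm
    rw [e1, l2_const_mul _ hm]
    unfold l2 bourgainNorm
    rw [lintegral_mu (hm.pow_const 2)]
    congr 2
    refine tsum_congr fun k => ?_
    rw [← lintegral_sub_right_eq_self _ (θ k)]
    refine lintegral_congr_ae ?_
    filter_upwards [hae k] with τ hτ
    rw [sub_add_cancel, ← hτ, mul_pow, jb_half_sq]
    simp [jb, schrodingerWeight, hθ]
  have h2 : l2l1 (fun x => ‖B x‖ₑ) =
      c * (∑' k : ℤ, (∫⁻ τ : ℝ, ENNReal.ofReal (bracket k ^ (0 : ℝ)) * ‖F k τ‖ₑ) ^ 2) ^ (1 / 2 : ℝ) := by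
    have e1 : (fun k : ℤ => ∫⁻ τ : ℝ, ‖B (k, τ)‖ₑ) = fun k => c * ∫⁻ τ : ℝ, ‖F k τ‖ₑ := by
      ext k
      simp only [hB, enorm_mul]
      have := hGm k
      rw [lintegral_const_mul _ (by fun_prop),
        lintegral_add_right_eq_self (fun τ => ‖G k τ‖ₑ) (θ k)]
      congr 1
      refine lintegral_congr_ae ?_
      filter_upwards [hae k] with τ hτ
      rw [hτ]
    rw [l2l1, e1, l2_const_mul _ (measurable_of_countable _), l2, lintegral_count]
    simp
  have hfin : yn (fun x => ‖B x‖ₑ) ≠ ∞ := by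
    rw [yn, h1, h2, ← mul_add]
    exact ENNReal.mul_ne_top hctop hn.ne
  refine ⟨YSpace.mk B hBm hfin, fun t ht k => ?_⟩
  have h3 := YSpace.integral_translate (YSpace.mk B hBm hfin) (θ k) t k
  rw [← h3, hu t ht k, ← integral_const_mul]
  refine integral_congr_ae ?_
  filter_upwards [hae k] with τ hτ
  simp only [YSpace.mk_apply, hB, sub_add_cancel]
  rw [hτ]; ring

theorem HasExt.of_memY {α a b : ℝ} {v : ℝ → L2} (h : MemY (schrodingerWeight α) 0 a b fun t k => v t k) :
    HasExt a b fun t => L2.rot (fun k => α * (k : ℝ) ^ 2) t (v t) := by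
  obtain ⟨A, hA⟩ := exists_ev_of_memY h
  refine ⟨A, fun t ht => ?_⟩
  ext k
  rw [L2.rot_apply, hA t ht k, ← mul_assoc, ← Complex.exp_add]
  push_cast
  rw [show Complex.I * (α * (k : ℂ) ^ 2) * t + Complex.I * -(α * (k : ℂ) ^ 2) * t = 0 by ring,
    Complex.exp_zero, one_mul]

end Zakharov

end

noncomputable section

namespace Zakharov

/-! ### The Duhamel integral of a single mode -/

/-- The integral of `N` against an oscillating factor. -/
def oscInt (θ : ℝ) (N : ℝ → ℂ) (t : ℝ) : ℂ :=
  ∫ s in (0 : ℝ)..t, Complex.exp (Complex.I * θ * s) * N s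

theorem oscInt_zero (θ : ℝ) (N : ℝ → ℂ) : oscInt θ N 0 = 0 := intervalIntegral.integral_same

theorem hasDerivAt_oscInt (θ : ℝ) {N : ℝ → ℂ} (hN : Continuous N) (t : ℝ) :
    HasDerivAt (oscInt θ N) (Complex.exp (Complex.I * θ * t) * N t) t := by
  have h : Continuous fun s : ℝ => Complex.exp (Complex.I * θ * s) * N s := by fun_prop
  exact intervalIntegral.integral_hasDerivAt_right (h.intervalIntegrable _ _)
    h.aestronglyMeasurable.stronglyMeasurableAtFilter h.continuousAt

theorem conj_exp_I_mul (θ t : ℝ) : starRingEnd ℂ (Complex.exp (Complex.I * θ * t)) =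
    Complex.exp (Complex.I * (-θ : ℝ) * t) := by
  rw [← Complex.exp_conj]; simp

theorem conj_oscInt (θ : ℝ) (N : ℝ → ℂ) (t : ℝ) :
    starRingEnd ℂ (oscInt θ N t) = oscInt (-θ) (fun s => starRingEnd ℂ (N s)) t := by
  unfold oscInt
  simp only [← conj_exp_I_mul, ← map_mul, intervalIntegral, map_sub, integral_conj]

theorem exp_mul_exp_neg (θ t : ℝ) :
    Complex.exp (Complex.I * θ * t) * Complex.exp (Complex.I * (-θ : ℝ) * t) = 1 := by
  rw [← Complex.exp_add]; push_cast
  rw [show Complex.I * θ * t + Complex.I * -θ * t = 0 by ring, Complex.exp_zero]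

theorem hasDerivAt_exp_I_mul (θ t : ℝ) : HasDerivAt (fun s : ℝ => Complex.exp (Complex.I * θ * s))
    (Complex.I * θ * Complex.exp (Complex.I * θ * t)) t := by
  have h := (((hasDerivAt_id (t : ℂ)).const_mul (Complex.I * θ)).cexp).comp_ofReal
  simp only [id, mul_one] at h
  rw [mul_comm (Complex.I * θ : ℂ)]
  exact h

/-- The two contributions containing `N t` cancel because the source enters the half waves with
opposite signs; the derivative involves only their difference. -/
theorem hasDerivAt_duhamel_mode (θ : ℝ) (b c x y : ℂ) {N : ℝ → ℂ} (hN : Continuous N) (t : ℝ) :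
    HasDerivAt (fun t : ℝ => b * (Complex.exp (Complex.I * θ * t) * (x + c * oscInt (-θ) N t) +
      Complex.exp (Complex.I * (-θ : ℝ) * t) * (y - c * oscInt θ N t)))
      (Complex.I * (θ * b) * (Complex.exp (Complex.I * θ * t) * (x + c * oscInt (-θ) N t) -
      Complex.exp (Complex.I * (-θ : ℝ) * t) * (y - c * oscInt θ N t))) t := by
  have h1 := (hasDerivAt_exp_I_mul θ t).mul (((hasDerivAt_oscInt (-θ) hN t).const_mul c).const_add x)
  have h2 := (hasDerivAt_exp_I_mul (-θ) t).mul (((hasDerivAt_oscInt θ hN t).const_mul c).const_sub y)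
  have h3 := (h1.add h2).const_mul b
  refine h3.congr_deriv ?_
  have e := exp_mul_exp_neg θ t
  push_cast at e ⊢
  ring

theorem integral_sin_mul (θ : ℝ) {N : ℝ → ℂ} (hN : Continuous N) (t : ℝ) :
    ∫ s in (0 : ℝ)..t, (Real.sin (θ * (t - s)) : ℂ) * N s =
      -Complex.I / 2 * (Complex.exp (Complex.I * θ * t) * oscInt (-θ) N t -
        Complex.exp (Complex.I * (-θ : ℝ) * t) * oscInt θ N t) := by
  have h : ∀ s : ℝ, (Real.sin (θ * (t - s)) : ℂ) * N s =
      -Complex.I / 2 * Complex.exp (Complex.I * θ * t) * (Complex.exp (Complex.I * (-θ : ℝ) * s) * N s) -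
        -Complex.I / 2 * Complex.exp (Complex.I * (-θ : ℝ) * t) *
          (Complex.exp (Complex.I * θ * s) * N s) := fun s => by
    have e1 : Complex.exp (Complex.I * θ * t) * Complex.exp (Complex.I * (-θ : ℝ) * s) =
        Complex.exp ((θ * (t - s) : ℝ) * Complex.I) := by
      rw [← Complex.exp_add]; congr 1; push_cast; ring
    have e2 : Complex.exp (Complex.I * (-θ : ℝ) * t) * Complex.exp (Complex.I * θ * s) =
        Complex.exp (-(θ * (t - s) : ℝ) * Complex.I) := by
      rw [← Complex.exp_add]; congr 1; push_cast; ring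
    have e3 : (Real.sin (θ * (t - s)) : ℂ) = (Complex.exp (-(θ * (t - s) : ℝ) * Complex.I) -
        Complex.exp ((θ * (t - s) : ℝ) * Complex.I)) * Complex.I / 2 := by
      rw [Complex.ofReal_sin, Complex.sin]
    rw [e3, ← e1, ← e2]; ring
  simp only [h]
  rw [intervalIntegral.integral_sub, intervalIntegral.integral_const_mul,
    intervalIntegral.integral_const_mul]
  · unfold oscInt; ring
  · exact Continuous.intervalIntegrable (by fun_prop) _ _
  · exact Continuous.intervalIntegrable (by fun_prop) _ _

/-- Expanding the exponentials in sines and cosines turns the first order form of the wave equation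
into Duhamel's formula of second order. The condition on `b * c` is the normalisation satisfied by
`waveCoeff`. -/
theorem duhamel_mode {θ : ℝ} (hθ : θ ≠ 0) {b c : ℂ} (x y : ℂ) (hbc : b * c = Complex.I * θ / 2)
    {N : ℝ → ℂ} (hN : Continuous N) (t : ℝ) :
    b * (Complex.exp (Complex.I * θ * t) * (x + c * oscInt (-θ) N t) +
      Complex.exp (Complex.I * (-θ : ℝ) * t) * (y - c * oscInt θ N t)) =
    Real.cos (θ * t) * (b * (x + y)) + ((Real.sin (θ * t) / θ : ℝ) : ℂ) * (Complex.I * (θ * b) * (x - y)) -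
      θ * ∫ s in (0 : ℝ)..t, (Real.sin (θ * (t - s)) : ℂ) * N s := by
  have hθ' : (θ : ℂ) ≠ 0 := by exact_mod_cast hθ
  have e1 : Complex.exp (Complex.I * θ * t) = Real.cos (θ * t) + Real.sin (θ * t) * Complex.I := by
    rw [Complex.ofReal_cos, Complex.ofReal_sin, ← Complex.exp_mul_I]; congr 1; push_cast; ring
  have e2 : Complex.exp (Complex.I * (-θ : ℝ) * t) =
      Real.cos (θ * t) - Real.sin (θ * t) * Complex.I := by
    have h := Complex.exp_mul_I (-((θ * t : ℝ) : ℂ))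
    rw [Complex.cos_neg, Complex.sin_neg, ← Complex.ofReal_cos, ← Complex.ofReal_sin] at h
    rw [sub_eq_add_neg, ← neg_mul, ← h]; congr 1; push_cast; ring
  have e3 : ((Real.sin (θ * t) / θ : ℝ) : ℂ) * (Complex.I * (θ * b) * (x - y)) =
      Real.sin (θ * t) * (Complex.I * b * (x - y)) := by
    push_cast; field_simp
  rw [integral_sin_mul θ hN, e3, e1, e2]
  set C : ℂ := ((Real.cos (θ * t) : ℝ) : ℂ)
  set S : ℂ := ((Real.sin (θ * t) : ℝ) : ℂ)
  linear_combination ((C + S * Complex.I) * oscInt (-θ) N t - (C - S * Complex.I) * oscInt θ N t) * hbc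

/-! ### The wave equation as a first order equation -/

/-- The wave part in interaction variables obtained from the data `x` and the source `N`. -/
def waveSol (β ρ : ℝ) (x : L2) (N : ℝ → Coeffs) (t : ℝ) (k : ℤ) : ℂ :=
  x k + 2 * Real.pi * waveCoeff β k * oscInt (-(β * |(k : ℝ)|)) (fun s => N s k) t -
    if k = 0 then ((t * ρ : ℝ) : ℂ) else 0

/-- The first order wave component obtained from the data `x` and the source `N`. -/
def waveFlow (β ρ : ℝ) (x : L2) (N : ℝ → Coeffs) (t : ℝ) (k : ℤ) : ℂ :=
  Complex.exp (Complex.I * (β * |(k : ℝ)| : ℝ) * t) * waveSol β ρ x N t k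

theorem conj_waveCoeff_neg (β : ℝ) (k : ℤ) : starRingEnd ℂ (waveCoeff β (-k)) = -waveCoeff β k := by
  simp only [waveCoeff, map_mul, Complex.conj_I, Complex.conj_ofReal, Int.cast_neg, abs_neg, bracket_neg]
  ring

/-- Since the source is real, the reflected half wave is driven by the same `N k` with the opposite
frequency and the opposite sign, which is the form required by `duhamel_mode`. -/
theorem conj_waveFlow_neg (β ρ : ℝ) (x : L2) {N : ℝ → Coeffs} (hN : ∀ s, IsRealValued (N s)) (t : ℝ)
    (k : ℤ) : starRingEnd ℂ (waveFlow β ρ x N t (-k)) =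
    Complex.exp (Complex.I * (-(β * |(k : ℝ)|) : ℝ) * t) * (starRingEnd ℂ (x (-k)) -
      2 * Real.pi * waveCoeff β k * oscInt (β * |(k : ℝ)|) (fun s => N s k) t -
      if k = 0 then ((t * ρ : ℝ) : ℂ) else 0) := by
  have h1 : (fun s => starRingEnd ℂ (N s (-k))) = fun s => N s k := funext fun s => by
    rw [← hN s (-k), neg_neg]
  have h2 : starRingEnd ℂ (if -k = 0 then ((t * ρ : ℝ) : ℂ) else 0) =
      if k = 0 then ((t * ρ : ℝ) : ℂ) else 0 := by
    simp only [neg_eq_zero]; split_ifs <;> simp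
  unfold waveFlow waveSol
  rw [map_mul, map_sub, map_add, map_mul, map_mul, h2, conj_exp_I_mul, conj_oscInt, h1,
    conj_waveCoeff_neg]
  simp only [Int.cast_neg, abs_neg, neg_neg, map_mul, Complex.conj_ofReal, map_ofNat]
  ring

theorem waveFlow_zero (β ρ : ℝ) (x : L2) (N : ℝ → Coeffs) : waveFlow β ρ x N 0 = x := by
  ext k; simp [waveFlow, waveSol, oscInt_zero]

theorem waveCoeff_zero (β : ℝ) : waveCoeff β 0 = 0 := by simp [waveCoeff]

theorem bracket_mul_waveCoeff (β : ℝ) (k : ℤ) :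
    ((bracket k ^ (1 / 2 : ℝ) : ℝ) : ℂ) * (2 * Real.pi * waveCoeff β k) =
      Complex.I * (β * |(k : ℝ)| : ℝ) / 2 := by
  have h2 : ((bracket k ^ (-(1 / 2) : ℝ) : ℝ) : ℂ) * ((bracket k ^ (1 / 2 : ℝ) : ℝ) : ℂ) = 1 := by
    rw [← Complex.ofReal_mul, bracket_rpow_mul_half]; norm_num
  have h3 : (Real.pi : ℂ) ≠ 0 := by exact_mod_cast Real.pi_ne_zero
  unfold waveCoeff
  push_cast at h2 ⊢
  field_simp
  linear_combination 4 * (β : ℂ) * ((|(k : ℝ)| : ℝ) : ℂ) * h2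

/-- The mean of `n` has no source and is affine in time. At frequency zero the half wave does not
rotate, so the motion comes entirely from the drift. The choice `ρ = (x 0).im` makes its velocity
agree with the mean of `∂ₜn`. -/
theorem density_waveFlow_zero_mode (β ρ : ℝ) (x : L2) {N : ℝ → Coeffs} (hN : ∀ s, IsRealValued (N s))
    (t : ℝ) : density (waveFlow β ρ x N t) 0 = x 0 + starRingEnd ℂ (x 0) - 2 * t * ρ := by
  have h := conj_waveFlow_neg β ρ x hN t 0
  rw [density, h]
  simp [waveFlow, waveSol, waveCoeff_zero, bracket]
  ring

theorem densityDeriv_waveFlow_zero_mode (β ρ : ℝ) (x : L2) {N : ℝ → Coeffs}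
    (hN : ∀ s, IsRealValued (N s)) (hρ : ρ = (x 0).im) (t : ℝ) :
    densityDeriv β (waveFlow β ρ x N t) 0 = -2 * ρ := by
  have h := conj_waveFlow_neg β ρ x hN t 0
  rw [densityDeriv, h]
  have h2 : x 0 - starRingEnd ℂ (x 0) = 2 * ρ * Complex.I := by
    rw [hρ, Complex.sub_conj]; push_cast; ring
  have h3 : x 0 = starRingEnd ℂ (x 0) + 2 * ρ * Complex.I := by rw [← h2]; ring
  simp [waveFlow, waveSol, waveCoeff_zero, bracket, waveFreq]
  rw [h2]
  linear_combination 2 * ρ * Complex.I_sq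

theorem hasDerivAt_density {β ρ : ℝ} {x : L2} {N : ℝ → Coeffs} (hN : ∀ s, IsRealValued (N s))
    (hc : ∀ k, Continuous fun s => N s k) (hρ : ρ = (x 0).im) (t : ℝ) (k : ℤ) :
    HasDerivAt (fun t => density (waveFlow β ρ x N t) k) (densityDeriv β (waveFlow β ρ x N t) k) t := by
  by_cases hk : k = 0
  · subst hk
    simp only [density_waveFlow_zero_mode β ρ x hN]
    rw [densityDeriv_waveFlow_zero_mode β ρ x hN hρ]
    have h1 : HasDerivAt (fun t : ℝ => 2 * (t : ℂ) * ρ) (2 * 1 * ρ) t :=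
      ((HasDerivAt.ofReal_comp (hasDerivAt_id t)).const_mul 2).mul_const _
    refine (h1.const_sub _).congr_deriv ?_
    ring
  · have h := hasDerivAt_duhamel_mode (β * |(k : ℝ)|) ((bracket k ^ (1 / 2 : ℝ) : ℝ) : ℂ)
      (2 * Real.pi * waveCoeff β k) (x k) (starRingEnd ℂ (x (-k))) (hc k) t
    refine (h.congr_deriv ?_).congr_of_eventuallyEq (Eventually.of_forall fun r => ?_)
    · rw [densityDeriv, conj_waveFlow_neg β ρ x hN]
      simp only [waveFlow, waveSol, hk, if_false, sub_zero, waveFreq]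
      push_cast; ring
    · simp only [density]
      rw [conj_waveFlow_neg β ρ x hN]
      simp only [waveFlow, waveSol, hk, if_false, sub_zero]

theorem density_waveFlow {β ρ : ℝ} (hβ : 0 < β) {x : L2} {N : ℝ → Coeffs} (hN : ∀ s, IsRealValued (N s))
    (hc : ∀ k, Continuous fun s => N s k) (hρ : ρ = (x 0).im) (t : ℝ) (k : ℤ) :
    density (waveFlow β ρ x N t) k = dV β t k * density x k + V β t k * densityDeriv β x k +
      (β : ℂ) ^ 2 * ∫ s in (0 : ℝ)..t, (V β (t - s) k : ℂ) * (-(k : ℂ) ^ 2 * N s k) := by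
  by_cases hk : k = 0
  · subst hk
    have h1 := density_waveFlow_zero_mode β ρ x hN 0
    have h2 := densityDeriv_waveFlow_zero_mode β ρ x hN hρ 0
    rw [waveFlow_zero] at h1 h2
    rw [density_waveFlow_zero_mode β ρ x hN, h1, h2]
    simp [dV, V]; ring
  · have hk' : (k : ℝ) ≠ 0 := by exact_mod_cast hk
    have hθ : β * |(k : ℝ)| ≠ 0 := by positivity
    have h := duhamel_mode hθ (x k) (starRingEnd ℂ (x (-k))) (bracket_mul_waveCoeff β k) (hc k) t
    have h1 : density (waveFlow β ρ x N t) k = ((bracket k ^ (1 / 2 : ℝ) : ℝ) : ℂ) *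
        (Complex.exp (Complex.I * (β * |(k : ℝ)| : ℝ) * t) * (x k + 2 * Real.pi * waveCoeff β k *
          oscInt (-(β * |(k : ℝ)|)) (fun s => N s k) t) +
        Complex.exp (Complex.I * (-(β * |(k : ℝ)|) : ℝ) * t) * (starRingEnd ℂ (x (-k)) -
          2 * Real.pi * waveCoeff β k * oscInt (β * |(k : ℝ)|) (fun s => N s k) t)) := by
      rw [density, conj_waveFlow_neg β ρ x hN]
      simp only [waveFlow, waveSol, hk, if_false, sub_zero]
    have h2 : ∀ s : ℝ, (V β (t - s) k : ℂ) * (-(k : ℂ) ^ 2 * N s k) =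
        (-(|(k : ℝ)| / β : ℝ) : ℂ) * ((Real.sin (β * |(k : ℝ)| * (t - s)) : ℂ) * N s k) := fun s => by
      have e1 : β * (t - s) * |(k : ℝ)| = β * |(k : ℝ)| * (t - s) := by ring
      have e2 : (k : ℂ) ^ 2 = ((|(k : ℝ)| : ℝ) : ℂ) ^ 2 := by
        rw [← Complex.ofReal_pow, sq_abs]; push_cast; ring
      have e3 : ((|(k : ℝ)| : ℝ) : ℂ) ≠ 0 := by exact_mod_cast (abs_pos.2 hk').ne'
      have e4 : (β : ℂ) ≠ 0 := by exact_mod_cast hβ.ne'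
      rw [V, if_neg hk, e1, e2, Complex.ofReal_div, Complex.ofReal_div, Complex.ofReal_mul β]
      field_simp
    simp only [h2]
    rw [h1, h, intervalIntegral.integral_const_mul]
    simp only [dV, V, hk, if_false, density, densityDeriv, waveFreq]
    have e5 : β * t * |(k : ℝ)| = β * |(k : ℝ)| * t := by ring
    have e4 : (β : ℂ) ≠ 0 := by exact_mod_cast hβ.ne'
    rw [e5, ← mul_assoc ((β : ℂ) ^ 2)]
    have e6 : (β : ℂ) ^ 2 * (-(|(k : ℝ)| / β : ℝ) : ℂ) = -((β * |(k : ℝ)| : ℝ) : ℂ) := by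
      push_cast; field_simp
    rw [e6, Complex.ofReal_mul (β * |(k : ℝ)|)]
    ring

end Zakharov

end

noncomputable section

namespace Zakharov

/-! ### The density `|u|²` -/

theorem norm_mul_conj_le (z w : ℂ) : ‖z * starRingEnd ℂ w‖ ≤ (‖z‖ ^ 2 + ‖w‖ ^ 2) / 2 := by
  rw [norm_mul, RCLike.norm_conj]
  nlinarith [sq_nonneg (‖z‖ - ‖w‖)]

theorem L2.hasSum_sq_pair (x : L2) (k : ℤ) :
    HasSum (fun j => (‖x (k + j)‖ ^ 2 + ‖x j‖ ^ 2) / 2) (‖x‖ ^ 2) := by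
  have h1 : HasSum (fun j => ‖x j‖ ^ 2) (‖x‖ ^ 2) := by
    rw [L2.norm_sq]; exact (L2.summable_sq x).hasSum
  have h2 : HasSum (fun j => ‖x (k + j)‖ ^ 2) (‖x‖ ^ 2) := (Equiv.addLeft k).hasSum_iff.2 h1
  have h3 := (h2.add h1).div_const 2
  rwa [add_self_div_two] at h3

theorem L2.summable_mul_conj (x : L2) (k : ℤ) :
    Summable fun j => x (k + j) * starRingEnd ℂ (x j) :=
  Summable.of_norm_bounded (L2.hasSum_sq_pair x k).summable fun _ => norm_mul_conj_le _ _

theorem isRealValued_normSqCoeff (u : Coeffs) : IsRealValued (normSqCoeff u) := fun k => by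
  unfold normSqCoeff
  rw [map_mul, map_inv₀, map_mul, Complex.conj_ofReal, map_ofNat, Complex.conj_tsum,
    ← (Equiv.addLeft k).tsum_eq]
  congr 1
  refine tsum_congr fun j => ?_
  simp [mul_comm]

/-- The translation of a sequence. -/
def L2.shift (k : ℤ) (x : L2) : L2 := toL2 (fun j => x (k + j)) (by
  have h : l2 Measure.count (fun j => ‖x (k + j)‖ₑ) = l2 Measure.count fun j => ‖x j‖ₑ := by
    unfold l2
    rw [lintegral_count, lintegral_count]
    congr 1
    exact (Equiv.addLeft k).tsum_eq fun j => ‖x j‖ₑ ^ 2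
  rw [h]; exact L2.l2_ne_top x)

theorem L2.shift_apply (k : ℤ) (x : L2) (j : ℤ) : L2.shift k x j = x (k + j) := rfl

theorem L2.norm_shift (k : ℤ) (x : L2) : ‖L2.shift k x‖ = ‖x‖ := by
  have h : ‖L2.shift k x‖ ^ 2 = ‖x‖ ^ 2 := by
    rw [L2.norm_sq, L2.norm_sq]
    exact (Equiv.addLeft k).tsum_eq fun j => ‖x j‖ ^ 2
  exact (pow_left_inj₀ (norm_nonneg _) (norm_nonneg _) two_ne_zero).1 h

theorem L2.continuous_shift (k : ℤ) : Continuous (L2.shift k) := by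
  refine (LipschitzWith.of_dist_le_mul (K := 1) fun x y => ?_).continuous
  have h : L2.shift k x - L2.shift k y = L2.shift k (x - y) := by
    ext j
    rw [lp.coeFn_sub, Pi.sub_apply, L2.shift_apply, L2.shift_apply, L2.shift_apply, lp.coeFn_sub,
      Pi.sub_apply]
  rw [dist_eq_norm, dist_eq_norm, h, L2.norm_shift]; simp

theorem normSqCoeff_eq_inner (x : L2) (k : ℤ) :
    normSqCoeff x k = (2 * Real.pi : ℂ)⁻¹ * inner ℂ x (L2.shift k x) := by
  rw [normSqCoeff, lp.inner_eq_tsum]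
  rfl

theorem continuous_normSqCoeff {v : ℝ → L2} (hv : Continuous v) (k : ℤ) :
    Continuous fun s => normSqCoeff (v s) k := by
  simp only [normSqCoeff_eq_inner]
  exact continuous_const.mul (hv.inner ((L2.continuous_shift k).comp hv))

/-! ### Interaction variables -/

/-- The frequencies of the Schrödinger flow. -/
def schrFreq (α : ℝ) (k : ℤ) : ℝ := -(α * (k : ℝ) ^ 2)

theorem rot_mul_conj_rot (α : ℝ) (s : ℝ) (x : L2) (k j : ℤ) :
    L2.rot (schrFreq α) s x (k + j) * starRingEnd ℂ (L2.rot (schrFreq α) s x j) =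
      Complex.exp (Complex.I * (-(α * ((k + j : ℤ) : ℝ) ^ 2) + α * (j : ℝ) ^ 2 : ℝ) * s) *
        (x (k + j) * starRingEnd ℂ (x j)) := by
  rw [L2.rot_apply, L2.rot_apply, map_mul, conj_exp_I_mul]
  have e : Complex.exp (Complex.I * (-(α * ((k + j : ℤ) : ℝ) ^ 2) + α * (j : ℝ) ^ 2 : ℝ) * s) =
      Complex.exp (Complex.I * (schrFreq α (k + j)) * s) *
        Complex.exp (Complex.I * (-schrFreq α j : ℝ) * s) := by
    rw [← Complex.exp_add]; congr 1; unfold schrFreq; push_cast; ring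
  rw [e]; ring

/-- The index of the interactions is the opposite of the index in `normSqCoeff`, because the
conjugated factor is represented by the reflected sequence. -/
theorem hasSum_osc_wave (α β : ℝ) (f : ℝ → L2) (k : ℤ) (s : ℝ) :
    HasSum (fun m => osc (fun k _ => waveCoeff β k) (wavePhase α β) (fun r => L2.refl (f r)) f k m s)
      (2 * Real.pi * waveCoeff β k * (Complex.exp (Complex.I * (-(β * |(k : ℝ)|) : ℝ) * s) *
        normSqCoeff (L2.rot (schrFreq α) s (f s)) k)) := by
  have h1 := ((L2.summable_mul_conj (L2.rot (schrFreq α) s (f s)) k).hasSum.mul_left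
    (waveCoeff β k * Complex.exp (Complex.I * (-(β * |(k : ℝ)|) : ℝ) * s)))
  have h2 := (Equiv.neg ℤ).hasSum_iff.2 h1
  have h3 : (2 * Real.pi * waveCoeff β k * (Complex.exp (Complex.I * (-(β * |(k : ℝ)|) : ℝ) * s) *
        normSqCoeff (L2.rot (schrFreq α) s (f s)) k)) = waveCoeff β k *
        Complex.exp (Complex.I * (-(β * |(k : ℝ)|) : ℝ) * s) *
        ∑' j : ℤ, L2.rot (schrFreq α) s (f s) (k + j) *
          starRingEnd ℂ (L2.rot (schrFreq α) s (f s) j) := by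
    have : (Real.pi : ℂ) ≠ 0 := by exact_mod_cast Real.pi_ne_zero
    unfold normSqCoeff
    field_simp
  rw [h3]
  refine h2.congr_fun fun m => ?_
  simp only [Function.comp_apply, Equiv.neg_apply]
  rw [rot_mul_conj_rot, osc, L2.refl_apply]
  have e : Complex.exp (Complex.I * (wavePhase α β k m) * s) =
      Complex.exp (Complex.I * (-(β * |(k : ℝ)|) : ℝ) * s) *
      Complex.exp (Complex.I * (-(α * ((k + -m : ℤ) : ℝ) ^ 2) + α * ((-m : ℤ) : ℝ) ^ 2 : ℝ) * s) := by
    rw [← Complex.exp_add]; congr 1; unfold wavePhase; push_cast; ring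
  rw [e, sub_eq_add_neg k m]; ring

theorem norm_osc_wave_le (α β : ℝ) (f : ℝ → L2) (k m : ℤ) (s : ℝ) :
    ‖osc (fun k _ => waveCoeff β k) (wavePhase α β) (fun r => L2.refl (f r)) f k m s‖ ≤
      ‖waveCoeff β k‖ * ((‖f s (k + -m)‖ ^ 2 + ‖f s (-m)‖ ^ 2) / 2) := by
  rw [osc, norm_mul, norm_mul, norm_exp_I_mul, one_mul, L2.refl_apply, mul_comm (starRingEnd ℂ _),
    sub_eq_add_neg]
  exact mul_le_mul_of_nonneg_left (norm_mul_conj_le _ _) (norm_nonneg _)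

/-- For the wave equation the series converges absolutely at each time, dominated by `‖f s‖²`, so it
can be summed under the integral. -/
theorem hasSum_waveTerm (α β : ℝ) {f : ℝ → L2} (hf : Continuous f) (t : ℝ) (k : ℤ) :
    HasSum (waveTerm α β f 0 t k) (2 * Real.pi * waveCoeff β k *
      oscInt (-(β * |(k : ℝ)|)) (fun s => normSqCoeff (L2.rot (schrFreq α) s (f s)) k) t) := by
  have hsum : ∀ s, HasSum (fun m => ‖waveCoeff β k‖ * ((‖f s (k + -m)‖ ^ 2 + ‖f s (-m)‖ ^ 2) / 2))
      (‖waveCoeff β k‖ * ‖f s‖ ^ 2) := fun s =>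
    ((Equiv.neg ℤ).hasSum_iff.2 (L2.hasSum_sq_pair (f s) k)).mul_left _
  have h := intervalIntegral.hasSum_integral_of_dominated_convergence (μ := volume) (a := 0) (b := t)
    (F := fun m s => osc (fun k _ => waveCoeff β k) (wavePhase α β) (fun r => L2.refl (f r)) f k m s)
    (fun m s => ‖waveCoeff β k‖ * ((‖f s (k + -m)‖ ^ 2 + ‖f s (-m)‖ ^ 2) / 2))
    (fun m => (continuous_osc (L2.continuous_refl.comp hf) hf k m).aestronglyMeasurable)
    (fun m => Eventually.of_forall fun s _ => norm_osc_wave_le α β f k m s)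
    (Eventually.of_forall fun s _ => (hsum s).summable)
    (by
      simp only [fun s => (hsum s).tsum_eq]
      exact Continuous.intervalIntegrable (by fun_prop) _ _)
    (Eventually.of_forall fun s _ => hasSum_osc_wave α β f k s)
  rw [intervalIntegral.integral_const_mul] at h
  exact h

/-- The frequencies of the wave flow. -/
def halfWaveFreq (β : ℝ) (k : ℤ) : ℝ := β * |(k : ℝ)|

/-- The triple given at time `t` by the interaction variables. -/
def ofInteraction (α β t : ℝ) (x y : L2) : Triple :=
  ofHalfWave β (L2.rot (schrFreq α) t x) (L2.rot (halfWaveFreq β) t y)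

/-- The two half waves that make up the mode `j` of the density give the two integrals of
`schrTerm`, with `m = k - j`. -/
theorem schrTerm_eq (α β : ℝ) {f g : ℝ → L2} {t : ℝ} (hf : ContinuousOn f (Set.uIcc 0 t))
    (hg : ContinuousOn g (Set.uIcc 0 t)) (k j : ℤ) :
    Complex.exp (Complex.I * (-schrFreq α k : ℝ) * t) * (-Complex.I * ∫ s in (0 : ℝ)..t,
      U α (t - s) k * ((2 * Real.pi : ℂ)⁻¹ * ((ofInteraction α β s (f s) (g s)).1 (k - j) *
        (ofInteraction α β s (f s) (g s)).2.1 j))) = schrTerm α β f g 0 t k (k - j) := by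
  have i1 := ((continuousOn_osc (c := schrCoeff) (ω := schrPhase α β 1) hf hg k (k - j))
    ).intervalIntegrable (μ := volume)
  have i2 := ((continuousOn_osc (c := schrCoeff) (ω := schrPhase α β (-1)) hf
    (L2.continuous_refl.comp_continuousOn hg) k (k - j))).intervalIntegrable (μ := volume)
  simp only [Function.comp_def] at i2
  rw [schrTerm, ← intervalIntegral.integral_add i1 i2, ← intervalIntegral.integral_const_mul,
    ← intervalIntegral.integral_const_mul]
  refine intervalIntegral.integral_congr fun s _ => ?_
  simp only [ofInteraction, ofHalfWave, density, osc, L2.rot_apply, L2.refl_apply, map_mul,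
    conj_exp_I_mul, schrCoeff, sub_sub_cancel, U]
  have e1 : ∀ e : ℝ, Complex.exp (Complex.I * (schrPhase α β e k (k - j)) * s) =
      Complex.exp (Complex.I * (-schrFreq α k : ℝ) * t) *
      Complex.exp (-(Complex.I * α * (k : ℂ) ^ 2 * ((t - s : ℝ) : ℂ))) *
      Complex.exp (Complex.I * (schrFreq α (k - j)) * s) *
      Complex.exp (Complex.I * (e * (β * |(j : ℝ)|) : ℝ) * s) := fun e => by
    rw [← Complex.exp_add, ← Complex.exp_add, ← Complex.exp_add]
    congr 1
    unfold schrPhase schrFreq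
    rw [sub_sub_cancel]; push_cast; ring
  rw [e1, e1]
  simp only [halfWaveFreq, one_mul, neg_one_mul, Int.cast_neg, abs_neg]
  have : (Real.pi : ℂ) ≠ 0 := by exact_mod_cast Real.pi_ne_zero
  push_cast
  field_simp
  ring

/-- The two series correspond term by term up to a unimodular factor and a relabelling of the modes,
so no rearrangement beyond unconditional convergence is involved. One direction serves for
existence, the other for uniqueness. -/
theorem hasSum_schr_iff (α β : ℝ) {f g : ℝ → L2} {t : ℝ} (hf : ContinuousOn f (Set.uIcc 0 t))
    (hg : ContinuousOn g (Set.uIcc 0 t)) {z : ℝ → Triple}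
    (hz : ∀ s ∈ Set.uIcc 0 t, z s = ofInteraction α β s (f s) (g s)) (k : ℤ) :
    HasSum (fun j : ℤ => -Complex.I * ∫ s in (0 : ℝ)..t, U α (t - s) k *
      ((2 * Real.pi : ℂ)⁻¹ * ((z s).1 (k - j) * (z s).2.1 j))) ((z t).1 k - U α t k * (z 0).1 k) ↔
    HasSum (schrTerm α β f g 0 t k) (f t k - f 0 k) := by
  have h0 : ∀ j, (∫ s in (0 : ℝ)..t, U α (t - s) k *
      ((2 * Real.pi : ℂ)⁻¹ * ((z s).1 (k - j) * (z s).2.1 j))) = ∫ s in (0 : ℝ)..t, U α (t - s) k *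
      ((2 * Real.pi : ℂ)⁻¹ * ((ofInteraction α β s (f s) (g s)).1 (k - j) *
        (ofInteraction α β s (f s) (g s)).2.1 j)) := fun j =>
    intervalIntegral.integral_congr fun s hs => by simp only [hz s hs]
  have e : Complex.exp (Complex.I * (-schrFreq α k : ℝ) * t) * U α t k = 1 := by
    rw [U, ← Complex.exp_add]; unfold schrFreq; push_cast
    rw [show Complex.I * (- -(α * (k : ℂ) ^ 2)) * t + -(Complex.I * α * (k : ℂ) ^ 2 * t) = 0 by ring,
      Complex.exp_zero]
  have e' : (z t).1 k = U α t k * f t k := by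
    rw [hz t Set.right_mem_uIcc, U]
    simp only [ofInteraction, ofHalfWave, L2.rot_apply, schrFreq]
    congr 2; push_cast; ring
  have e0 : (z 0).1 k = f 0 k := by
    rw [hz 0 Set.left_mem_uIcc]
    simp only [ofInteraction, ofHalfWave, L2.rot_zero]
  have hne : Complex.exp (Complex.I * (-schrFreq α k : ℝ) * t) ≠ 0 := Complex.exp_ne_zero _
  rw [← hasSum_mul_left_iff hne, ← (Equiv.subLeft k).hasSum_iff (f := schrTerm α β f g 0 t k)]
  have h1 : (fun j => Complex.exp (Complex.I * (-schrFreq α k : ℝ) * t) *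
      (-Complex.I * ∫ s in (0 : ℝ)..t, U α (t - s) k *
      ((2 * Real.pi : ℂ)⁻¹ * ((z s).1 (k - j) * (z s).2.1 j)))) =
      schrTerm α β f g 0 t k ∘ Equiv.subLeft k := funext fun j => by
    rw [h0, schrTerm_eq α β hf hg]; rfl
  have h2 : Complex.exp (Complex.I * (-schrFreq α k : ℝ) * t) * ((z t).1 k - U α t k * (z 0).1 k) =
      f t k - f 0 k := by
    rw [e', e0]
    linear_combination (f t k - f 0 k) * e
  rw [h1, h2]

end Zakharov

end

/-! ### Equivalence with the Zakharov system -/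

noncomputable section

namespace Zakharov

variable {α β ρ a b : ℝ} {f g : ℝ → L2}

theorem wave_sum_iff (A : YSpace) (x : L2) (t : ℝ) (k : ℤ) (y : ℂ) :
    HasSum (waveTerm α β (YSpace.ev A) 0 t k)
      (y - x k + if k = 0 then (((t - 0) * ρ : ℝ) : ℂ) else 0) ↔
    y = waveSol β ρ x (fun s => normSqCoeff (L2.rot (schrFreq α) s (YSpace.ev A s))) t k := by
  have h := hasSum_waveTerm α β (YSpace.continuous_ev A) t k
  rw [sub_zero]
  constructor
  · intro h'
    have e := h'.unique h
    unfold waveSol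
    linear_combination e
  · intro e
    convert h using 1
    rw [e]; unfold waveSol; ring

/-- A curve that satisfies the wave equation with a source in `Y` is in `Y`. -/
theorem hasExt_of_wave (hα : 0 < α) (hβ : 0 < β) (hαβ : ¬ ∃ m : ℤ, β / α = m) (A : YSpace) (x : L2)
    (h : ∀ t ∈ Set.Icc a b, ∀ k, HasSum (waveTerm α β (YSpace.ev A) 0 t k)
      (g t k - x k + if k = 0 then (((t - 0) * ρ : ℝ) : ℂ) else 0)) : HasExt a b g := by
  obtain ⟨C, hC, hsys⟩ := exists_localSystem hα hβ hαβ
  -- The bilinear estimate needs no smallness. A large `δ` maps `[a, b]` into `[-1, 1]` in a single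
  -- rescaling.
  set δ : ℝ := |a| + |b| + 1 with hδdef
  have hδ : 0 < δ := by positivity
  obtain ⟨S, -, hS⟩ := hsys δ hδ 0
  obtain ⟨F, hF⟩ := exists_affine A hδ 0 (-1) 1
  refine (exists_affine (waveData x (δ * ρ) + S.E F F) (inv_pos.2 hδ) 0 a b).congr fun t ht => ?_
  have ht' : δ⁻¹ * t + 0 ∈ Set.Icc (-1 : ℝ) 1 := by
    have h1 : |t| ≤ δ := by
      rw [abs_le]
      constructor
      · linarith [ht.1, neg_abs_le a, abs_nonneg b]
      · linarith [ht.2, le_abs_self b, abs_nonneg a]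
    rw [add_zero, Set.mem_Icc, ← abs_le, abs_mul, abs_of_pos (inv_pos.2 hδ), inv_mul_le_iff₀ hδ, mul_one]
    exact h1
  set s := δ⁻¹ * t + 0 with hs
  have hst : δ * s + 0 = t := by rw [hs]; field_simp; ring
  have h0 : (0 : ℝ) ∈ Set.Icc (-1 : ℝ) 1 := ⟨by norm_num, by norm_num⟩
  ext k
  have h2 := hS.hasSum_E (f := YSpace.ev A) hδ F ht'
    (fun r hr => hF r (Set.OrdConnected.uIcc_subset Set.ordConnected_Icc h0 ht' hr)) k
  rw [hst] at h2
  have h3 := h2.unique (h t ht k)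
  rw [YSpace.ev_add, ev_waveData x _ ht', lp.coeFn_add, Pi.add_apply, lp.coeFn_add, Pi.add_apply,
    lp.coeFn_smul, Pi.smul_apply, lp.single_apply, Pi.single_apply, h3]
  split_ifs with hk
  · have hst' : (δ : ℂ) * s = t := by rw [← hst]; push_cast; ring
    rw [smul_eq_mul]; push_cast; rw [← hst']; ring
  · rw [smul_zero]; ring

theorem continuous_ofInteraction (hβ : 0 < β) (A B : YSpace) (t : ℝ) :
    Tendsto (fun s => phaseNorm (ofInteraction α β s (YSpace.ev A s) (YSpace.ev B s) -
      ofInteraction α β t (YSpace.ev A t) (YSpace.ev B t))) (𝓝 t) (𝓝 0) := by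
  set v := fun s => L2.rot (schrFreq α) s (YSpace.ev A s) with hv
  set w := fun s => L2.rot (halfWaveFreq β) s (YSpace.ev B s) with hw
  have cv : Continuous v := L2.continuous_rot _ (YSpace.continuous_ev A)
  have cw : Continuous w := L2.continuous_rot _ (YSpace.continuous_ev B)
  have h1 : Tendsto (fun s => ENNReal.ofReal ((4 + 2 * β) * (‖v s - v t‖ + ‖w s - w t‖))) (𝓝 t)
      (𝓝 0) := by
    have c : Continuous fun s => ENNReal.ofReal ((4 + 2 * β) * (‖v s - v t‖ + ‖w s - w t‖)) :=
      ENNReal.continuous_ofReal.comp (by fun_prop)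
    have := c.tendsto t
    simpa using this
  refine tendsto_of_tendsto_of_tendsto_of_le_of_le tendsto_const_nhds h1 (fun _ => zero_le) fun s => ?_
  simp only [ofInteraction, ofHalfWave_sub]
  exact phaseNorm_ofHalfWave_le hβ _ _

/-- The modulation of the wave is the distance from `|τ|` to `β|k|`, which is at most the distance
from `τ` to either of `±β|k|`. -/
theorem abs_waveWeight_le (hβ : 0 < β) (k : ℤ) (τ : ℝ) :
    |waveWeight β k τ| ≤ |τ - halfWaveFreq β k| ∧ |waveWeight β k τ| ≤ |τ - -halfWaveFreq β k| := by
  have h : |halfWaveFreq β k| = β * |(k : ℝ)| := by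
    unfold halfWaveFreq; rw [abs_mul, abs_abs, abs_of_pos hβ]
  unfold waveWeight
  rw [← h]
  refine ⟨abs_abs_sub_abs_le _ _, ?_⟩
  rw [← abs_neg (halfWaveFreq β k)]
  exact abs_abs_sub_abs_le _ _

theorem waveFlow_eq_rot (x : L2) (N : ℝ → Coeffs) (t : ℝ) {y : L2}
    (h : ∀ k, y k = waveSol β ρ x N t k) :
    ((L2.rot (halfWaveFreq β) t y : L2) : Coeffs) = waveFlow β ρ x N t := by
  ext k
  rw [L2.rot_apply, h]; rfl

/-- Solutions in interaction variables give solutions of the Zakharov system. -/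
theorem Sys.isSolutionOn (hβ : 0 < β) (h : Sys α β ρ a b f g) (ha : a ≤ 0) (hb : 0 ≤ b)
    (hρ : ρ = (g 0 0).im) {z : ℝ → Triple}
    (hz : ∀ t ∈ Set.Icc a b, z t = ofInteraction α β t (f t) (g t)) : IsSolutionOn α β a b (z 0) z := by
  have h0 : (0 : ℝ) ∈ Set.Icc a b := ⟨ha, hb⟩
  have hI : ∀ t ∈ Set.Icc a b, Set.uIcc 0 t ⊆ Set.Icc a b := fun t ht =>
    Set.OrdConnected.uIcc_subset Set.ordConnected_Icc h0 ht
  obtain ⟨A, hA⟩ := h.ext_f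
  obtain ⟨B, hB⟩ := h.ext_g
  have hz' : ∀ t ∈ Set.Icc a b, z t = ofInteraction α β t (YSpace.ev A t) (YSpace.ev B t) :=
    fun t ht => by rw [hz t ht, hA t ht, hB t ht]
  set v : ℝ → L2 := fun s => L2.rot (schrFreq α) s (YSpace.ev A s) with hv
  have cv : Continuous v := L2.continuous_rot _ (YSpace.continuous_ev A)
  set N : ℝ → Coeffs := fun s => normSqCoeff (v s) with hN
  have hNr : ∀ s, IsRealValued (N s) := fun s => isRealValued_normSqCoeff _
  have hNc : ∀ k, Continuous fun s => N s k := continuous_normSqCoeff cv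
  have hsol : ∀ t ∈ Set.Icc a b, ∀ k, g t k = waveSol β ρ (g 0) N t k := fun t ht k => by
    have h1 := h.wave 0 h0 t ht k
    rw [waveTerm_congr fun r hr => (hA r (hI t ht hr)).symm] at h1
    exact (wave_sum_iff A (g 0) t k _).1 h1
  have hn : ∀ t ∈ Set.Icc a b, (z t).2 =
      (density (waveFlow β ρ (g 0) N t), densityDeriv β (waveFlow β ρ (g 0) N t)) := fun t ht => by
    rw [hz t ht, ofInteraction, ofHalfWave, waveFlow_eq_rot (g 0) N t (hsol t ht)]
  have hn0 : (z 0).2 = (density (g 0), densityDeriv β (g 0)) := by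
    rw [hn 0 h0, waveFlow_zero]
  refine ⟨rfl, fun t ht => ?_, fun t ht => ?_, ?_, ?_, fun t ht k => ?_, fun t ht k => ?_,
    fun t ht k => ?_⟩
  · rw [hz t ht]; exact ofHalfWave_mem hβ _ _
  · refine ((continuous_ofInteraction (α := α) hβ A B t).mono_left nhdsWithin_le_nhds).congr' ?_
    filter_upwards [self_mem_nhdsWithin] with s hs
    rw [hz' s hs, hz' t ht]
  -- There is only one branch of frequencies here; `A - A` fills the second slot with zero.
  · refine memY_of_ev (θ := schrFreq α) (θ' := schrFreq α) A (A - A) (fun k τ => ?_) (fun k τ => ?_)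
      fun t ht k => ?_
    · unfold schrodingerWeight schrFreq; rw [sub_neg_eq_add]
    · unfold schrodingerWeight schrFreq; rw [sub_neg_eq_add]
    · rw [hz' t ht, YSpace.ev_sub, sub_self]
      simp [ofInteraction, ofHalfWave, L2.rot_apply]
  · refine memY_of_ev (θ := halfWaveFreq β) (θ' := fun k => -halfWaveFreq β k) B (YSpace.refl B)
      (fun k τ => (abs_waveWeight_le hβ k τ).1) (fun k τ => (abs_waveWeight_le hβ k τ).2)
      fun t ht k => ?_
    rw [hz' t ht, YSpace.ev_refl, L2.refl_apply, neg_neg]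
    simp only [ofInteraction, ofHalfWave, density, L2.rot_apply, map_mul, conj_exp_I_mul]
    simp only [halfWaveFreq, Int.cast_neg, abs_neg]
  · exact (hasSum_schr_iff α β (h.ext_f.continuousOn.mono (hI t ht))
      (h.ext_g.continuousOn.mono (hI t ht)) (fun s hs => hz s (hI t ht hs)) k).2 (h.schr 0 h0 t ht k)
  · have e : ∀ s ∈ Set.uIcc 0 t, (V β (t - s) k : ℂ) * (-(k : ℂ) ^ 2 * N s k) =
        (V β (t - s) k : ℂ) * (-(k : ℂ) ^ 2 * normSqCoeff (z s).1 k) := fun s hs => by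
      rw [hz' s (hI t ht hs)]; rfl
    rw [← intervalIntegral.integral_congr e]
    simp only
    rw [hn t ht, hn0]
    exact density_waveFlow hβ hNr hNc hρ t k
  · rw [hn t ht]
    refine (hasDerivAt_density hNr hNc hρ t k).hasDerivWithinAt.congr (fun s hs => ?_) ?_
    · rw [hn s hs]
    · rw [hn t ht]

theorem MemY.congr {w : ℤ → ℝ → ℝ} {s : ℝ} {u u' : ℝ → Coeffs} (h : MemY w s a b u)
    (hu : ∀ t ∈ Set.Icc a b, u t = u' t) : MemY w s a b u' := by
  obtain ⟨F, h1, h2, h3⟩ := h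
  exact ⟨F, h1, h2, fun t ht k => by rw [← hu t ht, h3 t ht k]⟩

/-- Solutions of the Zakharov system in interaction variables. -/
theorem IsSolutionOn.exists_sys (hα : 0 < α) (hβ : 0 < β) (hαβ : ¬ ∃ m : ℤ, β / α = m)
    {z₀ : Triple} {z : ℝ → Triple} (h : IsSolutionOn α β a b z₀ z) (ha : a ≤ 0) (hb : 0 ≤ b)
    (hab : a < b) :
    ∃ f g, Sys α β (g 0 0).im a b f g ∧ ∀ t ∈ Set.Icc a b, z t = ofInteraction α β t (f t) (g t) := by
  have h0 : (0 : ℝ) ∈ Set.Icc a b := ⟨ha, hb⟩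
  have hI : ∀ t ∈ Set.Icc a b, Set.uIcc 0 t ⊆ Set.Icc a b := fun t ht =>
    Set.OrdConnected.uIcc_subset Set.ordConnected_Icc h0 ht
  have hex : ∀ t, ∃ v w : L2, t ∈ Set.Icc a b → z t = ofHalfWave β v w := fun t => by
    by_cases ht : t ∈ Set.Icc a b
    · obtain ⟨v, w, e⟩ := exists_ofHalfWave hβ (h.mem t ht)
      exact ⟨v, w, fun _ => e⟩
    · exact ⟨0, 0, fun h' => absurd h' ht⟩
  choose v w hvw using hex
  set f : ℝ → L2 := fun t => L2.rot (fun k => α * (k : ℝ) ^ 2) t (v t) with hf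
  set g : ℝ → L2 := fun t => L2.rot (fun k => -halfWaveFreq β k) t (w t) with hg
  have hfv : ∀ t, L2.rot (schrFreq α) t (f t) = v t := fun t => by
    ext k
    simp only [hf, L2.rot_apply]
    rw [← mul_assoc, ← Complex.exp_add]
    unfold schrFreq; push_cast
    rw [show Complex.I * -(α * (k : ℂ) ^ 2) * t + Complex.I * (α * (k : ℂ) ^ 2) * t = 0 by ring,
      Complex.exp_zero, one_mul]
  have hgw : ∀ t, L2.rot (halfWaveFreq β) t (g t) = w t := fun t => by
    ext k
    simp only [hg, L2.rot_apply]
    rw [← mul_assoc, exp_mul_exp_neg, one_mul]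
  have hz : ∀ t ∈ Set.Icc a b, z t = ofInteraction α β t (f t) (g t) := fun t ht => by
    rw [ofInteraction, hfv, hgw, hvw t ht]
  have hextf : HasExt a b f := HasExt.of_memY (h.memY_u.congr fun t ht => by rw [hvw t ht]; rfl)
  obtain ⟨A, hA⟩ := hextf
  set u : ℝ → L2 := fun s => L2.rot (schrFreq α) s (YSpace.ev A s) with hu
  have cu : Continuous u := L2.continuous_rot _ (YSpace.continuous_ev A)
  set N : ℝ → Coeffs := fun s => normSqCoeff (u s) with hN
  have hNr : ∀ s, IsRealValued (N s) := fun s => isRealValued_normSqCoeff _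
  have hNc : ∀ k, Continuous fun s => N s k := continuous_normSqCoeff cu
  have hg0 : g 0 = w 0 := by rw [← hgw 0, L2.rot_zero]
  have hz0 : z₀.2 = (density (g 0), densityDeriv β (g 0)) := by
    rw [← h.initial, hvw 0 h0, hg0]; rfl
  have huz : ∀ s ∈ Set.Icc a b, (z s).1 = u s := fun s hs => by
    rw [hvw s hs, hu]; simp only [hA s hs, hfv]; rfl
  -- The source is known from `u` alone, so Duhamel's formula identifies `n` with the density of an
  -- explicit half wave; differentiation then identifies `∂ₜn`, and the two together determine the
  -- half wave.
  have hn : ∀ t ∈ Set.Icc a b, ∀ k, (z t).2.1 k =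
      density (waveFlow β (g 0 0).im (g 0) N t) k := fun t ht k => by
    have h1 := h.wave t ht k
    have e : ∀ s ∈ Set.uIcc 0 t, (V β (t - s) k : ℂ) * (-(k : ℂ) ^ 2 * normSqCoeff (z s).1 k) =
        (V β (t - s) k : ℂ) * (-(k : ℂ) ^ 2 * N s k) := fun s hs => by
      rw [huz s (hI t ht hs)]
    rw [intervalIntegral.integral_congr e, hz0] at h1
    exact h1.trans (density_waveFlow hβ hNr hNc rfl t k).symm
  have hm : ∀ t ∈ Set.Icc a b, ∀ k, (z t).2.2 k =
      densityDeriv β (waveFlow β (g 0 0).im (g 0) N t) k := fun t ht k => by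
    have h1 := h.deriv t ht k
    have h2 : HasDerivWithinAt (fun s => (z s).2.1 k)
        (densityDeriv β (waveFlow β (g 0 0).im (g 0) N t) k) (Set.Icc a b) t :=
      (hasDerivAt_density hNr hNc rfl t k).hasDerivWithinAt.congr (fun s hs => hn s hs k) (hn t ht k)
    -- Derivatives within `[a, b]` are unique only if the interval is nondegenerate, hence the
    -- condition `a < b`.
    exact (uniqueDiffOn_Icc hab t ht).eq_deriv _ h1 h2
  have hw : ∀ t ∈ Set.Icc a b, ∀ k, w t k = waveFlow β (g 0 0).im (g 0) N t k := fun t ht k => by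
    have e1 : density (w t) = density (waveFlow β (g 0 0).im (g 0) N t) := funext fun k => by
      rw [← hn t ht k, hvw t ht]; rfl
    have e2 : densityDeriv β (w t) = densityDeriv β (waveFlow β (g 0 0).im (g 0) N t) :=
      funext fun k => by rw [← hm t ht k, hvw t ht]; rfl
    rw [← halfWave_density hβ (w t), e1, e2, halfWave_density hβ]
  have hsol : ∀ t ∈ Set.Icc a b, ∀ k, g t k = waveSol β (g 0 0).im (g 0) N t k := fun t ht k => by
    have e := exp_mul_exp_neg (halfWaveFreq β k) t
    have e1 : g t k = Complex.exp (Complex.I * (-halfWaveFreq β k : ℝ) * t) * w t k := by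
      simp only [hg, L2.rot_apply]
    rw [e1, hw t ht k, waveFlow]
    unfold halfWaveFreq at e ⊢
    linear_combination waveSol β (g 0 0).im (g 0) N t k * e
  have hwave : ∀ t ∈ Set.Icc a b, ∀ k, HasSum (waveTerm α β (YSpace.ev A) 0 t k)
      (g t k - g 0 k + if k = 0 then (((t - 0) * (g 0 0).im : ℝ) : ℂ) else 0) := fun t ht k =>
    (wave_sum_iff A (g 0) t k _).2 (hsol t ht k)
  -- Membership of the half wave in `Y` is obtained from its equation and the regularity of `f`,
  -- which avoids separating the two directions of propagation in a given extension of `n`.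
  have hextg : HasExt a b g := hasExt_of_wave hα hβ hαβ A (g 0) hwave
  have hextf : HasExt a b f := ⟨A, hA⟩
  refine ⟨f, g, Sys.of_base (x := f 0) (y := g 0) h0 hextf hextg (fun t ht k => ?_) (fun t ht k => ?_), hz⟩
  · have h1 := h.schrodinger t ht k
    rw [← h.initial] at h1
    exact (hasSum_schr_iff α β (hextf.continuousOn.mono (hI t ht)) (hextg.continuousOn.mono (hI t ht))
      (fun s hs => hz s (hI t ht hs)) k).1 h1
  · rw [waveTerm_congr fun r hr => (hA r (hI t ht hr)).symm]
    exact hwave t ht k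

end Zakharov

end

/-! ### Global flow and transfer to the phase space -/

noncomputable section

namespace Zakharov

variable {α β : ℝ}

theorem ofHalfWave_injective (hβ : 0 < β) {v w v' w' : L2}
    (h : ofHalfWave β v w = ofHalfWave β v' w') : v = v' ∧ w = w' := by
  obtain ⟨h1, h2⟩ := Prod.mk.injEq .. ▸ h
  obtain ⟨h2, h3⟩ := Prod.mk.injEq .. ▸ h2
  refine ⟨lp.ext h1, ?_⟩
  ext k
  rw [← halfWave_density hβ w, h2, h3, halfWave_density hβ]

theorem ofInteraction_zero (x y : L2) : ofInteraction α β 0 x y = ofHalfWave β x y := by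
  rw [ofInteraction, L2.rot_zero, L2.rot_zero]

theorem phaseNorm_ofInteraction_sub_le (hβ : 0 < β) (t : ℝ) (x y x' y' : L2) :
    phaseNorm (ofInteraction α β t x y - ofInteraction α β t x' y') ≤
      ENNReal.ofReal ((4 + 2 * β) * (‖x - x'‖ + ‖y - y'‖)) := by
  rw [ofInteraction, ofInteraction, ofHalfWave_sub, ← L2.rot_sub, ← L2.rot_sub]
  exact (phaseNorm_ofHalfWave_le hβ _ _).trans_eq (by rw [L2.norm_rot, L2.norm_rot])

theorem phaseNorm_ofInteraction_le (hβ : 0 < β) (t : ℝ) (x y : L2) :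
    phaseNorm (ofInteraction α β t x y) ≤ ENNReal.ofReal ((4 + 2 * β) * (‖x‖ + ‖y‖)) := by
  rw [ofInteraction]
  exact (phaseNorm_ofHalfWave_le hβ _ _).trans_eq (by rw [L2.norm_rot, L2.norm_rot])

theorem norm_le_of_phaseNorm_ofHalfWave_le (hβ : 0 < β) {v w : L2} {R : ℝ} (hR : 0 ≤ R)
    (h : phaseNorm (ofHalfWave β v w) ≤ ENNReal.ofReal R) : ‖v‖ + ‖w‖ ≤ phaseC β * R := by
  have hC := phaseC_nonneg hβ
  rw [← ENNReal.ofReal_le_ofReal_iff (by positivity), ENNReal.ofReal_mul hC]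
  exact (norm_le_phaseNorm_ofHalfWave hβ v w).trans (mul_le_mul' le_rfl h)

theorem abs_im_le_norm (y : L2) : |(y 0).im| ≤ ‖y‖ :=
  (Complex.abs_im_le_norm _).trans (L2.norm_apply_le y 0)

/-- Solutions on different intervals agree on the smaller one by uniqueness, so the value at `t` may
be taken from the solution on `[-(|t| + 1), |t| + 1]`. -/
theorem exists_sys (hα : 0 < α) (hβ : 0 < β) (hαβ : ¬ ∃ m : ℤ, β / α = m) (x y : L2) (ρ : ℝ) :
    ∃ f g : ℝ → L2, f 0 = x ∧ g 0 = y ∧ ∀ T, 0 < T → Sys α β ρ (-T) T f g := by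
  have hex : ∀ T : ℝ, ∃ f g : ℝ → L2, 0 < T → Sys α β ρ (-T) T f g ∧ f 0 = x ∧ g 0 = y := by
    intro T
    by_cases hT : 0 < T
    · have hx := norm_nonneg x
      have hy := norm_nonneg y
      have hr := abs_nonneg ρ
      obtain ⟨B, -, hB⟩ := exists_sys_bound hα hβ hαβ (R := 1 + ‖x‖ + ‖y‖ + |ρ|) (by linarith) T
      obtain ⟨f, g, h, h1, h2, -⟩ := hB x y ρ (by linarith) (by linarith) (by linarith)
      exact ⟨f, g, fun _ => ⟨h, h1, h2⟩⟩
    · exact ⟨0, 0, fun h => absurd h hT⟩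
  choose F G hFG using hex
  have hT : ∀ t : ℝ, 0 < |t| + 1 := fun t => by positivity
  have heq : ∀ T, 0 < T → ∀ t ∈ Set.Icc (-T) T, F T t = F (|t| + 1) t ∧ G T t = G (|t| + 1) t := by
    intro T hT0 t ht
    obtain ⟨h1, h2, h3⟩ := hFG T hT0
    obtain ⟨h1', h2', h3'⟩ := hFG _ (hT t)
    have ht' : |t| ≤ T := abs_le.2 ht
    have hm : 0 < min T (|t| + 1) := lt_min hT0 (hT t)
    have hmt : |t| ≤ min T (|t| + 1) := le_min ht' (by linarith)
    have s1 : Set.Icc (-min T (|t| + 1)) (min T (|t| + 1)) ⊆ Set.Icc (-T) T :=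
      Set.Icc_subset_Icc (neg_le_neg (min_le_left _ _)) (min_le_left _ _)
    have s2 : Set.Icc (-min T (|t| + 1)) (min T (|t| + 1)) ⊆ Set.Icc (-(|t| + 1)) (|t| + 1) :=
      Set.Icc_subset_Icc (neg_le_neg (min_le_right _ _)) (min_le_right _ _)
    exact (h1.mono s1).unique hα hβ hαβ (h1'.mono s2) (t₀ := 0) ⟨by linarith, hm.le⟩
      (h2.trans h2'.symm) (h3.trans h3'.symm) t (abs_le.1 hmt)
  refine ⟨fun t => F (|t| + 1) t, fun t => G (|t| + 1) t, (hFG _ (hT 0)).2.1, (hFG _ (hT 0)).2.2,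
    fun T hT0 => ?_⟩
  exact (hFG T hT0).1.congr (fun t ht => (heq T hT0 t ht).1) fun t ht => (heq T hT0 t ht).2

theorem exists_bound_of_sys (hα : 0 < α) (hβ : 0 < β) (hαβ : ¬ ∃ m : ℤ, β / α = m) {R : ℝ}
    (hR : 1 ≤ R) {T : ℝ} (hT : 0 < T) :
    ∃ B : ℝ, R ≤ B ∧ ∀ f g ρ, Sys α β ρ (-T) T f g → ‖f 0‖ ≤ R → ‖g 0‖ ≤ R → |ρ| ≤ R →
      ∀ t ∈ Set.Icc (-T) T, ‖f t‖ ≤ B ∧ ‖g t‖ ≤ B := by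
  obtain ⟨B, hRB, hB⟩ := exists_sys_bound hα hβ hαβ hR T
  refine ⟨B, hRB, fun f g ρ h hf hg hρ t ht => ?_⟩
  obtain ⟨f', g', h', h1, h2, h3⟩ := hB (f 0) (g 0) ρ hf hg hρ
  obtain ⟨e1, e2⟩ := h.unique hα hβ hαβ h' (t₀ := 0) ⟨by linarith, hT.le⟩ h1.symm h2.symm t ht
  rw [e1, e2]
  exact h3 t ht

end Zakharov

end

/-- Global well-posedness: there is a solution flow `Z t` on the phase space such that
(1) for all data `t ↦ Z t z₀` is a global solution,
(2) it is the only solution with these data, on any interval of time around `0`,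
(3) on every bounded interval of time the solution is bounded in the phase space by a constant that
depends only on the interval and on the size of the data (and on `α`, `β`),
(4) the solution depends continuously on the data, uniformly on bounded intervals of time. -/
theorem theorem2 (α β : ℝ) (hα : 0 < α) (hβ : 0 < β) (hαβ : ¬ ∃ m : ℤ, β / α = m) :
    ∃ Z : ℝ → Zakharov.Triple → Zakharov.Triple,
      (∀ z₀ ∈ Zakharov.PhaseSpace, Zakharov.IsGlobalSolution α β z₀ (fun t => Z t z₀)) ∧
      (∀ z₀ ∈ Zakharov.PhaseSpace, ∀ a b : ℝ, a ≤ 0 → 0 ≤ b → ∀ z : ℝ → Zakharov.Triple,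
        Zakharov.IsSolutionOn α β a b z₀ z → ∀ t ∈ Set.Icc a b, z t = Z t z₀) ∧
      (∀ T R : ℝ, 0 < T → 0 < R → ∃ C : ℝ, ∀ z₀ ∈ Zakharov.PhaseSpace,
        Zakharov.phaseNorm z₀ ≤ ENNReal.ofReal R →
          ∀ t ∈ Set.Icc (-T) T, Zakharov.phaseNorm (Z t z₀) ≤ ENNReal.ofReal C) ∧
      (∀ z₀ ∈ Zakharov.PhaseSpace, ∀ T ε : ℝ, 0 < T → 0 < ε → ∃ δ : ℝ, 0 < δ ∧
        ∀ w₀ ∈ Zakharov.PhaseSpace, Zakharov.phaseNorm (w₀ - z₀) ≤ ENNReal.ofReal δ →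
          ∀ t ∈ Set.Icc (-T) T, Zakharov.phaseNorm (Z t w₀ - Z t z₀) ≤ ENNReal.ofReal ε) := by
  classical
  have hex : ∀ z₀ : Zakharov.Triple, ∃ f g : ℝ → Zakharov.L2, z₀ ∈ Zakharov.PhaseSpace →
      z₀ = Zakharov.ofHalfWave β (f 0) (g 0) ∧
      ∀ T, 0 < T → Zakharov.Sys α β (g 0 0).im (-T) T f g := by
    intro z₀
    by_cases hz : z₀ ∈ Zakharov.PhaseSpace
    · obtain ⟨v, w, e⟩ := Zakharov.exists_ofHalfWave hβ hz
      obtain ⟨f, g, h1, h2, h⟩ := Zakharov.exists_sys hα hβ hαβ v w (w 0).im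
      exact ⟨f, g, fun _ => ⟨by rw [h1, h2, e], by rw [h2]; exact h⟩⟩
    · exact ⟨0, 0, fun h => absurd h hz⟩
  choose f g hfg using hex
  have hZ0 : ∀ z₀ ∈ Zakharov.PhaseSpace,
      Zakharov.ofInteraction α β 0 (f z₀ 0) (g z₀ 0) = z₀ := fun z₀ hz => by
    rw [Zakharov.ofInteraction_zero, ← (hfg z₀ hz).1]
  refine ⟨fun t z₀ => Zakharov.ofInteraction α β t (f z₀ t) (g z₀ t), fun z₀ hz T hT => ?_,
    fun z₀ hz a b ha hb z hsol t ht => ?_, fun T R hT hR => ?_, fun z₀ hz T ε hT hε => ?_⟩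
  · have h := ((hfg z₀ hz).2 T hT).isSolutionOn hβ (by linarith) hT.le rfl
      (z := fun t => Zakharov.ofInteraction α β t (f z₀ t) (g z₀ t)) fun _ _ => rfl
    simpa only [hZ0 z₀ hz] using h
  -- On the degenerate interval `a = b = 0` the derivative carries no information, and the claim
  -- reduces to the initial condition.
  · rcases (ha.trans hb).eq_or_lt with hab | hab
    · have ht0 : t = 0 := by linarith [ht.1, ht.2]
      rw [ht0, hsol.initial]
      exact (hZ0 z₀ hz).symm
    · obtain ⟨f', g', h, hz'⟩ := hsol.exists_sys hα hβ hαβ ha hb hab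
      have e : Zakharov.ofHalfWave β (f' 0) (g' 0) = Zakharov.ofHalfWave β (f z₀ 0) (g z₀ 0) := by
        rw [← (hfg z₀ hz).1, ← hsol.initial, hz' 0 ⟨ha, hb⟩, Zakharov.ofInteraction_zero]
      obtain ⟨e1, e2⟩ := Zakharov.ofHalfWave_injective hβ e
      have hT : 0 < |a| + |b| + 1 := by positivity
      have h2 := ((hfg z₀ hz).2 _ hT).mono (a' := a) (b' := b) (Set.Icc_subset_Icc
        (by linarith [neg_abs_le a, abs_nonneg b]) (by linarith [le_abs_self b, abs_nonneg a]))
      rw [e2] at h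
      obtain ⟨e3, e4⟩ := h.unique hα hβ hαβ h2 (t₀ := 0) ⟨ha, hb⟩ e1 e2 t ht
      rw [hz' t ht, e3, e4]
  · have hC := Zakharov.phaseC_nonneg hβ
    obtain ⟨B, -, hB⟩ := Zakharov.exists_bound_of_sys hα hβ hαβ
      (R := Zakharov.phaseC β * R + 1) (by nlinarith) hT
    refine ⟨(4 + 2 * β) * (B + B), fun z₀ hz hn t ht => ?_⟩
    rw [(hfg z₀ hz).1] at hn
    have h1 := Zakharov.norm_le_of_phaseNorm_ofHalfWave_le hβ hR.le hn
    have hg := Zakharov.abs_im_le_norm (g z₀ 0)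
    have hf0 := norm_nonneg (f z₀ 0)
    have hg0 := norm_nonneg (g z₀ 0)
    obtain ⟨b1, b2⟩ := hB _ _ _ ((hfg z₀ hz).2 T hT) (by linarith) (by linarith) (by linarith) t ht
    refine (Zakharov.phaseNorm_ofInteraction_le hβ t _ _).trans (ENNReal.ofReal_le_ofReal ?_)
    gcongr
  · have hC := Zakharov.phaseC_nonneg hβ
    have hf0 := norm_nonneg (f z₀ 0)
    have hg0 := norm_nonneg (g z₀ 0)
    have hg := Zakharov.abs_im_le_norm (g z₀ 0)
    -- The radius exceeds the size of the data of `z₀` by at least `phaseC β`, which accommodates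
    -- all perturbations of phase norm at most `1`.
    obtain ⟨B, hRB, hB⟩ := Zakharov.exists_bound_of_sys hα hβ hαβ
      (R := ‖f z₀ 0‖ + ‖g z₀ 0‖ + Zakharov.phaseC β + 1) (by linarith) hT
    obtain ⟨L, hL0, hL⟩ := Zakharov.exists_sys_lipschitz hα hβ hαβ (B := B) (by linarith) hT
    -- The Lipschitz constant of the flow in the phase norm; the factor `2` accounts for the drift,
    -- whose difference is bounded by that of the wave data.
    set M : ℝ := (4 + 2 * β) * (L * (2 * Zakharov.phaseC β)) with hM
    have hM0 : 0 ≤ M := by positivity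
    refine ⟨min 1 (ε / (M + 1)), by positivity, fun w₀ hw hn t ht => ?_⟩
    have hδ0 : 0 ≤ min 1 (ε / (M + 1)) := by positivity
    have hδ1 : min 1 (ε / (M + 1)) ≤ 1 := min_le_left _ _
    have hδ2 : M * min 1 (ε / (M + 1)) ≤ ε := by
      have h1 : min 1 (ε / (M + 1)) * (M + 1) ≤ ε := by
        rw [← le_div_iff₀ (by positivity)]; exact min_le_right _ _
      nlinarith
    set δ : ℝ := min 1 (ε / (M + 1))
    have hn' : Zakharov.phaseNorm (Zakharov.ofHalfWave β (f w₀ 0 - f z₀ 0) (g w₀ 0 - g z₀ 0)) ≤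
        ENNReal.ofReal δ := by
      rw [← Zakharov.ofHalfWave_sub, ← (hfg w₀ hw).1, ← (hfg z₀ hz).1]; exact hn
    have h1 := Zakharov.norm_le_of_phaseNorm_ofHalfWave_le hβ hδ0 hn'
    have h2 : Zakharov.phaseC β * δ ≤ Zakharov.phaseC β := mul_le_of_le_one_right hC hδ1
    have e1 := norm_nonneg (f w₀ 0 - f z₀ 0)
    have e2 := norm_nonneg (g w₀ 0 - g z₀ 0)
    have h3 : ‖f w₀ 0‖ ≤ ‖f z₀ 0‖ + ‖f w₀ 0 - f z₀ 0‖ := norm_le_norm_add_norm_sub' _ _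
    have h4 : ‖g w₀ 0‖ ≤ ‖g z₀ 0‖ + ‖g w₀ 0 - g z₀ 0‖ := norm_le_norm_add_norm_sub' _ _
    have hgw := Zakharov.abs_im_le_norm (g w₀ 0)
    have hgd : |(g w₀ 0 0).im - (g z₀ 0 0).im| ≤ ‖g w₀ 0 - g z₀ 0‖ :=
      Zakharov.abs_im_le_norm (g w₀ 0 - g z₀ 0)
    have hbz := hB _ _ _ ((hfg z₀ hz).2 T hT) (by linarith) (by linarith) (by linarith)
    have hbw := hB _ _ _ ((hfg w₀ hw).2 T hT) (by linarith) (by linarith) (by linarith)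
    have h5 := hL _ _ _ _ _ _ ((hfg w₀ hw).2 T hT) ((hfg z₀ hz).2 T hT) (by linarith) (by linarith)
      hbw hbz t ht
    refine (Zakharov.phaseNorm_ofInteraction_sub_le hβ t _ _ _ _).trans (ENNReal.ofReal_le_ofReal ?_)
    calc _ ≤ (4 + 2 * β) * (L * (2 * (Zakharov.phaseC β * δ))) := by
          gcongr
          refine h5.trans ?_
          gcongr
          linarith
      _ = M * δ := by rw [hM]; ring
      _ ≤ ε := hδ2
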